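/- An instance of the $\ell_1$ necklace alignment problem consists of two sorted vectors $\vec x=\langle x_0\le x_1\le\dots\le x_{n-1}\rangle$ and $\vec y=\langle y_0\le y_1\le\dots\le y_{n-1}\rangle$ of $n\ge 1$ real numbers in $[0,1)$, regarded as points ("beads") on a circle of circumference $1$. For $a,b\in[0,1)$ let $d^\circ(a,b)=\min\{|a-b|,\,1-|a-b|\}$ be their distance along the circle. The task is to find an offset $c\in[0,1)$ and a shift $s\in\{0,1,\dots,n\}$ that minimize $$\sum_{i=0}^{n-1} d^\circ\bigl((x_i+c)\bmod 1,\; y_{(i+s)\bmod n}\bigr)$$ over all $c\in[0,1)$ and $s\in\{0,1,\dots,n\}$. A real RAM is a random access machine that has, besides cells holding words (non-negative integers) of $O(\lg n)$ bits, cells holding exact real numbers. A program is a finite list of instructions, independent of $n$. At unit cost it can: load a constant word; copy a cell; access memory at an address given by a word; apply $+,-,\times$ or integer division to words (subtraction truncated at $0$); apply $+,-,\times,\div$ to reals; convert a word to the equal real number; jump, unconditionally or on the outcome of a comparison ($<$) of two words or of two reals; and halt. There is no other conversion between reals and words; in particular, there is no rounding of reals. **Theorem.** The $\ell_1$ necklace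 alignment problem can be solved in $O\bigl(n^2(\lg\lg n)^2/\lg n\bigr)$ time on a real RAM, where $\lg=\log_2$. That is, there are a real RAM program, a constant $k$ and a function $T:\mathbb N\to\mathbb N$ with $$T(n)=O\!\left(\frac{n^2(\lg\lg n)^2}{\lg n}\right)\quad(n\to\infty)$$ such that, for every $n\ge 1$ and every instance with $n$ beads per necklace, the program, run with words of $k(\lfloor\lg n\rfloor+1)$ bits, halts after at most $T(n)$ steps, never produces a word that does not fit and never divides by zero, and outputs an optimal pair $(c,s)$. In particular, $T(n)=o(n^2)$, which answers Toussaint's open question whether the problem can be solved in $o(n^2)$ time. -/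

import Mathlib

open Asymptotics

/-! ## The real RAM

A real RAM has word registers and real registers (named directly by the program) and a word memory
and a real memory (addressed through word registers). Words are natural numbers of at most `w` bits.
Real cells hold exact real numbers. A program is a finite list of instructions; every instruction
costs one time step. Reals can only be added, subtracted, multiplied, divided and compared: there is
no rounding and no other passage from reals to words. -/

namespace RealRAM

/-- Arithmetic on words: `sub` is truncated at `0`, `div` is the quotient with remainder. -/
inductive WordOp
  | add | sub | mul | div

/-- Exact arithmetic on reals. -/
inductive RealOp
  | add | sub | mul | div

/-- Instructions. `w_i`, `r_i` are the word and real registers, `W[a]`, `R[a]` the word and real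
memory cells. The last argument of each jump is the position of its target in the program. -/
inductive Instr
  /-- `w_i := v` -/
  | wconst (i v : ℕ)
  /-- `w_i := w_j` -/
  | wmove (i j : ℕ)
  /-- `w_i := w_j op w_k` -/
  | wop (op : WordOp) (i j k : ℕ)
  /-- `w_i := W[w_j]` -/
  | wload (i j : ℕ)
  /-- `W[w_i] := w_j` -/
  | wstore (i j : ℕ)
  /-- `r_i := w_j`, the word `w_j` regarded as a real number -/
  | rcast (i j : ℕ)
  /-- `r_i := r_j` -/
  | rmove (i j : ℕ)
  /-- `r_i := r_j op r_k` -/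
  | rop (op : RealOp) (i j k : ℕ)
  /-- `r_i := R[w_j]` -/
  | rload (i j : ℕ)
  /-- `R[w_i] := r_j` -/
  | rstore (i j : ℕ)
  /-- `goto l` -/
  | jump (l : ℕ)
  /-- `if w_i < w_j then goto l` -/
  | jumpWLt (i j l : ℕ)
  /-- `if r_i < r_j then goto l` -/
  | jumpRLt (i j l : ℕ)
  /-- stop -/
  | halt

/-- A program is a finite list of instructions. -/
abbrev Program := List Instr

/-- A configuration: program counter, registers and memories. -/
structure Config where
  pc : ℕ
  wreg : ℕ → ℕ
  rreg : ℕ → ℝ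
  wmem : ℕ → ℕ
  rmem : ℕ → ℝ

/-- Result of a word operation; undefined on division by zero. -/
def WordOp.eval : WordOp → ℕ → ℕ → Option ℕ
  | add, a, b => some (a + b)
  | sub, a, b => some (a - b)
  | mul, a, b => some (a * b)
  | div, a, b => if b = 0 then none else some (a / b)

/-- Result of a real operation; undefined on division by zero. -/
noncomputable def RealOp.eval : RealOp → ℝ → ℝ → Option ℝ
  | add, a, b => some (a + b)
  | sub, a, b => some (a - b)
  | mul, a, b => some (a * b)
  | div, a, b => if b = 0 then none else some (a / b)

namespace Config

/-- Advance the program counter by one. -/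
def next (σ : Config) : Config := { σ with pc := σ.pc + 1 }

/-- Write `v` to the word register `i`; fails if `v` does not fit into `w` bits. -/
def setW (w : ℕ) (σ : Config) (i v : ℕ) : Option Config :=
  if v < 2 ^ w then some { σ with wreg := Function.update σ.wreg i v } else none

/-- Write `v` to the real register `i`. -/
def setR (σ : Config) (i : ℕ) (v : ℝ) : Config :=
  { σ with rreg := Function.update σ.rreg i v }

end Config

/-- One time step of the machine with `w`-bit words. There is no successor configuration
(`none`) at a `halt` instruction, outside the program, on a division by zero, and when a word
operation produces a value of more than `w` bits. -/
noncomputable def step (w : ℕ) (P : Program) (σ : Config) : Option Config :=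
  match P[σ.pc]? with
  | none => none
  | some .halt => none
  | some (.wconst i v) => (σ.setW w i v).map Config.next
  | some (.wmove i j) => (σ.setW w i (σ.wreg j)).map Config.next
  | some (.wop op i j k) =>
      (op.eval (σ.wreg j) (σ.wreg k)).bind fun v => (σ.setW w i v).map Config.next
  | some (.wload i j) => (σ.setW w i (σ.wmem (σ.wreg j))).map Config.next
  | some (.wstore i j) =>
      some { σ with wmem := Function.update σ.wmem (σ.wreg i) (σ.wreg j) }.next
  | some (.rcast i j) => some (σ.setR i (σ.wreg j : ℝ)).next
  | some (.rmove i j) => some (σ.setR i (σ.rreg j)).next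
  | some (.rop op i j k) =>
      (op.eval (σ.rreg j) (σ.rreg k)).map fun v => (σ.setR i v).next
  | some (.rload i j) => some (σ.setR i (σ.rmem (σ.wreg j))).next
  | some (.rstore i j) =>
      some { σ with rmem := Function.update σ.rmem (σ.wreg i) (σ.rreg j) }.next
  | some (.jump l) => some { σ with pc := l }
  | some (.jumpWLt i j l) =>
      if σ.wreg i < σ.wreg j then some { σ with pc := l } else some σ.next
  | some (.jumpRLt i j l) =>
      if σ.rreg i < σ.rreg j then some { σ with pc := l } else some σ.next

/-- The configuration after `t` time steps, if the machine gets that far. -/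
noncomputable def steps (w : ℕ) (P : Program) : ℕ → Config → Option Config
  | 0, σ => some σ
  | t + 1, σ => (step w P σ).bind (steps w P t)

/-- Started in `σ`, the program arrives at a `halt` instruction after exactly `t` time steps, and
its configuration is then `τ`. -/
def HaltsIn (w : ℕ) (P : Program) (σ : Config) (t : ℕ) (τ : Config) : Prop :=
  steps w P t σ = some τ ∧ P[τ.pc]? = some Instr.halt

end RealRAM

/-! ## Necklace alignment -/

namespace Necklace

/-- A necklace with `n` beads: a sorted vector of `n` points of the circle `[0, 1)`. -/
def IsNecklace {n : ℕ} (x : Fin n → ℝ) : Prop :=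
  Monotone x ∧ ∀ i, x i ∈ Set.Ico (0 : ℝ) 1

/-- Distance of two points of `[0, 1)` along the circle of circumference `1`. -/
noncomputable def circDist (a b : ℝ) : ℝ := min |a - b| (1 - |a - b|)

/-- The `ℓ₁` cost of the offset `c` and the shift `s`: the first necklace is rotated by `c`, and
its bead `i` is matched with the bead `(i + s) mod n` of the second necklace. -/
noncomputable def cost {n : ℕ} (x y : Fin n → ℝ) (c : ℝ) (s : ℕ) : ℝ :=
  ∑ i : Fin n, circDist (Int.fract (x i + c)) (y ⟨((i : ℕ) + s) % n, Nat.mod_lt _ i.pos⟩)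

/-- `(c, s)` is an optimal solution: it minimizes the `ℓ₁` cost over all offsets in `[0, 1)` and all
shifts in `{0, …, n}`. -/
def IsOptimal {n : ℕ} (x y : Fin n → ℝ) (c : ℝ) (s : ℕ) : Prop :=
  c ∈ Set.Ico (0 : ℝ) 1 ∧ s ≤ n ∧
    ∀ c' ∈ Set.Ico (0 : ℝ) 1, ∀ s' ≤ n, cost x y c s ≤ cost x y c' s'

/-- Initial configuration: `w_0 = n`, `R[0..n-1] = x`, `R[n..2n-1] = y`, everything else is `0`. -/
noncomputable def input {n : ℕ} (x y : Fin n → ℝ) : RealRAM.Config where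
  pc := 0
  wreg := fun i => if i = 0 then n else 0
  rreg := fun _ => 0
  wmem := fun _ => 0
  rmem := fun a =>
    if h : a < n then x ⟨a, h⟩ else if h' : a - n < n then y ⟨a - n, h'⟩ else 0

/-- The program `P`, on a real RAM with words of `k (⌊lg n⌋ + 1)` bits, solves the `ℓ₁` necklace
alignment problem in at most `T n` time steps on all pairs of necklaces with `n ≥ 1` beads. When it
halts, the offset is in `r_0` and the shift is in `w_0`. -/
def SolvesInTime (P : RealRAM.Program) (k : ℕ) (T : ℕ → ℕ) : Prop :=
  ∀ n : ℕ, 1 ≤ n → ∀ x y : Fin n → ℝ, IsNecklace x → IsNecklace y →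
    ∃ t ≤ T n, ∃ τ : RealRAM.Config,
      RealRAM.HaltsIn (k * (Nat.log 2 n + 1)) P (input x y) t τ ∧
        IsOptimal x y (τ.rreg 0) (τ.wreg 0)

end Necklace

namespace RealRAM

/-! ## A structured language compiled to the real RAM -/

/-- Word expressions. -/
inductive WExp
  | const (v : ℕ)
  | reg (i : ℕ)
  | mem (a : WExp)
  | op (o : WordOp) (a b : WExp)

/-- Real expressions. -/
inductive RExp
  | reg (i : ℕ)
  | mem (a : WExp)
  | cast (a : WExp)
  | op (o : RealOp) (a b : RExp)

/-- Conditions. -/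
inductive Cond
  | wlt (a b : WExp)
  | rlt (a b : RExp)
  | not (c : Cond)
  | and (c d : Cond)

/-- Statements. -/
inductive Stmt
  | skip
  | wset (i : ℕ) (e : WExp)
  | rset (i : ℕ) (e : RExp)
  | wput (a e : WExp)
  | rput (a : WExp) (e : RExp)
  | seq (s t : Stmt)
  | ite (c : Cond) (s t : Stmt)
  | loop (c : Cond) (s : Stmt)

instance : Add WExp := ⟨.op .add⟩
instance : Sub WExp := ⟨.op .sub⟩
instance : Mul WExp := ⟨.op .mul⟩
instance : Div WExp := ⟨.op .div⟩
instance (n : ℕ) : OfNat WExp n := ⟨.const n⟩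
instance : Add RExp := ⟨.op .add⟩
instance : Sub RExp := ⟨.op .sub⟩
instance : Mul RExp := ⟨.op .mul⟩

/-- Sequential composition. -/
infixr:60 " ;; " => Stmt.seq

/-- The part of a configuration visible to structured programs. -/
@[ext] structure St where
  w : ℕ → ℕ
  r : ℕ → ℝ
  wm : ℕ → ℕ
  rm : ℕ → ℝ

namespace St
/-- Assign a word variable. -/
def setW (σ : St) (i v : ℕ) : St := { σ with w := Function.update σ.w i v }
/-- Assign a real variable. -/
def setR (σ : St) (i : ℕ) (v : ℝ) : St := { σ with r := Function.update σ.r i v }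
/-- Write a word memory cell. -/
def putW (σ : St) (a v : ℕ) : St := { σ with wm := Function.update σ.wm a v }
/-- Write a real memory cell. -/
def putR (σ : St) (a : ℕ) (v : ℝ) : St := { σ with rm := Function.update σ.rm a v }

variable (σ : St) (i j v : ℕ) (x : ℝ)
@[simp] theorem setW_w : (σ.setW i v).w j = if j = i then v else σ.w j := by
  simp [setW, Function.update_apply]
@[simp] theorem setW_r : (σ.setW i v).r = σ.r := rfl
@[simp] theorem setW_wm : (σ.setW i v).wm = σ.wm := rfl
@[simp] theorem setW_rm : (σ.setW i v).rm = σ.rm := rfl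
@[simp] theorem setR_r : (σ.setR i x).r j = if j = i then x else σ.r j := by
  simp [setR, Function.update_apply]
@[simp] theorem setR_w : (σ.setR i x).w = σ.w := rfl
@[simp] theorem setR_wm : (σ.setR i x).wm = σ.wm := rfl
@[simp] theorem setR_rm : (σ.setR i x).rm = σ.rm := rfl
@[simp] theorem putW_wm : (σ.putW i v).wm j = if j = i then v else σ.wm j := by
  simp [putW, Function.update_apply]
@[simp] theorem putW_w : (σ.putW i v).w = σ.w := rfl
@[simp] theorem putW_r : (σ.putW i v).r = σ.r := rfl
@[simp] theorem putW_rm : (σ.putW i v).rm = σ.rm := rfl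
@[simp] theorem putR_rm : (σ.putR i x).rm j = if j = i then x else σ.rm j := by
  simp [putR, Function.update_apply]
@[simp] theorem putR_w : (σ.putR i x).w = σ.w := rfl
@[simp] theorem putR_r : (σ.putR i x).r = σ.r := rfl
@[simp] theorem putR_wm : (σ.putR i x).wm = σ.wm := rfl
end St

/-- Value of a word operation. -/
def WordOp.val : WordOp → ℕ → ℕ → ℕ
  | .add, a, b => a + b
  | .sub, a, b => a - b
  | .mul, a, b => a * b
  | .div, a, b => a / b

/-- The word operation is defined and does not overflow. -/
def WordOp.ok (B : ℕ) : WordOp → ℕ → ℕ → Prop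
  | .add, a, b => a + b < B
  | .sub, _, _ => True
  | .mul, a, b => a * b < B
  | .div, _, b => 0 < b

/-- Value of a real operation. -/
noncomputable def RealOp.val : RealOp → ℝ → ℝ → ℝ
  | .add, a, b => a + b
  | .sub, a, b => a - b
  | .mul, a, b => a * b
  | .div, a, b => a / b

/-- The real operation is defined. -/
def RealOp.ok : RealOp → ℝ → Prop
  | .div, b => b ≠ 0
  | _, _ => True

theorem WordOp.eval_eq {B : ℕ} {o : WordOp} {a b : ℕ} (h : o.ok B a b) (ha : a < B) :
    o.eval a b = some (o.val a b) ∧ o.val a b < B := by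
  cases o
  · exact ⟨rfl, h⟩
  · exact ⟨rfl, lt_of_le_of_lt (Nat.sub_le _ _) ha⟩
  · exact ⟨rfl, h⟩
  · exact ⟨if_neg (Nat.pos_iff_ne_zero.1 h), lt_of_le_of_lt (Nat.div_le_self _ _) ha⟩

theorem RealOp.eval_eq {o : RealOp} {a b : ℝ} (h : o.ok b) : o.eval a b = some (o.val a b) := by
  cases o <;> first | rfl | exact if_neg h

namespace WExp
/-- Value of a word expression. -/
def eval (σ : St) : WExp → ℕ
  | const v => v
  | reg i => σ.w i
  | mem a => σ.wm (a.eval σ)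
  | op o a b => o.val (a.eval σ) (b.eval σ)
/-- No operation of the expression overflows or is undefined. -/
def ok (B : ℕ) (σ : St) : WExp → Prop
  | const v => v < B
  | reg _ => True
  | mem a => a.ok B σ
  | op o a b => a.ok B σ ∧ b.ok B σ ∧ o.ok B (a.eval σ) (b.eval σ)
/-- Code that puts the value into the `t`-th temporary. -/
def code : WExp → ℕ → List Instr
  | const v, t => [.wconst (2 * t + 1) v]
  | reg i, t => [.wmove (2 * t + 1) (2 * i)]
  | mem a, t => a.code t ++ [.wload (2 * t + 1) (2 * t + 1)]
  | op o a b, t => a.code t ++ b.code (t + 1) ++ [.wop o (2 * t + 1) (2 * t + 1) (2 * (t + 1) + 1)]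
/-- Running time. -/
def cost : WExp → ℕ
  | const _ => 1
  | reg _ => 1
  | mem a => a.cost + 1
  | op _ a b => a.cost + b.cost + 1
@[simp] theorem length_code (e : WExp) (t : ℕ) : (e.code t).length = e.cost := by
  induction e generalizing t <;> simp [code, cost, Nat.add_assoc, *]
end WExp

namespace RExp
/-- Value of a real expression. -/
noncomputable def eval (σ : St) : RExp → ℝ
  | reg i => σ.r i
  | mem a => σ.rm (a.eval σ)
  | cast a => (a.eval σ : ℝ)
  | op o a b => o.val (a.eval σ) (b.eval σ)
/-- No operation of the expression overflows or is undefined. -/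
def ok (B : ℕ) (σ : St) : RExp → Prop
  | reg _ => True
  | mem a => a.ok B σ
  | cast a => a.ok B σ
  | op o a b => a.ok B σ ∧ b.ok B σ ∧ o.ok (b.eval σ)
/-- Code that puts the value into the `t`-th real temporary. -/
def code : RExp → ℕ → List Instr
  | reg i, t => [.rmove (2 * t + 1) (2 * i)]
  | mem a, t => a.code t ++ [.rload (2 * t + 1) (2 * t + 1)]
  | cast a, t => a.code t ++ [.rcast (2 * t + 1) (2 * t + 1)]
  | op o a b, t => a.code t ++ b.code (t + 1) ++ [.rop o (2 * t + 1) (2 * t + 1) (2 * (t + 1) + 1)]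
/-- Running time. -/
def cost : RExp → ℕ
  | reg _ => 1
  | mem a => a.cost + 1
  | cast a => a.cost + 1
  | op _ a b => a.cost + b.cost + 1
@[simp] theorem length_code (e : RExp) (t : ℕ) : (e.code t).length = e.cost := by
  induction e generalizing t <;> simp [code, cost, Nat.add_assoc, *]
end RExp

namespace Cond
/-- Truth value. -/
def eval (σ : St) : Cond → Prop
  | wlt a b => a.eval σ < b.eval σ
  | rlt a b => a.eval σ < b.eval σ
  | not c => ¬ c.eval σ
  | and c d => c.eval σ ∧ d.eval σ
/-- Everything that is evaluated is defined. -/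
def ok (B : ℕ) (σ : St) : Cond → Prop
  | wlt a b => a.ok B σ ∧ b.ok B σ
  | rlt a b => a.ok B σ ∧ b.ok B σ
  | not c => c.ok B σ
  | and c d => c.ok B σ ∧ (c.eval σ → d.ok B σ)
/-- Running time (upper bound). -/
def cost : Cond → ℕ
  | wlt a b => a.cost + b.cost + 2
  | rlt a b => a.cost + b.cost + 2
  | not c => c.cost
  | and c d => c.cost + d.cost
/-- Code, to be placed at `o`, that jumps to `l` if the condition holds and to `l'` otherwise. -/
def code : Cond → ℕ → ℕ → ℕ → List Instr
  | wlt a b, _, l, l' => a.code 0 ++ b.code 1 ++ [.jumpWLt 1 3 l, .jump l']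
  | rlt a b, _, l, l' => a.code 0 ++ b.code 1 ++ [.jumpRLt 1 3 l, .jump l']
  | not c, o, l, l' => c.code o l' l
  | and c d, o, l, l' => c.code o (o + c.cost) l' ++ d.code (o + c.cost) l l'
@[simp] theorem length_code (c : Cond) (o l l' : ℕ) : (c.code o l l').length = c.cost := by
  induction c generalizing o l l' <;> simp [code, cost, Nat.add_assoc, *]
end Cond

namespace Stmt
/-- Length of the code. -/
def len : Stmt → ℕ
  | skip => 0
  | wset _ e => e.cost + 1
  | rset _ e => e.cost + 1
  | wput a e => a.cost + e.cost + 1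
  | rput a e => a.cost + e.cost + 1
  | seq s t => s.len + t.len
  | ite c s t => c.cost + s.len + 1 + t.len
  | loop c s => c.cost + s.len + 1
/-- Code, to be placed at `o`. -/
def code : Stmt → ℕ → List Instr
  | skip, _ => []
  | wset i e, _ => e.code 0 ++ [.wmove (2 * i) 1]
  | rset i e, _ => e.code 0 ++ [.rmove (2 * i) 1]
  | wput a e, _ => a.code 0 ++ e.code 1 ++ [.wstore 1 3]
  | rput a e, _ => a.code 0 ++ e.code 1 ++ [.rstore 1 3]
  | seq s t, o => s.code o ++ t.code (o + s.len)
  | ite c s t, o =>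
      c.code o (o + c.cost) (o + c.cost + s.len + 1) ++ (s.code (o + c.cost) ++
        (.jump (o + c.cost + s.len + 1 + t.len) :: t.code (o + c.cost + s.len + 1)))
  | loop c s, o =>
      c.code o (o + c.cost) (o + c.cost + s.len + 1) ++ (s.code (o + c.cost) ++ [.jump o])
@[simp] theorem length_code (s : Stmt) (o : ℕ) : (s.code o).length = s.len := by
  induction s generalizing o <;> simp [code, len, *] <;> omega
end Stmt

/-- Big-step semantics with running time (an upper bound for the time of the compiled code). -/
inductive Exec (B : ℕ) : Stmt → St → ℕ → St → Prop
  | skip (σ) : Exec B .skip σ 0 σ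
  | wset (σ i) (e : WExp) (h : e.ok B σ) : Exec B (.wset i e) σ (e.cost + 1) (σ.setW i (e.eval σ))
  | rset (σ i) (e : RExp) (h : e.ok B σ) : Exec B (.rset i e) σ (e.cost + 1) (σ.setR i (e.eval σ))
  | wput (σ) (a e : WExp) (h : a.ok B σ) (h' : e.ok B σ) :
      Exec B (.wput a e) σ (a.cost + e.cost + 1) (σ.putW (a.eval σ) (e.eval σ))
  | rput (σ) (a : WExp) (e : RExp) (h : a.ok B σ) (h' : e.ok B σ) :
      Exec B (.rput a e) σ (a.cost + e.cost + 1) (σ.putR (a.eval σ) (e.eval σ))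
  | seq {s t σ k τ k' υ} (h : Exec B s σ k τ) (h' : Exec B t τ k' υ) :
      Exec B (.seq s t) σ (k + k') υ
  | iteTrue {c s t σ k τ} (hc : c.ok B σ) (h : c.eval σ) (h' : Exec B s σ k τ) :
      Exec B (.ite c s t) σ (c.cost + k + 1) τ
  | iteFalse {c s t σ k τ} (hc : c.ok B σ) (h : ¬ c.eval σ) (h' : Exec B t σ k τ) :
      Exec B (.ite c s t) σ (c.cost + k + 1) τ
  | loopFalse {c s σ} (hc : c.ok B σ) (h : ¬ c.eval σ) : Exec B (.loop c s) σ c.cost σ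
  | loopTrue {c s σ k τ k' υ} (hc : c.ok B σ) (h : c.eval σ) (h' : Exec B s σ k τ)
      (h'' : Exec B (.loop c s) τ k' υ) : Exec B (.loop c s) σ (c.cost + k + 1 + k') υ

/-! ### Correctness of the compiler -/

theorem steps_add (w : ℕ) (P : Program) (a b : ℕ) (τ : Config) :
    steps w P (a + b) τ = (steps w P a τ).bind (steps w P b) := by
  induction a generalizing τ with
  | zero => simp [steps]
  | succ a ih =>
    rw [Nat.succ_add]
    simp only [steps]
    cases h : step w P τ with
    | none => simp
    | some τ' => simpa using ih τ'

theorem steps_trans {w : ℕ} {P : Program} {a b : ℕ} {τ τ' τ'' : Config}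
    (h : steps w P a τ = some τ') (h' : steps w P b τ' = some τ'') :
    steps w P (a + b) τ = some τ'' := by
  rw [steps_add, h]; simpa using h'

theorem steps_one {w : ℕ} {P : Program} {τ : Config} : steps w P 1 τ = step w P τ := by
  simp only [steps]
  cases step w P τ <;> rfl

/-- The code `l` stands in the program `P` at position `o`. -/
def CodeAt (P : Program) (o : ℕ) (l : List Instr) : Prop :=
  ∀ i < l.length, P[o + i]? = l[i]?

theorem codeAt_append {P : Program} {o : ℕ} {c d : List Instr} :
    CodeAt P o (c ++ d) ↔ CodeAt P o c ∧ CodeAt P (o + c.length) d := by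
  constructor
  · intro h
    refine ⟨fun i hi => ?_, fun i hi => ?_⟩
    · rw [h i (by simp; omega), List.getElem?_append_left hi]
    · rw [Nat.add_assoc, h (c.length + i) (by simp; omega), List.getElem?_append_right (by omega)]
      simp
  · rintro ⟨h1, h2⟩ i hi
    by_cases hc : i < c.length
    · rw [h1 i hc, List.getElem?_append_left hc]
    · have := h2 (i - c.length) (by simp at hi; omega)
      rw [show o + c.length + (i - c.length) = o + i by omega] at this
      rw [this, List.getElem?_append_right (by omega)]

theorem codeAt_cons {P : Program} {o : ℕ} {a : Instr} {d : List Instr} :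
    CodeAt P o (a :: d) ↔ P[o]? = some a ∧ CodeAt P (o + 1) d := by
  rw [← List.singleton_append, codeAt_append]
  simp [CodeAt]

theorem codeAt_self (c d : List Instr) : CodeAt (c ++ d) 0 c := by
  intro i hi
  rw [Nat.zero_add, List.getElem?_append_left hi]

/-- The configuration `τ` represents the state `σ`: variables live in the registers with even
numbers. -/
structure Sim (B : ℕ) (τ : Config) (σ : St) : Prop where
  w : ∀ i, τ.wreg (2 * i) = σ.w i
  r : ∀ i, τ.rreg (2 * i) = σ.r i
  wm : τ.wmem = σ.wm
  rm : τ.rmem = σ.rm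
  wB : ∀ i, σ.w i < B
  wmB : ∀ i, σ.wm i < B

theorem Sim.setTemp {B : ℕ} {τ : Config} {σ : St} (h : Sim B τ σ) (t v pc : ℕ) :
    Sim B { τ with pc := pc, wreg := Function.update τ.wreg (2 * t + 1) v } σ where
  w i := by simp [h.w, show 2 * i ≠ 2 * t + 1 by omega]
  r := h.r
  wm := h.wm
  rm := h.rm
  wB := h.wB
  wmB := h.wmB

theorem Sim.setTempR {B : ℕ} {τ : Config} {σ : St} (h : Sim B τ σ) (t : ℕ) (v : ℝ) (pc : ℕ) :
    Sim B { τ with pc := pc, rreg := Function.update τ.rreg (2 * t + 1) v } σ where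
  w := h.w
  r i := by simp [h.r, show 2 * i ≠ 2 * t + 1 by omega]
  wm := h.wm
  rm := h.rm
  wB := h.wB
  wmB := h.wmB

theorem WExp.eval_lt {B w : ℕ} (hB : B = 2 ^ w) {τ : Config} {σ : St} (hs : Sim B τ σ) (e : WExp)
    (h : e.ok B σ) : e.eval σ < B := by
  induction e with
  | const v => exact h
  | reg i => exact hs.wB i
  | mem a _ => exact hs.wmB _
  | op o a b iha ihb => exact (WordOp.eval_eq h.2.2 (iha h.1)).2

theorem WExp.run {B w : ℕ} (hB : B = 2 ^ w) {P : Program} (e : WExp) :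
    ∀ (t o : ℕ) (τ : Config) (σ : St), CodeAt P o (e.code t) → Sim B τ σ → τ.pc = o → e.ok B σ →
    ∃ τ', steps w P e.cost τ = some τ' ∧ Sim B τ' σ ∧ τ'.pc = o + e.cost ∧
      τ'.wreg (2 * t + 1) = e.eval σ ∧ (∀ j < t, τ'.wreg (2 * j + 1) = τ.wreg (2 * j + 1)) ∧
      τ'.rreg = τ.rreg := by
  induction e with
  | const v =>
    intro t o τ σ hc hs hpc hok
    rw [code, codeAt_cons] at hc
    have hv : v < 2 ^ w := hB ▸ hok
    refine ⟨_, ?_, hs.setTemp t v (τ.pc + 1), ?_, ?_, ?_, ?_⟩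
    · rw [cost, steps_one, step, hpc, hc.1]
      simp [Config.setW, hv, Config.next, hpc]
    · simp [hpc, cost]
    · simp [eval]
    · intro j hj; simp [show j ≠ t by omega]
    · rfl
  | reg i =>
    intro t o τ σ hc hs hpc hok
    rw [code, codeAt_cons] at hc
    have hv : τ.wreg (2 * i) < 2 ^ w := by rw [hs.w, ← hB]; exact hs.wB i
    refine ⟨_, ?_, hs.setTemp t (τ.wreg (2 * i)) (τ.pc + 1), ?_, ?_, ?_, ?_⟩
    · rw [cost, steps_one, step, hpc, hc.1]
      simp [Config.setW, hv, Config.next, hpc]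
    · simp [hpc, cost]
    · simp [eval, hs.w]
    · intro j hj; simp [show j ≠ t by omega]
    · rfl
  | mem a ih =>
    intro t o τ σ hc hs hpc hok
    rw [code, codeAt_append, codeAt_cons, length_code] at hc
    obtain ⟨τ1, h1, hs1, hpc1, hv1, ht1, hr1⟩ := ih t o τ σ hc.1 hs hpc hok
    have hv : τ1.wmem (τ1.wreg (2 * t + 1)) < 2 ^ w := by rw [hs1.wm, ← hB]; exact hs1.wmB _
    refine ⟨_, ?_, hs1.setTemp t (τ1.wmem (τ1.wreg (2 * t + 1))) (τ1.pc + 1), ?_, ?_, ?_, ?_⟩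
    · refine steps_trans h1 ?_
      rw [steps_one, step, hpc1, hc.2.1]
      simp [Config.setW, hv, Config.next, hpc1]
    · simp [hpc1, cost, Nat.add_assoc]
    · simp [eval, hs1.wm, hv1]
    · intro j hj; simp [show j ≠ t by omega, ht1 j hj]
    · exact hr1
  | op f a b iha ihb =>
    intro t o τ σ hc hs hpc hok
    rw [code, codeAt_append, codeAt_append, codeAt_cons, length_code] at hc
    obtain ⟨τ1, h1, hs1, hpc1, hv1, ht1, hr1⟩ := iha t o τ σ hc.1.1 hs hpc hok.1
    obtain ⟨τ2, h2, hs2, hpc2, hv2, ht2, hr2⟩ := ihb (t + 1) _ τ1 σ hc.1.2 hs1 hpc1 hok.2.1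
    have ha := ht2 t (by omega)
    obtain ⟨hf, hf'⟩ := WordOp.eval_eq hok.2.2 (a.eval_lt hB hs hok.1)
    have hi := hc.2.1
    simp only [List.length_append, length_code] at hi
    rw [hB] at hf'
    refine ⟨_, ?_, hs2.setTemp t (f.val (a.eval σ) (b.eval σ)) (τ2.pc + 1), ?_, ?_, ?_, ?_⟩
    · refine steps_trans (steps_trans h1 h2) ?_
      rw [steps_one, step, hpc2, Nat.add_assoc, hi]
      simp only [hv2, ha, hv1, hf]
      simp [Config.setW, hf', Config.next, hpc2, Nat.add_assoc]
    · simp [hpc2, cost, Nat.add_assoc]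
    · simp [eval]
    · intro j hj
      simp [show j ≠ t by omega, ht1 j hj, ht2 j (by omega)]
    · simp [hr2, hr1]

theorem RExp.run {B w : ℕ} (hB : B = 2 ^ w) {P : Program} (e : RExp) :
    ∀ (t o : ℕ) (τ : Config) (σ : St), CodeAt P o (e.code t) → Sim B τ σ → τ.pc = o → e.ok B σ →
    ∃ τ', steps w P e.cost τ = some τ' ∧ Sim B τ' σ ∧ τ'.pc = o + e.cost ∧
      τ'.rreg (2 * t + 1) = e.eval σ ∧ (∀ j < t, τ'.wreg (2 * j + 1) = τ.wreg (2 * j + 1)) ∧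
      (∀ j < t, τ'.rreg (2 * j + 1) = τ.rreg (2 * j + 1)) := by
  induction e with
  | reg i =>
    intro t o τ σ hc hs hpc hok
    rw [code, codeAt_cons] at hc
    refine ⟨_, ?_, hs.setTempR t (τ.rreg (2 * i)) (τ.pc + 1), ?_, ?_, ?_, ?_⟩
    · rw [cost, steps_one, step, hpc, hc.1]
      simp [Config.setR, Config.next, hpc]
    · simp [hpc, cost]
    · simp [eval, hs.r]
    · intro j hj; rfl
    · intro j hj; simp [show j ≠ t by omega]
  | mem a =>
    intro t o τ σ hc hs hpc hok
    rw [code, codeAt_append, codeAt_cons, WExp.length_code] at hc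
    obtain ⟨τ1, h1, hs1, hpc1, hv1, ht1, hr1⟩ := a.run hB t o τ σ hc.1 hs hpc hok
    refine ⟨_, ?_, hs1.setTempR t (τ1.rmem (τ1.wreg (2 * t + 1))) (τ1.pc + 1), ?_, ?_, ?_, ?_⟩
    · refine steps_trans h1 ?_
      rw [steps_one, step, hpc1, hc.2.1]
      simp [Config.setR, Config.next, hpc1]
    · simp [hpc1, cost, Nat.add_assoc]
    · simp [eval, hs1.rm, hv1]
    · exact ht1
    · intro j hj; simp [show j ≠ t by omega, hr1]
  | cast a =>
    intro t o τ σ hc hs hpc hok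
    rw [code, codeAt_append, codeAt_cons, WExp.length_code] at hc
    obtain ⟨τ1, h1, hs1, hpc1, hv1, ht1, hr1⟩ := a.run hB t o τ σ hc.1 hs hpc hok
    refine ⟨_, ?_, hs1.setTempR t (τ1.wreg (2 * t + 1)) (τ1.pc + 1), ?_, ?_, ?_, ?_⟩
    · refine steps_trans h1 ?_
      rw [steps_one, step, hpc1, hc.2.1]
      simp [Config.setR, Config.next, hpc1]
    · simp [hpc1, cost, Nat.add_assoc]
    · simp [eval, hv1]
    · exact ht1
    · intro j hj; simp [show j ≠ t by omega, hr1]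
  | op f a b iha ihb =>
    intro t o τ σ hc hs hpc hok
    rw [code, codeAt_append, codeAt_append, codeAt_cons, length_code] at hc
    obtain ⟨τ1, h1, hs1, hpc1, hv1, ht1, hr1⟩ := iha t o τ σ hc.1.1 hs hpc hok.1
    obtain ⟨τ2, h2, hs2, hpc2, hv2, ht2, hr2⟩ := ihb (t + 1) _ τ1 σ hc.1.2 hs1 hpc1 hok.2.1
    have ha := hr2 t (by omega)
    have hf := RealOp.eval_eq (a := a.eval σ) hok.2.2
    have hi := hc.2.1
    simp only [List.length_append, length_code] at hi
    refine ⟨_, ?_, hs2.setTempR t (f.val (a.eval σ) (b.eval σ)) (τ2.pc + 1), ?_, ?_, ?_, ?_⟩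
    · refine steps_trans (steps_trans h1 h2) ?_
      rw [steps_one, step, hpc2, Nat.add_assoc, hi]
      simp only [hv2, ha, hv1, hf]
      simp [Config.setR, Config.next, hpc2, Nat.add_assoc]
    · simp [hpc2, cost, Nat.add_assoc]
    · simp [eval]
    · intro j hj
      simp [ht1 j hj, ht2 j (by omega)]
    · intro j hj
      simp [show j ≠ t by omega, hr1 j hj, hr2 j (by omega)]

open Classical in
theorem Cond.run {B w : ℕ} (hB : B = 2 ^ w) {P : Program} (c : Cond) :
    ∀ (o l l' : ℕ) (τ : Config) (σ : St), CodeAt P o (c.code o l l') → Sim B τ σ → τ.pc = o →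
    c.ok B σ → ∃ k ≤ c.cost, ∃ τ', steps w P k τ = some τ' ∧ Sim B τ' σ ∧
      τ'.pc = if c.eval σ then l else l' := by
  induction c with
  | wlt a b =>
    intro o l l' τ σ hc hs hpc hok
    rw [code, codeAt_append, codeAt_append, codeAt_cons, codeAt_cons, WExp.length_code] at hc
    obtain ⟨τ1, h1, hs1, hpc1, hv1, ht1, hr1⟩ := a.run hB 0 o τ σ hc.1.1 hs hpc hok.1
    obtain ⟨τ2, h2, hs2, hpc2, hv2, ht2, hr2⟩ := b.run hB 1 _ τ1 σ hc.1.2 hs1 hpc1 hok.2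
    have ha := ht2 0 (by omega)
    obtain ⟨hi, hi', -⟩ := hc.2
    simp only [List.length_append, WExp.length_code] at hi hi'
    simp only [Nat.mul_zero, Nat.zero_add, Nat.mul_one] at hv2 ha hv1
    have hst : step w P τ2 = if a.eval σ < b.eval σ then some { τ2 with pc := l }
        else some τ2.next := by
      rw [step, hpc2, Nat.add_assoc, hi]
      simp only [hv2, ha, hv1]
    by_cases hlt : a.eval σ < b.eval σ
    · refine ⟨a.cost + b.cost + 1, by simp [cost], _, steps_trans (steps_trans h1 h2)
        (by rw [steps_one, hst, if_pos hlt]), ?_, ?_⟩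
      · exact ⟨hs2.w, hs2.r, hs2.wm, hs2.rm, hs2.wB, hs2.wmB⟩
      · simp [eval, hlt]
    · have hst2 : step w P τ2.next = some { τ2 with pc := l' } := by
        rw [step, Config.next, hpc2]
        simp only [Nat.add_assoc] at hi' ⊢
        rw [hi']
      refine ⟨a.cost + b.cost + 1 + 1, by simp [cost], _, steps_trans (steps_trans (steps_trans h1 h2)
        (by rw [steps_one, hst, if_neg hlt])) (by rw [steps_one, hst2]), ?_, ?_⟩
      · exact ⟨hs2.w, hs2.r, hs2.wm, hs2.rm, hs2.wB, hs2.wmB⟩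
      · simp [eval, hlt]
  | rlt a b =>
    intro o l l' τ σ hc hs hpc hok
    rw [code, codeAt_append, codeAt_append, codeAt_cons, codeAt_cons, RExp.length_code] at hc
    obtain ⟨τ1, h1, hs1, hpc1, hv1, ht1, hr1⟩ := a.run hB 0 o τ σ hc.1.1 hs hpc hok.1
    obtain ⟨τ2, h2, hs2, hpc2, hv2, ht2, hr2⟩ := b.run hB 1 _ τ1 σ hc.1.2 hs1 hpc1 hok.2
    have ha := hr2 0 (by omega)
    obtain ⟨hi, hi', -⟩ := hc.2
    simp only [List.length_append, RExp.length_code] at hi hi'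
    simp only [Nat.mul_zero, Nat.zero_add, Nat.mul_one] at hv2 ha hv1
    have hst : step w P τ2 = if a.eval σ < b.eval σ then some { τ2 with pc := l }
        else some τ2.next := by
      rw [step, hpc2, Nat.add_assoc, hi]
      simp only [hv2, ha, hv1]
    by_cases hlt : a.eval σ < b.eval σ
    · refine ⟨a.cost + b.cost + 1, by simp [cost], _, steps_trans (steps_trans h1 h2)
        (by rw [steps_one, hst, if_pos hlt]), ?_, ?_⟩
      · exact ⟨hs2.w, hs2.r, hs2.wm, hs2.rm, hs2.wB, hs2.wmB⟩
      · simp [eval, hlt]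
    · have hst2 : step w P τ2.next = some { τ2 with pc := l' } := by
        rw [step, Config.next, hpc2]
        simp only [Nat.add_assoc] at hi' ⊢
        rw [hi']
      refine ⟨a.cost + b.cost + 1 + 1, by simp [cost], _, steps_trans (steps_trans (steps_trans h1 h2)
        (by rw [steps_one, hst, if_neg hlt])) (by rw [steps_one, hst2]), ?_, ?_⟩
      · exact ⟨hs2.w, hs2.r, hs2.wm, hs2.rm, hs2.wB, hs2.wmB⟩
      · simp [eval, hlt]
  | not c ih =>
    intro o l l' τ σ hc hs hpc hok
    obtain ⟨k, hk, τ', h, hs', hpc'⟩ := ih o l' l τ σ hc hs hpc hok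
    refine ⟨k, hk, τ', h, hs', ?_⟩
    rw [hpc']
    by_cases he : c.eval σ <;> simp [eval, he]
  | and c d ihc ihd =>
    intro o l l' τ σ hc hs hpc hok
    rw [code, codeAt_append, length_code] at hc
    obtain ⟨k, hk, τ', h, hs', hpc'⟩ := ihc _ _ _ τ σ hc.1 hs hpc hok.1
    by_cases he : c.eval σ
    · rw [if_pos he] at hpc'
      obtain ⟨k2, hk2, τ2, h2, hs2, hpc2⟩ := ihd _ _ _ τ' σ hc.2 hs' hpc' (hok.2 he)
      refine ⟨k + k2, by simp only [cost]; omega, τ2, steps_trans h h2, hs2, ?_⟩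
      simp [hpc2, eval, he]
    · refine ⟨k, by simp only [cost]; omega, τ', h, hs', ?_⟩
      simp [hpc', eval, he]

theorem step_jump {w l : ℕ} {P : Program} {τ : Config} (h : P[τ.pc]? = some (.jump l)) :
    step w P τ = some { τ with pc := l } := by rw [step, h]

theorem Exec.run {B w : ℕ} (hB : B = 2 ^ w) {P : Program} {s : Stmt} {σ σ' : St} {k : ℕ}
    (he : Exec B s σ k σ') : ∀ (o : ℕ) (τ : Config), CodeAt P o (s.code o) → Sim B τ σ →
    τ.pc = o → ∃ k' ≤ k, ∃ τ', steps w P k' τ = some τ' ∧ Sim B τ' σ' ∧ τ'.pc = o + s.len := by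
  induction he with
  | skip σ => exact fun o τ _ hs hpc => ⟨0, le_rfl, τ, rfl, hs, by simpa [Stmt.len] using hpc⟩
  | wset σ i e hok =>
    intro o τ hc hs hpc
    rw [Stmt.code, codeAt_append, codeAt_cons, WExp.length_code] at hc
    obtain ⟨τ1, h1, hs1, hpc1, hv1, ht1, hr1⟩ := e.run hB 0 o τ σ hc.1 hs hpc hok
    have hv := e.eval_lt hB hs hok
    have hv' := hv
    rw [hB] at hv'
    simp only [Nat.mul_zero, Nat.zero_add] at hv1
    refine ⟨_, le_rfl, { τ1 with pc := τ1.pc + 1, wreg := Function.update τ1.wreg (2 * i) (e.eval σ) },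
      steps_trans h1 ?_, ?_, ?_⟩
    · rw [steps_one, step, hpc1, hc.2.1]
      simp [Config.setW, Config.next, hv1, hv', hpc1]
    · refine ⟨fun j => ?_, hs1.r, hs1.wm, hs1.rm, fun j => ?_, hs1.wmB⟩
      · by_cases hj : j = i <;> simp [hj, hs1.w]
      · by_cases hj : j = i <;> simp [hj, hv, hs1.wB]
    · simp [hpc1, Stmt.len, Nat.add_assoc]
  | rset σ i e hok =>
    intro o τ hc hs hpc
    rw [Stmt.code, codeAt_append, codeAt_cons, RExp.length_code] at hc
    obtain ⟨τ1, h1, hs1, hpc1, hv1, ht1, hr1⟩ := e.run hB 0 o τ σ hc.1 hs hpc hok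
    simp only [Nat.mul_zero, Nat.zero_add] at hv1
    refine ⟨_, le_rfl, { τ1 with pc := τ1.pc + 1, rreg := Function.update τ1.rreg (2 * i) (e.eval σ) },
      steps_trans h1 ?_, ?_, ?_⟩
    · rw [steps_one, step, hpc1, hc.2.1]
      simp [Config.setR, Config.next, hv1, hpc1]
    · refine ⟨hs1.w, fun j => ?_, hs1.wm, hs1.rm, hs1.wB, hs1.wmB⟩
      by_cases hj : j = i <;> simp [hj, hs1.r]
    · simp [hpc1, Stmt.len, Nat.add_assoc]
  | wput σ a e ha hok =>
    intro o τ hc hs hpc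
    rw [Stmt.code, codeAt_append, codeAt_append, codeAt_cons, WExp.length_code] at hc
    obtain ⟨τ1, h1, hs1, hpc1, hv1, ht1, hr1⟩ := a.run hB 0 o τ σ hc.1.1 hs hpc ha
    obtain ⟨τ2, h2, hs2, hpc2, hv2, ht2, hr2⟩ := e.run hB 1 _ τ1 σ hc.1.2 hs1 hpc1 hok
    have hv := e.eval_lt hB hs hok
    have h0 := ht2 0 (by omega)
    have hi := hc.2.1
    simp only [List.length_append, WExp.length_code] at hi
    simp only [Nat.mul_zero, Nat.zero_add, Nat.mul_one] at hv1 hv2 h0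
    refine ⟨_, le_rfl, { τ2 with pc := τ2.pc + 1, wmem := Function.update τ2.wmem (a.eval σ) (e.eval σ) },
      steps_trans (steps_trans h1 h2) ?_, ?_, ?_⟩
    · rw [steps_one, step, hpc2, Nat.add_assoc, hi]
      simp [Config.next, hv1, hv2, h0, Nat.add_assoc]
    · refine ⟨hs2.w, hs2.r, ?_, hs2.rm, hs2.wB, fun j => ?_⟩
      · simp [hs2.wm, St.putW]
      · by_cases hj : j = a.eval σ <;> simp [hj, hv, hs1.wmB]
    · simp [hpc2, Stmt.len, Nat.add_assoc]
  | rput σ a e ha hok =>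
    intro o τ hc hs hpc
    rw [Stmt.code, codeAt_append, codeAt_append, codeAt_cons, WExp.length_code] at hc
    obtain ⟨τ1, h1, hs1, hpc1, hv1, ht1, hr1⟩ := a.run hB 0 o τ σ hc.1.1 hs hpc ha
    obtain ⟨τ2, h2, hs2, hpc2, hv2, ht2, hr2⟩ := e.run hB 1 _ τ1 σ hc.1.2 hs1 hpc1 hok
    have h0 := ht2 0 (by omega)
    have hi := hc.2.1
    simp only [List.length_append, WExp.length_code, RExp.length_code] at hi
    simp only [Nat.mul_zero, Nat.zero_add, Nat.mul_one] at hv1 hv2 h0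
    refine ⟨_, le_rfl, { τ2 with pc := τ2.pc + 1, rmem := Function.update τ2.rmem (a.eval σ) (e.eval σ) },
      steps_trans (steps_trans h1 h2) ?_, ?_, ?_⟩
    · rw [steps_one, step, hpc2, Nat.add_assoc, hi]
      simp [Config.next, hv1, hv2, h0, Nat.add_assoc]
    · exact ⟨hs2.w, hs2.r, hs2.wm, by simp [hs2.rm, St.putR], hs2.wB, hs2.wmB⟩
    · simp [hpc2, Stmt.len, Nat.add_assoc]
  | @seq s t σ k τ' k' υ h h' ih ih' =>
    intro o τ hc hs hpc
    rw [Stmt.code, codeAt_append, Stmt.length_code] at hc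
    obtain ⟨k1, hk1, τ1, h1, hs1, hpc1⟩ := ih o τ hc.1 hs hpc
    obtain ⟨k2, hk2, τ2, h2, hs2, hpc2⟩ := ih' _ τ1 hc.2 hs1 hpc1
    exact ⟨k1 + k2, by omega, τ2, steps_trans h1 h2, hs2, by rw [hpc2, Stmt.len, Nat.add_assoc]⟩
  | @iteTrue c s t σ k υ hok hev h ih =>
    intro o τ hc hs hpc
    rw [Stmt.code, codeAt_append, codeAt_append, codeAt_cons, Cond.length_code,
      Stmt.length_code] at hc
    obtain ⟨k1, hk1, τ1, h1, hs1, hpc1⟩ := c.run hB _ _ _ τ σ hc.1 hs hpc hok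
    rw [if_pos hev] at hpc1
    obtain ⟨k2, hk2, τ2, h2, hs2, hpc2⟩ := ih _ τ1 hc.2.1 hs1 hpc1
    refine ⟨k1 + k2 + 1, by omega, _, steps_trans (steps_trans h1 h2)
      (by rw [steps_one, step_jump (by rw [hpc2]; exact hc.2.2.1)]), ?_, ?_⟩
    · exact ⟨hs2.w, hs2.r, hs2.wm, hs2.rm, hs2.wB, hs2.wmB⟩
    · simp only [Stmt.len]; omega
  | @iteFalse c s t σ k υ hok hev h ih =>
    intro o τ hc hs hpc
    rw [Stmt.code, codeAt_append, codeAt_append, codeAt_cons, Cond.length_code,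
      Stmt.length_code] at hc
    obtain ⟨k1, hk1, τ1, h1, hs1, hpc1⟩ := c.run hB _ _ _ τ σ hc.1 hs hpc hok
    rw [if_neg hev] at hpc1
    obtain ⟨k2, hk2, τ2, h2, hs2, hpc2⟩ := ih _ τ1 hc.2.2.2 hs1 hpc1
    refine ⟨k1 + k2, by omega, τ2, steps_trans h1 h2, hs2, ?_⟩
    simp only [hpc2, Stmt.len]; omega
  | @loopFalse c s σ hok hev =>
    intro o τ hc hs hpc
    rw [Stmt.code, codeAt_append, codeAt_append, codeAt_cons, Cond.length_code,
      Stmt.length_code] at hc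
    obtain ⟨k1, hk1, τ1, h1, hs1, hpc1⟩ := c.run hB _ _ _ τ σ hc.1 hs hpc hok
    rw [if_neg hev] at hpc1
    exact ⟨k1, hk1, τ1, h1, hs1, by simp only [hpc1, Stmt.len]; omega⟩
  | @loopTrue c s σ k υ k' υ' hok hev h h' ih ih' =>
    intro o τ hc hs hpc
    have hc0 := hc
    rw [Stmt.code, codeAt_append, codeAt_append, codeAt_cons, Cond.length_code,
      Stmt.length_code] at hc
    obtain ⟨k1, hk1, τ1, h1, hs1, hpc1⟩ := c.run hB _ _ _ τ σ hc.1 hs hpc hok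
    rw [if_pos hev] at hpc1
    obtain ⟨k2, hk2, τ2, h2, hs2, hpc2⟩ := ih _ τ1 hc.2.1 hs1 hpc1
    obtain ⟨k3, hk3, τ3, h3, hs3, hpc3⟩ := ih' o { τ2 with pc := o } hc0
      ⟨hs2.w, hs2.r, hs2.wm, hs2.rm, hs2.wB, hs2.wmB⟩ rfl
    exact ⟨k1 + k2 + 1 + k3, by omega, τ3, steps_trans (steps_trans (steps_trans h1 h2)
      (by rw [steps_one, step_jump (by rw [hpc2]; exact hc.2.2.1)])) h3, hs3, hpc3⟩

/-! ### Weakest preconditions -/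

/-- `s`, started in `σ`, terminates after some time `t` in some state `τ` with `Q t τ`. -/
def wp (B : ℕ) (s : Stmt) (Q : ℕ → St → Prop) (σ : St) : Prop := ∃ t τ, Exec B s σ t τ ∧ Q t τ

section wp
variable {B : ℕ} {Q Q' : ℕ → St → Prop} {σ : St}

theorem wp_mono {s : Stmt} (h : wp B s Q σ) (hQ : ∀ t τ, Q t τ → Q' t τ) : wp B s Q' σ := by
  obtain ⟨t, τ, he, hq⟩ := h
  exact ⟨t, τ, he, hQ t τ hq⟩

theorem wp_skip : wp B .skip Q σ ↔ Q 0 σ :=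
  ⟨by rintro ⟨_, _, ⟨⟩, h⟩; exact h, fun h => ⟨_, _, .skip σ, h⟩⟩

theorem wp_wset {i : ℕ} {e : WExp} :
    wp B (.wset i e) Q σ ↔ e.ok B σ ∧ Q (e.cost + 1) (σ.setW i (e.eval σ)) :=
  ⟨by rintro ⟨_, _, ⟨⟩, h⟩; exact ⟨‹_›, h⟩, fun h => ⟨_, _, .wset σ i e h.1, h.2⟩⟩

theorem wp_rset {i : ℕ} {e : RExp} :
    wp B (.rset i e) Q σ ↔ e.ok B σ ∧ Q (e.cost + 1) (σ.setR i (e.eval σ)) :=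
  ⟨by rintro ⟨_, _, ⟨⟩, h⟩; exact ⟨‹_›, h⟩, fun h => ⟨_, _, .rset σ i e h.1, h.2⟩⟩

theorem wp_wput {a e : WExp} :
    wp B (.wput a e) Q σ ↔
      (a.ok B σ ∧ e.ok B σ) ∧ Q (a.cost + e.cost + 1) (σ.putW (a.eval σ) (e.eval σ)) :=
  ⟨by rintro ⟨_, _, ⟨⟩, h⟩; exact ⟨⟨‹_›, ‹_›⟩, h⟩, fun h => ⟨_, _, .wput σ a e h.1.1 h.1.2, h.2⟩⟩

theorem wp_rput {a : WExp} {e : RExp} :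
    wp B (.rput a e) Q σ ↔
      (a.ok B σ ∧ e.ok B σ) ∧ Q (a.cost + e.cost + 1) (σ.putR (a.eval σ) (e.eval σ)) :=
  ⟨by rintro ⟨_, _, ⟨⟩, h⟩; exact ⟨⟨‹_›, ‹_›⟩, h⟩, fun h => ⟨_, _, .rput σ a e h.1.1 h.1.2, h.2⟩⟩

theorem wp_seq {s t : Stmt} :
    wp B (s ;; t) Q σ ↔ wp B s (fun k τ => wp B t (fun k' υ => Q (k + k') υ) τ) σ := by
  constructor
  · rintro ⟨_, _, ⟨⟩, h⟩
    exact ⟨_, _, ‹_›, _, _, ‹_›, h⟩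
  · rintro ⟨_, _, h, _, _, h', hq⟩
    exact ⟨_, _, .seq h h', hq⟩

theorem wp_ite {c : Cond} {s t : Stmt} :
    wp B (.ite c s t) Q σ ↔ c.ok B σ ∧ (c.eval σ → wp B s (fun k τ => Q (c.cost + k + 1) τ) σ) ∧
      (¬ c.eval σ → wp B t (fun k τ => Q (c.cost + k + 1) τ) σ) := by
  constructor
  · rintro ⟨_, _, h | h, hq⟩
    · exact ⟨‹_›, fun _ => ⟨_, _, ‹_›, hq⟩, fun h => absurd ‹_› h⟩
    · exact ⟨‹_›, fun h => absurd h ‹_›, fun _ => ⟨_, _, ‹_›, hq⟩⟩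
  · rintro ⟨hc, h1, h2⟩
    by_cases he : c.eval σ
    · obtain ⟨_, _, h, hq⟩ := h1 he
      exact ⟨_, _, .iteTrue hc he h, hq⟩
    · obtain ⟨_, _, h, hq⟩ := h2 he
      exact ⟨_, _, .iteFalse hc he h, hq⟩

/-- The loop rule: `I` is the invariant, `a` a ghost variable and `Φ` a potential that pays for
the running time. -/
theorem wp_loop {α : Type*} (I : α → St → Prop) (Φ : α → ℕ) {c : Cond} {s : Stmt}
    (hok : ∀ a σ, I a σ → c.ok B σ)
    (hstep : ∀ a σ, I a σ → c.eval σ →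
      wp B s (fun k τ => ∃ a', I a' τ ∧ c.cost + k + 1 + Φ a' ≤ Φ a) σ)
    (a : α) (h0 : I a σ)
    (hQ : ∀ a' k τ, I a' τ → ¬ c.eval τ → k + Φ a' ≤ Φ a + c.cost → Q k τ) :
    wp B (.loop c s) Q σ := by
  suffices H : ∀ (N : ℕ) (a : α) (σ : St), Φ a ≤ N → I a σ →
      ∃ t τ, Exec B (.loop c s) σ t τ ∧ ∃ a', I a' τ ∧ ¬ c.eval τ ∧ t + Φ a' ≤ Φ a + c.cost by
    obtain ⟨t, τ, he, a', hI, hc, ht⟩ := H _ a σ le_rfl h0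
    exact ⟨t, τ, he, hQ a' t τ hI hc ht⟩
  intro N
  induction N with
  | zero =>
    intro a σ hN hI
    by_cases he : c.eval σ
    · obtain ⟨t, τ, _, a', _, h⟩ := hstep a σ hI he
      omega
    · exact ⟨_, _, .loopFalse (hok a σ hI) he, a, hI, he, by omega⟩
  | succ N ih =>
    intro a σ hN hI
    by_cases he : c.eval σ
    · obtain ⟨t, τ, hx, a', hI', h⟩ := hstep a σ hI he
      obtain ⟨t', τ', hx', a'', hI'', hc, ht⟩ := ih a' τ (by omega) hI'
      exact ⟨_, _, .loopTrue (hok a σ hI) he hx hx', a'', hI'', hc, by omega⟩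
    · exact ⟨_, _, .loopFalse (hok a σ hI) he, a, hI, he, by omega⟩
end wp

/-- Evaluation rules for word expressions. -/
theorem WExp.rules :
    (∀ σ i, eval σ (reg i) = σ.w i) ∧ (∀ σ a, eval σ (mem a) = σ.wm (eval σ a)) ∧
    (∀ σ n, eval σ (no_index (OfNat.ofNat n)) = n) ∧ (∀ σ a b, eval σ (a + b) = eval σ a + eval σ b) ∧
    (∀ σ a b, eval σ (a - b) = eval σ a - eval σ b) ∧ (∀ σ a b, eval σ (a * b) = eval σ a * eval σ b) ∧
    (∀ σ a b, eval σ (a / b) = eval σ a / eval σ b) ∧ (∀ B σ i, ok B σ (reg i) ↔ True) ∧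
    (∀ B σ a, ok B σ (mem a) ↔ ok B σ a) ∧ (∀ B σ n, ok B σ (no_index (OfNat.ofNat n)) ↔ n < B) ∧
    (∀ B σ a b, ok B σ (a + b) ↔ ok B σ a ∧ ok B σ b ∧ eval σ a + eval σ b < B) ∧
    (∀ B σ a b, ok B σ (a - b) ↔ ok B σ a ∧ ok B σ b) ∧
    (∀ B σ a b, ok B σ (a * b) ↔ ok B σ a ∧ ok B σ b ∧ eval σ a * eval σ b < B) ∧
    (∀ B σ a b, ok B σ (a / b) ↔ ok B σ a ∧ ok B σ b ∧ 0 < eval σ b) ∧ (∀ i, cost (reg i) = 1) ∧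
    (∀ a, cost (mem a) = cost a + 1) ∧ (∀ n, cost (no_index (OfNat.ofNat n)) = 1) ∧
    (∀ a b, cost (a + b) = cost a + cost b + 1) ∧ (∀ a b, cost (a - b) = cost a + cost b + 1) ∧
    (∀ a b, cost (a * b) = cost a + cost b + 1) ∧ ∀ a b, cost (a / b) = cost a + cost b + 1 := by
  have h : ∀ p q : Prop, (p ∧ q ∧ True) ↔ p ∧ q := by simp
  refine ⟨?_, ?_, ?_, ?_, ?_, ?_, ?_, ?_, ?_, ?_, ?_, fun _ _ _ _ => h _ _, ?_, ?_, ?_, ?_, ?_, ?_, ?_, ?_, ?_⟩ <;> intros <;> rfl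

/-- Evaluation rules for real expressions. -/
theorem RExp.rules :
    (∀ σ i, eval σ (reg i) = σ.r i) ∧ (∀ σ a, eval σ (mem a) = σ.rm (a.eval σ)) ∧
    (∀ σ a, eval σ (cast a) = a.eval σ) ∧ (∀ σ a b, eval σ (a + b) = eval σ a + eval σ b) ∧
    (∀ σ a b, eval σ (a - b) = eval σ a - eval σ b) ∧ (∀ σ a b, eval σ (a * b) = eval σ a * eval σ b) ∧
    (∀ B σ i, ok B σ (reg i) ↔ True) ∧ (∀ B σ a, ok B σ (mem a) ↔ a.ok B σ) ∧ (∀ B σ a, ok B σ (cast a) ↔ a.ok B σ) ∧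
    (∀ B σ a b, ok B σ (a + b) ↔ ok B σ a ∧ ok B σ b) ∧ (∀ B σ a b, ok B σ (a - b) ↔ ok B σ a ∧ ok B σ b) ∧
    (∀ B σ a b, ok B σ (a * b) ↔ ok B σ a ∧ ok B σ b) ∧ (∀ i, cost (reg i) = 1) ∧ (∀ a, cost (mem a) = a.cost + 1) ∧
    (∀ a, cost (cast a) = a.cost + 1) ∧ (∀ a b, cost (a + b) = cost a + cost b + 1) ∧
    (∀ a b, cost (a - b) = cost a + cost b + 1) ∧ ∀ a b, cost (a * b) = cost a + cost b + 1 := by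
  have h : ∀ p q : Prop, (p ∧ q ∧ True) ↔ p ∧ q := by simp
  refine ⟨?_, ?_, ?_, ?_, ?_, ?_, ?_, ?_, ?_, fun _ _ _ _ => h _ _, fun _ _ _ _ => h _ _, fun _ _ _ _ => h _ _, ?_, ?_, ?_, ?_,
    ?_, ?_⟩ <;> intros <;> rfl

/-- Evaluation rules for expressions and conditions. -/
@[simp] theorem rules : type_of% WExp.rules ∧ type_of% RExp.rules ∧
    (∀ σ a b, Cond.eval σ (.wlt a b) ↔ a.eval σ < b.eval σ) ∧ (∀ σ a b, Cond.eval σ (.rlt a b) ↔ a.eval σ < b.eval σ) ∧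
    (∀ σ c, Cond.eval σ (.not c) ↔ ¬ c.eval σ) ∧ (∀ σ c d, Cond.eval σ (.and c d) ↔ c.eval σ ∧ d.eval σ) ∧
    (∀ B σ a b, Cond.ok B σ (.wlt a b) ↔ a.ok B σ ∧ b.ok B σ) ∧ (∀ B σ a b, Cond.ok B σ (.rlt a b) ↔ a.ok B σ ∧ b.ok B σ) ∧
    (∀ B σ c, Cond.ok B σ (.not c) ↔ c.ok B σ) ∧ (∀ B σ c d, Cond.ok B σ (.and c d) ↔ c.ok B σ ∧ (c.eval σ → d.ok B σ)) ∧
    (∀ a b, Cond.cost (.wlt a b) = a.cost + b.cost + 2) ∧ (∀ a b, Cond.cost (.rlt a b) = a.cost + b.cost + 2) ∧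
    (∀ c, Cond.cost (.not c) = c.cost) ∧ ∀ c d, Cond.cost (.and c d) = c.cost + d.cost := by
  refine ⟨WExp.rules, RExp.rules, ?_, ?_, ?_, ?_, ?_, ?_, ?_, ?_, ?_, ?_, ?_, ?_⟩ <;> intros <;> rfl

attribute [simp] wp_skip wp_wset wp_rset wp_wput wp_rput wp_seq wp_ite

end RealRAM

/-! ## Sorted runs -/

section Runs
variable {α : Type*} [LinearOrder α]

/-- Number of entries at most `v`. -/
def cntLE (v : α) (l : List α) : ℕ := l.countP (fun a => decide (a ≤ v))

@[simp] theorem cntLE_nil (v : α) : cntLE v [] = 0 := rfl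
theorem cntLE_cons (v a : α) (l : List α) :
    cntLE v (a :: l) = cntLE v l + if a ≤ v then 1 else 0 := by
  simp [cntLE, List.countP_cons]
@[simp] theorem cntLE_append (v : α) (l l' : List α) : cntLE v (l ++ l') = cntLE v l + cntLE v l' := by
  simp [cntLE]
theorem cntLE_perm {v : α} {l l' : List α} (h : l.Perm l') : cntLE v l = cntLE v l' :=
  h.countP_eq _
theorem cntLE_le_length (v : α) (l : List α) : cntLE v l ≤ l.length := List.countP_le_length

/-- The entries at odd positions. -/
def odds : List α → List α
  | _ :: y :: t => y :: odds t
  | [_] => []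
  | [] => []

theorem length_odds : ∀ l : List α, (odds l).length = l.length / 2
  | [] => by simp [odds]
  | [_] => by simp [odds]
  | _ :: y :: t => by simp only [odds, List.length_cons, length_odds t]; omega

theorem odds_sublist : ∀ l : List α, (odds l).Sublist l
  | [] => List.Sublist.refl _
  | [_] => List.nil_sublist _
  | _ :: _ :: t => ((odds_sublist t).cons_cons _).cons _

theorem odds_append : ∀ l l' : List α, Even l.length → odds (l ++ l') = odds l ++ odds l'
  | [], _, _ => rfl
  | [_], _, h => by simp at h
  | _ :: y :: t, l', h => by
    have : Even t.length := by
      simp only [List.length_cons] at h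
      obtain ⟨r, hr⟩ := h
      exact ⟨r - 1, by omega⟩
    simp [odds, odds_append t l' this]

theorem cntLE_odds (v : α) : ∀ l : List α, l.Pairwise (· ≤ ·) →
    2 * cntLE v (odds l) ≤ cntLE v l ∧ cntLE v l ≤ 2 * cntLE v (odds l) + 1
  | [], _ => by simp [odds]
  | [a], _ => by simp only [odds, cntLE_cons, cntLE_nil]; split_ifs <;> omega
  | a :: y :: t, h => by
    obtain ⟨h1, h2⟩ := List.pairwise_cons.1 h
    obtain ⟨h3, h4⟩ := List.pairwise_cons.1 h2
    have ih := cntLE_odds v t h4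
    simp only [odds, cntLE_cons]
    by_cases hy : y ≤ v
    · have ha : a ≤ v := (h1 y (by simp)).trans hy
      simp only [hy, ha, if_true]; omega
    · have h0 : cntLE v t = 0 := by
        rw [cntLE, List.countP_eq_zero]
        intro b hb
        simpa using lt_of_lt_of_le (not_le.1 hy) (h3 b hb)
      simp only [hy, if_false]
      split_ifs <;> omega

/-- The list consists of sorted runs of length `L`, the last of which may be shorter. -/
inductive Runs (L : ℕ) : List α → Prop
  | last (b : List α) (hb : b.Pairwise (· ≤ ·)) (hL : b.length ≤ L) : Runs L b
  | cons (b l : List α) (hb : b.Pairwise (· ≤ ·)) (hL : b.length = L) (hl : Runs L l) :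
      Runs L (b ++ l)

theorem Runs.nil (L : ℕ) : Runs L ([] : List α) := .last _ .nil (by simp)

theorem runs_one : ∀ l : List α, Runs 1 l
  | [] => .nil 1
  | a :: l => .cons [a] l (by simp) rfl (runs_one l)

theorem Runs.take_drop {L : ℕ} {l : List α} (h : Runs L l) :
    (l.take L).Pairwise (· ≤ ·) ∧ Runs L (l.drop L) := by
  cases h with
  | last _ hb hL => rw [List.take_of_length_le hL, List.drop_of_length_le hL]; exact ⟨hb, .nil L⟩
  | cons b l hb hL hl => subst hL; simpa using ⟨hb, hl⟩

theorem Runs.sorted {L : ℕ} {l : List α} (h : Runs L l) (hl : l.length ≤ L) :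
    l.Pairwise (· ≤ ·) := by
  simpa [List.take_of_length_le hl] using h.take_drop.1

theorem Runs.append {L : ℕ} {l b : List α} (h : Runs L l) (hd : L ∣ l.length)
    (hb : b.Pairwise (· ≤ ·)) (hL : b.length ≤ L) : Runs L (l ++ b) := by
  induction h with
  | last c hc hcL =>
    rcases Nat.eq_zero_or_pos c.length with h0 | h0
    · rw [List.length_eq_zero_iff.1 h0]; exact .last _ hb hL
    · exact .cons c b hc (le_antisymm hcL (Nat.le_of_dvd h0 hd)) (.last _ hb hL)
  | cons c l hc hcL _ ih =>
    rw [List.append_assoc]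
    refine .cons c _ hc hcL (ih ?_)
    rw [List.length_append, hcL] at hd
    exact (Nat.dvd_add_right (dvd_refl L)).1 hd

theorem Runs.odds {L : ℕ} {l : List α} (h : Runs (2 * L) l) : Runs L (odds l) := by
  induction h with
  | last c hc hcL => exact .last _ (hc.sublist (odds_sublist c)) (by rw [length_odds]; omega)
  | cons c l hc hcL _ ih =>
    rw [odds_append _ _ (by rw [hcL]; simp)]
    exact .cons _ _ (hc.sublist (odds_sublist c)) (by rw [length_odds]; omega) ih

theorem Runs.cntLE_odds {L : ℕ} {l : List α} (h : Runs (2 * L) l) (hL : 0 < L) (v : α) :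
    2 * cntLE v (_root_.odds l) ≤ cntLE v l ∧
      cntLE v l ≤ 2 * cntLE v (_root_.odds l) + (l.length / (2 * L) + 1) := by
  induction h with
  | last c hc hcL =>
    have := _root_.cntLE_odds v c hc
    have := Nat.zero_le (c.length / (2 * L))
    generalize c.length / (2 * L) = q at *
    omega
  | cons c l hc hcL _ ih =>
    rw [odds_append _ _ (by rw [hcL]; simp)]
    have := _root_.cntLE_odds v c hc
    rw [List.length_append, hcL, cntLE_append, cntLE_append, Nat.add_div_left _ (by omega)]
    omega

end Runs

/-- The values of `f` on `b, b + 1, …, b + n - 1`. -/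
def arr {α : Type*} (f : ℕ → α) (b n : ℕ) : List α := (List.range' b n).map f

section arr
variable {α : Type*} (f : ℕ → α) (b n : ℕ)
@[simp] theorem length_arr : (arr f b n).length = n := by simp [arr]
@[simp] theorem arr_zero : arr f b 0 = [] := rfl
theorem arr_succ_left : arr f b (n + 1) = f b :: arr f (b + 1) n := by
  simp [arr, List.range'_succ]
theorem arr_add (k : ℕ) : arr f b (n + k) = arr f b n ++ arr f (b + n) k := by
  simp [arr, ← List.map_append, List.range'_append_1]
theorem arr_succ : arr f b (n + 1) = arr f b n ++ [f (b + n)] := by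
  rw [arr_add]; rfl
theorem getElem_arr (i : ℕ) (h : i < (arr f b n).length) : (arr f b n)[i] = f (b + i) := by
  simp [arr]
theorem mem_arr {x : α} : x ∈ arr f b n ↔ ∃ i < n, f (b + i) = x := by
  simp only [arr, List.mem_map, List.mem_range'_1]
  constructor
  · rintro ⟨p, h, rfl⟩; exact ⟨p - b, by omega, by congr 1; omega⟩
  · rintro ⟨i, h, rfl⟩; exact ⟨b + i, by omega, rfl⟩
variable {f b n}
theorem arr_congr {g : ℕ → α} (h : ∀ p, b ≤ p → p < b + n → f p = g p) : arr f b n = arr g b n := by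
  refine List.map_congr_left fun p hp => ?_
  rw [List.mem_range'_1] at hp
  exact h p hp.1 hp.2
theorem take_arr (k : ℕ) : (arr f b n).take k = arr f b (min k n) := by
  rcases le_total k n with h | h
  · obtain ⟨c, rfl⟩ := Nat.exists_eq_add_of_le h
    rw [arr_add, min_eq_left h, List.take_left' (by simp)]
  · rw [List.take_of_length_le (by simpa using h), min_eq_right h]
theorem drop_arr (k : ℕ) : (arr f b n).drop k = arr f (b + k) (n - k) := by
  rcases le_total k n with h | h
  · obtain ⟨c, rfl⟩ := Nat.exists_eq_add_of_le h
    rw [arr_add, List.drop_left' (by simp)]; simp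
  · rw [List.drop_of_length_le (by simpa using h), Nat.sub_eq_zero_of_le h, arr_zero]
end arr

namespace RealRAM

/-- A memory address as a sortable item: the real there is the key, the word there is the payload
and breaks ties. -/
def St.cell (σ : St) (p : ℕ) : ℝ ×ₗ ℕ := toLex (σ.rm p, σ.wm p)

@[simp] theorem St.cell_setW (σ : St) (i v : ℕ) : (σ.setW i v).cell = σ.cell := rfl
@[simp] theorem St.cell_setR (σ : St) (i : ℕ) (v : ℝ) : (σ.setR i v).cell = σ.cell := rfl

/-- Register `99` is the allocation pointer. The step from `σ` to `τ` keeps the variables below `b`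
and the memory below the allocation pointer. -/
structure Keeps (b : ℕ) (σ τ : St) : Prop where
  wlt : ∀ i < b, τ.w i = σ.w i
  rlt : ∀ i < b, τ.r i = σ.r i
  al : σ.w 99 ≤ τ.w 99
  wm : ∀ p < σ.w 99, τ.wm p = σ.wm p
  rm : ∀ p < σ.w 99, τ.rm p = σ.rm p

namespace Keeps
variable {b : ℕ} {σ τ υ : St}
theorem w (h : Keeps b σ τ) (i : ℕ) (hi : i < b := by omega) : τ.w i = σ.w i := h.wlt i hi
theorem r (h : Keeps b σ τ) (i : ℕ) (hi : i < b := by omega) : τ.r i = σ.r i := h.rlt i hi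
theorem rfl' : Keeps b σ σ := ⟨fun _ _ => rfl, fun _ _ => rfl, le_rfl, fun _ _ => rfl, fun _ _ => rfl⟩
theorem trans (h : Keeps b σ τ) (h' : Keeps b τ υ) : Keeps b σ υ where
  wlt i hi := (h'.w i hi).trans (h.w i hi)
  rlt i hi := (h'.r i hi).trans (h.r i hi)
  al := h.al.trans h'.al
  wm p hp := (h'.wm p (hp.trans_le h.al)).trans (h.wm p hp)
  rm p hp := (h'.rm p (hp.trans_le h.al)).trans (h.rm p hp)
theorem mono {c : ℕ} (h : Keeps c σ τ) (hb : b ≤ c := by omega) : Keeps b σ τ where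
  wlt i hi := h.w i (hi.trans_le hb)
  rlt i hi := h.r i (hi.trans_le hb)
  al := h.al
  wm := h.wm
  rm := h.rm
theorem setW (h : Keeps b σ τ) {i v : ℕ} (hi : b ≤ i := by omega) (hi' : i ≠ 99 := by omega) : Keeps b σ (τ.setW i v) where
  wlt j hj := by simp [show j ≠ i by omega, h.w j hj]
  rlt := h.rlt
  al := by simp [hi'.symm, h.al]
  wm := h.wm
  rm := h.rm
theorem setAl (h : Keeps b σ τ) {v : ℕ} (hv : σ.w 99 ≤ v) (hb : b ≤ 99 := by omega) :
    Keeps b σ (τ.setW 99 v) where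
  wlt j hj := by simp [show j ≠ 99 by omega, h.w j hj]
  rlt := h.rlt
  al := by simpa using hv
  wm := h.wm
  rm := h.rm
theorem setR (h : Keeps b σ τ) {i : ℕ} {v : ℝ} (hi : b ≤ i := by omega) : Keeps b σ (τ.setR i v) where
  wlt := h.wlt
  rlt j hj := by simp [show j ≠ i by omega, h.r j hj]
  al := h.al
  wm := h.wm
  rm := h.rm
theorem putW (h : Keeps b σ τ) {a v : ℕ} (ha : σ.w 99 ≤ a) : Keeps b σ (τ.putW a v) where
  wlt := h.wlt
  rlt := h.rlt
  al := h.al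
  wm p hp := by simp [show p ≠ a by omega, h.wm p hp]
  rm := h.rm
theorem putR (h : Keeps b σ τ) {a : ℕ} {v : ℝ} (ha : σ.w 99 ≤ a) : Keeps b σ (τ.putR a v) where
  wlt := h.wlt
  rlt := h.rlt
  al := h.al
  wm := h.wm
  rm p hp := by simp [show p ≠ a by omega, h.rm p hp]
theorem cell (h : Keeps b σ τ) {p : ℕ} (hp : p < σ.w 99) : τ.cell p = σ.cell p := by
  simp [St.cell, h.wm p hp, h.rm p hp]
theorem arr_cell (h : Keeps b σ τ) {p n : ℕ} (hp : p + n ≤ σ.w 99) :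
    arr τ.cell p n = arr σ.cell p n :=
  arr_congr fun q _ hq => h.cell (by omega)
theorem arr_wm (h : Keeps b σ τ) {p n : ℕ} (hp : p + n ≤ σ.w 99) :
    arr τ.wm p n = arr σ.wm p n :=
  arr_congr fun q _ hq => h.wm q (by omega)
end Keeps

/-! ## Merging -/

/-- Comparison of the memory cells at the addresses in the variables `i` and `j`. -/
def cellLE (i j : ℕ) : Cond :=
  .and (.not (.rlt (.mem (.reg j)) (.mem (.reg i))))
    (.not (.and (.not (.rlt (.mem (.reg i)) (.mem (.reg j))))
      (.wlt (.mem (.reg j)) (.mem (.reg i)))))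

theorem cellLE_eval (σ : St) (i j : ℕ) :
    (cellLE i j).eval σ ↔ σ.cell (σ.w i) ≤ σ.cell (σ.w j) := by
  simp only [cellLE, St.cell, Prod.Lex.toLex_le_toLex, rules, not_lt, not_and]
  constructor
  · rintro ⟨h1, h2⟩
    rcases h1.lt_or_eq with h | h
    · exact Or.inl h
    · exact Or.inr ⟨h, h2 h.ge⟩
  · rintro (h | ⟨h, h'⟩)
    · exact ⟨h.le, fun h2 => absurd h (not_lt.2 h2)⟩
    · exact ⟨h.le, fun _ => h'⟩

@[simp] theorem cellLE_ok (B : ℕ) (σ : St) (i j : ℕ) : (cellLE i j).ok B σ ↔ True := by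
  simp [cellLE]

@[simp] theorem cellLE_cost (i j : ℕ) : (cellLE i j).cost = 18 := by simp [cellLE]

/-- Merge the runs at `w60, …, w61 - 1` and `w62, …, w63 - 1` into new memory. -/
def mergeRuns : Stmt :=
  .loop (.not (.and (.not (.wlt (.reg 60) (.reg 61))) (.not (.wlt (.reg 62) (.reg 63)))))
    (.ite (.and (.wlt (.reg 62) (.reg 63)) (.not (.and (.wlt (.reg 60) (.reg 61)) (cellLE 60 62))))
      (.wset 64 (.reg 62) ;; .wset 62 (.reg 62 + 1))
      (.wset 64 (.reg 60) ;; .wset 60 (.reg 60 + 1)) ;;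
    .wput (.reg 99) (.mem (.reg 64)) ;;
    .rput (.reg 99) (.mem (.reg 64)) ;;
    .wset 99 (.reg 99 + 1))

/-- Merge of two lists. -/
noncomputable def mrg (l l' : List (ℝ ×ₗ ℕ)) : List (ℝ ×ₗ ℕ) := List.merge l l' (fun a b => decide (a ≤ b))

theorem mrg_perm (l l' : List (ℝ ×ₗ ℕ)) : (mrg l l').Perm (l ++ l') := List.merge_perm_append _

theorem mrg_sorted {l l' : List (ℝ ×ₗ ℕ)} (h : l.Pairwise (· ≤ ·)) (h' : l'.Pairwise (· ≤ ·)) :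
    (mrg l l').Pairwise (· ≤ ·) := by
  have := List.pairwise_merge (le := fun a b : ℝ ×ₗ ℕ => decide (a ≤ b))
    (fun a b c hab hbc => by simp only [decide_eq_true_eq] at *; exact hab.trans hbc)
    (fun a b => by simpa using le_total a b) l l' (by simpa using h) (by simpa using h')
  simpa [mrg] using this

theorem mrg_cons_right {l l' : List (ℝ ×ₗ ℕ)} {b : ℝ ×ₗ ℕ} (h : ∀ a ∈ l.head?, b < a) :
    mrg l (b :: l') = b :: mrg l l' := by
  cases l with
  | nil => simp [mrg]
  | cons a l =>
    have := h a rfl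
    simp [mrg, this]

theorem mrg_cons_left {l l' : List (ℝ ×ₗ ℕ)} {a : ℝ ×ₗ ℕ} (h : ∀ b ∈ l'.head?, a ≤ b) :
    mrg (a :: l) l' = a :: mrg l l' := by
  cases l' with
  | nil => simp [mrg]
  | cons b l' =>
    have := h b rfl
    simp [mrg, this]

theorem head?_arr {α : Type*} {f : ℕ → α} {b n : ℕ} {x : α} (h : x ∈ (arr f b n).head?) :
    0 < n ∧ x = f b := by
  cases n with
  | zero => simp at h
  | succ n => rw [arr_succ_left] at h; simp at h; exact ⟨by omega, h.symm⟩

theorem mergeRuns_spec {B : ℕ} {Q : ℕ → St → Prop} (σ : St) (hi : σ.w 60 ≤ σ.w 61)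
    (hj : σ.w 62 ≤ σ.w 63) (hi' : σ.w 61 ≤ σ.w 99) (hj' : σ.w 63 ≤ σ.w 99)
    (hB : σ.w 99 + (σ.w 61 - σ.w 60) + (σ.w 63 - σ.w 62) + 2 < B)
    (hQ : ∀ t τ, Keeps 60 σ τ → τ.w 99 = σ.w 99 + ((σ.w 61 - σ.w 60) + (σ.w 63 - σ.w 62)) →
      arr τ.cell (σ.w 99) ((σ.w 61 - σ.w 60) + (σ.w 63 - σ.w 62)) =
        mrg (arr σ.cell (σ.w 60) (σ.w 61 - σ.w 60)) (arr σ.cell (σ.w 62) (σ.w 63 - σ.w 62)) →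
      t ≤ 70 * ((σ.w 61 - σ.w 60) + (σ.w 63 - σ.w 62)) + 20 → Q t τ) :
    wp B mergeRuns Q σ := by
  unfold mergeRuns
  refine wp_loop (fun (a : ℕ) τ => Keeps 60 σ τ ∧ τ.w 61 = σ.w 61 ∧ τ.w 63 = σ.w 63 ∧
    τ.w 60 ≤ τ.w 61 ∧ τ.w 62 ≤ τ.w 63 ∧ a = (τ.w 61 - τ.w 60) + (τ.w 63 - τ.w 62) ∧
    τ.w 99 + a = σ.w 99 + ((σ.w 61 - σ.w 60) + (σ.w 63 - σ.w 62)) ∧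
    arr τ.cell (σ.w 99) (τ.w 99 - σ.w 99) ++
      mrg (arr σ.cell (τ.w 60) (τ.w 61 - τ.w 60)) (arr σ.cell (τ.w 62) (τ.w 63 - τ.w 62)) =
        mrg (arr σ.cell (σ.w 60) (σ.w 61 - σ.w 60)) (arr σ.cell (σ.w 62) (σ.w 63 - σ.w 62)))
    (fun a => 70 * a) ?_ ?_ ((σ.w 61 - σ.w 60) + (σ.w 63 - σ.w 62)) ?_ ?_
  · intros; simp
  · rintro a τ ⟨hK, h61, h63, h1, h2, ha, h99, hM⟩ hc
    have hal := hK.al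
    have key : ∀ (υ : St) (q : ℕ), q < σ.w 99 → υ.cell (τ.w 99) = σ.cell q →
        (∀ p < τ.w 99, υ.cell p = τ.cell p) →
        arr υ.cell (σ.w 99) (τ.w 99 + 1 - σ.w 99) =
          arr τ.cell (σ.w 99) (τ.w 99 - σ.w 99) ++ [σ.cell q] := by
      intro υ q _ h1 h2
      rw [show τ.w 99 + 1 - σ.w 99 = τ.w 99 - σ.w 99 + 1 by omega, arr_succ,
        show σ.w 99 + (τ.w 99 - σ.w 99) = τ.w 99 by omega, h1,
        arr_congr (g := τ.cell) fun p _ hp => h2 p (by omega)]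
    simp only [rules, not_and, not_lt] at hc
    simp [cellLE_eval]
    constructor
    · intro hj1 hij
      refine ⟨⟨by omega, by omega⟩, ⟨by omega, by omega⟩, ⟨?_, h61, h63, h1, by omega, by omega, ?_⟩,
        by omega⟩
      · exact ((((((hK.setW).setW).putW hal).putR
          hal)).setAl (by omega))
      · rw [key _ (τ.w 62) (by omega), List.append_assoc, ← hM,
          show τ.w 63 - τ.w 62 = τ.w 63 - (τ.w 62 + 1) + 1 by omega, arr_succ_left, mrg_cons_right,
          List.singleton_append]
        · intro x hx
          obtain ⟨hx1, rfl⟩ := head?_arr hx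
          have := hij (by omega)
          rwa [hK.cell (by omega), hK.cell (by omega)] at this
        · simp [St.cell, hK.rm (τ.w 62) (by omega), hK.wm (τ.w 62) (by omega)]
        · intro p hp; simp [St.cell, show p ≠ τ.w 99 by omega]
    · intro hij
      have h3 : τ.w 60 < τ.w 61 := by
        by_contra h
        exact absurd (hij (not_le.1 (hc (by omega)))).1 h
      refine ⟨⟨by omega, by omega⟩, ⟨by omega, by omega⟩, ⟨?_, h61, h63, by omega, h2, by omega, ?_⟩,
        by omega⟩
      · exact ((((((hK.setW).setW).putW hal).putR
          hal)).setAl (by omega))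
      · rw [key _ (τ.w 60) (by omega), List.append_assoc, ← hM,
          show τ.w 61 - τ.w 60 = τ.w 61 - (τ.w 60 + 1) + 1 by omega, arr_succ_left, mrg_cons_left,
          List.singleton_append]
        · intro x hx
          obtain ⟨hx1, rfl⟩ := head?_arr hx
          have := (hij (by omega)).2
          rwa [hK.cell (by omega), hK.cell (by omega)] at this
        · simp [St.cell, hK.rm (τ.w 60) (by omega), hK.wm (τ.w 60) (by omega)]
        · intro p hp; simp [St.cell, show p ≠ τ.w 99 by omega]
  · exact ⟨Keeps.rfl', rfl, rfl, hi, hj, rfl, rfl, by simp⟩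
  · rintro a k τ ⟨hK, h61, h63, h1, h2, ha, h99, hM⟩ hc ht
    simp only [rules, not_and, not_lt] at hc
    have e1 : τ.w 61 - τ.w 60 = 0 := by omega
    have e2 : τ.w 63 - τ.w 62 = 0 := by omega
    simp only [e1, e2, arr_zero] at hM
    simp only [show mrg [] [] = [] by simp [mrg], List.append_nil] at hM
    refine hQ k τ hK (by omega) ?_ ?_
    · rw [← hM]; congr 1; omega
    · simp only [rules] at ht; omega

end RealRAM

namespace RealRAM

/-- Choose the next two runs to merge. -/
def mergeSetup : Stmt :=
  .wset 60 (.reg 56) ;;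
  .wset 61 (.reg 56 + .reg 52) ;;
  .ite (.wlt (.reg 57) (.reg 61)) (.wset 61 (.reg 57)) .skip ;;
  .wset 62 (.reg 61) ;;
  .wset 63 (.reg 61 + .reg 52) ;;
  .ite (.wlt (.reg 57) (.reg 63)) (.wset 63 (.reg 57)) .skip ;;
  .wset 56 (.reg 63)

theorem mergeSetup_spec {B : ℕ} (σ : St) (h : σ.w 56 ≤ σ.w 57) (hB : σ.w 57 + 2 * σ.w 52 < B) :
    wp B mergeSetup (fun k τ => k ≤ 60 ∧ τ.wm = σ.wm ∧ τ.rm = σ.rm ∧ τ.r = σ.r ∧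
      τ.w 60 = σ.w 56 ∧ τ.w 61 = min (σ.w 57) (σ.w 56 + σ.w 52) ∧ τ.w 62 = τ.w 61 ∧
      τ.w 63 = min (σ.w 57) (τ.w 61 + σ.w 52) ∧ τ.w 56 = τ.w 63 ∧ τ.w 99 = σ.w 99 ∧
      (∀ i < 56, τ.w i = σ.w i) ∧ τ.w 57 = σ.w 57) σ := by
  unfold mergeSetup
  have key : ∀ i < 56, i ≠ 60 ∧ i ≠ 61 ∧ i ≠ 62 ∧ i ≠ 63 ∧ i ≠ 56 := fun i hi => by omega
  simp +contextual [key]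
  refine ⟨by omega, fun h1 => ⟨by omega, fun _ => by omega, fun _ => by omega⟩, fun h1 =>
    ⟨by omega, fun h => ?_⟩⟩ <;> omega

/-- One pass of mergesort over the `w51` cells at `w50`, which consist of runs of length `w52`. -/
def mergePass : Stmt :=
  .wset 55 (.reg 99) ;;
  .wset 56 (.reg 50) ;;
  .wset 57 (.reg 50 + .reg 51) ;;
  .loop (.wlt (.reg 56) (.reg 57)) (mergeSetup ;; mergeRuns)


theorem mergePass_spec {B : ℕ} {Q : ℕ → St → Prop} (σ : St) (hL : 0 < σ.w 52)
    (hal : σ.w 50 + σ.w 51 ≤ σ.w 99)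
    (hB : σ.w 99 + σ.w 51 + 2 * σ.w 52 + 2 < B)
    (hR : Runs (σ.w 52) (arr σ.cell (σ.w 50) (σ.w 51)))
    (hQ : ∀ t τ, Keeps 55 σ τ → τ.w 99 = σ.w 99 + σ.w 51 → τ.w 55 = σ.w 99 →
      (arr τ.cell (σ.w 99) (σ.w 51)).Perm (arr σ.cell (σ.w 50) (σ.w 51)) →
      Runs (2 * σ.w 52) (arr τ.cell (σ.w 99) (σ.w 51)) →
      t ≤ 170 * σ.w 51 + 20 → Q t τ) :
    wp B mergePass Q σ := by
  unfold mergePass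
  simp
  refine ⟨by omega, ?_⟩
  refine wp_loop (fun (i : ℕ) τ => Keeps 55 σ τ ∧ τ.w 55 = σ.w 99 ∧ τ.w 57 = σ.w 50 + σ.w 51 ∧
    τ.w 56 = σ.w 50 + i ∧ i ≤ σ.w 51 ∧ τ.w 99 = σ.w 99 + i ∧ (2 * σ.w 52 ∣ i ∨ i = σ.w 51) ∧
    (arr τ.cell (σ.w 99) i).Perm (arr σ.cell (σ.w 50) i) ∧
    Runs (2 * σ.w 52) (arr τ.cell (σ.w 99) i) ∧
    Runs (σ.w 52) (arr σ.cell (σ.w 50 + i) (σ.w 51 - i)))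
    (fun i => 170 * (σ.w 51 - i)) ?_ ?_ 0 ?_ ?_
  · intros; simp
  · rintro i τ ⟨hK, h55, h57, h56, hi, h99, hd, hP, hR1, hR2⟩ hc
    have h52 := hK.w 52
    simp only [rules] at hc
    have hd' : 2 * σ.w 52 ∣ i := by
      rcases hd with h | h
      · exact h
      · omega
    have h3 := hR2.take_drop
    have h4 := h3.2.take_drop
    simp only [take_arr, drop_arr] at h3 h4
    have h51 := hK.w 51
    rw [wp_seq]
    refine wp_mono (mergeSetup_spec τ (by omega) (by omega)) ?_
    rintro k υ ⟨hk, ewm, erm, er, e60, e61, e62, e63, e56, e99, elt, e57⟩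
    generalize hn1 : min (σ.w 52) (σ.w 51 - i) = n1 at *
    generalize hn2 : min (σ.w 52) (σ.w 51 - i - σ.w 52) = n2 at *
    have hKυ : Keeps 55 σ υ := by
      refine hK.trans ⟨fun j hj => elt j (by omega), fun j _ => by rw [er], e99.ge, fun p _ => by rw [ewm],
        fun p _ => by rw [erm]⟩
    have hcell : υ.cell = τ.cell := by funext p; simp [St.cell, ewm, erm]
    have e55 := elt 55 (by omega)
    replace e61 : υ.w 61 = τ.w 56 + n1 := by omega
    replace e62 : υ.w 62 = τ.w 56 + n1 := by omega
    replace e63 : υ.w 63 = τ.w 56 + n1 + n2 := by omega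
    replace e56 : υ.w 56 = τ.w 56 + n1 + n2 := by omega
    obtain ⟨A1, A2, A3, A4, A5, A6⟩ : (2 * σ.w 52 ≤ σ.w 51 - i → n1 + n2 = 2 * σ.w 52) ∧
        (σ.w 51 - i < 2 * σ.w 52 → n1 + n2 = σ.w 51 - i) ∧ (0 < n2 → n1 = σ.w 52) ∧ 0 < n1 ∧
        n1 + n2 ≤ σ.w 51 - i ∧ n1 + n2 ≤ 2 * σ.w 52 := by
      clear e61 e62 e63 e56 elt hK hP hR1 hR2 hcell
      omega
    clear hn1 hn2
    refine mergeRuns_spec υ (by omega) (by omega) (by omega) (by omega) (by omega) ?_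
    intro t τ' hK' h99' hM ht
    rw [e60, e61, e62, e63, e99, show τ.w 56 + n1 - τ.w 56 = n1 by omega,
      show τ.w 56 + n1 + n2 - (τ.w 56 + n1) = n2 by omega, hcell, hK.arr_cell (by omega),
      hK.arr_cell (by omega), h56, h99] at hM
    have hsame : arr τ'.cell (σ.w 99) i = arr τ.cell (σ.w 99) i := by
      rw [hK'.arr_cell (by omega), hcell]
    have hsplit : arr σ.cell (σ.w 50) (i + (n1 + n2)) = arr σ.cell (σ.w 50) i ++
        (arr σ.cell (σ.w 50 + i) n1 ++ arr σ.cell (σ.w 50 + i + n1) n2) := by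
      rw [arr_add, arr_add]
    have hs2 : (arr σ.cell (σ.w 50 + i + n1) n2).Pairwise (· ≤ ·) := by
      rcases Nat.eq_zero_or_pos n2 with h | h
      · rw [h]; exact .nil
      · rw [A3 h]; exact h4.1
    have hsorted := mrg_sorted h3.1 hs2
    have hperm := mrg_perm (arr σ.cell (σ.w 50 + i) n1) (arr σ.cell (σ.w 50 + i + n1) n2)
    refine ⟨i + (n1 + n2), ⟨hKυ.trans (hK'.mono), ?_, ?_, ?_, by omega, by omega, ?_, ?_,
      ?_, ?_⟩, by simp only [rules]; omega⟩
    · rw [hK'.w 55]; omega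
    · rw [hK'.w 57]; omega
    · rw [hK'.w 56]; omega
    · by_cases h : 2 * σ.w 52 ≤ σ.w 51 - i
      · left
        rw [A1 h]
        exact dvd_add hd' dvd_rfl
      · right; omega
    · rw [arr_add, hsame, hM, hsplit]
      exact hP.append hperm
    · rw [arr_add, hsame, hM]
      refine hR1.append (by simpa using hd') hsorted ?_
      rw [hperm.length_eq]; simp; omega
    · by_cases h : 2 * σ.w 52 ≤ σ.w 51 - i
      · have h5 := h4.2
        have e1 : σ.w 50 + i + σ.w 52 + σ.w 52 = σ.w 50 + (i + (n1 + n2)) := by rw [A1 h]; ring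
        have e2 : σ.w 51 - i - σ.w 52 - σ.w 52 = σ.w 51 - (i + (n1 + n2)) := by rw [A1 h]; omega
        rw [e1, e2] at h5
        exact h5
      · rw [show σ.w 51 - (i + (n1 + n2)) = 0 by omega]; exact .nil _
  · have e0 := σ.w 99
    refine ⟨?_, by simp, by simp, by simp, by omega, by simp, Or.inl (by simp), by simp, .nil _, by simpa using hR⟩
    exact ((Keeps.rfl'.setW).setW).setW
  · rintro i k τ ⟨hK, h55, h57, h56, hi, h99, hd, hP, hR1, hR2⟩ hc ht
    simp only [rules] at hc ht
    obtain rfl : i = σ.w 51 := by omega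
    exact hQ _ τ hK h99 h55 hP hR1 (by omega)

/-- Keep every second cell. -/
def thinPass : Stmt :=
  .wset 55 (.reg 99) ;;
  .wset 56 (.reg 50 + 1) ;;
  .wset 57 (.reg 50 + .reg 51) ;;
  .loop (.wlt (.reg 56) (.reg 57))
    (.wput (.reg 99) (.mem (.reg 56)) ;;
    .rput (.reg 99) (.mem (.reg 56)) ;;
    .wset 99 (.reg 99 + 1) ;;
    .wset 56 (.reg 56 + 2))

theorem thinPass_spec {B : ℕ} {Q : ℕ → St → Prop} (σ : St)
    (hal : σ.w 50 + σ.w 51 ≤ σ.w 99) (hB : σ.w 99 + σ.w 51 + 3 < B)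
    (hQ : ∀ t τ, Keeps 55 σ τ → τ.w 99 = σ.w 99 + σ.w 51 / 2 → τ.w 55 = σ.w 99 →
      arr τ.cell (σ.w 99) (σ.w 51 / 2) = odds (arr σ.cell (σ.w 50) (σ.w 51)) →
      t ≤ 25 * σ.w 51 + 20 → Q t τ) :
    wp B thinPass Q σ := by
  unfold thinPass
  simp
  refine ⟨⟨by omega, by omega⟩, by omega, ?_⟩
  refine wp_loop (fun (i : ℕ) τ => Keeps 55 σ τ ∧ τ.w 55 = σ.w 99 ∧ τ.w 57 = σ.w 50 + σ.w 51 ∧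
    τ.w 56 = σ.w 50 + 1 + 2 * i ∧ 2 * i ≤ σ.w 51 ∧ τ.w 99 = σ.w 99 + i ∧
    arr τ.cell (σ.w 99) i ++ odds (arr σ.cell (σ.w 50 + 2 * i) (σ.w 51 - 2 * i)) =
      odds (arr σ.cell (σ.w 50) (σ.w 51)))
    (fun i => 25 * (σ.w 51 - 2 * i)) ?_ ?_ 0 ?_ ?_
  · intros; simp
  · rintro i τ ⟨hK, h55, h57, h56, hi, h99, hM⟩ hc
    simp only [rules] at hc
    obtain ⟨n, hn⟩ : ∃ n, σ.w 51 - 2 * i = n + 2 := ⟨σ.w 51 - 2 * i - 2, by omega⟩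
    have hal := hK.al
    generalize hQ' : (fun (k : ℕ) (τ' : St) => ∃ a', _ ∧ _) = Q'
    simp
    refine ⟨⟨by omega, by omega⟩, ⟨by omega, by omega⟩, ?_⟩
    rw [← hQ']
    refine ⟨i + 1, ⟨?_, by simp [h55], by simp [h57], by simp [h56]; omega, by omega, by simp [h99]; omega,
      ?_⟩, by simp; omega⟩
    · exact (((hK.putW hal).putR hal).setAl (by omega)).setW
    · rw [← hM, hn, show σ.w 51 - 2 * (i + 1) = n by omega, arr_succ, arr_succ_left, arr_succ_left, odds,
        List.append_assoc, List.singleton_append]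
      congr 1
      · refine arr_congr fun p hp1 hp2 => ?_
        simp [St.cell, show p ≠ τ.w 99 by omega]
      · rw [← h99, show σ.w 50 + 2 * i + 1 = τ.w 56 by omega, show τ.w 56 + 1 = σ.w 50 + 2 * (i + 1) by omega]
        congr 1
        simp [St.cell, hK.rm (τ.w 56) (by omega), hK.wm (τ.w 56) (by omega)]
  · refine ⟨?_, by simp, by simp, by simp, by omega, by simp, by simp⟩
    exact ((Keeps.rfl'.setW).setW).setW
  · rintro i k τ ⟨hK, h55, h57, h56, hi, h99, hM⟩ hc ht
    simp only [rules] at hc ht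
    obtain rfl : i = σ.w 51 / 2 := by omega
    refine hQ _ τ hK h99 h55 ?_ (by omega)
    rw [← hM]
    have hcase : σ.w 51 - 2 * (σ.w 51 / 2) = 0 ∨ σ.w 51 - 2 * (σ.w 51 / 2) = 1 := by omega
    rcases hcase with h | h <;> simp [h, odds, arr_succ_left]

end RealRAM

namespace RealRAM

/-- Mergesort of the `w51` cells at `w50`. When the runs have reached the length `w54`, every second
cell is dropped and `w54` is doubled; `w53` is the number of original cells that each remaining cell
stands for. -/
def mergeSort : Stmt :=
  .wset 52 1 ;;
  .wset 53 1 ;;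
  .loop (.wlt (.reg 52) (.reg 51))
    (mergePass ;;
    .wset 50 (.reg 55) ;;
    .wset 52 (.reg 52 + .reg 52) ;;
    .ite (.wlt (.reg 52) (.reg 54)) .skip
      (thinPass ;;
      .wset 50 (.reg 55) ;;
      .wset 51 (.reg 51 / 2) ;;
      .wset 52 (.reg 52 / 2) ;;
      .wset 53 (.reg 53 + .reg 53) ;;
      .wset 54 (.reg 54 + .reg 54)))

/-- The sorted list `l` is a sample of `l₀` in which each entry has weight `w`, produced with
threshold `T`. -/
structure IsSample (T : ℕ) (l₀ : List (ℝ ×ₗ ℕ)) (w err : ℕ) (l : List (ℝ ×ₗ ℕ)) : Prop where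
  sub : l.Subperm l₀
  pos : 0 < w
  lower : ∀ v, w * cntLE v l ≤ cntLE v l₀
  upper : ∀ v, cntLE v l₀ ≤ w * cntLE v l + err
  err_le : err * (T * w) + 2 * l₀.length ≤ 2 * w * l₀.length + T * w * w
  len_le : w * l.length ≤ l₀.length
  w_le : T * w * w ≤ T + 8 * l₀.length
  perm : 2 * l₀.length ≤ T → w = 1 ∧ l.Perm l₀

theorem IsSample.refl (T : ℕ) (l : List (ℝ ×ₗ ℕ)) : IsSample T l 1 0 l where
  sub := List.Subperm.refl l
  pos := one_pos
  lower v := by simp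
  upper v := by simp
  err_le := by simp
  len_le := by simp
  w_le := by simp
  perm _ := ⟨rfl, .refl l⟩

theorem IsSample.of_perm {T w err : ℕ} {l₀ l l' : List (ℝ ×ₗ ℕ)} (h : IsSample T l₀ w err l)
    (hp : l'.Perm l) : IsSample T l₀ w err l' where
  sub := hp.subperm.trans h.sub
  pos := h.pos
  lower v := by rw [cntLE_perm hp]; exact h.lower v
  upper v := by rw [cntLE_perm hp]; exact h.upper v
  err_le := h.err_le
  len_le := by rw [hp.length_eq]; exact h.len_le
  w_le := h.w_le
  perm h2 := ⟨(h.perm h2).1, hp.trans (h.perm h2).2⟩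

theorem IsSample.thin {T w err L : ℕ} {l₀ l : List (ℝ ×ₗ ℕ)} (h : IsSample T l₀ w err l)
    (hr : Runs (2 * L) l) (hL : 0 < L) (hT : T * w ≤ 2 * L) (hl : L < l.length) :
    IsSample T l₀ (w + w) (err + w * (l.length / (2 * L) + 1)) (odds l) where
  sub := (odds_sublist l).subperm.trans h.sub
  pos := by have := h.pos; omega
  lower v := by
    have := (hr.cntLE_odds hL v).1
    have h2 := h.lower v
    nlinarith
  upper v := by
    have := (hr.cntLE_odds hL v).2
    have h2 := h.upper v
    have h3 := Nat.mul_le_mul_left w this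
    nlinarith
  err_le := by
    have h1 := h.err_le
    have h2 : l.length / (2 * L) * (2 * L) ≤ l.length := Nat.div_mul_le_self _ _
    have h3 : l.length / (2 * L) * (T * w) ≤ l.length :=
      (Nat.mul_le_mul_left _ hT).trans h2
    have h4 := h.len_le
    have h5 : w * (l.length / (2 * L) * (T * w)) ≤ l₀.length := (Nat.mul_le_mul_left w h3).trans h4
    nlinarith
  len_le := by
    rw [length_odds]
    have h4 := h.len_le
    have : 2 * (l.length / 2) ≤ l.length := Nat.mul_div_le _ _
    have := Nat.mul_le_mul_left w this
    nlinarith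
  w_le := by
    have h4 := h.len_le
    have h5 : T * w ≤ 2 * l.length := by omega
    have h6 := Nat.mul_le_mul_right w h5
    nlinarith
  perm h2 := by
    have h3 := (h.perm h2)
    rw [h3.1] at hT
    have := h3.2.length_eq
    omega

theorem IsSample.err_le' {T w err : ℕ} {l₀ l : List (ℝ ×ₗ ℕ)} (h : IsSample T l₀ w err l) :
    err * T ≤ 2 * l₀.length + T * w := by
  have h1 := h.err_le
  refine Nat.le_of_mul_le_mul_right ?_ h.pos
  nlinarith

/-- The invariant of the main loop of `mergeSort`. -/
structure SortInv (σ : St) (l₀ : List (ℝ ×ₗ ℕ)) (T g₀ : ℕ) (a : ℕ × ℕ) (τ : St) : Prop where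
  keeps : Keeps 50 σ τ
  len : a.1 = τ.w 51
  al : τ.w 50 + τ.w 51 ≤ τ.w 99
  L : 0 < τ.w 52
  runs : Runs (τ.w 52) (arr τ.cell (τ.w 50) (τ.w 51))
  sample : ∃ err, IsSample T l₀ (τ.w 53) err (arr τ.cell (τ.w 50) (τ.w 51))
  thr : τ.w 54 = T * τ.w 53
  g : τ.w 54 ≤ τ.w 52 * 2 ^ a.2
  mem : τ.w 99 + τ.w 51 * (a.2 + 5) ≤ σ.w 99 + l₀.length * (g₀ + 5)
  base : σ.w 50 ≤ τ.w 50

theorem mergeSort_spec {B : ℕ} {Q : ℕ → St → Prop} (σ : St) (g : ℕ)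
    (hal : σ.w 50 + σ.w 51 ≤ σ.w 99) (hT : 0 < σ.w 54) (hg : σ.w 54 ≤ 2 ^ g)
    (hB : σ.w 99 + σ.w 51 * (g + 15) + 10 < B)
    (hQ : ∀ t τ err, Keeps 50 σ τ →
      σ.w 50 ≤ τ.w 50 → τ.w 50 + τ.w 51 ≤ τ.w 99 →
      IsSample (σ.w 54) (arr σ.cell (σ.w 50) (σ.w 51)) (τ.w 53) err (arr τ.cell (τ.w 50) (τ.w 51)) →
      (arr τ.cell (τ.w 50) (τ.w 51)).Pairwise (· ≤ ·) →
      τ.w 99 ≤ σ.w 99 + σ.w 51 * (g + 5) → t ≤ 300 * (σ.w 51 * (g + 5)) + 20 → Q t τ) :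
    wp B mergeSort Q σ := by
  unfold mergeSort
  simp only [wp_seq, wp_wset, rules]
  refine ⟨by omega, by omega, ?_⟩
  refine wp_loop (SortInv σ (arr σ.cell (σ.w 50) (σ.w 51)) (σ.w 54) g)
    (fun a => 300 * (a.1 * (a.2 + 5))) ?_ ?_ (σ.w 51, g) ?_ ?_
  · intros; simp
  · rintro ⟨N, g'⟩ τ ⟨hK, hN, hal', hL, hR, ⟨err, hS⟩, hthr, hg', hmem, hbase⟩ hc
    simp only [rules, length_arr] at *
    have hlen := hS.len_le
    simp only [length_arr] at hlen
    have hN0 : τ.w 51 ≤ σ.w 51 := (Nat.le_mul_of_pos_left _ hS.pos).trans hlen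
    have hsz : σ.w 51 * (g + 15) = σ.w 51 * (g + 5) + 10 * σ.w 51 := by ring
    have hsz' : τ.w 51 ≤ τ.w 51 * (g' + 5) := Nat.le_mul_of_pos_right _ (by omega)
    rw [hsz] at hB
    generalize hQ' : (fun (k : ℕ) (τ' : St) => ∃ a', _ ∧ _) = Q'
    rw [wp_seq]
    refine mergePass_spec τ hL hal' (by omega) hR ?_
    intro t υ hKυ h99 h55 hP hR' ht
    have e51 := hKυ.w 51
    have e52 := hKυ.w 52
    have e53 := hKυ.w 53
    have e54 := hKυ.w 54
    simp only [wp_seq, wp_wset, wp_ite, wp_skip, rules, St.setW_w]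
    simp only [Nat.reduceEqDiff, if_true, if_false, true_and, e52, e54, h55]
    have hS' := hS.of_perm hP
    refine ⟨by omega, fun hlt => ?_, fun hlt => ?_⟩
    · rw [← hQ']
      obtain ⟨g2, rfl⟩ : ∃ g2, g' = g2 + 1 := by
        refine ⟨g' - 1, ?_⟩
        rcases g' with _ | g'
        · simp at hg'; omega
        · omega
      refine ⟨(N, g2), ⟨?_, ?_, ?_, ?_, ?_, ⟨err, ?_⟩, ?_, ?_, ?_, ?_⟩, ?_⟩
      · exact ((hK.trans (hKυ.mono)).setW).setW
      · simp [e51, hN]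
      · simp [e51, h99]
      · simp; omega
      · simpa [e51, e52, two_mul, h55] using hR'
      · simpa [e51, e53, h55] using hS'
      · simpa [e53, e54] using hthr
      · simpa [e54, pow_succ, ← two_mul, mul_assoc, mul_comm, mul_left_comm] using hg'
      · simp [e51, h99]
        have : τ.w 51 * (g2 + 1 + 5) = τ.w 51 * (g2 + 5) + τ.w 51 := by ring
        omega
      · simp; omega
      · have : N * (g2 + 1 + 5) = N * (g2 + 5) + N := by ring
        simp only [this]
        omega
    · generalize hυ : (υ.setW 50 (τ.w 99)).setW 52 (τ.w 52 + τ.w 52) = υ'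
      have hKυ' : Keeps 50 σ υ' := by
        rw [← hυ]
        exact ((hK.trans (hKυ.mono)).setW).setW
      have f50 : υ'.w 50 = τ.w 99 := by simp [← hυ]
      have f51 : υ'.w 51 = τ.w 51 := by simp [← hυ, e51]
      have f52 : υ'.w 52 = τ.w 52 + τ.w 52 := by simp [← hυ]
      have f53 : υ'.w 53 = τ.w 53 := by simp [← hυ, e53]
      have f54 : υ'.w 54 = τ.w 54 := by simp [← hυ, e54]
      have f99 : υ'.w 99 = τ.w 99 + τ.w 51 := by simp [← hυ, h99]
      have fc : υ'.cell = υ.cell := by rw [← hυ]; rfl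
      refine thinPass_spec υ' (by omega) (by omega) ?_
      intro t2 ω hKω g99 g55 hodds ht2
      rw [f50, f51, f99, fc] at hodds
      rw [f51] at ht2 g99
      rw [f99] at g99 g55
      have k52 := hKω.w 52
      have k53 := hKω.w 53
      have k54 := hKω.w 54
      have k51 := hKω.w 51
      have hw : τ.w 53 ≤ τ.w 51 * 2 := by
        have h1 : 1 * τ.w 53 ≤ σ.w 54 * τ.w 53 := Nat.mul_le_mul_right _ hT
        omega
      simp only [k52, k53, k54, k51, f51, f52, f53,
        f54, g55]
      refine ⟨⟨by omega, by omega⟩, ⟨by omega, by omega⟩, by omega, by omega, ?_⟩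
      rw [← hQ']
      have hthin := hS'.thin (L := τ.w 52) hR' hL (by omega) (by simpa using hc)
      rw [← hodds] at hthin
      refine ⟨(τ.w 51 / 2, 2), ⟨?_, ?_, ?_, ?_, ?_,
        ⟨err + τ.w 53 * ((arr υ.cell (τ.w 99) (τ.w 51)).length / (2 * τ.w 52) + 1), ?_⟩, ?_, ?_, ?_, ?_⟩, ?_⟩
      · exact (((((hKυ'.trans (hKω.mono)).setW).setW).setW).setW).setW
      · simp
      · simp [g99]
      · simp; omega
      · have := hR'.odds
        rw [← hodds] at this
        simpa [show (τ.w 52 + τ.w 52) / 2 = τ.w 52 by omega] using this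
      · simpa using hthin
      · simp [hthr]; ring
      · simp; omega
      · simp [g99]
        have : τ.w 51 * (g' + 5) = τ.w 51 * g' + 5 * τ.w 51 := by ring
        omega
      · simp; omega
      · have : N * (g' + 5) = N * g' + 5 * N := by ring
        simp only [this]
        omega
  · refine ⟨(Keeps.rfl'.setW).setW, by simp, by simpa using hal,
      by simp, by simpa using runs_one _, ⟨0, by simpa using IsSample.refl _ _⟩, by simp, by simpa using hg,
      by simp, by simp⟩
  · rintro ⟨N, g'⟩ k τ ⟨hK, hN, hal', hL, hR, ⟨err, hS⟩, hthr, hg', hmem, hbase⟩ hc ht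
    simp only [rules, length_arr] at *
    refine hQ _ τ err hK hbase hal' hS (hR.sorted (by simpa using hc)) (by omega) (by omega)

end RealRAM

/-! ## Unrolling the circle -/

namespace Necklace

/-- The periodic extension of a necklace to the real line. -/
noncomputable def unroll {n : ℕ} [NeZero n] (y : Fin n → ℝ) (j : ℤ) : ℝ :=
  y ⟨(j % n).toNat, by
    have h := Int.emod_lt_of_pos j (Int.natCast_pos.2 (Nat.pos_of_neZero n))
    have h' := Int.emod_nonneg j (Int.natCast_ne_zero.2 (NeZero.ne n))
    omega⟩ + ((j / n : ℤ) : ℝ)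

variable {n : ℕ} [NeZero n]

theorem unroll_add_mul (y : Fin n → ℝ) (j q : ℤ) : unroll y (j + q * n) = unroll y j + q := by
  have hn : (n : ℤ) ≠ 0 := Int.natCast_ne_zero.2 (NeZero.ne n)
  simp only [unroll, Int.add_mul_emod_self_right, Int.add_mul_ediv_right _ _ hn]
  push_cast; ring

theorem unroll_add (y : Fin n → ℝ) (j : ℤ) : unroll y (j + n) = unroll y j + 1 := by
  simpa using unroll_add_mul y j 1

theorem unroll_le_succ {y : Fin n → ℝ} (hy : IsNecklace y) (j : ℤ) : unroll y j ≤ unroll y (j + 1) := by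
  have hn : (0 : ℤ) < n := Int.natCast_pos.2 (Nat.pos_of_neZero n)
  have h0 := Int.emod_nonneg j hn.ne'
  have h1 := Int.emod_lt_of_pos j hn
  have h2 := Int.emod_add_mul_ediv j n
  by_cases h : j % n + 1 < n
  · have e1 : (j + 1) % n = j % n + 1 := by
      rw [Int.add_emod, Int.emod_eq_of_lt (a := j % n + 1 % n)] <;>
      rw [Int.emod_eq_of_lt (a := 1)] <;> omega
    have e2 : (j + 1) / n = j / n := by
      have h3 := Int.emod_add_mul_ediv (j + 1) n
      rw [e1] at h3
      have : (n : ℤ) * ((j + 1) / n) = n * (j / n) := by linarith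
      exact mul_left_cancel₀ hn.ne' this
    simp only [unroll, e1, e2]
    gcongr
    apply hy.1
    simp only [Fin.mk_le_mk]; omega
  · have e1 : (j + 1) % n = 0 := by
      have : j + 1 = n * (j / n + 1) := by linarith
      rw [this]; exact Int.mul_emod_right _ _
    have e2 : (j + 1) / n = j / n + 1 := by
      have : j + 1 = n * (j / n + 1) := by linarith
      rw [this]; exact Int.mul_ediv_cancel_left _ hn.ne'
    simp only [unroll, e1, e2]
    push_cast
    have h3 := (hy.2 ⟨(j % n).toNat, by omega⟩).2
    have h4 : 0 ≤ y ⟨(0 : ℤ).toNat, by simp; exact Nat.pos_of_neZero n⟩ := (hy.2 _).1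
    simp only [Int.toNat_zero] at h4 ⊢
    linarith

theorem unroll_mono {y : Fin n → ℝ} (hy : IsNecklace y) : Monotone (unroll y) :=
  monotone_int_of_le_succ (unroll_le_succ hy)

/-- The cost of a matching on the real line. -/
noncomputable def lineCost (x y : Fin n → ℝ) (c : ℝ) (s : ℤ) : ℝ :=
  ∑ i : Fin n, |unroll y (i + s) - x i - c|

theorem lineCost_add_mul (x y : Fin n → ℝ) (c : ℝ) (s q : ℤ) :
    lineCost x y c (s + q * n) = lineCost x y (c - q) s := by
  refine Finset.sum_congr rfl fun i _ => ?_
  rw [← add_assoc, unroll_add_mul]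
  congr 1; ring

theorem circDist_le {a b : ℝ} (ha : a ∈ Set.Ico (0 : ℝ) 1) (hb : b ∈ Set.Ico (0 : ℝ) 1) (k : ℤ) :
    circDist a b ≤ |b + k - a| := by
  rcases eq_or_ne k 0 with rfl | hk
  · rw [Int.cast_zero, add_zero, abs_sub_comm b a]
    exact min_le_left _ _
  · refine (min_le_right _ _).trans ?_
    have h1 : (1 : ℝ) ≤ |(k : ℝ)| := by exact_mod_cast Int.one_le_abs hk
    have h2 := abs_sub_abs_le_abs_sub (k : ℝ) (a - b)
    have h3 : (k : ℝ) - (a - b) = b + k - a := by ring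
    rw [h3] at h2
    linarith

theorem circDist_eq {a b : ℝ} (ha : a ∈ Set.Ico (0 : ℝ) 1) (hb : b ∈ Set.Ico (0 : ℝ) 1) :
    ∃ k : ℤ, circDist a b = |b + k - a| := by
  obtain ⟨ha1, ha2⟩ := ha
  obtain ⟨hb1, hb2⟩ := hb
  rcases min_choice |a - b| (1 - |a - b|) with h | h
  · exact ⟨0, by rw [circDist, h]; simp [abs_sub_comm]⟩
  · rcases le_total a b with hab | hab
    · refine ⟨-1, ?_⟩
      rw [circDist, h, abs_of_nonpos (by linarith), abs_of_nonpos (by push_cast; linarith)]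
      push_cast; ring
    · refine ⟨1, ?_⟩
      rw [circDist, h, abs_of_nonneg (by linarith), abs_of_nonneg (by push_cast; linarith)]
      push_cast; ring

theorem unroll_natCast (y : Fin n → ℝ) (j : ℕ) :
    unroll y j = y ⟨j % n, Nat.mod_lt _ (Nat.pos_of_neZero n)⟩ + (j / n : ℕ) := by
  simp only [unroll]
  congr 1

theorem cost_fract_le {x y : Fin n → ℝ} (hy : IsNecklace y) (c : ℝ) (s : ℕ) :
    cost x y (Int.fract c) s ≤ lineCost x y c s := by
  refine Finset.sum_le_sum fun i _ => ?_
  have h1 : Int.fract (x i + Int.fract c) = Int.fract (x i + c) := by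
    rw [Int.fract_eq_fract]
    exact ⟨-⌊c⌋, by rw [Int.fract]; push_cast; ring⟩
  have h2 := unroll_natCast y (i + s)
  rw [Nat.cast_add] at h2
  rw [h1, h2]
  generalize ((i : ℕ) + s) / n = q
  refine (circDist_le ⟨Int.fract_nonneg _, Int.fract_lt_one _⟩ (hy.2 _)
    ((q : ℤ) - ⌊x i + c⌋)).trans (le_of_eq ?_)
  rw [Int.fract]; push_cast; congr 1; ring

theorem intervalIntegrable_floor (v : ℝ) :
    IntervalIntegrable (fun t : ℝ => ((⌊v - t⌋ : ℤ) : ℝ)) MeasureTheory.volume 0 1 := by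
  apply Antitone.intervalIntegrable
  intro a b hab
  simp only [Int.cast_le]
  exact Int.floor_le_floor (by linarith)

theorem integral_floor (v : ℝ) : ∫ t in (0 : ℝ)..1, ((⌊v - t⌋ : ℤ) : ℝ) = v - 1 := by
  have h1 : ∀ t : ℝ, ((⌊v - t⌋ : ℤ) : ℝ) = (v - t) - Int.fract (v - t) := fun t => by
    rw [Int.fract]; ring
  have hf : IntervalIntegrable (fun t : ℝ => Int.fract (v - t)) MeasureTheory.volume 0 1 := by
    have : (fun t : ℝ => Int.fract (v - t)) = fun t => (v - t) - ((⌊v - t⌋ : ℤ) : ℝ) := by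
      funext t; rw [Int.fract]
    rw [this]
    exact (Continuous.intervalIntegrable (by fun_prop) 0 1).sub (intervalIntegrable_floor v)
  simp_rw [h1]
  rw [intervalIntegral.integral_sub (Continuous.intervalIntegrable (by fun_prop) 0 1) hf]
  have h2 : ∫ t in (0 : ℝ)..1, Int.fract (v - t) = 1 / 2 := by
    rw [intervalIntegral.integral_comp_sub_left (fun t => Int.fract t) v]
    have hp : Function.Periodic (fun t : ℝ => Int.fract t) 1 := fun t => by simp
    have := hp.intervalIntegral_add_eq (v - 1) 0
    simp only [sub_add_cancel, zero_add] at this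
    rw [sub_zero, this]
    have : ∫ t in (0 : ℝ)..1, Int.fract t = ∫ t in (0 : ℝ)..1, t := by
      refine intervalIntegral.integral_congr_ae ?_
      have h1 : ∀ᵐ t : ℝ, t ≠ 1 := by
        simp [MeasureTheory.ae_iff]
      filter_upwards [h1] with t ht hm
      rw [Set.uIoc_of_le zero_le_one] at hm
      exact Int.fract_eq_self.2 ⟨hm.1.le, lt_of_le_of_ne hm.2 ht⟩
    rw [this]; simp
  rw [h2, intervalIntegral.integral_sub (by simp) (by simp)]
  simp; ring

theorem intervalIntegrable_abs_floor (u v : ℝ) :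
    IntervalIntegrable (fun t : ℝ => |((⌊v - t⌋ : ℤ) : ℝ) - ((⌊u - t⌋ : ℤ) : ℝ)|)
      MeasureTheory.volume 0 1 :=
  ((intervalIntegrable_floor v).sub (intervalIntegrable_floor u)).abs

theorem abs_eq_integral (u v : ℝ) :
    |v - u| = ∫ t in (0 : ℝ)..1, |((⌊v - t⌋ : ℤ) : ℝ) - ((⌊u - t⌋ : ℤ) : ℝ)| := by
  wlog h : u ≤ v generalizing u v
  · rw [abs_sub_comm, this v u (le_of_not_ge h)]
    exact intervalIntegral.integral_congr fun t _ => abs_sub_comm _ _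
  have : ∀ t : ℝ, |((⌊v - t⌋ : ℤ) : ℝ) - ((⌊u - t⌋ : ℤ) : ℝ)| = ((⌊v - t⌋ : ℤ) : ℝ) - ((⌊u - t⌋ : ℤ) : ℝ) := by
    intro t
    refine abs_of_nonneg (sub_nonneg.2 ?_)
    exact_mod_cast Int.floor_le_floor (by linarith)
  simp_rw [this]
  rw [intervalIntegral.integral_sub (intervalIntegrable_floor v) (intervalIntegrable_floor u),
    integral_floor, integral_floor, abs_of_nonneg (by linarith)]
  ring

theorem sum_shift (f : ℤ → ℤ) (hf : ∀ j, f (j + n) = f j + 1) (s : ℤ) (k : ℤ) :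
    ∑ i : Fin n, f (i + (s + k)) = ∑ i : Fin n, f (i + s) + k := by
  have step : ∀ s : ℤ, ∑ i : Fin n, f (i + (s + 1)) = ∑ i : Fin n, f (i + s) + 1 := by
    intro s
    rw [Fin.sum_univ_eq_sum_range (fun i => f (i + (s + 1))), Fin.sum_univ_eq_sum_range (fun i => f (i + s))]
    have h1 := Finset.sum_range_succ' (fun i : ℕ => f (i + s)) n
    rw [Finset.sum_range_succ] at h1
    have h2 := hf s
    rw [add_comm s] at h2
    simp only [Nat.cast_add, Nat.cast_one, Nat.cast_zero, zero_add] at h1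
    have h3 : ∑ i ∈ Finset.range n, f (i + (s + 1)) = ∑ i ∈ Finset.range n, f (i + 1 + s) :=
      Finset.sum_congr rfl fun i _ => by congr 1; ring
    linarith
  induction k using Int.induction_on with
  | zero => simp
  | succ k ih => rw [← add_assoc s, step, ih]; ring
  | pred k ih =>
    have := step (s + (-k - 1))
    rw [show s + (-(k : ℤ) - 1) + 1 = s + -k by ring, ih] at this
    linarith

theorem sum_abs_eq {a b : Fin n → ℤ} (ha : Monotone a) (ha' : ∀ i j, a i ≤ a j + 1) (hb : Monotone b)
    (hb' : ∀ i j, b i ≤ b j + 1) : ∑ i, |b i - a i| = |∑ i, (b i - a i)| := by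
  by_cases h : ∀ i, a i ≤ b i
  · rw [abs_of_nonneg (Finset.sum_nonneg fun i _ => sub_nonneg.2 (h i))]
    exact Finset.sum_congr rfl fun i _ => abs_of_nonneg (sub_nonneg.2 (h i))
  · push Not at h
    obtain ⟨i, hi⟩ := h
    have h : ∀ j, b j - a j ≤ 0 := by
      intro j
      rcases le_total i j with hij | hij
      · have := ha hij; have := hb' j i; omega
      · have := hb hij; have := ha' i j; omega
    rw [abs_of_nonpos (Finset.sum_nonpos fun i _ => h i), ← Finset.sum_neg_distrib]
    exact Finset.sum_congr rfl fun i _ => abs_of_nonpos (h i)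

/-- Among all matchings on the line with the same total shift, the monotone one is the best. -/
theorem lineCost_le {x y : Fin n → ℝ} (hx : IsNecklace x) (hy : IsNecklace y) (c : ℝ) (s : ℤ)
    (k : Fin n → ℤ) :
    lineCost x y c (s + ∑ i, k i) ≤ ∑ i : Fin n, |unroll y (i + s) + k i - (x i + c)| := by
  have h1 : lineCost x y c (s + ∑ i, k i) =
      ∑ i : Fin n, |unroll y (i + (s + ∑ i, k i)) - (x i + c)| :=
    Finset.sum_congr rfl fun i _ => by rw [sub_sub]
  rw [h1, Finset.sum_congr rfl fun i _ => abs_eq_integral _ _,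
    Finset.sum_congr rfl fun i _ => abs_eq_integral (x i + c) (unroll y (i + s) + k i)]
  rw [← intervalIntegral.integral_finsetSum fun i _ => intervalIntegrable_abs_floor _ _,
    ← intervalIntegral.integral_finsetSum fun i _ => intervalIntegrable_abs_floor _ _]
  refine intervalIntegral.integral_mono zero_le_one ?_ ?_ ?_
  · have h := IntervalIntegrable.sum Finset.univ
      (f := fun (i : Fin n) (t : ℝ) => |((⌊unroll y (i + (s + ∑ i, k i)) - t⌋ : ℤ) : ℝ) - ((⌊x i + c - t⌋ : ℤ) : ℝ)|)
      fun i _ => intervalIntegrable_abs_floor _ _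
    simpa only [Finset.sum_fn] using h
  · have h := IntervalIntegrable.sum Finset.univ
      (f := fun (i : Fin n) (t : ℝ) => |((⌊unroll y (i + s) + k i - t⌋ : ℤ) : ℝ) - ((⌊x i + c - t⌋ : ℤ) : ℝ)|)
      fun i _ => intervalIntegrable_abs_floor _ _
    simpa only [Finset.sum_fn] using h
  · intro t
    have e1 : ∀ i : Fin n, ⌊unroll y (i + s) + k i - t⌋ = ⌊unroll y (i + s) - t⌋ + k i := by
      intro i
      rw [← Int.floor_add_intCast]; congr 1; ring
    have hshift := sum_shift (n := n) (fun j => ⌊unroll y j - t⌋)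
      (fun j => by rw [unroll_add, ← Int.floor_add_one]; congr 1; ring) s (∑ i, k i)
    have hmono := fun {a b : ℤ} (h : a ≤ b) => Int.floor_le_floor (sub_le_sub_right (unroll_mono hy h) t)
    have hs := sum_abs_eq (n := n) (a := fun i => ⌊x i + c - t⌋)
      (b := fun i => ⌊unroll y (i + (s + ∑ i, k i)) - t⌋)
      (fun i j hij => Int.floor_le_floor (by have := hx.1 hij; linarith))
      (fun i j => by
        rw [← Int.floor_add_one]
        refine Int.floor_le_floor ?_
        have := (hx.2 i).2; have := (hx.2 j).1; linarith)
      (fun i j hij => hmono (by have : (i : ℕ) ≤ j := hij; omega))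
      (fun i j => by
        have h := hmono (show ((i : ℕ) : ℤ) + (s + ∑ i, k i) ≤ (j : ℕ) + (s + ∑ i, k i) + n by
          have := i.2; omega)
        rw [unroll_add, show unroll y ((j : ℕ) + (s + ∑ i, k i)) + 1 - t =
          unroll y ((j : ℕ) + (s + ∑ i, k i)) - t + 1 by ring, Int.floor_add_one] at h
        exact h)
    have : ∑ i : Fin n, |⌊unroll y (i + (s + ∑ i, k i)) - t⌋ - ⌊x i + c - t⌋| ≤
        ∑ i : Fin n, |⌊unroll y (i + s) + k i - t⌋ - ⌊x i + c - t⌋| := by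
      rw [hs, Finset.sum_sub_distrib, hshift, ← Finset.sum_add_distrib, ← Finset.sum_sub_distrib]
      simp_rw [e1]
      exact Finset.abs_sum_le_sum_abs _ _
    simp only
    exact_mod_cast this

theorem exists_lineCost_le {x y : Fin n → ℝ} (hx : IsNecklace x) (hy : IsNecklace y) (c : ℝ) (s : ℕ) :
    ∃ s' < n, ∃ c', lineCost x y c' s' ≤ cost x y c s := by
  have hn := Nat.pos_of_neZero n
  have h := fun i : Fin n => circDist_eq (a := Int.fract (x i + c))
    (b := y ⟨((i : ℕ) + s) % n, Nat.mod_lt _ i.pos⟩) ⟨Int.fract_nonneg _, Int.fract_lt_one _⟩ (hy.2 _)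
  choose k hk using h
  set k' : Fin n → ℤ := fun i => k i + ⌊x i + c⌋ - ((((i : ℕ) + s) / n : ℕ) : ℤ) with hk'
  have h1 := lineCost_le hx hy c s k'
  have h2 : ∑ i : Fin n, |unroll y (i + (s : ℤ)) + k' i - (x i + c)| = cost x y c s := by
    refine Finset.sum_congr rfl fun i _ => ?_
    have h2 := unroll_natCast y (i + s)
    rw [Nat.cast_add] at h2
    rw [hk i, h2, hk', Int.fract]
    simp only
    generalize ((i : ℕ) + s) / n = q
    push_cast; congr 1; ring
  rw [h2] at h1
  set S : ℤ := s + ∑ i, k' i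
  have h3 := Int.emod_add_ediv_mul S n
  have h4 := Int.emod_nonneg S (Int.natCast_ne_zero.2 hn.ne')
  have h5 := Int.emod_lt_of_pos S (Int.natCast_pos.2 hn)
  refine ⟨(S % n).toNat, by omega, c - (S / n : ℤ), ?_⟩
  rw [Int.toNat_of_nonneg h4, ← lineCost_add_mul, h3]
  exact h1

theorem isOptimal_fract {x y : Fin n → ℝ} (hx : IsNecklace x) (hy : IsNecklace y) {c : ℝ} {s : ℕ}
    (hs : s < n) (h : ∀ s' < n, ∀ c', lineCost x y c s ≤ lineCost x y c' s') :
    IsOptimal x y (Int.fract c) s := by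
  refine ⟨⟨Int.fract_nonneg _, Int.fract_lt_one _⟩, hs.le, fun c' _ s' _ => ?_⟩
  obtain ⟨s'', hs'', c'', h'⟩ := exists_lineCost_le hx hy c' s'
  exact (cost_fract_le hy c s).trans ((h s'' hs'' c'').trans h')

end Necklace

namespace RealRAM

/-! ## Classification of pairs of blocks -/

/-- Append the words in the memory segment from `w36` to `w37` that satisfy `c` (a condition on `w38`). -/
def filterSeg (c : Cond) : Stmt :=
  .loop (.wlt (.reg 36) (.reg 37))
    (.wset 38 (.mem (.reg 36)) ;;
    .ite c (.wput (.reg 99) (.reg 38) ;; .wset 99 (.reg 99 + 1)) .skip ;;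
    .wset 36 (.reg 36 + 1))

theorem filterSeg_spec {B : ℕ} {Q : ℕ → St → Prop} {c : Cond} (f : ℕ → Bool) (σ : St) (b n : ℕ)
    (hc : ∀ τ, τ.w 6 = σ.w 6 → (c.eval τ ↔ f (τ.w 38) = true)) (hok : ∀ τ, c.ok B τ) (hcost : c.cost ≤ 5)
    (h36 : σ.w 36 = b) (h37 : σ.w 37 = b + n) (hal : b + n ≤ σ.w 99) (hB : σ.w 99 + n + 1 < B)
    (hQ : ∀ t τ, Keeps 36 σ τ →
      arr τ.wm (σ.w 99) ((arr σ.wm b n).filter f).length = (arr σ.wm b n).filter f →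
      τ.w 99 = σ.w 99 + ((arr σ.wm b n).filter f).length → τ.rm = σ.rm → t ≤ 30 * n + 5 → Q t τ) :
    wp B (filterSeg c) Q σ := by
  unfold filterSeg
  refine wp_loop (fun (i : ℕ) τ => Keeps 36 σ τ ∧ i ≤ n ∧ τ.w 36 = b + i ∧ τ.w 37 = b + n ∧
      arr τ.wm (σ.w 99) ((arr σ.wm b i).filter f).length = (arr σ.wm b i).filter f ∧
      τ.w 99 = σ.w 99 + ((arr σ.wm b i).filter f).length ∧ τ.rm = σ.rm)
    (fun i => 30 * (n - i)) ?_ ?_ 0 ?_ ?_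
  · intros; simp
  · rintro i τ ⟨hK, hi, h36, h37, ha, h99, hrm⟩ he
    simp only [rules] at he
    have hle : ((arr σ.wm b i).filter f).length ≤ i :=
      (List.length_filter_le _ _).trans (by simp)
    have hmem : τ.wm (b + i) = σ.wm (b + i) := hK.wm _ (by omega)
    have h6 := hK.w 6
    have hs : arr σ.wm b (i + 1) = arr σ.wm b i ++ [σ.wm (b + i)] := arr_succ ..
    have hal' := hK.al
    generalize hQ' : (fun (k : ℕ) (τ' : St) => ∃ a', _ ∧ _) = Q'
    simp only [wp_seq, wp_wset, wp_ite, wp_wput, wp_skip, hok, hc (τ.setW 38 _) (by simp [h6])]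
    simp only [rules, true_and, St.setW_w, if_true, St.putW_w, Nat.reduceEqDiff, if_false]
    rw [h36, hmem]
    refine ⟨fun hf => ⟨by omega, by omega, ?_⟩, fun hf => ⟨by omega, ?_⟩⟩
    · rw [← hQ']
      have hs' : (arr σ.wm b (i + 1)).filter f = (arr σ.wm b i).filter f ++ [σ.wm (b + i)] := by
        rw [hs, List.filter_append]; simp [hf]
      refine ⟨i + 1, ⟨?_, by omega, by simp; omega, by simp [h37], ?_, ?_, by simpa using hrm⟩, ?_⟩
      · exact (((hK.setW).putW (by simpa using hal')).setAl (by omega)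
          (by omega)).setW
      · rw [hs', List.length_append, List.length_singleton, arr_succ]
        congr 1
        · refine Eq.trans (arr_congr fun p hp1 hp2 => ?_) ha
          simp [show p ≠ τ.w 99 by omega]
        · simp [h99]
      · rw [hs']; simp [h99]; omega
      · simp; omega
    · rw [← hQ']
      have hs' : (arr σ.wm b (i + 1)).filter f = (arr σ.wm b i).filter f := by
        rw [hs, List.filter_append]; simp [hf]
      refine ⟨i + 1, ⟨?_, by omega, by simp; omega, by simp [h37], ?_, ?_, by simpa using hrm⟩, ?_⟩
      · exact (hK.setW).setW
      · rw [hs']; exact ha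
      · rw [hs']; simp [h99]
      · simp; omega
  · exact ⟨.rfl', by omega, by omega, by omega, by simp, by simp, rfl⟩
  · rintro i k τ ⟨hK, hi, h36, h37, ha, h99, hrm⟩ he ht
    simp only [rules] at he ht
    obtain rfl : i = n := by omega
    exact hQ _ τ hK ha h99 hrm (by omega)

/-- Copy the words in the memory segment from `w36` to `w37`. -/
def copySeg : Stmt := filterSeg (.not (.wlt (.reg 38) (.reg 38)))

theorem copySeg_spec {B : ℕ} {Q : ℕ → St → Prop} (σ : St) (b n : ℕ)
    (h36 : σ.w 36 = b) (h37 : σ.w 37 = b + n) (hal : b + n ≤ σ.w 99) (hB : σ.w 99 + n + 1 < B)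
    (hQ : ∀ t τ, Keeps 36 σ τ → arr τ.wm (σ.w 99) n = arr σ.wm b n → τ.w 99 = σ.w 99 + n →
      τ.rm = σ.rm → t ≤ 30 * n + 5 → Q t τ) :
    wp B copySeg Q σ := by
  refine filterSeg_spec (fun _ => true) σ b n (by simp) (by simp) (by simp) h36 h37 hal hB ?_
  intro t τ hK ha h99 hrm ht
  simp only [List.filter_true, length_arr] at ha h99
  exact hQ t τ hK ha h99 hrm ht

/-- For each block `e` in the memory segment from `w36` to `w37`, append the difference of its
entries `w34` and `w35`, labelled with `e`. -/
def keySeg : Stmt :=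
  .loop (.wlt (.reg 36) (.reg 37))
    (.wset 38 (.mem (.reg 36)) ;;
    .rput (.reg 99) (.mem (.reg 38 + .reg 34) - .mem (.reg 38 + .reg 35)) ;;
    .wput (.reg 99) (.reg 38) ;;
    .wset 99 (.reg 99 + 1) ;;
    .wset 36 (.reg 36 + 1))

theorem keySeg_spec {B : ℕ} {Q : ℕ → St → Prop} (σ : St) (b n : ℕ)
    (h36 : σ.w 36 = b) (h37 : σ.w 37 = b + n) (hal : b + n ≤ σ.w 99) (hB : σ.w 99 + n + 1 < B)
    (he : ∀ e ∈ arr σ.wm b n, e + σ.w 34 < σ.w 99 ∧ e + σ.w 35 < σ.w 99)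
    (hQ : ∀ t τ, Keeps 36 σ τ →
      arr τ.cell (σ.w 99) n = (arr σ.wm b n).map
        (fun e => toLex (σ.rm (e + σ.w 34) - σ.rm (e + σ.w 35), e)) →
      τ.w 99 = σ.w 99 + n → t ≤ 30 * n + 5 → Q t τ) :
    wp B keySeg Q σ := by
  unfold keySeg
  refine wp_loop (fun (i : ℕ) τ => Keeps 36 σ τ ∧ i ≤ n ∧ τ.w 36 = b + i ∧ τ.w 37 = b + n ∧
      arr τ.cell (σ.w 99) i = (arr σ.wm b i).map
        (fun e => toLex (σ.rm (e + σ.w 34) - σ.rm (e + σ.w 35), e)) ∧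
      τ.w 99 = σ.w 99 + i)
    (fun i => 30 * (n - i)) ?_ ?_ 0 ?_ ?_
  · intros; simp
  · rintro i τ ⟨hK, hi, h36, h37, ha, h99⟩ hlt
    simp only [rules] at hlt
    have hmem : τ.wm (b + i) = σ.wm (b + i) := hK.wm _ (by omega)
    have h34 := hK.w 34
    have h35 := hK.w 35
    have he' := he (σ.wm (b + i)) ((mem_arr _ _ _).2 ⟨i, by omega, rfl⟩)
    have hal' := hK.al
    have r1 := hK.rm _ he'.1
    have r2 := hK.rm _ he'.2
    generalize hQ' : (fun (k : ℕ) (τ' : St) => ∃ a', _ ∧ _) = Q'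
    simp
    rw [h36, hmem, h34, h35]
    refine ⟨by omega, by omega, by omega, ?_⟩
    rw [← hQ']
    refine ⟨i + 1, ⟨?_, by omega, by simp; omega, by simp [h37], ?_, by simp; omega⟩, by simp; omega⟩
    · exact ((((hK.setW).putR (by simpa using hal')).putW (by simpa using hal')).setAl
        (by omega) (by omega)).setW
    · rw [arr_succ, arr_succ, List.map_append]
      congr 1
      · refine Eq.trans (arr_congr fun p hp1 hp2 => ?_) ha
        simp [St.cell, show p ≠ τ.w 99 by omega]
      · simp [St.cell, h99, r1, r2]
  · exact ⟨.rfl', by omega, by omega, by omega, by simp, by simp⟩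
  · rintro i k τ ⟨hK, hi, h36, h37, ha, h99⟩ hlt ht
    simp only [rules] at hlt ht
    obtain rfl : i = n := by omega
    exact hQ _ τ hK ha h99 (by omega)

/-- Append a record for the block `w38`: its prefix sums in the order of the permutation at `w23`. -/
def record : Stmt :=
  .wset 39 (.reg 23) ;;
  .wset 40 (.reg 23 + .reg 1) ;;
  .wput (.reg 99) (.reg 38) ;;
  .rset 39 (.cast 0) ;;
  .rput (.reg 99) (.reg 39) ;;
  .wset 99 (.reg 99 + 1) ;;
  .loop (.wlt (.reg 39) (.reg 40))
    (.rset 39 (.reg 39 + .mem (.reg 38 + .mem (.reg 39))) ;;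
    .rput (.reg 99) (.reg 39) ;;
    .wset 99 (.reg 99 + 1) ;;
    .wset 39 (.reg 39 + 1))

/-- The memory at `q` holds the prefix sums of the block `e` of `v` in the order `π`. -/
def IsRecord (v : ℕ → ℝ) (π : List ℕ) (e : ℕ) (σ : St) (q : ℕ) : Prop :=
  ∀ u ≤ π.length, σ.rm (q + u) = ((π.take u).map fun t => v (e + t)).sum

theorem record_spec {B : ℕ} {Q : ℕ → St → Prop} (σ : St) (v : ℕ → ℝ) {A : ℕ}
    (hA : A ≤ σ.w 99) (hv : ∀ p < A, σ.rm p = v p)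
    (hal : σ.w 23 + σ.w 1 ≤ σ.w 99) (hB : σ.w 99 + σ.w 1 + 2 < B)
    (he : ∀ t ∈ arr σ.wm (σ.w 23) (σ.w 1), σ.w 38 + t < A)
    (hQ : ∀ t τ, Keeps 39 σ τ → τ.wm (σ.w 99) = σ.w 38 →
      IsRecord v (arr σ.wm (σ.w 23) (σ.w 1)) (σ.w 38) τ (σ.w 99) →
      τ.w 99 = σ.w 99 + σ.w 1 + 1 → (∀ p, p ≠ σ.w 99 → τ.wm p = σ.wm p) → t ≤ 30 * σ.w 1 + 30 → Q t τ) :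
    wp B record Q σ := by
  unfold record
  simp
  refine ⟨by omega, by omega, by omega, ?_⟩
  refine wp_loop (fun (i : ℕ) τ => Keeps 39 σ τ ∧ i ≤ σ.w 1 ∧ τ.w 39 = σ.w 23 + i ∧
      τ.w 40 = σ.w 23 + σ.w 1 ∧ τ.wm (σ.w 99) = σ.w 38 ∧
      (∀ u ≤ i, τ.rm (σ.w 99 + u) = ((arr σ.wm (σ.w 23) u).map fun t => v (σ.w 38 + t)).sum) ∧
      τ.r 39 = ((arr σ.wm (σ.w 23) i).map fun t => v (σ.w 38 + t)).sum ∧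
      τ.w 99 = σ.w 99 + i + 1 ∧ (∀ p, p ≠ σ.w 99 → τ.wm p = σ.wm p))
    (fun i => 30 * (σ.w 1 - i)) ?_ ?_ 0 ?_ ?_
  · intros; simp
  · rintro i τ ⟨hK, hi, h39, h40, hw, hrec, hr, h99, hwm⟩ hlt
    simp only [rules] at hlt
    have hmem : τ.wm (σ.w 23 + i) = σ.wm (σ.w 23 + i) := hK.wm _ (by omega)
    have h38 := hK.w 38
    have he' := he (σ.wm (σ.w 23 + i)) ((mem_arr _ _ _).2 ⟨i, by omega, rfl⟩)
    have hal' := hK.al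
    have r1 := (hK.rm _ (he'.trans_le hA)).trans (hv _ he')
    generalize hQ' : (fun (k : ℕ) (τ' : St) => ∃ a', _ ∧ _) = Q'
    simp
    rw [h39, hmem, h38]
    refine ⟨by omega, ⟨by omega, by omega⟩, by omega, ?_⟩
    rw [← hQ']
    have hsum : τ.r 39 + τ.rm (σ.w 38 + σ.wm (σ.w 23 + i)) =
        ((arr σ.wm (σ.w 23) (i + 1)).map fun t => v (σ.w 38 + t)).sum := by
      rw [arr_succ, List.map_append, List.sum_append, hr, r1]; simp
    refine ⟨i + 1, ⟨?_, by omega, by simp; omega, by simp [h40], by simp [hw], ?_, by simp [hsum],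
      by simp; omega, by simpa using hwm⟩, by simp; omega⟩
    · exact (((hK.setR).putR (by simpa using hal')).setAl
        (by omega) (by omega)).setW
    · intro u hu
      rcases Nat.lt_or_ge i u with h | h
      · obtain rfl : u = i + 1 := by omega
        simp [← hsum, h99, add_assoc]
      · rw [← hrec u h]
        simp
        intro h; omega
  · refine ⟨?_, by omega, by simp, by simp, by simp, ?_, by simp, by simp, ?_⟩
    · exact (((((Keeps.rfl'.setW).setW).putW le_rfl).setR).putR le_rfl).setAl (by omega)
    · intro u hu
      obtain rfl : u = 0 := by omega
      simp
    · intro p hp; simp [hp]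
  · rintro i k τ ⟨hK, hi, h39, h40, hw, hrec, hr, h99, hwm⟩ hlt ht
    simp only [rules] at hlt ht
    obtain rfl : i = σ.w 1 := by omega
    refine hQ _ τ hK hw ?_ (by omega) hwm (by omega)
    intro u hu
    rw [length_arr] at hu
    rw [hrec u hu, take_arr, min_eq_left hu]

end RealRAM

namespace RealRAM

/-! ### Items of the classification -/

/-- A list `els` of blocks for which the same comparisons have been made: the first `p` entries of
`perm` are in order, and the next one belongs to a position between `lo` and `hi`. -/
structure Item where
  els : List ℕ
  perm : List ℕ
  p : ℕ
  lo : ℕ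
  hi : ℕ
  r : ℕ

/-- The order information in an item. -/
def SortedAt (z : ℕ → ℝ) (perm : List ℕ) (p lo hi : ℕ) : Prop :=
  (perm.take p).Pairwise (fun s t => z s ≤ z t) ∧ ∀ q ∈ perm[p]?,
    (∀ t ∈ perm.take lo, z t ≤ z q) ∧ (∀ t ∈ (perm.take p).drop hi, z q ≤ z t)

section SortedAt
variable {z : ℕ → ℝ} {l : List ℕ} {p lo hi mid : ℕ}

theorem SortedAt.right (h : SortedAt z l p lo hi) (hp : p < l.length) (hm : mid < p)
    (hz : z (l[mid]'(by omega)) ≤ z l[p]) : SortedAt z l p (mid + 1) hi := by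
  refine ⟨h.1, fun q hq => ⟨fun t ht => ?_, (h.2 q hq).2⟩⟩
  obtain rfl : l[p] = q := by simpa [List.getElem?_eq_getElem hp] using hq
  obtain ⟨i, hi, rfl⟩ := List.getElem_of_mem ht
  have hi' : i < mid + 1 ∧ i < l.length := by simpa using hi
  rcases Nat.lt_or_ge i mid with h' | h'
  · have := List.pairwise_iff_getElem.1 h.1 i mid (by simp; omega) (by simp; omega) h'
    simp only [List.getElem_take] at this ⊢
    exact this.trans hz
  · obtain rfl : i = mid := by omega
    simpa using hz

theorem SortedAt.left (h : SortedAt z l p lo hi) (hp : p < l.length) (hm : mid < p)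
    (hz : z l[p] ≤ z (l[mid]'(by omega))) : SortedAt z l p lo mid := by
  refine ⟨h.1, fun q hq => ⟨(h.2 q hq).1, fun t ht => ?_⟩⟩
  obtain rfl : l[p] = q := by simpa [List.getElem?_eq_getElem hp] using hq
  obtain ⟨i, hi, rfl⟩ := List.getElem_of_mem ht
  have hi' : i < p - mid := by simp at hi; omega
  simp only [List.getElem_drop, List.getElem_take]
  rcases Nat.eq_zero_or_pos i with rfl | h'
  · simpa using hz
  · have := List.pairwise_iff_getElem.1 h.1 mid (mid + i) (by simp; omega) (by simp; omega) (by omega)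
    simp only [List.getElem_take] at this
    exact hz.trans this

/-- Move the entry `p` to the position `lo`. -/
def rotate (l : List ℕ) (p lo : ℕ) : List ℕ :=
  l.take lo ++ (l[p]?.toList ++ ((l.take p).drop lo ++ l.drop (p + 1)))

theorem rotate_perm (hp : p < l.length) (hlo : lo ≤ p) : (rotate l p lo).Perm l := by
  have h1 : l.take p = l.take lo ++ (l.take p).drop lo := by
    conv_lhs => rw [← List.take_append_drop lo (l.take p)]
    rw [List.take_take, min_eq_left hlo]
  have h2 : l = l.take lo ++ ((l.take p).drop lo ++ ([l[p]] ++ l.drop (p + 1))) := by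
    conv_lhs => rw [← List.take_append_drop p l, List.drop_eq_getElem_cons hp, h1]
    simp
  rw [rotate, List.getElem?_eq_getElem hp, Option.toList_some]
  conv_rhs => rw [h2]
  refine List.Perm.append_left _ ?_
  rw [← List.append_assoc, ← List.append_assoc]
  exact List.Perm.append_right _ List.perm_append_comm

theorem SortedAt.rotate (h : SortedAt z l p lo lo) (hp : p < l.length) (hlo : lo ≤ p) :
    SortedAt z (rotate l p lo) (p + 1) 0 (p + 1) := by
  have h1 : l.take p = l.take lo ++ (l.take p).drop lo := by
    conv_lhs => rw [← List.take_append_drop lo (l.take p)]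
    rw [List.take_take, min_eq_left hlo]
  have h2 : (RealRAM.rotate l p lo).take (p + 1) = l.take lo ++ ([l[p]] ++ (l.take p).drop lo) := by
    rw [RealRAM.rotate, List.getElem?_eq_getElem hp, Option.toList_some, ← List.append_assoc [_],
      ← List.append_assoc]
    refine List.take_left' ?_
    simp; omega
  obtain ⟨h3, h4⟩ := h
  obtain ⟨h5, h6⟩ := h4 l[p] (by simp [List.getElem?_eq_getElem hp])
  refine ⟨?_, fun q hq => ⟨by simp, fun t ht => ?_⟩⟩
  · rw [h2]
    rw [h1, List.pairwise_append] at h3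
    rw [List.pairwise_append]
    refine ⟨h3.1, ?_, ?_⟩
    · rw [List.singleton_append, List.pairwise_cons]
      exact ⟨h6, h3.2.1⟩
    · intro a ha b hb
      rcases List.mem_append.1 hb with hb | hb
      · rw [List.mem_singleton.1 hb]; exact h5 a ha
      · exact h3.2.2 a ha b hb
  · rw [List.drop_eq_nil_of_le (by simp)] at ht
    simp at ht
end SortedAt

/-- The blocks are in the memory of `v`, those of the first kind below `yb`. -/
def IsBlock (xb d yb J e : ℕ) : Prop := (xb ≤ e ∧ e + d ≤ yb) ∨ (yb ≤ e ∧ e < yb + J)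

/-- Fixed data of the classification. The result for the blocks `x` and `y` will be stored in the matrix
at `mb`. -/
structure Data where
  mb : ℕ
  v : ℕ → ℝ
  xb : ℕ
  d : ℕ
  yb : ℕ
  J : ℕ

namespace Data
variable (P : Data)
/-- Difference of the entries `t` of the blocks `x` and `y`. -/
def z (x y t : ℕ) : ℝ := P.v (y + t) - P.v (x + t)
end Data

structure Item.Valid (P : Data) (it : Item) : Prop where
  perm : it.perm.Perm (List.range P.d)
  p_le : it.p ≤ P.d
  lo_le : it.lo ≤ it.hi
  hi_le : it.hi ≤ it.p
  len : it.els.length ≤ 2 ^ it.r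
  els : ∀ e ∈ it.els, IsBlock P.xb P.d P.yb P.J e
  sorted : ∀ x ∈ it.els, x < P.yb → ∀ y ∈ it.els, P.yb ≤ y → SortedAt (P.z x y) it.perm it.p it.lo it.hi

/-- The pair of blocks occurs in the item. -/
def Item.Covers (P : Data) (it : Item) (x y : ℕ) : Prop :=
  x ∈ it.els ∧ x < P.yb ∧ y ∈ it.els ∧ P.yb ≤ y

/-- The number of pairs of an item. -/
def pairs (yb : ℕ) (l : List ℕ) : ℕ := l.countP (· < yb) * l.countP (fun e => !decide (e < yb))

/-- The number of comparisons that may still be needed. -/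
def Item.height (d : ℕ) (it : Item) : ℕ := (d - it.p) * (Nat.size d + 1) + Nat.size (it.hi - it.lo)

/-- Amortized cost of one element. -/
def budget (D : ℕ) : ℕ → ℕ → ℕ
  | 0, _ => D
  | _ + 1, 0 => D
  | r + 1, h + 1 => D + budget D r (h + 1) + budget D (r + 1) h

theorem le_budget (D r h : ℕ) : D ≤ budget D r h := by
  cases r <;> cases h <;> simp only [budget] <;> omega

theorem budget_mono_left (D r h : ℕ) : budget D r h ≤ budget D (r + 1) h := by
  cases r <;> cases h <;> simp only [budget] <;> omega

theorem budget_mono_right (D r h : ℕ) : budget D r h ≤ budget D r (h + 1) := by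
  cases r <;> simp only [budget] <;> omega

theorem budget_mono {D r h r' h' : ℕ} (hr : r ≤ r') (hh : h ≤ h') : budget D r h ≤ budget D r' h' :=
  (monotone_nat_of_le_succ (f := fun r => budget D r h) (fun r => budget_mono_left D r h) hr).trans
    (monotone_nat_of_le_succ (f := fun h => budget D r' h) (fun h => budget_mono_right D r' h) hh)

theorem budget_le (D r h : ℕ) : 3 ^ r * budget D r h ≤ 8 * D * 4 ^ r * 8 ^ h := by
  induction r generalizing h with
  | zero =>
    simp only [budget, pow_zero, one_mul, mul_one]
    have : 1 ≤ 8 ^ h := Nat.one_le_pow _ _ (by norm_num)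
    nlinarith [Nat.zero_le D]
  | succ r ih =>
    have h34 : 3 ^ (r + 1) ≤ 4 ^ (r + 1) := Nat.pow_le_pow_left (by norm_num) _
    induction h with
    | zero =>
      simp only [budget, pow_zero, mul_one]
      nlinarith [Nat.zero_le D, Nat.zero_le (4 ^ (r + 1) * D)]
    | succ h ih' =>
      have h1 := ih (h + 1)
      have h8 : 1 ≤ 8 ^ h := Nat.one_le_pow _ _ (by norm_num)
      have e1 : 3 ^ (r + 1) * budget D (r + 1) (h + 1) =
          3 ^ (r + 1) * D + 3 * (3 ^ r * budget D r (h + 1)) + 3 ^ (r + 1) * budget D (r + 1) h := by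
        simp only [budget]; ring
      have e2 : 8 * D * 4 ^ r * 8 ^ (h + 1) = 16 * (4 ^ (r + 1) * 8 ^ h * D) := by ring
      have e3 : 8 * D * 4 ^ (r + 1) * 8 ^ h = 8 * (4 ^ (r + 1) * 8 ^ h * D) := by ring
      have e4 : 8 * D * 4 ^ (r + 1) * 8 ^ (h + 1) = 64 * (4 ^ (r + 1) * 8 ^ h * D) := by ring
      have e5 : 3 ^ (r + 1) * D ≤ 4 ^ (r + 1) * 8 ^ h * D :=
        Nat.mul_le_mul_right _ (h34.trans (Nat.le_mul_of_pos_right _ h8))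
      omega

/-- The potential of an item. -/
def Item.pot (P : Data) (D : ℕ) (it : Item) : ℕ :=
  200 + 400 * (it.els.length * budget D it.r (it.height P.d)) + 100 * pairs P.yb it.els

/-- The potential of a stack of items. -/
def stackPot (P : Data) (D : ℕ) (l : List Item) : ℕ := (l.map (Item.pot P D)).sum

@[simp] theorem stackPot_cons (P : Data) (D : ℕ) (it : Item) (l : List Item) :
    stackPot P D (it :: l) = it.pot P D + stackPot P D l := by simp [stackPot]
@[simp] theorem stackPot_nil (P : Data) (D : ℕ) : stackPot P D [] = 0 := rfl

/-- The blocks of the first kind. -/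
abbrev isX (yb : ℕ) : ℕ → Bool := fun e => decide (e < yb)
/-- The blocks of the second kind. -/
abbrev isY (yb : ℕ) : ℕ → Bool := fun e => !decide (e < yb)

/-- The four items that result from comparing the entries `p` and `mid`, where `L` is the list of
blocks ordered by the difference of these entries. -/
def Item.first (it : Item) (L : List ℕ) : Item := { it with els := L.take (L.length / 2), r := it.r - 1 }
def Item.second (it : Item) (L : List ℕ) : Item := { it with els := L.drop (L.length / 2), r := it.r - 1 }
def Item.right (yb : ℕ) (it : Item) (L : List ℕ) (mid : ℕ) : Item :=
  { it with
    els := (L.take (L.length / 2)).filter (isX yb) ++ (L.drop (L.length / 2)).filter (isY yb)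
    lo := mid + 1 }
def Item.left (yb : ℕ) (it : Item) (L : List ℕ) (mid : ℕ) : Item :=
  { it with
    els := (L.take (L.length / 2)).filter (isY yb) ++ (L.drop (L.length / 2)).filter (isX yb)
    hi := mid }

theorem mem_of_mem_filter_append {l l' : List ℕ} {f g : ℕ → Bool} {e : ℕ}
    (h : e ∈ l.filter f ++ l'.filter g) : e ∈ l ++ l' := by
  simp only [List.mem_append, List.mem_filter] at h ⊢
  tauto

theorem size_half_lt {a b : ℕ} (h : 2 * a ≤ b) (hb : 0 < b) : Nat.size a + 1 ≤ Nat.size b := by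
  have h1 : 2 ^ (Nat.size b - 1) ≤ b := by
    by_contra hc
    have := Nat.size_le.2 (not_le.1 hc)
    have := Nat.size_pos.2 hb
    omega
  have h2 := Nat.lt_size_self b
  have h3 := Nat.size_pos.2 hb
  have h4 : Nat.size a ≤ Nat.size b - 1 := by
    rw [Nat.size_le]
    have : 2 ^ Nat.size b = 2 * 2 ^ (Nat.size b - 1) := by
      rw [← pow_succ']; congr 1; omega
    omega
  omega

section compare
variable {P : Data} {it : Item} {L : List ℕ} {mid : ℕ}

theorem Item.Valid.compare (h : it.Valid P) (hL : L.Perm it.els) (hk : 2 ≤ it.els.length)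
    (hp : it.p < P.d) (hlo : it.lo ≤ mid) (hhi : mid < it.hi)
    (hs : L.Pairwise fun e e' => P.v (e + it.perm.getD it.p 0) - P.v (e + it.perm.getD mid 0) ≤
      P.v (e' + it.perm.getD it.p 0) - P.v (e' + it.perm.getD mid 0)) :
    (it.first L).Valid P ∧ (it.second L).Valid P ∧ (it.right P.yb L mid).Valid P ∧
      (it.left P.yb L mid).Valid P := by
  have hlen := hL.length_eq
  have hlp := h.perm.length_eq
  rw [List.length_range] at hlp
  have hr : it.r ≠ 0 := by
    intro h0
    have := h.len
    rw [h0] at this; omega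
  have hr' : 2 ^ it.r = 2 * 2 ^ (it.r - 1) := by rw [← pow_succ']; congr 1; omega
  have hlen2 := h.len
  have ht : ∀ e ∈ L.take (L.length / 2), e ∈ it.els := fun e he => hL.mem_iff.1 (List.mem_of_mem_take he)
  have hd : ∀ e ∈ L.drop (L.length / 2), e ∈ it.els := fun e he => hL.mem_iff.1 (List.mem_of_mem_drop he)
  have htd : ∀ {f g : ℕ → Bool}, ∀ e ∈ (L.take (L.length / 2)).filter f ++ (L.drop (L.length / 2)).filter g,
      e ∈ it.els := fun e he => by
    have := mem_of_mem_filter_append he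
    rw [List.take_append_drop] at this
    exact hL.mem_iff.1 this
  have hsub : ∀ {f g : ℕ → Bool}, ((L.take (L.length / 2)).filter f ++
      (L.drop (L.length / 2)).filter g).length ≤ it.els.length := fun {f g} => by
    have h1 := List.length_filter_le f (L.take (L.length / 2))
    have h2 := List.length_filter_le g (L.drop (L.length / 2))
    simp only [List.length_take, List.length_drop, List.length_append] at *
    omega
  rw [← List.take_append_drop (L.length / 2) L, List.pairwise_append] at hs
  have hcross := hs.2.2
  have hhi' := h.hi_le
  have g1 : it.perm.getD it.p 0 = it.perm[it.p] := by simp [List.getD,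
      List.getElem?_eq_getElem (show it.p < it.perm.length by omega)]
  have g2 : it.perm.getD mid 0 = it.perm[mid] := by simp [List.getD,
      List.getElem?_eq_getElem (show mid < it.perm.length by omega)]
  rw [g1, g2] at hcross
  refine ⟨⟨h.perm, h.p_le, h.lo_le, h.hi_le, ?_, fun e he => h.els e (ht e he), fun x hx hx' y hy hy' =>
    h.sorted x (ht x hx) hx' y (ht y hy) hy'⟩, ⟨h.perm, h.p_le, h.lo_le, h.hi_le, ?_,
    fun e he => h.els e (hd e he), fun x hx hx' y hy hy' => h.sorted x (hd x hx) hx' y (hd y hy) hy'⟩,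
    ⟨h.perm, h.p_le, ?_, h.hi_le, hsub.trans h.len, fun e he => h.els e (htd e he), ?_⟩,
    ⟨h.perm, h.p_le, hlo, ?_, hsub.trans h.len, fun e he => h.els e (htd e he), ?_⟩⟩
  · simp only [Item.first, List.length_take]; omega
  · simp only [Item.second, List.length_drop]; omega
  · simp only [Item.right]; omega
  · intro x hx hx' y hy hy'
    refine (h.sorted x (htd x hx) hx' y (htd y hy) hy').right (by omega) (by omega) ?_
    simp only [Item.right, List.mem_append, List.mem_filter, decide_eq_true_eq, Bool.not_eq_true',
      decide_eq_false_iff_not] at hx hy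
    have := hcross x (by rcases hx with h | h; exacts [h.1, absurd hx' h.2]) y
      (by rcases hy with h | h; exacts [absurd h.2 (by omega), h.1])
    simp only [Data.z]; linarith
  · simp only [Item.left]; omega
  · intro x hx hx' y hy hy'
    show SortedAt (P.z x y) it.perm it.p it.lo mid
    refine (h.sorted x (htd x hx) hx' y (htd y hy) hy').left (by omega) (by omega) ?_
    simp only [Item.left, List.mem_append, List.mem_filter, decide_eq_true_eq, Bool.not_eq_true',
      decide_eq_false_iff_not] at hx hy
    have := hcross y (by rcases hy with h | h; exacts [h.1, absurd h.2 (by omega)]) x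
      (by rcases hx with h | h; exacts [absurd hx' h.2, h.1])
    simp only [Data.z]; linarith

theorem Item.Covers.compare (hL : L.Perm it.els) {x y : ℕ} (h : it.Covers P x y) :
    (it.first L).Covers P x y ∨ (it.second L).Covers P x y ∨ (it.right P.yb L mid).Covers P x y ∨
      (it.left P.yb L mid).Covers P x y := by
  obtain ⟨hx, hx', hy, hy'⟩ := h
  rw [← hL.mem_iff, ← List.take_append_drop (L.length / 2) L, List.mem_append] at hx hy
  simp only [Item.Covers, Item.first, Item.second, Item.right, Item.left, List.mem_append,
    List.mem_filter, decide_eq_true_eq, Bool.not_eq_true', decide_eq_false_iff_not, hx', hy', and_true,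
    true_and, not_lt]
  tauto

theorem pot_compare (h : it.Valid P) (hL : L.Perm it.els) (hk : 2 ≤ it.els.length)
    (hp : it.p < P.d) (hlo : it.lo ≤ mid) (hhi : mid < it.hi) (h1 : 2 * (mid - it.lo) ≤ it.hi - it.lo)
    (h2 : 2 * (it.hi - (mid + 1)) ≤ it.hi - it.lo) (D : ℕ) :
    (it.first L).pot P D + (it.second L).pot P D + (it.right P.yb L mid).pot P D +
      (it.left P.yb L mid).pot P D + 400 * (it.els.length * D) ≤ it.pot P D + 600 := by
  have hlen := hL.length_eq
  obtain ⟨r, hr⟩ : ∃ r, it.r = r + 1 := by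
    refine ⟨it.r - 1, ?_⟩
    have := h.len
    rcases Nat.eq_zero_or_pos it.r with h0 | h0
    · rw [h0] at this; omega
    · omega
  have hs1 := size_half_lt h1 (by omega)
  have hs2 := size_half_lt h2 (by omega)
  obtain ⟨H, hH⟩ : ∃ H, it.height P.d = H + 1 := ⟨it.height P.d - 1, by unfold Item.height; omega⟩
  have e1 : (it.first L).height P.d = H + 1 := hH
  have e2 : (it.second L).height P.d = H + 1 := hH
  have e3 : (it.right P.yb L mid).height P.d ≤ H := by
    simp only [Item.height, Item.right] at hH ⊢; omega
  have e4 : (it.left P.yb L mid).height P.d ≤ H := by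
    simp only [Item.height, Item.left] at hH ⊢; omega
  have b3 := budget_mono (D := D) (le_refl (r + 1)) e3
  have b4 := budget_mono (D := D) (le_refl (r + 1)) e4
  have hc1 : ∀ f : ℕ → Bool, it.els.countP f = (L.take (L.length / 2)).countP f + (L.drop (L.length / 2)).countP f := by
    intro f
    rw [← hL.countP_eq, ← List.countP_append, List.take_append_drop]
  have n3 : (it.right P.yb L mid).els.length = (L.take (L.length / 2)).countP (isX P.yb) +
      (L.drop (L.length / 2)).countP (isY P.yb) := by
    simp [Item.right, List.countP_eq_length_filter]
  have n4 : (it.left P.yb L mid).els.length = (L.take (L.length / 2)).countP (isY P.yb) +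
      (L.drop (L.length / 2)).countP (isX P.yb) := by
    simp [Item.left, List.countP_eq_length_filter]
  have n1 : (it.first L).els.length + (it.second L).els.length = it.els.length := by
    simp only [Item.first, Item.second, ← hlen, ← List.length_append, List.take_append_drop]
  have nn : it.els.length = it.els.countP (isX P.yb) + it.els.countP (isY P.yb) := by
    rw [List.length_eq_countP_add_countP (isX P.yb)]
    congr 1
    exact List.countP_congr (by simp)
  have hxy : ∀ l : List ℕ, (l.filter (isX P.yb)).countP (isY P.yb) = 0 := by
    intro l; rw [List.countP_filter]; simp
  have hyx : ∀ l : List ℕ, (l.filter (isY P.yb)).countP (isX P.yb) = 0 := by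
    intro l; rw [List.countP_filter]; simp
  have hxx : ∀ (l : List ℕ) (f : ℕ → Bool), (l.filter f).countP f = l.countP f := by
    intro l f; rw [List.countP_filter]; simp
  have p1 : pairs P.yb (it.first L).els + pairs P.yb (it.second L).els +
      pairs P.yb (it.right P.yb L mid).els + pairs P.yb (it.left P.yb L mid).els = pairs P.yb it.els := by
    simp only [pairs, Item.first, Item.second, Item.right, Item.left, List.countP_append, hc1]
    simp only [hxy, hyx, hxx]
    ring
  have n34 : (it.right P.yb L mid).els.length + (it.left P.yb L mid).els.length = it.els.length := by
    rw [n3, n4, nn, hc1, hc1]; ring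
  have m1 := Nat.mul_le_mul_left (it.right P.yb L mid).els.length b3
  have m2 := Nat.mul_le_mul_left (it.left P.yb L mid).els.length b4
  simp only [Item.pot]
  rw [e1, e2, hH]
  have r1 : (it.first L).r = r := by simp [Item.first, hr]
  have r2 : (it.second L).r = r := by simp [Item.second, hr]
  have r3 : (it.right P.yb L mid).r = r + 1 := by simp [Item.right, hr]
  have r4 : (it.left P.yb L mid).r = r + 1 := by simp [Item.left, hr]
  rw [r1, r2, r3, r4, hr]
  have e5 : it.els.length * budget D (r + 1) (H + 1) = it.els.length * D +
      ((it.first L).els.length * budget D r (H + 1) + (it.second L).els.length * budget D r (H + 1)) +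
      ((it.right P.yb L mid).els.length * budget D (r + 1) H +
        (it.left P.yb L mid).els.length * budget D (r + 1) H) := by
    rw [← Nat.add_mul, ← Nat.add_mul, n1, n34]; simp only [budget]; ring
  omega

/-- The item after the insertion of the entry `p`. -/
def Item.insert (it : Item) : Item :=
  { it with perm := rotate it.perm it.p it.lo, p := it.p + 1, lo := 0, hi := it.p + 1 }

theorem Item.Valid.insert (h : it.Valid P) (hp : it.p < P.d) (hlo : it.hi ≤ it.lo) :
    it.insert.Valid P := by
  have hlp := h.perm.length_eq
  rw [List.length_range] at hlp
  have h1 := h.lo_le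
  have h2 := h.hi_le
  refine ⟨(rotate_perm (by omega) (by omega)).trans h.perm, hp, by simp [Item.insert], by simp [Item.insert], h.len, h.els,
    fun x hx hx' y hy hy' => ?_⟩
  have h3 := h.sorted x hx hx' y hy hy'
  rw [show it.hi = it.lo by omega] at h3
  exact h3.rotate (by omega) (by omega)

theorem pot_insert (h : it.Valid P) (hk : 2 ≤ it.els.length) (hp : it.p < P.d) (D : ℕ) :
    it.insert.pot P D + 400 * (it.els.length * D) ≤ it.pot P D := by
  obtain ⟨r, hr⟩ : ∃ r, it.r = r + 1 := by
    refine ⟨it.r - 1, ?_⟩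
    have := h.len
    rcases Nat.eq_zero_or_pos it.r with h0 | h0
    · rw [h0] at this; omega
    · omega
  have hs : Nat.size (it.p + 1) ≤ Nat.size P.d := Nat.size_le_size hp
  have h1 : it.insert.height P.d + 1 ≤ it.height P.d := by
    obtain ⟨q, hq⟩ : ∃ q, P.d - it.p = q + 1 := ⟨P.d - it.p - 1, by omega⟩
    simp only [Item.height, Item.insert, hq, show P.d - (it.p + 1) = q by omega, Nat.add_mul, Nat.sub_zero]
    omega
  obtain ⟨H, hH⟩ : ∃ H, it.height P.d = H + 1 := ⟨it.height P.d - 1, by omega⟩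
  have h2 := budget_mono (D := D) (le_refl (r + 1)) (show it.insert.height P.d ≤ H by omega)
  have h3 := Nat.mul_le_mul_left it.els.length h2
  have e : it.els.length * budget D (r + 1) (H + 1) = it.els.length * D +
      it.els.length * budget D r (H + 1) + it.els.length * budget D (r + 1) H := by
    simp only [budget]; ring
  simp only [Item.pot, hH, hr, show it.insert.r = r + 1 from hr, show it.insert.els = it.els from rfl]
  omega
end compare

end RealRAM

namespace RealRAM

/-! ### The stack of items -/

/-- The word memory from `b` on contains the list `l`. -/
def Seg (σ : St) (A b : ℕ) (l : List ℕ) : Prop :=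
  A ≤ b ∧ b + l.length ≤ σ.w 99 ∧ arr σ.wm b l.length = l

/-- The word memory between `A` and the allocation pointer is kept. -/
def Ext (A : ℕ) (σ τ : St) : Prop :=
  σ.w 99 ≤ τ.w 99 ∧ ∀ p, A ≤ p → p < σ.w 99 → τ.wm p = σ.wm p

theorem Ext.trans {A : ℕ} {σ τ υ : St} (h : Ext A σ τ) (h' : Ext A τ υ) : Ext A σ υ :=
  ⟨h.1.trans h'.1, fun p hp hp' => (h'.2 p hp (hp'.trans_le h.1)).trans (h.2 p hp hp')⟩

theorem Keeps.ext {b : ℕ} {σ τ : St} (h : Keeps b σ τ) (A : ℕ) : Ext A σ τ :=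
  ⟨h.al, fun p _ hp => h.wm p hp⟩

theorem Ext.seg {A b : ℕ} {σ τ : St} {l : List ℕ} (h : Ext A σ τ) (hs : Seg σ A b l) : Seg τ A b l :=
  ⟨hs.1, hs.2.1.trans h.1, (arr_congr fun p hp hp' => h.2 p (hs.1.trans hp) (hp'.trans_le hs.2.1)).trans hs.2.2⟩

/-- The item `it` is stored at `q`. -/
structure ItemAt (σ : St) (A q : ℕ) (it : Item) : Prop where
  els : Seg σ A (σ.wm (q + 1)) it.els
  len : σ.wm (q + 2) = it.els.length
  perm : Seg σ A (σ.wm (q + 3)) it.perm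
  p : σ.wm (q + 4) = it.p
  lo : σ.wm (q + 5) = it.lo
  hi : σ.wm (q + 6) = it.hi
  le : A ≤ q
  lt : q + 7 ≤ σ.w 99

/-- The linked stack `l` starts at `q`. -/
def StackAt (σ : St) (A : ℕ) : ℕ → List Item → Prop
  | q, [] => q = 0
  | q, it :: l => 0 < q ∧ ItemAt σ A q it ∧ StackAt σ A (σ.wm q) l

theorem Ext.itemAt {A q : ℕ} {σ τ : St} {it : Item} (h : Ext A σ τ) (hi : ItemAt σ A q it) :
    ItemAt τ A q it := by
  have hle := hi.le
  have hlt := hi.lt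
  have e : ∀ i, i < 7 → τ.wm (q + i) = σ.wm (q + i) := fun i hi => h.2 _ (by omega) (by omega)
  refine ⟨?_, ?_, ?_, ?_, ?_, ?_, hi.le, hi.lt.trans h.1⟩
  · rw [e 1 (by omega)]; exact h.seg hi.els
  · rw [e 2 (by omega)]; exact hi.len
  · rw [e 3 (by omega)]; exact h.seg hi.perm
  · rw [e 4 (by omega)]; exact hi.p
  · rw [e 5 (by omega)]; exact hi.lo
  · rw [e 6 (by omega)]; exact hi.hi

theorem Ext.stackAt {A : ℕ} {σ τ : St} (h : Ext A σ τ) : ∀ {q : ℕ} {l : List Item},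
    StackAt σ A q l → StackAt τ A q l
  | _, [], hs => hs
  | q, _ :: l, hs => by
    have hle := hs.2.1.le
    have hlt := hs.2.1.lt
    refine ⟨hs.1, h.itemAt hs.2.1, ?_⟩
    rw [h.2 q hle (by omega)]
    exact h.stackAt hs.2.2

/-- Push an item. -/
def push : Stmt :=
  .wput (.reg 99) (.reg 20) ;;
  .wput (.reg 99 + 1) (.reg 27) ;;
  .wput (.reg 99 + 2) (.reg 28) ;;
  .wput (.reg 99 + 3) (.reg 23) ;;
  .wput (.reg 99 + 4) (.reg 24) ;;
  .wput (.reg 99 + 5) (.reg 31) ;;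
  .wput (.reg 99 + 6) (.reg 32) ;;
  .wset 20 (.reg 99) ;;
  .wset 99 (.reg 99 + 7)

/-- Registers `20` and `99` and fresh memory may change. -/
structure Pushed (σ τ : St) : Prop where
  w : ∀ i, i ≠ 20 → i ≠ 99 → τ.w i = σ.w i
  r : τ.r = σ.r
  al : τ.w 99 = σ.w 99 + 7
  wm : ∀ p < σ.w 99, τ.wm p = σ.wm p
  rm : τ.rm = σ.rm

theorem Pushed.keeps {σ τ : St} (h : Pushed σ τ) : Keeps 20 σ τ :=
  ⟨fun i hi => h.w i (by omega) (by omega), fun i _ => by rw [h.r], by rw [h.al]; omega, h.wm,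
    fun p _ => by rw [h.rm]⟩

theorem push_spec {B : ℕ} {Q : ℕ → St → Prop} (σ : St) {A : ℕ} (it : Item) (l : List Item)
    (hels : Seg σ A (σ.w 27) it.els) (hlen : σ.w 28 = it.els.length) (hperm : Seg σ A (σ.w 23) it.perm)
    (hp : σ.w 24 = it.p) (hlo : σ.w 31 = it.lo) (hhi : σ.w 32 = it.hi)
    (hst : StackAt σ A (σ.w 20) l) (hA : 0 < A) (hA' : A ≤ σ.w 99) (hB : σ.w 99 + 7 < B)
    (hQ : ∀ t τ, Pushed σ τ → StackAt τ A (τ.w 20) (it :: l) → t ≤ 60 → Q t τ) :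
    wp B push Q σ := by
  unfold push
  simp
  refine ⟨by omega, by omega, by omega, by omega, by omega, by omega, by omega, ?_⟩
  have hP : Pushed σ (((((((((σ.putW (σ.w 99) (σ.w 20)).putW (σ.w 99 + 1) (σ.w 27)).putW (σ.w 99 + 2)
      (σ.w 28)).putW (σ.w 99 + 3) (σ.w 23)).putW (σ.w 99 + 4) (σ.w 24)).putW (σ.w 99 + 5) (σ.w 31)).putW
      (σ.w 99 + 6) (σ.w 32)).setW 20 (σ.w 99)).setW 99 (σ.w 99 + 7)) := by
    refine ⟨fun i h h' => by simp [h, h'], rfl, by simp, fun p hp => ?_, rfl⟩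
    simp [show p ≠ σ.w 99 by omega, show p ≠ σ.w 99 + 1 by omega, show p ≠ σ.w 99 + 2 by omega,
      show p ≠ σ.w 99 + 3 by omega, show p ≠ σ.w 99 + 4 by omega, show p ≠ σ.w 99 + 5 by omega,
      show p ≠ σ.w 99 + 6 by omega]
  have hE := hP.keeps.ext A
  refine hQ _ _ hP ?_ (by omega)
  refine ⟨by simp; omega, ⟨?_, ?_, ?_, ?_, ?_, ?_, by simpa using hA', by simp⟩, ?_⟩
  · have := hE.seg hels
    simpa using this
  · simpa using hlen
  · have := hE.seg hperm
    simpa using this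
  · simpa using hp
  · simpa using hlo
  · simpa using hhi
  · have := hE.stackAt hst
    simpa using this

/-- Item at the top of the stack, loaded into registers. -/
structure Loaded (σ : St) (A : ℕ) (it : Item) : Prop where
  els : Seg σ A (σ.w 21) it.els
  len : σ.w 22 = it.els.length
  perm : Seg σ A (σ.w 23) it.perm
  p : σ.w 24 = it.p
  lo : σ.w 25 = it.lo
  hi : σ.w 26 = it.hi

/-- Push the item made of the blocks that satisfy `c` between `w34` and `w35` and the blocks that satisfy
`c'` between `w35` and `w34 + w22`. -/
def crossPush (c c' : Cond) : Stmt :=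
  .wset 27 (.reg 99) ;;
  .wset 36 (.reg 34) ;;
  .wset 37 (.reg 35) ;;
  filterSeg c ;;
  .wset 36 (.reg 35) ;;
  .wset 37 (.reg 34 + .reg 22) ;;
  filterSeg c' ;;
  .wset 28 (.reg 99 - .reg 27) ;;
  push

theorem crossPush_spec {B : ℕ} {Q : ℕ → St → Prop} {c c' : Cond} (f f' : ℕ → Bool) (σ : St) {A : ℕ}
    (it : Item) (l : List Item) (L : List ℕ)
    (hc : ∀ τ, τ.w 6 = σ.w 6 → (c.eval τ ↔ f (τ.w 38) = true)) (hok : ∀ τ, c.ok B τ) (hcost : c.cost ≤ 5)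
    (hc' : ∀ τ, τ.w 6 = σ.w 6 → (c'.eval τ ↔ f' (τ.w 38) = true)) (hok' : ∀ τ, c'.ok B τ)
    (hcost' : c'.cost ≤ 5) (hL : Seg σ A (σ.w 34) L) (h22 : σ.w 22 = L.length)
    (h35 : σ.w 35 = σ.w 34 + L.length / 2)
    (hels : it.els = (L.take (L.length / 2)).filter f ++ (L.drop (L.length / 2)).filter f')
    (hperm : Seg σ A (σ.w 23) it.perm)
    (hp : σ.w 24 = it.p) (hlo : σ.w 31 = it.lo) (hhi : σ.w 32 = it.hi)
    (hst : StackAt σ A (σ.w 20) l) (hA : 0 < A) (hA' : A ≤ σ.w 99) (hB : σ.w 99 + L.length + 10 < B)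
    (hQ : ∀ t τ, Keeps 20 σ τ → (∀ i, i ≠ 20 → i ≠ 27 → i ≠ 28 → i < 36 → τ.w i = σ.w i) →
      τ.w 99 ≤ σ.w 99 + L.length + 7 → StackAt τ A (τ.w 20) (it :: l) → t ≤ 30 * L.length + 150 → Q t τ) :
    wp B (crossPush c c') Q σ := by
  have hL1 := hL.2.1
  unfold crossPush
  simp only [wp_seq, wp_wset, rules, true_and, St.setW_w, Nat.reduceEqDiff, if_false]
  generalize h0 : ((σ.setW 27 (σ.w 99)).setW 36 (σ.w 34)).setW 37 (σ.w 35) = σ1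
  have k1 : Keeps 27 σ σ1 := by
    rw [← h0]
    exact ((Keeps.rfl'.setW).setW).setW
  have a1 : ∀ i, i ≠ 27 → i < 36 → σ1.w i = σ.w i := fun i h h' => by
    simp [← h0, h, show i ≠ 36 by omega, show i ≠ 37 by omega]
  have al1 : σ1.w 99 = σ.w 99 := by simp [← h0]
  have b1 : σ1.w 27 = σ.w 99 := by simp [← h0]
  have c1 : σ1.w 6 = σ.w 6 := by simp [← h0]
  have d1 : σ1.wm = σ.wm := by rw [← h0]; rfl
  have arrL : arr σ.wm (σ.w 34) L.length = L := hL.2.2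
  have arr1 : arr σ1.wm (σ.w 34) (L.length / 2) = L.take (L.length / 2) := by
    have h := take_arr (f := σ.wm) (b := σ.w 34) (n := L.length) (L.length / 2)
    rw [arrL, min_eq_left (by omega)] at h
    rw [h, d1]
  refine filterSeg_spec f σ1 (σ.w 34) (L.length / 2) (fun τ h => hc τ (h.trans c1)) hok hcost (by simp [← h0])
    (by simp [← h0, h35]) (by omega) (by omega) ?_
  intro t1 σ2 k2 f2 al2 _ ht1
  rw [arr1] at f2 al2
  have n1 : ((L.take (L.length / 2)).filter f).length ≤ L.length / 2 :=
    (List.length_filter_le _ _).trans (by simp)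
  have n2 : ((L.drop (L.length / 2)).filter f').length ≤ L.length - L.length / 2 :=
    (List.length_filter_le _ _).trans (by simp)
  have a2 : ∀ i, i ≠ 27 → i < 36 → σ2.w i = σ.w i := fun i h h' => (k2.w i h').trans (a1 i h h')
  have b2 : σ2.w 27 = σ.w 99 := (k2.w 27).trans b1
  have k02 : Keeps 27 σ σ2 := k1.trans (k2.mono)
  have e34 := a2 34 (by omega) (by omega)
  have e35 := a2 35 (by omega) (by omega)
  have e22 := a2 22 (by omega) (by omega)
  have e6 := a2 6 (by omega) (by omega)
  refine ⟨by omega, ?_⟩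
  generalize h3 : (σ2.setW 36 (σ2.w 35)).setW 37 (σ2.w 34 + σ2.w 22) = σ3
  have k3 : Keeps 36 σ2 σ3 := by
    rw [← h3]
    exact (Keeps.rfl'.setW).setW
  have al3 : σ3.w 99 = σ2.w 99 := by simp [← h3]
  have arr3 : arr σ3.wm (σ.w 35) (L.length - L.length / 2) = L.drop (L.length / 2) := by
    have h := drop_arr (f := σ.wm) (b := σ.w 34) (n := L.length) (L.length / 2)
    rw [arrL, ← h35] at h
    rw [h]
    exact (k02.trans (k3.mono)).arr_wm (by omega)
  refine filterSeg_spec f' σ3 (σ.w 35) (L.length - L.length / 2)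
    (fun τ h => hc' τ (h.trans ((k3.w 6).trans e6))) hok' hcost' (by simp [← h3, e35])
    (by simp [← h3, e34, e22]; omega) (by omega) (by omega) ?_
  intro t2 σ4 k4 f4 al4 _ ht2
  rw [arr3] at f4 al4
  have k24 : Keeps 36 σ2 σ4 := k3.trans k4
  have a4 : ∀ i, i ≠ 27 → i < 36 → σ4.w i = σ.w i := fun i h h' => (k24.w i h').trans (a2 i h h')
  have b4 : σ4.w 27 = σ.w 99 := (k24.w 27).trans b2
  have k04 : Keeps 27 σ σ4 := k02.trans (k24.mono)
  have E := k04.ext A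
  have hlen : it.els.length = ((L.take (L.length / 2)).filter f).length +
      ((L.drop (L.length / 2)).filter f').length := by rw [hels, List.length_append]
  generalize h5 : σ4.setW 28 (σ4.w 99 - σ4.w 27) = σ5
  have k5 : Keeps 27 σ σ5 := by rw [← h5]; exact k04.setW
  have wm5 : σ5.wm = σ4.wm := by rw [← h5]; rfl
  have al5 : σ5.w 99 = σ4.w 99 := by simp [← h5]
  have a5 : ∀ i, i ≠ 27 → i ≠ 28 → i < 36 → σ5.w i = σ.w i := fun i h h' h'' => by
    simp [← h5, h', a4 i h h'']
  have E5 := k5.ext A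
  refine push_spec σ5 it l ?_ ?_ ?_ ?_ ?_ ?_ ?_ hA ?_ ?_ ?_
  · have b5 : σ5.w 27 = σ.w 99 := by simp [← h5, b4]
    rw [b5]
    refine ⟨hA', by omega, ?_⟩
    rw [hlen, arr_add, wm5, hels]
    congr 1
    · rw [k24.arr_wm (by omega), ← al1, f2]
    · rw [← al1, ← al2, ← al3, f4]
  · simp [← h5, b4]; omega
  · rw [a5 23 (by omega) (by omega) (by omega)]; exact E5.seg hperm
  · rw [a5 24 (by omega) (by omega) (by omega)]; exact hp
  · rw [a5 31 (by omega) (by omega) (by omega)]; exact hlo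
  · rw [a5 32 (by omega) (by omega) (by omega)]; exact hhi
  · rw [a5 20 (by omega) (by omega) (by omega)]; exact E5.stackAt hst
  · omega
  · omega
  · intro t3 τ hP hS ht3
    refine hQ _ τ ((k5.mono).trans hP.keeps) (fun i h1 h2 h3 h4 => ?_) ?_ hS ?_
    · rw [hP.w i h1 (by omega), a5 i h2 h3 h4]
    · rw [hP.al]; omega
    · omega

end RealRAM

namespace RealRAM

/-- Sort the blocks of the item in registers by the difference of the entries that are compared next. -/
def sortStep : Stmt :=
  .wset 33 ((.reg 25 + .reg 26) / 2) ;;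
  .wset 34 (.mem (.reg 23 + .reg 24)) ;;
  .wset 35 (.mem (.reg 23 + .reg 33)) ;;
  .wset 36 (.reg 21) ;;
  .wset 37 (.reg 21 + .reg 22) ;;
  .wset 32 (.reg 99) ;;
  keySeg ;;
  .wset 50 (.reg 32) ;;
  .wset 51 (.reg 22) ;;
  .wset 54 (.reg 22 + .reg 22 + 2) ;;
  mergeSort ;;
  .wset 34 (.reg 50) ;;
  .wset 35 (.reg 50 + .reg 22 / 2)

/-- Compare two entries for all pairs of blocks of the item in registers. -/
def compareStep : Stmt :=
  sortStep ;;
  .wset 27 (.reg 34) ;; .wset 28 (.reg 22 / 2) ;; .wset 31 (.reg 25) ;; .wset 32 (.reg 26) ;;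
  push ;;
  .wset 27 (.reg 35) ;; .wset 28 (.reg 22 - .reg 22 / 2) ;;
  push ;;
  .wset 31 (.reg 33 + 1) ;;
  crossPush (.wlt (.reg 38) (.reg 6)) (.not (.wlt (.reg 38) (.reg 6))) ;;
  .wset 31 (.reg 25) ;; .wset 32 (.reg 33) ;;
  crossPush (.not (.wlt (.reg 38) (.reg 6))) (.wlt (.reg 38) (.reg 6))

/-- The memory contains the data. -/
structure Data.In (P : Data) (A : ℕ) (σ : St) : Prop where
  rm : ∀ p < A, σ.rm p = P.v p
  d : σ.w 1 = P.d
  mb : σ.w 3 = P.mb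
  J : σ.w 4 = P.J
  xb : σ.w 5 = P.xb
  yb : σ.w 6 = P.yb
  matrix : P.mb + 2 * ((P.yb - P.xb) * P.J) ≤ A
  le : P.yb + P.J + P.d ≤ A
  pos : 0 < A
  al : A ≤ σ.w 99

theorem Data.In.keeps {P : Data} {A b : ℕ} {σ τ : St} (h : P.In A σ) (hb : 7 ≤ b) (hK : Keeps b σ τ) :
    P.In A τ :=
  ⟨fun p hp => (hK.rm p (hp.trans_le h.al)).trans (h.rm p hp), (hK.w 1).trans h.d,
    (hK.w 3).trans h.mb, (hK.w 4).trans h.J, (hK.w 5).trans h.xb,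
    (hK.w 6).trans h.yb, h.matrix, h.le, h.pos,
    h.al.trans hK.al⟩

theorem IsBlock.lt {P : Data} {A e t : ℕ} (h : IsBlock P.xb P.d P.yb P.J e) (ht : t < P.d)
    (hA : P.yb + P.J + P.d ≤ A) : e + t < A := by
  rcases h with h | h <;> omega

theorem Item.Valid.getD_lt {P : Data} {it : Item} (h : it.Valid P) {i : ℕ} (hi : i < P.d) :
    it.perm.getD i 0 < P.d := by
  have hl := h.perm.length_eq
  rw [List.length_range] at hl
  rw [List.getD_eq_getElem _ _ (by omega)]
  have := h.perm.mem_iff.1 (List.getElem_mem (l := it.perm) (n := i) (by omega))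
  simpa using this

theorem Seg.getD {σ : St} {A b : ℕ} {l : List ℕ} (h : Seg σ A b l) {i : ℕ} (hi : i < l.length) :
    σ.wm (b + i) = l.getD i 0 := by
  rw [List.getD_eq_getElem _ _ hi]
  have h2 := h.2.2
  have := getElem_arr σ.wm b l.length i (by simpa using hi)
  rw [← this]
  congr 1

/-- `L` is the list of blocks of `it`, sorted by the difference of the entries `p` and `mid`. -/
structure IsSplit (P : Data) (it : Item) (mid : ℕ) (L : List ℕ) : Prop where
  perm : L.Perm it.els
  sorted : L.Pairwise fun e e' => P.v (e + it.perm.getD it.p 0) - P.v (e + it.perm.getD mid 0) ≤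
      P.v (e' + it.perm.getD it.p 0) - P.v (e' + it.perm.getD mid 0)

theorem sortStep_spec {B : ℕ} {Q : ℕ → St → Prop} (σ : St) {A : ℕ} (P : Data) (it : Item)
    (hV : it.Valid P) (hI : P.In A σ) (hl : Loaded σ A it) (hp : it.p < P.d) (hlo : it.lo < it.hi)
    (hB : σ.w 99 + 300 * (it.els.length * (it.r + 7)) + 90 * it.els.length + 20 < B)
    (hQ : ∀ t τ L, Keeps 32 σ τ → IsSplit P it ((it.lo + it.hi) / 2) L → Seg τ A (τ.w 34) L →
      τ.w 33 = (it.lo + it.hi) / 2 → τ.w 35 = τ.w 34 + L.length / 2 →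
      τ.w 99 ≤ σ.w 99 + (it.els.length * (it.r + 7)) + it.els.length →
      t ≤ 300 * (it.els.length * (it.r + 7)) + 30 * it.els.length + 100 → Q t τ) :
    wp B sortStep Q σ := by
  have hpl := hV.perm.length_eq
  rw [List.length_range] at hpl
  have h1 := hV.lo_le
  have h2 := hV.hi_le
  have s1 := hl.els.2.1
  have s2 := hl.perm.2.1
  have e1 := hl.p
  have e2 := hl.lo
  have e3 := hl.hi
  have e4 := hl.len
  have e5 := hl.perm.1
  have e6 := hI.le
  have hal := hI.al
  have hk : it.els.length ≤ it.els.length * (it.r + 7) := Nat.le_mul_of_pos_right _ (by omega)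
  have hk' : it.els.length * (it.r + 2 + 5) = it.els.length * (it.r + 7) := by ring
  have hk2 : it.els.length * (it.r + 2 + 15) = it.els.length * (it.r + 7) + 10 * it.els.length := by ring
  generalize hmid : (it.lo + it.hi) / 2 = mid at *
  have hmid1 : it.lo ≤ mid := by omega
  have hmid2 : mid < it.hi := by omega
  have w1 : σ.wm (σ.w 23 + σ.w 24) = it.perm.getD it.p 0 := by rw [e1]; exact hl.perm.getD (by omega)
  have w2 : σ.wm (σ.w 23 + mid) = it.perm.getD mid 0 := hl.perm.getD (by omega)
  have b1 := hV.getD_lt hp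
  have b2 := hV.getD_lt (i := mid) (by omega)
  generalize hq1 : it.perm.getD it.p 0 = q1 at *
  generalize hq2 : it.perm.getD mid 0 = q2 at *
  unfold sortStep
  simp only [wp_seq, wp_wset, rules, true_and, St.setW_w, Nat.reduceEqDiff, if_true, if_false, St.setW_wm]
  rw [e2, e3, hmid]
  refine ⟨by omega, by omega, by omega, by omega, ?_⟩
  rw [w1, w2]
  generalize h0 : (((((σ.setW 33 mid).setW 34 q1).setW 35 q2).setW 36 (σ.w 21)).setW 37
    (σ.w 21 + σ.w 22)).setW 32 (σ.w 99) = σ1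
  have k1 : Keeps 32 σ σ1 := by
    rw [← h0]
    exact (((((Keeps.rfl'.setW).setW).setW).setW).setW).setW
  have al1 : σ1.w 99 = σ.w 99 := by simp [← h0]
  have d1 : σ1.wm = σ.wm := by rw [← h0]; rfl
  have d2 : σ1.rm = σ.rm := by rw [← h0]; rfl
  have f34 : σ1.w 34 = q1 := by simp [← h0]
  have f35 : σ1.w 35 = q2 := by simp [← h0]
  have hI1 := hI.keeps (by omega) k1
  have harr : arr σ1.wm (σ.w 21) it.els.length = it.els := by rw [d1]; exact hl.els.2.2
  refine keySeg_spec σ1 (σ.w 21) it.els.length (by simp [← h0]) (by simp [← h0, e4]) (by omega) (by omega) ?_ ?_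
  · intro e he
    rw [harr] at he
    have hb := hV.els e he
    rw [f34, f35]
    have hle := hI.le
    have x1 := hb.lt b1 hle
    have x2 := hb.lt b2 hle
    omega
  intro t1 σ2 k2 f2 al2 ht1
  rw [harr, f34, f35, d2] at f2
  have g22 : σ2.w 22 = it.els.length := by
    rw [k2.w 22, k1.w 22, e4]
  simp only [g22]
  refine ⟨⟨by omega, by omega, by omega⟩, ?_⟩
  generalize h3 : ((σ2.setW 50 (σ2.w 32)).setW 51 it.els.length).setW 54 (it.els.length + it.els.length + 2) = σ3
  have k3 : Keeps 36 σ1 σ3 := by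
    rw [← h3]; exact ((k2.setW).setW).setW
  have al3 : σ3.w 99 = σ2.w 99 := by simp [← h3]
  have g32 : σ2.w 32 = σ.w 99 := by rw [k2.w 32, ← h0]; simp
  have g50 : σ3.w 50 = σ.w 99 := by simp [← h3, g32]
  have g51 : σ3.w 51 = it.els.length := by simp [← h3]
  have g54 : σ3.w 54 = 2 * it.els.length + 2 := by simp [← h3, two_mul]
  have c3 : σ3.cell = σ2.cell := by rw [← h3]; rfl
  have hr := hV.len
  have hr0 := Nat.one_le_two_pow (n := it.r)
  have k03 : Keeps 32 σ σ3 := k1.trans (k3.mono)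
  refine mergeSort_spec σ3 (it.r + 2) (by omega) (by omega) (by rw [g54, pow_add]; omega)
    (by rw [g51, hk2]; omega) ?_
  intro t2 σ4 err k4 base4 al4 hS hsort m4 ht2
  rw [g54, g50, g51, c3, ← al1, f2] at hS
  obtain ⟨hw, hperm⟩ := hS.perm (by simp)
  have hn4 : σ4.w 51 = it.els.length := by
    have := hperm.length_eq
    simpa using this
  rw [hn4] at hperm hsort al4
  rw [g51, hk'] at m4 ht2
  have k04 : Keeps 32 σ σ4 := k03.trans (k4.mono)
  have g22' : σ4.w 22 = it.els.length := by rw [k04.w 22, e4]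
  rw [g22']
  refine ⟨by omega, ?_⟩
  generalize h5 : (σ4.setW 34 (σ4.w 50)).setW 35 (σ4.w 50 + it.els.length / 2) = σ5
  have k5 : Keeps 32 σ σ5 := by
    rw [← h5]; exact (k04.setW).setW
  have f50 : σ5.w 34 = σ4.w 50 := by simp [← h5]
  have hmap : arr σ4.wm (σ4.w 50) it.els.length = (arr σ4.cell (σ4.w 50) it.els.length).map (fun c => (ofLex c).2) := by
    simp [arr, St.cell, Function.comp_def]
  have hLp : (arr σ4.wm (σ4.w 50) it.els.length).Perm it.els := by
    rw [hmap]
    refine (hperm.map _).trans ?_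
    simp [Function.comp_def]
  have hb50 : A ≤ σ4.w 50 := by omega
  refine hQ _ σ5 (arr σ4.wm (σ4.w 50) it.els.length) k5 ⟨hLp, ?_⟩ ?_ ?_ ?_ ?_ ?_
  · rw [hmap, List.pairwise_map]
    have hform : ∀ c ∈ arr σ4.cell (σ4.w 50) it.els.length,
        (ofLex c).1 = P.v ((ofLex c).2 + q1) - P.v ((ofLex c).2 + q2) := by
      intro c hc
      obtain ⟨e, he, rfl⟩ := List.mem_map.1 (hperm.mem_iff.1 hc)
      have hb := hV.els e he
      have hle := hI.le
      simp only [ofLex_toLex]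
      rw [hI.rm _ (hb.lt b1 hle), hI.rm _ (hb.lt b2 hle)]
    refine hsort.imp_of_mem ?_
    intro a b ha hb hab
    rw [hq1, hq2, ← hform a ha, ← hform b hb]
    exact Prod.Lex.monotone_fst_ofLex hab
  · rw [f50]
    refine ⟨hb50, ?_, ?_⟩
    · simp [← h5]; omega
    · simp [← h5]
  · rw [show σ5.w 33 = σ4.w 33 by simp [← h5], k4.w 33, k3.w 33, ← h0]; simp
  · simp [← h5]
  · simp [← h5]; omega
  · omega

theorem compareStep_spec {B : ℕ} {Q : ℕ → St → Prop} (σ : St) {A : ℕ} (P : Data) (it : Item) (l : List Item)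
    (hV : it.Valid P) (hI : P.In A σ) (hl : Loaded σ A it) (hp : it.p < P.d) (hlo : it.lo < it.hi)
    (hk : 2 ≤ it.els.length) (hst : StackAt σ A (σ.w 20) l)
    (hB : σ.w 99 + 300 * (it.els.length * (it.r + 7)) + 90 * it.els.length + 700 < B)
    (hQ : ∀ t τ L, Keeps 20 σ τ → IsSplit P it ((it.lo + it.hi) / 2) L →
      StackAt τ A (τ.w 20) (it.left P.yb L ((it.lo + it.hi) / 2) :: it.right P.yb L ((it.lo + it.hi) / 2) ::
        it.second L :: it.first L :: l) →
      τ.w 99 ≤ σ.w 99 + (it.els.length * (it.r + 7)) + 3 * it.els.length + 28 →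
      t ≤ 300 * (it.els.length * (it.r + 7)) + 90 * it.els.length + 700 → Q t τ) :
    wp B compareStep Q σ := by
  have hal := hI.al
  have hA := hI.pos
  have e1 := hl.p
  have e2 := hl.lo
  have e3 := hl.hi
  have e4 := hl.len
  have hk' : it.els.length ≤ it.els.length * (it.r + 7) := Nat.le_mul_of_pos_right _ (by omega)
  have hdle := hV.hi_le
  have hple := hV.p_le
  have hIle := hI.le
  generalize hmid : (it.lo + it.hi) / 2 = mid at *
  unfold compareStep
  rw [wp_seq]
  refine sortStep_spec σ P it hV hI hl hp hlo (by omega) ?_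
  rw [hmid]
  intro t1 σ1 L k1 hL seg1 w33 w35 m1 ht1
  have hlen := hL.perm.length_eq
  have al01 := k1.al
  have b1 : ∀ i, i < 32 → σ1.w i = σ.w i := fun i hi => k1.w i hi
  simp only [wp_seq, wp_wset, rules, true_and, St.setW_w, Nat.reduceEqDiff, if_false]
  rw [b1 22 (by omega), b1 25 (by omega), b1 26 (by omega), e4, e2, e3, ← hlen]
  refine ⟨by omega, ?_⟩
  generalize h2 : (((σ1.setW 27 (σ1.w 34)).setW 28 (L.length / 2)).setW 31 it.lo).setW 32 it.hi = σ2
  have k2 : Keeps 27 σ1 σ2 := by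
    rw [← h2]
    exact (((Keeps.rfl'.setW).setW).setW).setW
  have b2 : ∀ i, i < 27 → σ2.w i = σ.w i := fun i hi => (k2.w i hi).trans (b1 i (by omega))
  have c2 : ∀ i, i ≠ 27 → i ≠ 28 → i ≠ 31 → i ≠ 32 → σ2.w i = σ1.w i := fun i h h' h'' h3 => by
    simp [← h2, h, h', h'', h3]
  have k02 : Keeps 27 σ σ2 := (k1.mono).trans k2
  have seg2 : Seg σ2 A (σ1.w 34) L := (k2.ext A).seg seg1
  have segp : Seg σ2 A (σ2.w 23) it.perm := by rw [b2 23 (by omega)]; exact (k02.ext A).seg hl.perm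
  have al2 : σ2.w 99 = σ1.w 99 := c2 99 (by omega) (by omega) (by omega) (by omega)
  have segF : Seg σ2 A (σ1.w 34) (L.take (L.length / 2)) := by
    refine ⟨seg2.1, ?_, ?_⟩
    · have := seg2.2.1; simp; omega
    · have h := take_arr (f := σ2.wm) (b := σ1.w 34) (n := L.length) (L.length / 2)
      rw [seg2.2.2, min_eq_left (by omega)] at h
      rw [h, length_arr]
  have segG : Seg σ2 A (σ1.w 35) (L.drop (L.length / 2)) := by
    rw [w35]
    refine ⟨seg2.1.trans (by omega), ?_, ?_⟩
    · have := seg2.2.1; simp; omega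
    · have h := drop_arr (f := σ2.wm) (b := σ1.w 34) (n := L.length) (L.length / 2)
      rw [seg2.2.2] at h
      rw [h, length_arr]
  refine push_spec σ2 (it.first L) l ?_ ?_ segp ?_ ?_ ?_ ?_ hA (by omega) (by omega) ?_
  · rw [show σ2.w 27 = σ1.w 34 by simp [← h2]]; exact segF
  · simp [← h2, Item.first]; omega
  · rw [b2 24 (by omega), e1]; rfl
  · simp [← h2, Item.first]
  · simp [← h2, Item.first]
  · rw [b2 20 (by omega)]; exact (k02.ext A).stackAt hst
  intro t3 σ3 k3 st3 ht3
  have b3 : ∀ i, i ≠ 20 → i < 27 → σ3.w i = σ.w i := fun i h hi => (k3.w i h (by omega)).trans (b2 i hi)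
  have c3 : ∀ i, i ≠ 20 → i ≠ 27 → i ≠ 28 → i ≠ 31 → i ≠ 32 → i ≠ 99 → σ3.w i = σ1.w i :=
    fun i h h' h'' h3 h4 h5 => (k3.w i h h5).trans (c2 i h' h'' h3 h4)
  rw [b3 22 (by omega) (by omega), c3 35 (by omega) (by omega) (by omega) (by omega) (by omega) (by omega), e4, ← hlen]
  refine ⟨by omega, ?_⟩
  generalize h4 : (σ3.setW 27 (σ1.w 35)).setW 28 (L.length - L.length / 2) = σ4
  have k4 : Keeps 27 σ3 σ4 := by
    rw [← h4]; exact (Keeps.rfl'.setW).setW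
  have b4 : ∀ i, i ≠ 20 → i < 27 → σ4.w i = σ.w i := fun i h hi => (k4.w i hi).trans (b3 i h hi)
  have c4 : ∀ i, i ≠ 20 → i ≠ 27 → i ≠ 28 → i ≠ 31 → i ≠ 32 → i ≠ 99 → σ4.w i = σ1.w i :=
    fun i h h' h'' h3 h4' h5 => by
      rw [← c3 i h h' h'' h3 h4' h5, ← h4]; simp [h', h'']
  have al4 : σ4.w 99 = σ2.w 99 + 7 := by rw [← k3.al, ← h4]; simp
  have k24 : Keeps 20 σ2 σ4 := k3.keeps.trans (k4.mono)
  have E24 := k24.ext A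
  refine push_spec σ4 (it.second L) (it.first L :: l) ?_ ?_ ?_ ?_ ?_ ?_ ?_ hA (by omega) (by omega) ?_
  · rw [show σ4.w 27 = σ1.w 35 by simp [← h4]]; exact E24.seg segG
  · simp [← h4, Item.second]
  · rw [b4 23 (by omega) (by omega), ← b2 23 (by omega)]; exact E24.seg segp
  · rw [b4 24 (by omega) (by omega), e1]; rfl
  · rw [show σ4.w 31 = σ3.w 31 by simp [← h4], k3.w 31 (by omega) (by omega), ← h2]; simp [Item.second]
  · rw [show σ4.w 32 = σ3.w 32 by simp [← h4], k3.w 32 (by omega) (by omega), ← h2]; simp [Item.second]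
  · rw [show σ4.w 20 = σ3.w 20 by simp [← h4]]; exact (k4.ext A).stackAt st3
  intro t5 σ5 k5 st5 ht5
  have b5 : ∀ i, i ≠ 20 → i < 27 → σ5.w i = σ.w i := fun i h hi => (k5.w i h (by omega)).trans (b4 i h hi)
  have c5 : ∀ i, i ≠ 20 → i ≠ 27 → i ≠ 28 → i ≠ 31 → i ≠ 32 → i ≠ 99 → σ5.w i = σ1.w i :=
    fun i h h' h'' h3 h4 h5 => (k5.w i h h5).trans (c4 i h h' h'' h3 h4 h5)
  rw [c5 33 (by omega) (by omega) (by omega) (by omega) (by omega) (by omega), w33]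
  refine ⟨by omega, ?_⟩
  have k25 : Keeps 20 σ2 σ5 := k24.trans k5.keeps
  generalize h6 : σ5.setW 31 (mid + 1) = σ6
  have k6 : Keeps 31 σ5 σ6 := by rw [← h6]; exact Keeps.rfl'.setW
  have c6 : ∀ i, i ≠ 31 → σ6.w i = σ5.w i := fun i h => by simp [← h6, h]
  have al6 : σ6.w 99 = σ5.w 99 := c6 99 (by omega)
  have al5 := k5.al
  have k26 : Keeps 20 σ2 σ6 := k25.trans (k6.mono)
  have hwlt : ∀ (τ : St) (σ' : St), σ'.w 6 = P.yb → τ.w 6 = σ'.w 6 →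
      (Cond.eval τ (.wlt (.reg 38) (.reg 6)) ↔ isX P.yb (τ.w 38) = true) := by
    intro τ σ' h h'
    simp [h', h]
  have hwge : ∀ (τ : St) (σ' : St), σ'.w 6 = P.yb → τ.w 6 = σ'.w 6 →
      (Cond.eval τ (.not (.wlt (.reg 38) (.reg 6))) ↔ isY P.yb (τ.w 38) = true) := by
    intro τ σ' h h'
    simp [h', h]
  have y6 : σ6.w 6 = P.yb := by rw [c6 6 (by omega), b5 6 (by omega) (by omega), hI.yb]
  have p6 : σ6.w 34 = σ1.w 34 := by
    rw [c6 34 (by omega), c5 34 (by omega) (by omega) (by omega) (by omega) (by omega) (by omega)]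
  refine crossPush_spec (isX P.yb) (isY P.yb) σ6 (it.right P.yb L mid) (it.second L :: it.first L :: l) L
    (fun τ => hwlt τ σ6 y6) (by simp) (by simp) (fun τ => hwge τ σ6 y6) (by simp) (by simp) ?_ ?_ ?_ rfl
    ?_ ?_ ?_ ?_ ?_ hA (by omega) (by omega) ?_
  · rw [p6]; exact (k26.ext A).seg seg2
  · rw [c6 22 (by omega), b5 22 (by omega) (by omega), e4, hlen]
  · rw [p6, c6 35 (by omega), c5 35 (by omega) (by omega) (by omega) (by omega) (by omega) (by omega), w35]
  · rw [c6 23 (by omega), b5 23 (by omega) (by omega), ← b2 23 (by omega)]; exact (k26.ext A).seg segp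
  · rw [c6 24 (by omega), b5 24 (by omega) (by omega), e1]; rfl
  · simp [← h6, Item.right]
  · rw [c6 32 (by omega), k5.w 32 (by omega) (by omega), show σ4.w 32 = σ3.w 32 by simp [← h4],
      k3.w 32 (by omega) (by omega), ← h2]; simp [Item.right]
  · rw [c6 20 (by omega)]; exact (k6.ext A).stackAt st5
  intro t7 σ7 k7 b7 m7 st7 ht7
  have d7 : ∀ i, i ≠ 20 → i ≠ 27 → i ≠ 28 → i ≠ 31 → i < 36 → σ7.w i = σ5.w i := fun i h h' h'' h3 h4 =>
    (b7 i h h' h'' h4).trans (c6 i h3)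
  rw [d7 25 (by omega) (by omega) (by omega) (by omega) (by omega), b5 25 (by omega) (by omega), e2,
    d7 33 (by omega) (by omega) (by omega) (by omega) (by omega),
    c5 33 (by omega) (by omega) (by omega) (by omega) (by omega) (by omega), w33]
  generalize h8 : (σ7.setW 31 it.lo).setW 32 mid = σ8
  have k8 : Keeps 31 σ7 σ8 := by
    rw [← h8]; exact (Keeps.rfl'.setW).setW
  have c8 : ∀ i, i ≠ 31 → i ≠ 32 → σ8.w i = σ7.w i := fun i h h' => by simp [← h8, h, h']
  have d8 : ∀ i, i ≠ 20 → i ≠ 27 → i ≠ 28 → i ≠ 31 → i ≠ 32 → i < 36 → σ8.w i = σ5.w i :=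
    fun i h h' h'' h3 h4 h5 => (c8 i h3 h4).trans (d7 i h h' h'' h3 h5)
  have al8 : σ8.w 99 = σ7.w 99 := c8 99 (by omega) (by omega)
  have k28 : Keeps 20 σ2 σ8 := k26.trans (k7.trans (k8.mono))
  have al28 := k28.al
  have y8 : σ8.w 6 = P.yb := by
    rw [d8 6 (by omega) (by omega) (by omega) (by omega) (by omega) (by omega), b5 6 (by omega) (by omega), hI.yb]
  have p8 : σ8.w 34 = σ1.w 34 := by
    rw [d8 34 (by omega) (by omega) (by omega) (by omega) (by omega) (by omega),
      c5 34 (by omega) (by omega) (by omega) (by omega) (by omega) (by omega)]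
  refine crossPush_spec (isY P.yb) (isX P.yb) σ8 (it.left P.yb L mid) (it.right P.yb L mid :: it.second L :: it.first L :: l) L
    (fun τ => hwge τ σ8 y8) (by simp) (by simp) (fun τ => hwlt τ σ8 y8) (by simp) (by simp) ?_ ?_ ?_ rfl
    ?_ ?_ ?_ ?_ ?_ hA (by omega) (by omega) ?_
  · rw [p8]; exact (k28.ext A).seg seg2
  · rw [d8 22 (by omega) (by omega) (by omega) (by omega) (by omega) (by omega), b5 22 (by omega) (by omega), e4, hlen]
  · rw [p8, d8 35 (by omega) (by omega) (by omega) (by omega) (by omega) (by omega),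
      c5 35 (by omega) (by omega) (by omega) (by omega) (by omega) (by omega), w35]
  · rw [d8 23 (by omega) (by omega) (by omega) (by omega) (by omega) (by omega), b5 23 (by omega) (by omega),
      ← b2 23 (by omega)]; exact (k28.ext A).seg segp
  · rw [d8 24 (by omega) (by omega) (by omega) (by omega) (by omega) (by omega), b5 24 (by omega) (by omega), e1]; rfl
  · simp [← h8, Item.left]
  · simp [← h8, Item.left]
  · rw [c8 20 (by omega) (by omega)]; exact (k8.ext A).stackAt st7
  intro t9 τ k9 _ m9 st9 ht9
  refine hQ _ τ L ((k02.mono).trans (k28.trans k9)) hL st9 ?_ ?_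
  · omega
  · omega

end RealRAM

namespace RealRAM

/-- Insert the next entry of the permutation into the sorted prefix. -/
def insertStep : Stmt :=
  .wset 27 (.reg 99) ;;
  .wset 36 (.reg 23) ;; .wset 37 (.reg 23 + .reg 25) ;;
  copySeg ;;
  .wput (.reg 99) (.mem (.reg 23 + .reg 24)) ;; .wset 99 (.reg 99 + 1) ;;
  .wset 36 (.reg 23 + .reg 25) ;; .wset 37 (.reg 23 + .reg 24) ;;
  copySeg ;;
  .wset 36 (.reg 23 + .reg 24 + 1) ;; .wset 37 (.reg 23 + .reg 1) ;;
  copySeg ;;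
  .wset 23 (.reg 27) ;; .wset 27 (.reg 21) ;; .wset 28 (.reg 22) ;;
  .wset 24 (.reg 24 + 1) ;; .wset 31 0 ;; .wset 32 (.reg 24) ;;
  push

theorem insertStep_spec {B : ℕ} {Q : ℕ → St → Prop} (σ : St) {A : ℕ} (P : Data) (it : Item) (l : List Item)
    (hV : it.Valid P) (hI : P.In A σ) (hl : Loaded σ A it) (hp : it.p < P.d) (hlo : it.hi ≤ it.lo)
    (hst : StackAt σ A (σ.w 20) l) (hB : σ.w 99 + P.d + 20 < B)
    (hQ : ∀ t τ, Keeps 20 σ τ → StackAt τ A (τ.w 20) (it.insert :: l) → τ.w 99 ≤ σ.w 99 + P.d + 7 →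
      t ≤ 30 * P.d + 200 → Q t τ) :
    wp B insertStep Q σ := by
  have hal := hI.al
  have hA := hI.pos
  have e1 := hl.p
  have e2 := hl.lo
  have e3 := hl.hi
  have e4 := hl.len
  have e5 := hI.d
  have hdle := hV.hi_le
  have hlole := hV.lo_le
  have hpl := hV.perm.length_eq
  rw [List.length_range] at hpl
  have hs := hl.perm.2.1
  have harr := hl.perm.2.2
  rw [hpl] at hs harr
  unfold insertStep
  simp only [wp_seq, wp_wset, wp_wput, rules, true_and, St.setW_w, Nat.reduceEqDiff, if_true, if_false, St.putW_w]
  rw [e2]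
  refine ⟨by omega, ?_⟩
  generalize h1 : ((σ.setW 27 (σ.w 99)).setW 36 (σ.w 23)).setW 37 (σ.w 23 + it.lo) = σ1
  have k1 : Keeps 27 σ σ1 := by
    rw [← h1]
    exact ((Keeps.rfl'.setW).setW).setW
  have al1 : σ1.w 99 = σ.w 99 := by simp [← h1]
  have d1 : σ1.wm = σ.wm := by rw [← h1]; rfl
  have b1 : σ1.w 27 = σ.w 99 := by simp [← h1]
  refine copySeg_spec σ1 (σ.w 23) it.lo (by simp [← h1]) (by simp [← h1]) (by omega) (by omega) ?_
  intro t1 σ2 k2 f2 al2 _ ht1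
  rw [d1, al1] at f2
  have k02 : Keeps 27 σ σ2 := k1.trans (k2.mono)
  have b2 := (k2.w 27).trans b1
  have w23 := k02.w 23
  have w24 := k02.w 24
  have w25 := k02.w 25
  rw [w23, w24, w25, e1, e2]
  refine ⟨by omega, by omega, by omega, by omega, ?_⟩
  rw [k02.wm _ (by omega)]
  generalize h3 : (((σ2.putW (σ2.w 99) (σ.wm (σ.w 23 + it.p))).setW 99 (σ2.w 99 + 1)).setW 36
    (σ.w 23 + it.lo)).setW 37 (σ.w 23 + it.p) = σ3
  have k3 : Keeps 36 σ2 σ3 := by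
    rw [← h3]
    exact (((Keeps.rfl'.putW le_rfl).setAl (by omega)).setW).setW
  have al3 : σ3.w 99 = σ2.w 99 + 1 := by simp [← h3]
  have f3 : σ3.wm (σ2.w 99) = σ.wm (σ.w 23 + it.p) := by simp [← h3]
  have k03 : Keeps 27 σ σ3 := k02.trans (k3.mono)
  refine copySeg_spec σ3 (σ.w 23 + it.lo) (it.p - it.lo) (by simp [← h3]) (by simp [← h3]; omega) (by omega) (by omega) ?_
  intro t2 σ4 k4 f4 al4 _ ht2
  rw [k03.arr_wm (by omega)] at f4
  have k04 : Keeps 27 σ σ4 := k03.trans (k4.mono)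
  have w23 := k04.w 23
  have w24 := k04.w 24
  have w01 := k04.w 1
  rw [w23, w24, w01, e1, e5]
  refine ⟨by omega, by omega, ?_⟩
  generalize h5 : (σ4.setW 36 (σ.w 23 + it.p + 1)).setW 37 (σ.w 23 + P.d) = σ5
  have k5 : Keeps 36 σ4 σ5 := by
    rw [← h5]
    exact (Keeps.rfl'.setW).setW
  have al5 : σ5.w 99 = σ4.w 99 := by simp [← h5]
  have k05 : Keeps 27 σ σ5 := k04.trans (k5.mono)
  refine copySeg_spec σ5 (σ.w 23 + it.p + 1) (P.d - (it.p + 1)) (by simp [← h5]) (by simp [← h5]; omega) (by omega) (by omega) ?_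
  intro t3 σ6 k6 f6 al6 _ ht3
  rw [k05.arr_wm (by omega)] at f6
  have k06 : Keeps 27 σ σ6 := k05.trans (k6.mono)
  have k36 : Keeps 36 σ3 σ6 := k4.trans (k5.trans k6)
  have b6 : σ6.w 27 = σ.w 99 := ((k3.trans k36).w 27 (by omega)).trans b2
  have w21 := k06.w 21
  have w22 := k06.w 22
  have w24 := k06.w 24
  have w20 := k06.w 20
  rw [w21, w22, w24, b6, e1, e4]
  refine ⟨by omega, by omega, ?_⟩
  generalize h7 : (((((σ6.setW 23 (σ.w 99)).setW 27 (σ.w 21)).setW 28 it.els.length).setW 24 (it.p + 1)).setW 31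
    0).setW 32 (it.p + 1) = σ7
  have k7 : Keeps 21 σ6 σ7 := by
    rw [← h7]
    exact (((((Keeps.rfl'.setW).setW).setW).setW).setW).setW
  have k07 : Keeps 21 σ σ7 := (k06.mono).trans k7
  have al7 : σ7.w 99 = σ6.w 99 := by simp [← h7]
  have d7 : σ7.wm = σ6.wm := by rw [← h7]; rfl
  have hlen : it.insert.perm.length = P.d := by
    simp only [Item.insert]
    rw [(rotate_perm (by omega) (by omega)).length_eq, hpl]
  refine push_spec σ7 it.insert l ?_ ?_ ?_ ?_ ?_ ?_ ?_ hA (by omega) (by omega) ?_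
  · rw [show σ7.w 27 = σ.w 21 by simp [← h7]]; exact (k07.ext A).seg hl.els
  · simp [← h7, Item.insert]
  · rw [show σ7.w 23 = σ.w 99 by simp [← h7]]
    refine ⟨hal, by omega, ?_⟩
    have hd : P.d = it.lo + (1 + ((it.p - it.lo) + (P.d - (it.p + 1)))) := by omega
    rw [hlen]
    conv_lhs => rw [hd]
    rw [arr_add, arr_add, arr_add, d7]
    simp only [Item.insert, rotate]
    have t1 : it.perm.take it.lo = arr σ.wm (σ.w 23) it.lo := by
      rw [← harr, take_arr, min_eq_left (by omega)]
    have t2 : it.perm[it.p]?.toList = [σ.wm (σ.w 23 + it.p)] := by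
      rw [List.getElem?_eq_getElem (by omega), Option.toList_some,
        hl.perm.getD (by omega), List.getD_eq_getElem _ _ (by omega)]
    have t3 : (it.perm.take it.p).drop it.lo = arr σ.wm (σ.w 23 + it.lo) (it.p - it.lo) := by
      rw [← harr, take_arr, min_eq_left (by omega), drop_arr]
    have t4 : it.perm.drop (it.p + 1) = arr σ.wm (σ.w 23 + it.p + 1) (P.d - (it.p + 1)) := by
      rw [← harr, drop_arr, add_assoc]
    rw [t1, t2, t3, t4]
    congr 1
    · rw [← f2, (k3.trans k36).arr_wm (by omega)]
    congr 1
    · rw [arr_succ_left, arr_zero, ← f3, k36.wm _ (by omega)]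
      congr 2; omega
    congr 1
    · rw [← f4, ← (k5.trans k6).arr_wm (by omega)]
      congr 1; omega
    · rw [← f6]
      congr 1; omega
  · simp [← h7, Item.insert]
  · simp [← h7, Item.insert]
  · simp [← h7, Item.insert]
  · rw [show σ7.w 20 = σ.w 20 by simp [← h7, w20]]; exact (k07.ext A).stackAt hst
  intro t4 τ k8 st8 ht4
  have al8 := k8.al
  have s1 : it.p - it.lo + it.lo = it.p := Nat.sub_add_cancel (by omega)
  have s2 : P.d - (it.p + 1) + (it.p + 1) = P.d := Nat.sub_add_cancel hp
  generalize it.p - it.lo = u at s1 al4 ht2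
  generalize P.d - (it.p + 1) = v at s2 al6 ht3
  clear h1 h3 h5 h7 f2 f4 f6 hI hV harr hs hdle hlole hlo hpl e1 e2 e3 e4 e5 hp
  refine hQ _ τ ((k07.mono).trans k8.keeps) st8 ?_ ?_
  · clear ht1 ht2 ht3 ht4
    rw [al8, al7, al6, al5, al4, al3, al2, al1]
    omega
  · linarith

end RealRAM

namespace RealRAM

/-- The matrix cell for the blocks `x` and `y` consists of two words. -/
def Data.slot (P : Data) (x y : ℕ) : ℕ := P.mb + 2 * ((x - P.xb) * P.J + (y - P.yb))

/-- `x` and `y` are blocks of the first and of the second kind. -/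
def Data.IsPair (P : Data) (x y : ℕ) : Prop := (P.xb ≤ x ∧ x + P.d ≤ P.yb) ∧ (P.yb ≤ y ∧ y < P.yb + P.J)

theorem Data.slot_lt {P : Data} {x y : ℕ} (h : P.IsPair x y) (hd : 0 < P.d) :
    P.slot x y + 2 ≤ P.mb + 2 * ((P.yb - P.xb) * P.J) := by
  obtain ⟨⟨h1, h2⟩, h3, h4⟩ := h
  have h5 : (x - P.xb + 1) * P.J ≤ (P.yb - P.xb) * P.J := Nat.mul_le_mul_right _ (by omega)
  rw [Nat.add_mul] at h5
  unfold Data.slot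
  omega

theorem Data.slot_inj {P : Data} {x y x' y' : ℕ} (h : P.IsPair x y) (h' : P.IsPair x' y')
    (he : P.slot x y = P.slot x' y') : x = x' ∧ y = y' := by
  obtain ⟨⟨h1, h2⟩, h3, h4⟩ := h
  obtain ⟨⟨h1', h2'⟩, h3', h4'⟩ := h'
  unfold Data.slot at he
  have he2 : (y - P.yb) + P.J * (x - P.xb) = (y' - P.yb) + P.J * (x' - P.xb) := by
    rw [mul_comm P.J, mul_comm P.J]; omega
  have hJ : 0 < P.J := by omega
  have q := congrArg (· / P.J) he2
  have r := congrArg (· % P.J) he2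
  simp only [Nat.add_mul_div_left _ _ hJ, Nat.add_mul_mod_self_left] at q r
  rw [Nat.div_eq_of_lt (by omega), Nat.div_eq_of_lt (by omega)] at q
  rw [Nat.mod_eq_of_lt (by omega), Nat.mod_eq_of_lt (by omega)] at r
  omega

/-- A record of the block `e` is stored at `q`. -/
def RecAt (P : Data) (π : List ℕ) (e : ℕ) (σ : St) (q : ℕ) : Prop :=
  IsRecord P.v π e σ q ∧ q + π.length < σ.w 99

/-- The matrix cell for `x` and `y` points to records of both blocks for a permutation that sorts
their difference. -/
def Good (P : Data) (σ : St) (x y : ℕ) : Prop :=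
  ∃ π : List ℕ, π.Perm (List.range P.d) ∧ π.Pairwise (fun s t => P.z x y s ≤ P.z x y t) ∧
    RecAt P π x σ (σ.wm (P.slot x y)) ∧ RecAt P π y σ (σ.wm (P.slot x y + 1))

/-- The real memory below the allocation pointer is kept. -/
def RKeep (σ τ : St) : Prop := σ.w 99 ≤ τ.w 99 ∧ ∀ p < σ.w 99, τ.rm p = σ.rm p

theorem RKeep.trans {σ τ υ : St} (h : RKeep σ τ) (h' : RKeep τ υ) : RKeep σ υ :=
  ⟨h.1.trans h'.1, fun p hp => (h'.2 p (hp.trans_le h.1)).trans (h.2 p hp)⟩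

theorem Keeps.rkeep {b : ℕ} {σ τ : St} (h : Keeps b σ τ) : RKeep σ τ := ⟨h.al, h.rm⟩

theorem RKeep.recAt {P : Data} {π : List ℕ} {e q : ℕ} {σ τ : St} (h : RKeep σ τ) (hr : RecAt P π e σ q) :
    RecAt P π e τ q :=
  ⟨fun u hu => (h.2 _ (by have := hr.2; omega)).trans (hr.1 u hu), hr.2.trans_le h.1⟩

theorem RKeep.good {P : Data} {x y : ℕ} {σ τ : St} (h : RKeep σ τ)
    (h1 : τ.wm (P.slot x y) = σ.wm (P.slot x y)) (h2 : τ.wm (P.slot x y + 1) = σ.wm (P.slot x y + 1))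
    (hg : Good P σ x y) : Good P τ x y := by
  obtain ⟨π, hp, hs, hx, hy⟩ := hg
  exact ⟨π, hp, hs, by rw [h1]; exact h.recAt hx, by rw [h2]; exact h.recAt hy⟩

theorem Good.put {P : Data} {x y x' y' q q' : ℕ} {σ τ : St} {π : List ℕ} (h : P.IsPair x y)
    (h' : P.IsPair x' y') (hτ : RKeep σ τ) (hq : τ.wm (P.slot x y) = q) (hq' : τ.wm (P.slot x y + 1) = q')
    (ho : ∀ p, p ≠ P.slot x y → p ≠ P.slot x y + 1 → τ.wm p = σ.wm p)
    (hp : π.Perm (List.range P.d)) (hs : π.Pairwise (fun s t => P.z x y s ≤ P.z x y t))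
    (hx : RecAt P π x σ q) (hy : RecAt P π y σ q') (hg : Good P σ x' y' ∨ (x' = x ∧ y' = y)) :
    Good P τ x' y' := by
  by_cases he : x' = x ∧ y' = y
  · obtain ⟨rfl, rfl⟩ := he
    exact ⟨π, hp, hs, by rw [hq]; exact hτ.recAt hx, by rw [hq']; exact hτ.recAt hy⟩
  · have hne : P.slot x' y' ≠ P.slot x y := fun e => he (Data.slot_inj h' h e)
    have hg := hg.resolve_right he
    have : P.slot x' y' ≠ P.slot x y + 1 ∧ P.slot x' y' + 1 ≠ P.slot x y := by
      unfold Data.slot; omega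
    exact hτ.good (ho _ hne this.1) (ho _ this.2 (by omega)) hg

/-- Append records for the blocks between `w31` and `w29`. -/
def recordSeg : Stmt :=
  .loop (.wlt (.reg 31) (.reg 29))
    (.wset 38 (.mem (.reg 31)) ;; record ;; .wset 31 (.reg 31 + 1))

theorem recordSeg_spec {B : ℕ} {Q : ℕ → St → Prop} (σ : St) {A : ℕ} (P : Data) (E π : List ℕ)
    (hI : P.In A σ) (hE : Seg σ A (σ.w 31) E) (h29 : σ.w 29 = σ.w 31 + E.length) (hp : Seg σ A (σ.w 23) π)
    (hperm : π.Perm (List.range P.d)) (hb : ∀ e ∈ E, IsBlock P.xb P.d P.yb P.J e)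
    (hB : σ.w 99 + E.length * (P.d + 1) + P.d + 2 < B)
    (hQ : ∀ t τ, Keeps 31 σ τ →
      (∀ i (h : i < E.length), τ.wm (σ.w 99 + i * (P.d + 1)) = E[i] ∧ RecAt P π E[i] τ (σ.w 99 + i * (P.d + 1))) →
      τ.w 99 = σ.w 99 + E.length * (P.d + 1) → t ≤ 60 * (E.length * (P.d + 1)) + 5 → Q t τ) :
    wp B recordSeg Q σ := by
  have hlen := hperm.length_eq
  rw [List.length_range] at hlen
  have hd := hI.d
  have hp1 := hp.2.1
  have hp2 := hp.2.2
  have hE1 := hE.2.1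
  have hle := hI.le
  unfold recordSeg
  refine wp_loop (fun (n : ℕ) τ => Keeps 31 σ τ ∧ n ≤ E.length ∧ τ.w 31 = σ.w 31 + n ∧
      (∀ i (h : i < E.length), i < n → τ.wm (σ.w 99 + i * (P.d + 1)) = E[i] ∧
        RecAt P π E[i] τ (σ.w 99 + i * (P.d + 1))) ∧
      τ.w 99 = σ.w 99 + n * (P.d + 1))
    (fun n => 60 * ((E.length - n) * (P.d + 1))) ?_ ?_ 0 ?_ ?_
  · intros; simp
  · rintro n τ ⟨hK, hn, h31, hrec, hal⟩ hlt
    simp only [rules] at hlt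
    rw [h31, hK.w 29] at hlt
    have hn' : n < E.length := by omega
    have hmul : (n + 1) * (P.d + 1) ≤ E.length * (P.d + 1) := Nat.mul_le_mul_right _ hn'
    have hmul2 : (E.length - n) * (P.d + 1) = (E.length - (n + 1)) * (P.d + 1) + (P.d + 1) := by
      rw [← Nat.succ_mul]; congr 1; omega
    rw [Nat.add_mul, one_mul] at hmul
    have hwm : τ.wm (σ.w 31 + n) = E[n] := by
      rw [hK.wm _ (by omega), hE.getD hn', List.getD_eq_getElem _ _ hn']
    have hbn := hb E[n] (List.getElem_mem hn')
    have h23 := hK.w 23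
    have h1 := hK.w 1
    have hAl := hI.al
    generalize hQ' : (fun (k : ℕ) (τ' : St) => ∃ a', _ ∧ _) = Q'
    simp only [wp_seq, wp_wset, rules, true_and]
    rw [h31, hwm]
    generalize hυ : τ.setW 38 E[n] = υ
    have kυ : Keeps 31 τ υ := by rw [← hυ]; exact Keeps.rfl'.setW
    have υw : ∀ i, i ≠ 38 → υ.w i = τ.w i := fun i hi => by simp [← hυ, hi]
    have hIυ := hI.keeps (by omega) (hK.trans kυ)
    have a23 : arr υ.wm (υ.w 23) (υ.w 1) = π := by
      rw [υw 23 (by omega), υw 1 (by omega), h23, h1, hd, (hK.trans kυ).arr_wm (by omega), ← hlen, hp2]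
    have e99 := υw 99 (by omega)
    have e23 := υw 23 (by omega)
    have e1 := υw 1 (by omega)
    refine record_spec υ P.v hIυ.al hIυ.rm (by omega) (by omega) ?_ ?_
    · intro t ht
      rw [a23, hperm.mem_iff, List.mem_range] at ht
      rw [show υ.w 38 = E[n] by simp [← hυ]]
      exact hbn.lt ht hle
    intro t1 ω k1 hw hr al1 hother ht1
    rw [a23, show υ.w 38 = E[n] by simp [← hυ], e99, hal] at hr
    rw [show υ.w 38 = E[n] by simp [← hυ], e99, hal] at hw
    rw [e1, h1, hd, e99, hal] at al1
    have w31 : ω.w 31 = σ.w 31 + n := by rw [k1.w 31, υw 31 (by omega), h31]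
    rw [w31]
    refine ⟨by omega, ?_⟩
    rw [← hQ']
    have hKω : Keeps 31 τ ω := kυ.trans (k1.mono)
    refine ⟨n + 1, ⟨(hK.trans hKω).setW, hn', by simp; omega, ?_, ?_⟩, ?_⟩
    · intro i hi hin
      rcases Nat.lt_or_ge i n with h | h
      · obtain ⟨g1, g2⟩ := hrec i hi h
        have : (i + 1) * (P.d + 1) ≤ n * (P.d + 1) := Nat.mul_le_mul_right _ h
        rw [Nat.add_mul, one_mul] at this
        exact ⟨(hKω.wm _ (by omega)).trans g1, hKω.rkeep.recAt g2⟩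
      · obtain rfl : i = n := by omega
        refine ⟨hw, hr, ?_⟩
        simp [hlen, al1]
    · simp [al1]; ring
    · simp only [rules]
      omega
  · exact ⟨.rfl', by omega, by omega, by omega, by simp⟩
  · rintro n k τ ⟨hK, hn, h31, hrec, hal⟩ hlt ht
    simp only [rules] at hlt ht
    rw [h31, hK.w 29] at hlt
    obtain rfl : n = E.length := by omega
    refine hQ _ τ hK (fun i h => hrec i h h) hal ?_
    simp only [Nat.sub_zero] at ht
    omega

end RealRAM

namespace RealRAM

/-- Write the matrix cells for the record `w31` and the records between `w30` and `w33`. -/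
def cellRow : Stmt :=
  .loop (.wlt (.reg 30) (.reg 33))
    (.wset 35 (.reg 34 + 2 * (.mem (.reg 30) - .reg 6)) ;;
    .wput (.reg 35) (.reg 31) ;;
    .wput (.reg 35 + 1) (.reg 30) ;;
    .wset 30 (.reg 30 + .reg 1 + 1))

/-- Only auxiliary registers and the word memory below `A` may change. -/
structure Wrote (A : ℕ) (σ τ : St) : Prop where
  w : ∀ i, i ≠ 30 → i ≠ 31 → i ≠ 34 → i ≠ 35 → τ.w i = σ.w i
  r : τ.r = σ.r
  rm : τ.rm = σ.rm
  wm : ∀ p, A ≤ p → τ.wm p = σ.wm p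

theorem Wrote.trans {A : ℕ} {σ τ υ : St} (h : Wrote A σ τ) (h' : Wrote A τ υ) : Wrote A σ υ :=
  ⟨fun i h1 h2 h3 h4 => (h'.w i h1 h2 h3 h4).trans (h.w i h1 h2 h3 h4), h'.r.trans h.r, h'.rm.trans h.rm,
    fun p hp => (h'.wm p hp).trans (h.wm p hp)⟩

theorem Wrote.setW {A i v : ℕ} {σ τ : St} (h : Wrote A σ τ) (hi : i = 30 ∨ i = 31 ∨ i = 34 ∨ i = 35) :
    Wrote A σ (τ.setW i v) :=
  ⟨fun j h1 h2 h3 h4 => by rw [← h.w j h1 h2 h3 h4]; simp; omega, h.r, h.rm, h.wm⟩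

theorem Wrote.putW {A p v : ℕ} {σ τ : St} (h : Wrote A σ τ) (hp : p < A) : Wrote A σ (τ.putW p v) :=
  ⟨h.w, h.r, h.rm, fun q hq => by rw [← h.wm q hq]; simp; omega⟩

theorem Wrote.refl (A : ℕ) (σ : St) : Wrote A σ σ := ⟨fun _ _ _ _ _ => rfl, rfl, rfl, fun _ _ => rfl⟩

theorem Wrote.rkeep {A : ℕ} {σ τ : St} (h : Wrote A σ τ) : RKeep σ τ :=
  ⟨(h.w 99 (by omega) (by omega) (by omega) (by omega)).ge, fun p _ => by rw [h.rm]⟩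

theorem Wrote.ext {A : ℕ} {σ τ : St} (h : Wrote A σ τ) : Ext A σ τ :=
  ⟨(h.w 99 (by omega) (by omega) (by omega) (by omega)).ge, fun p hp _ => h.wm p hp⟩

/-- The records of the blocks `E` start at `a`. -/
def RecsAt (P : Data) (A : ℕ) (π E : List ℕ) (σ : St) (a : ℕ) : Prop :=
  A ≤ a ∧ ∀ i (h : i < E.length), σ.wm (a + i * (P.d + 1)) = E[i] ∧ RecAt P π E[i] σ (a + i * (P.d + 1))

theorem RecsAt.wrote {P : Data} {A a : ℕ} {π E : List ℕ} {σ τ : St} (h : RecsAt P A π E σ a)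
    (hW : Wrote A σ τ) : RecsAt P A π E τ a :=
  ⟨h.1, fun i hi => ⟨(hW.wm _ (h.1.trans (Nat.le_add_right _ _))).trans (h.2 i hi).1,
    hW.rkeep.recAt (h.2 i hi).2⟩⟩

/-- All pairs that were good remain good. -/
def GoodMono (P : Data) (σ τ : St) : Prop := ∀ x y, P.IsPair x y → Good P σ x y → Good P τ x y

theorem cellRow_spec {B : ℕ} {Q : ℕ → St → Prop} (σ : St) {A : ℕ} (P : Data) (ys π : List ℕ) (x a1 : ℕ)
    (hI : P.In A σ) (hd : 0 < P.d) (hπ : π.Perm (List.range P.d)) (hx : RecAt P π x σ (σ.w 31))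
    (hys : RecsAt P A π ys σ a1)
    (h30 : σ.w 30 = a1) (h33 : σ.w 33 = a1 + ys.length * (P.d + 1)) (h34 : σ.w 34 = P.mb + 2 * ((x - P.xb) * P.J))
    (hpair : ∀ y ∈ ys, P.IsPair x y) (hsort : ∀ y ∈ ys, π.Pairwise (fun s t => P.z x y s ≤ P.z x y t))
    (hB : A + 3 < B) (hB' : a1 + ys.length * (P.d + 1) < B)
    (hQ : ∀ t τ, Wrote A σ τ → τ.w 31 = σ.w 31 → GoodMono P σ τ → (∀ y ∈ ys, Good P τ x y) →
      t ≤ 60 * ys.length + 5 → Q t τ) :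
    wp B cellRow Q σ := by
  unfold cellRow
  refine wp_loop (fun (n : ℕ) τ => Wrote A σ τ ∧ n ≤ ys.length ∧ τ.w 31 = σ.w 31 ∧ τ.w 34 = σ.w 34 ∧
      τ.w 30 = a1 + n * (P.d + 1) ∧ GoodMono P σ τ ∧ ∀ i (h : i < ys.length), i < n → Good P τ x ys[i])
    (fun n => 60 * (ys.length - n)) ?_ ?_ 0 ?_ ?_
  · intros; simp
  · rintro n τ ⟨hW, hn, h31', h34', h30', hG, hgood⟩ hlt
    simp only [rules] at hlt
    rw [h30', hW.w 33 (by omega) (by omega) (by omega) (by omega), h33] at hlt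
    have hn' : n < ys.length := Nat.lt_of_mul_lt_mul_right (by omega : n * (P.d + 1) < ys.length * (P.d + 1))
    have hmul : (n + 1) * (P.d + 1) ≤ ys.length * (P.d + 1) := Nat.mul_le_mul_right _ hn'
    rw [Nat.add_mul, one_mul] at hmul
    have hp := hpair _ (List.getElem_mem hn')
    have hslot := Data.slot_lt hp hd
    have hs := hsort _ (List.getElem_mem hn')
    have hmat := hI.matrix
    obtain ⟨r1, r2⟩ := (hys.wrote hW).2 n hn'
    have h1 : τ.w 1 = P.d := (hW.w 1 (by omega) (by omega) (by omega) (by omega)).trans hI.d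
    have h6 : τ.w 6 = P.yb := (hW.w 6 (by omega) (by omega) (by omega) (by omega)).trans hI.yb
    generalize hy : ys[n] = y at *
    have hse : P.slot x y = P.mb + 2 * ((x - P.xb) * P.J) + 2 * (y - P.yb) := by unfold Data.slot; ring
    generalize hQ' : (fun (k : ℕ) (τ' : St) => ∃ a', _ ∧ _) = Q'
    simp
    rw [h30', r1, h6, h34', h34, ← hse, h1, h31']
    refine ⟨by omega, by omega, by omega, ?_⟩
    rw [← hQ']
    generalize hυ : (((τ.setW 35 (P.slot x y)).putW (P.slot x y) (σ.w 31)).putW (P.slot x y + 1)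
      (a1 + n * (P.d + 1))).setW 30 (a1 + n * (P.d + 1) + P.d + 1) = υ
    have hWτ : Wrote A τ υ := by
      rw [← hυ]
      exact ((((Wrote.refl A τ).setW (by omega)).putW (by omega)).putW (by omega)).setW (by omega)
    have hput : ∀ x' y', P.IsPair x' y' → Good P τ x' y' ∨ (x' = x ∧ y' = y) → Good P υ x' y' := by
      intro x' y' h' hg
      refine Good.put hp h' hWτ.rkeep (q := σ.w 31) (q' := a1 + n * (P.d + 1)) ?_ ?_ ?_ hπ hs
        (hW.rkeep.recAt hx) r2 hg
      · simp [← hυ]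
      · simp [← hυ]
      · intro p hp1 hp2
        simp [← hυ, hp1, hp2]
    refine ⟨n + 1, ⟨hW.trans hWτ, hn', by simp [← hυ, h31'], by simp [← hυ, h34'], ?_, ?_, ?_⟩, ?_⟩
    · simp [← hυ]; ring
    · exact fun x' y' h' hg => hput x' y' h' (Or.inl (hG x' y' h' hg))
    · intro i hi hin
      rcases Nat.lt_or_ge i n with h | h
      · exact hput _ _ (hpair _ (List.getElem_mem hi)) (Or.inl (hgood i hi h))
      · obtain rfl : i = n := by omega
        exact hput _ _ (hpair _ (List.getElem_mem hi)) (Or.inr ⟨rfl, hy⟩)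
    · simp only [rules]; omega
  · exact ⟨.refl A σ, by omega, rfl, rfl, by omega, fun _ _ _ h => h, fun i _ h => absurd h (by omega)⟩
  · rintro n k τ ⟨hW, hn, h31', h34', h30', hG, hgood⟩ hlt ht
    simp only [rules] at hlt ht
    rw [h30', hW.w 33 (by omega) (by omega) (by omega) (by omega), h33] at hlt
    have hn' : n = ys.length := by
      refine le_antisymm hn (not_lt.1 fun h => hlt ?_)
      have := Nat.mul_lt_mul_of_pos_right h (show 0 < P.d + 1 by omega)
      omega
    subst hn'
    refine hQ _ τ hW h31' hG (fun y hy => ?_) (by omega)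
    obtain ⟨i, hi, rfl⟩ := List.getElem_of_mem hy
    exact hgood i hi hi

/-- Write the matrix cells for the records between `w29` and `w32` and those between `w32` and `w33`. -/
def cellSeg : Stmt :=
  .wset 31 (.reg 29) ;;
  .loop (.wlt (.reg 31) (.reg 32))
    (.wset 34 (.reg 3 + 2 * ((.mem (.reg 31) - .reg 5) * .reg 4)) ;;
    .wset 30 (.reg 32) ;;
    cellRow ;;
    .wset 31 (.reg 31 + .reg 1 + 1))

theorem cellSeg_spec {B : ℕ} {Q : ℕ → St → Prop} (σ : St) {A : ℕ} (P : Data) (xs ys π : List ℕ) (a0 a1 : ℕ)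
    (hI : P.In A σ) (hd : 0 < P.d) (hπ : π.Perm (List.range P.d)) (hxs : RecsAt P A π xs σ a0)
    (hys : RecsAt P A π ys σ a1) (h29 : σ.w 29 = a0) (h32 : σ.w 32 = a0 + xs.length * (P.d + 1))
    (h32' : σ.w 32 = a1) (h33 : σ.w 33 = a1 + ys.length * (P.d + 1))
    (hx : ∀ x ∈ xs, P.xb ≤ x ∧ x + P.d ≤ P.yb) (hy : ∀ y ∈ ys, P.yb ≤ y ∧ y < P.yb + P.J)
    (hsort : ∀ x ∈ xs, ∀ y ∈ ys, π.Pairwise (fun s t => P.z x y s ≤ P.z x y t))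
    (hB : A + 3 < B) (hB' : a1 + ys.length * (P.d + 1) < B)
    (hQ : ∀ t τ, Wrote A σ τ → GoodMono P σ τ → (∀ x ∈ xs, ∀ y ∈ ys, Good P τ x y) →
      t ≤ 60 * (xs.length * ys.length) + 60 * xs.length + 10 → Q t τ) :
    wp B cellSeg Q σ := by
  unfold cellSeg
  simp only [wp_seq, wp_wset, rules, true_and]
  refine wp_loop (fun (n : ℕ) τ => Wrote A σ τ ∧ n ≤ xs.length ∧ τ.w 31 = a0 + n * (P.d + 1) ∧
      GoodMono P σ τ ∧ ∀ i (h : i < xs.length), i < n → ∀ y ∈ ys, Good P τ xs[i] y)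
    (fun n => (60 * ys.length + 60) * (xs.length - n)) ?_ ?_ 0 ?_ ?_
  · intros; simp
  · rintro n τ ⟨hW, hn, h31', hG, hgood⟩ hlt
    simp only [rules] at hlt
    have e32 := hW.w 32 (by omega) (by omega) (by omega) (by omega)
    rw [h31', e32, h32] at hlt
    have hn' : n < xs.length := Nat.lt_of_mul_lt_mul_right (by omega : n * (P.d + 1) < xs.length * (P.d + 1))
    have hmul : (n + 1) * (P.d + 1) ≤ xs.length * (P.d + 1) := Nat.mul_le_mul_right _ hn'
    rw [Nat.add_mul, one_mul] at hmul
    obtain ⟨r1, r2⟩ := (hxs.wrote hW).2 n hn'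
    have h1 : τ.w 1 = P.d := (hW.w 1 (by omega) (by omega) (by omega) (by omega)).trans hI.d
    have h3 : τ.w 3 = P.mb := (hW.w 3 (by omega) (by omega) (by omega) (by omega)).trans hI.mb
    have h4 : τ.w 4 = P.J := (hW.w 4 (by omega) (by omega) (by omega) (by omega)).trans hI.J
    have h5 : τ.w 5 = P.xb := (hW.w 5 (by omega) (by omega) (by omega) (by omega)).trans hI.xb
    have h6 : τ.w 6 = P.yb := (hW.w 6 (by omega) (by omega) (by omega) (by omega)).trans hI.yb
    have e33 := hW.w 33 (by omega) (by omega) (by omega) (by omega)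
    have hxn := hx _ (List.getElem_mem hn')
    have hxJ : (xs[n] - P.xb) * P.J ≤ (P.yb - P.xb) * P.J := Nat.mul_le_mul_right _ (by omega)
    have hmat := hI.matrix
    generalize hQ' : (fun (k : ℕ) (τ' : St) => ∃ a', _ ∧ _) = Q'
    simp only [wp_seq, wp_wset, rules, true_and, St.setW_w, Nat.reduceEqDiff, if_false]
    rw [h31', r1, h3, h4, h5, e32, h32']
    refine ⟨⟨⟨by omega, by omega⟩, by omega⟩, ?_⟩
    generalize hυ : (τ.setW 34 (P.mb + 2 * ((xs[n] - P.xb) * P.J))).setW 30 a1 = υ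
    have hWυ : Wrote A τ υ := by
      rw [← hυ]; exact ((Wrote.refl A τ).setW (by omega)).setW (by omega)
    have hGυ : GoodMono P τ υ := fun x y _ hg =>
      hWυ.rkeep.good (by rw [← hυ]; rfl) (by rw [← hυ]; rfl) hg
    have υ31 : υ.w 31 = a0 + n * (P.d + 1) := by simp [← hυ, h31']
    have hIυ : P.In A υ := ⟨fun p hp => by rw [hWυ.rm, hW.rm, hI.rm p hp], by simp [← hυ, h1], by simp [← hυ, h3],
      by simp [← hυ, h4], by simp [← hυ, h5], by simp [← hυ, h6], hI.matrix, hI.le, hI.pos, by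
        rw [← hυ]; simp [hW.w 99, hI.al]⟩
    refine cellRow_spec υ P ys π xs[n] a1 hIυ hd hπ ?_ ((hys.wrote hW).wrote hWυ) (by simp [← hυ])
      (by simp [← hυ, e33, h33]) (by simp [← hυ]) (fun y hy' => ⟨hxn, hy y hy'⟩)
      (hsort _ (List.getElem_mem hn')) hB hB' ?_
    · rw [υ31]; exact hWυ.rkeep.recAt r2
    intro t1 ω hWω w31 hGω hgω ht1
    rw [w31, υ31, hWω.w 1 (by omega) (by omega) (by omega) (by omega), hIυ.d]
    refine ⟨by omega, ?_⟩
    rw [← hQ']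
    generalize hζ : ω.setW 31 (a0 + n * (P.d + 1) + P.d + 1) = ζ
    have hGζ : GoodMono P ω ζ := fun x y _ hg => by
      have hr : RKeep ω ζ := by rw [← hζ]; exact ⟨le_rfl, fun _ _ => rfl⟩
      exact hr.good (by rw [← hζ]; rfl) (by rw [← hζ]; rfl) hg
    have hmul2 : (60 * ys.length + 60) * (xs.length - n) =
        (60 * ys.length + 60) * (xs.length - (n + 1)) + (60 * ys.length + 60) := by
      have : xs.length - n = xs.length - (n + 1) + 1 := by omega
      rw [this]; ring
    refine ⟨n + 1, ⟨?_, hn', ?_, ?_, ?_⟩, ?_⟩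
    · rw [← hζ]; exact ((hW.trans hWυ).trans hWω).setW (by omega)
    · simp [← hζ]; ring
    · exact fun x y h hg => hGζ x y h (hGω x y h (hGυ x y h (hG x y h hg)))
    · intro i hi hin y hy'
      have hp : P.IsPair xs[i] y := ⟨hx _ (List.getElem_mem hi), hy y hy'⟩
      rcases Nat.lt_or_ge i n with h | h
      · exact hGζ _ y hp (hGω _ y hp (hGυ _ y hp (hgood i hi h y hy')))
      · obtain rfl : i = n := by omega
        exact hGζ _ y hp (hgω y hy')
    · simp only [rules]
      omega
  · refine ⟨(Wrote.refl A σ).setW (by omega), by omega, by simp [h29], ?_, fun i _ h => absurd h (by omega)⟩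
    intro x y _ hg
    have hr : RKeep σ (σ.setW 31 (σ.w 29)) := ⟨le_rfl, fun _ _ => rfl⟩
    exact hr.good rfl rfl hg
  · rintro n k τ ⟨hW, hn, h31', hG, hgood⟩ hlt ht
    simp only [rules] at hlt ht
    rw [h31', hW.w 32 (by omega) (by omega) (by omega) (by omega), h32] at hlt
    have hn' : n = xs.length := by
      refine le_antisymm hn (not_lt.1 fun h => hlt ?_)
      have := Nat.mul_lt_mul_of_pos_right h (show 0 < P.d + 1 by omega)
      omega
    subst hn'
    refine hQ _ τ hW hG (fun x hx' y hy' => ?_) ?_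
    · obtain ⟨i, hi, rfl⟩ := List.getElem_of_mem hx'
      exact hgood i hi hi y hy'
    · simp only [Nat.sub_zero] at ht
      have : (60 * ys.length + 60) * xs.length = 60 * (xs.length * ys.length) + 60 * xs.length := by ring
      omega

end RealRAM

namespace RealRAM

/-- Output the pairs of an item whose permutation is completely sorted. -/
def leafStep : Stmt :=
  .wset 27 (.reg 99) ;; .wset 36 (.reg 21) ;; .wset 37 (.reg 21 + .reg 22) ;;
  filterSeg (.wlt (.reg 38) (.reg 6)) ;;
  .wset 28 (.reg 99) ;; .wset 36 (.reg 21) ;; .wset 37 (.reg 21 + .reg 22) ;;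
  filterSeg (.not (.wlt (.reg 38) (.reg 6))) ;;
  .wset 29 (.reg 99) ;; .wset 31 (.reg 27) ;;
  recordSeg ;;
  .wset 32 (.reg 29 + (.reg 28 - .reg 27) * (.reg 1 + 1)) ;; .wset 33 (.reg 99) ;;
  cellSeg

/-- Registers from `b` on, fresh memory, and the word memory below `A` may change. -/
structure Step (b A : ℕ) (σ τ : St) : Prop where
  wlt : ∀ i < b, τ.w i = σ.w i
  rlt : ∀ i < b, τ.r i = σ.r i
  ext : Ext A σ τ
  rk : RKeep σ τ

theorem Keeps.step {b : ℕ} {σ τ : St} (h : Keeps b σ τ) (A : ℕ) : Step b A σ τ := ⟨h.wlt, h.rlt, h.ext A, h.rkeep⟩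

theorem Step.w {b A : ℕ} {σ τ : St} (h : Step b A σ τ) (i : ℕ) (hi : i < b := by omega) : τ.w i = σ.w i := h.wlt i hi

theorem Step.r {b A : ℕ} {σ τ : St} (h : Step b A σ τ) (i : ℕ) (hi : i < b := by omega) : τ.r i = σ.r i := h.rlt i hi

theorem Step.trans {b A : ℕ} {σ τ υ : St} (h : Step b A σ τ) (h' : Step b A τ υ) : Step b A σ υ :=
  ⟨fun i hi => (h'.w i hi).trans (h.w i hi), fun i hi => (h'.r i hi).trans (h.r i hi), h.ext.trans h'.ext,
    h.rk.trans h'.rk⟩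

theorem Step.mono {b c A : ℕ} {σ τ : St} (h : Step c A σ τ) (hb : b ≤ c := by omega) : Step b A σ τ :=
  ⟨fun i hi => h.w i, fun i hi => h.r i, h.ext, h.rk⟩

theorem Wrote.step {A : ℕ} {σ τ : St} (h : Wrote A σ τ) : Step 30 A σ τ :=
  ⟨fun i hi => h.w i (by omega) (by omega) (by omega) (by omega), fun i _ => by rw [h.r], h.ext, h.rkeep⟩

theorem Data.In.step {P : Data} {A b : ℕ} {σ τ : St} (h : P.In A σ) (hb : 7 ≤ b) (hK : Step b A σ τ) :
    P.In A τ :=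
  ⟨fun p hp => (hK.rk.2 p (hp.trans_le h.al)).trans (h.rm p hp), (hK.w 1).trans h.d,
    (hK.w 3).trans h.mb, (hK.w 4).trans h.J, (hK.w 5).trans h.xb,
    (hK.w 6).trans h.yb, h.matrix, h.le, h.pos, h.al.trans hK.rk.1⟩

theorem Keeps.goodMono {P : Data} {A b : ℕ} {σ τ : St} (h : Keeps b σ τ) (hI : P.In A σ) (hd : 0 < P.d) :
    GoodMono P σ τ := fun x y hp hg => by
  have h1 := Data.slot_lt hp hd
  have h2 := hI.matrix
  have h3 := hI.al
  exact h.rkeep.good (h.wm _ (by omega)) (h.wm _ (by omega)) hg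

theorem GoodMono.trans {P : Data} {σ τ υ : St} (h : GoodMono P σ τ) (h' : GoodMono P τ υ) : GoodMono P σ υ :=
  fun x y hp hg => h' x y hp (h x y hp hg)

theorem RecsAt.append {P : Data} {A a : ℕ} {π E E' : List ℕ} {σ : St} (h : RecsAt P A π (E ++ E') σ a) :
    RecsAt P A π E σ a ∧ RecsAt P A π E' σ (a + E.length * (P.d + 1)) := by
  refine ⟨⟨h.1, fun i hi => ?_⟩, h.1.trans (Nat.le_add_right _ _), fun i hi => ?_⟩
  · have := h.2 i (by simp; omega)
    simpa [List.getElem_append_left hi] using this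
  · have := h.2 (E.length + i) (by simp; omega)
    rw [List.getElem_append_right (by omega)] at this
    simp only [Nat.add_sub_cancel_left] at this
    rwa [Nat.add_mul, ← Nat.add_assoc] at this

theorem leafStep_spec {B : ℕ} {Q : ℕ → St → Prop} (σ : St) {A : ℕ} (P : Data) (it : Item)
    (hV : it.Valid P) (hI : P.In A σ) (hl : Loaded σ A it) (hp : P.d ≤ it.p) (hd : 0 < P.d)
    (hB : σ.w 99 + it.els.length * (P.d + 1) + it.els.length + P.d + 20 < B)
    (hQ : ∀ t τ, Step 27 A σ τ → GoodMono P σ τ → (∀ x y, it.Covers P x y → Good P τ x y) →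
      τ.w 99 ≤ σ.w 99 + it.els.length + it.els.length * (P.d + 1) →
      t ≤ 60 * (it.els.length * (P.d + 1)) + 120 * it.els.length + 60 * pairs P.yb it.els + 100 → Q t τ) :
    wp B leafStep Q σ := by
  have hal := hI.al
  have e4 := hl.len
  have e5 := hI.d
  have hs := hl.els.2.1
  have harr := hl.els.2.2
  have h2k : it.els.length * 2 ≤ it.els.length * (P.d + 1) := Nat.mul_le_mul_left _ (by omega)
  unfold leafStep
  simp only [wp_seq, wp_wset, rules, true_and, St.setW_w, Nat.reduceEqDiff, if_false]
  rw [e4]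
  refine ⟨by omega, ?_⟩
  generalize h1 : ((σ.setW 27 (σ.w 99)).setW 36 (σ.w 21)).setW 37 (σ.w 21 + it.els.length) = σ1
  have k1 : Keeps 27 σ σ1 := by
    rw [← h1]
    exact ((Keeps.rfl'.setW).setW).setW
  have al1 : σ1.w 99 = σ.w 99 := by simp [← h1]
  have d1 : σ1.wm = σ.wm := by rw [← h1]; rfl
  have b1 : σ1.w 27 = σ.w 99 := by simp [← h1]
  have y1 : σ1.w 6 = P.yb := by rw [k1.w 6, hI.yb]
  refine filterSeg_spec (isX P.yb) σ1 (σ.w 21) it.els.length (by intro τ h; simp [h, y1]) (by simp) (by simp)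
    (by simp [← h1]) (by simp [← h1]) (by omega) (by omega) ?_
  intro t1 σ2 k2 f2 al2 _ ht1
  rw [d1, harr, al1] at f2
  rw [d1, harr, al1] at al2
  have k02 : Keeps 27 σ σ2 := k1.trans (k2.mono)
  have b2 := (k2.w 27).trans b1
  have n12 : (it.els.filter (isX P.yb)).length + (it.els.filter (isY P.yb)).length = it.els.length := by
    rw [← List.countP_eq_length_filter, ← List.countP_eq_length_filter,
      List.length_eq_countP_add_countP (isX P.yb)]
    congr 1
    exact List.countP_congr (by simp)
  have hpairs : pairs P.yb it.els = (it.els.filter (isX P.yb)).length * (it.els.filter (isY P.yb)).length := by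
    rw [← List.countP_eq_length_filter, ← List.countP_eq_length_filter]; rfl
  rw [k02.w 21, k02.w 22, e4]
  refine ⟨by omega, ?_⟩
  generalize hxs : it.els.filter (isX P.yb) = xs at *
  generalize hys : it.els.filter (isY P.yb) = ys at *
  generalize h3 : ((σ2.setW 28 (σ2.w 99)).setW 36 (σ.w 21)).setW 37 (σ.w 21 + it.els.length) = σ3
  have k3 : Keeps 28 σ2 σ3 := by
    rw [← h3]
    exact ((Keeps.rfl'.setW).setW).setW
  have k03 : Keeps 27 σ σ3 := k02.trans (k3.mono)
  have al3 : σ3.w 99 = σ2.w 99 := by simp [← h3]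
  have b3 : σ3.w 28 = σ2.w 99 := by simp [← h3]
  have y3 : σ3.w 6 = P.yb := by rw [k03.w 6, hI.yb]
  refine filterSeg_spec (isY P.yb) σ3 (σ.w 21) it.els.length (by intro τ h; simp [h, y3]) (by simp) (by simp)
    (by simp [← h3]) (by simp [← h3]) (by omega) (by omega) ?_
  intro t2 σ4 k4 f4 al4 _ ht2
  rw [k03.arr_wm (by omega), harr, hys] at f4 al4
  have k04 : Keeps 27 σ σ4 := k03.trans (k4.mono)
  have k24 : Keeps 28 σ2 σ4 := k3.trans (k4.mono)
  have b4 : σ4.w 27 = σ.w 99 := (k24.w 27).trans b2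
  have b4' : σ4.w 28 = σ2.w 99 := (k4.w 28).trans b3
  rw [b4]
  have seg4 : Seg σ4 A (σ.w 99) (xs ++ ys) := by
    refine ⟨hal, by rw [List.length_append]; omega, ?_⟩
    rw [List.length_append, arr_add, k24.arr_wm (by omega), f2, ← al2, ← al3, f4]
  generalize h5 : (σ4.setW 29 (σ4.w 99)).setW 31 (σ.w 99) = σ5
  have k5 : Keeps 29 σ4 σ5 := by
    rw [← h5]
    exact (Keeps.rfl'.setW).setW
  have k05 : Keeps 27 σ σ5 := k04.trans (k5.mono)
  have al5 : σ5.w 99 = σ4.w 99 := by simp [← h5]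
  have hmem : ∀ e, e ∈ xs ++ ys → e ∈ it.els := by
    intro e he
    rcases List.mem_append.1 he with h | h
    · rw [← hxs] at h; exact (List.mem_filter.1 h).1
    · rw [← hys] at h; exact (List.mem_filter.1 h).1
  have hlenE : (xs ++ ys).length = it.els.length := by rw [List.length_append]; exact n12
  have p5 : Seg σ5 A (σ5.w 23) it.perm := by rw [k05.w 23]; exact (k05.ext A).seg hl.perm
  refine recordSeg_spec σ5 P (xs ++ ys) it.perm (hI.keeps (by omega) k05)
    (by rw [show σ5.w 31 = σ.w 99 by simp [← h5]]; exact (k5.ext A).seg seg4)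
    (by rw [hlenE]; simp [← h5]; omega) p5 hV.perm (fun e he => hV.els e (hmem e he)) (by rw [hlenE]; omega) ?_
  intro t3 σ6 k6 hrec al6 ht3
  rw [hlenE] at al6 ht3
  have k46 : Keeps 29 σ4 σ6 := k5.trans (k6.mono)
  have k06 : Keeps 27 σ σ6 := k05.trans (k6.mono)
  have hI6 := hI.keeps (by omega) k06
  have w29 : σ6.w 29 = σ4.w 99 := by rw [k6.w 29, ← h5]; simp
  rw [w29, k46.w 28, k46.w 27, b4, b4', hI6.d, al2, Nat.add_sub_cancel_left]
  have hmulx : xs.length * (P.d + 1) + ys.length * (P.d + 1) = it.els.length * (P.d + 1) := by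
    rw [← Nat.add_mul, n12]
  have hmulx1 : xs.length ≤ it.els.length := by omega
  refine ⟨by omega, ?_⟩
  generalize h7 : (σ6.setW 32 (σ4.w 99 + xs.length * (P.d + 1))).setW 33 (σ6.w 99) = σ7
  have k7 : Keeps 30 σ6 σ7 := by
    rw [← h7]
    exact (Keeps.rfl'.setW).setW
  have k07 : Keeps 27 σ σ7 := k06.trans (k7.mono)
  have hrec7 : RecsAt P A it.perm (xs ++ ys) σ7 (σ4.w 99) := by
    refine ⟨by omega, fun i hi => ?_⟩
    have := hrec i hi
    rw [al5] at this
    refine ⟨?_, k7.rkeep.recAt this.2⟩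
    rw [← this.1, ← h7]; rfl
  have hmx : ∀ x, x ∈ xs → x ∈ it.els ∧ x < P.yb := fun x hx => by
    rw [← hxs] at hx; simpa using List.mem_filter.1 hx
  have hmy : ∀ y, y ∈ ys → y ∈ it.els ∧ P.yb ≤ y := fun x hx => by
    rw [← hys] at hx; simpa using List.mem_filter.1 hx
  refine cellSeg_spec σ7 P xs ys it.perm (σ4.w 99) (σ4.w 99 + xs.length * (P.d + 1)) (hI.keeps (by omega) k07) hd
    hV.perm hrec7.append.1 hrec7.append.2 ?_ ?_ ?_ ?_ ?_ ?_ ?_ ?_ ?_ ?_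
  · rw [k7.w 29, w29]
  · simp [← h7]
  · simp [← h7]
  · simp [← h7]; omega
  · intro x hx
    have h := hmx x hx
    rcases hV.els x h.1 with h' | h'
    · exact h'
    · omega
  · intro y hy
    have h := hmy y hy
    rcases hV.els y h.1 with h' | h'
    · omega
    · exact h'
  · intro x hx y hy
    have h := (hV.sorted x (hmx x hx).1 (hmx x hx).2 y (hmy y hy).1 (hmy y hy).2).1
    rwa [List.take_of_length_le (by rw [hV.perm.length_eq, List.length_range]; exact hp)] at h
  · omega
  · omega
  intro t4 τ hW hG hgood ht4
  refine hQ _ τ ((k07.step A).trans (hW.step.mono)) ((k07.goodMono hI hd).trans hG) ?_ ?_ ?_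
  · rintro x y ⟨hx, hx', hy, hy'⟩
    refine hgood x ?_ y ?_
    · rw [← hxs]; simp [hx, hx']
    · rw [← hys]; simp [hy, hy']
  · rw [hW.w 99 (by omega) (by omega) (by omega) (by omega), show σ7.w 99 = σ6.w 99 by simp [← h7]]
    omega
  · have hx : xs.length ≤ it.els.length := by omega
    rw [hpairs]
    clear h1 h3 h5 h7 f2 f4
    linarith

/-- Load the item on the top of the stack and remove it. -/
def popItem : Stmt :=
  .wset 21 (.mem (.reg 20 + 1)) ;; .wset 22 (.mem (.reg 20 + 2)) ;; .wset 23 (.mem (.reg 20 + 3)) ;;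
  .wset 24 (.mem (.reg 20 + 4)) ;; .wset 25 (.mem (.reg 20 + 5)) ;; .wset 26 (.mem (.reg 20 + 6)) ;;
  .wset 20 (.mem (.reg 20))

theorem popItem_spec {B : ℕ} (σ : St) {A : ℕ} (it : Item) (l : List Item)
    (h : StackAt σ A (σ.w 20) (it :: l)) (hB : σ.w 99 < B) :
    wp B popItem (fun t τ => t ≤ 50 ∧ Keeps 20 σ τ ∧ Loaded τ A it ∧ StackAt τ A (τ.w 20) l ∧
      τ.w 99 = σ.w 99 ∧ τ.wm = σ.wm) σ := by
  obtain ⟨h0, hi, hl⟩ := h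
  have hlt := hi.lt
  unfold popItem
  simp only [wp_seq, wp_wset, rules, true_and, St.setW_w, St.setW_wm, Nat.reduceEqDiff, if_false]
  refine ⟨by omega, by omega, by omega, by omega, by omega, by omega, by omega, ?_, ?_, ?_, ?_⟩
  · exact ((((((Keeps.rfl'.setW).setW).setW).setW).setW).setW).setW
  · have h1 := hi.els
    have h2 := hi.perm
    exact ⟨by simpa [Seg] using h1, by simpa using hi.len, by simpa [Seg] using h2, by simpa using hi.p,
      by simpa using hi.lo, by simpa using hi.hi⟩
  · have hE : Ext A σ (((((((σ.setW 21 (σ.wm (σ.w 20 + 1))).setW 22 (σ.wm (σ.w 20 + 2))).setW 23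
      (σ.wm (σ.w 20 + 3))).setW 24 (σ.wm (σ.w 20 + 4))).setW 25 (σ.wm (σ.w 20 + 5))).setW 26
      (σ.wm (σ.w 20 + 6))).setW 20 (σ.wm (σ.w 20))) := ⟨by simp, fun _ _ _ => rfl⟩
    simpa using hE.stackAt hl
  · simp

/-- Process all items of the stack. -/
def classify : Stmt :=
  .loop (.wlt 0 (.reg 20))
    (popItem ;;
    .ite (.wlt (.reg 22) 2) .skip
      (.ite (.wlt (.reg 24) (.reg 1))
        (.ite (.wlt (.reg 25) (.reg 26)) compareStep insertStep)
        leafStep))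

theorem classify_spec {B : ℕ} {Q : ℕ → St → Prop} (σ : St) {A : ℕ} (P : Data) (l₀ : List Item) (R : ℕ)
    (hI : P.In A σ) (hd : 0 < P.d) (hst : StackAt σ A (σ.w 20) l₀)
    (hV : ∀ it ∈ l₀, it.Valid P ∧ it.r ≤ R)
    (hB : σ.w 99 + stackPot P (R + P.d + 10) l₀ + 5 < B)
    (hQ : ∀ t τ, Step 20 A σ τ → (∀ x y, P.IsPair x y → (∃ it ∈ l₀, it.Covers P x y) → Good P τ x y) →
      τ.w 99 ≤ σ.w 99 + stackPot P (R + P.d + 10) l₀ → t ≤ stackPot P (R + P.d + 10) l₀ + 10 → Q t τ) :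
    wp B classify Q σ := by
  unfold classify
  refine wp_loop (fun (l : List Item) τ => Step 20 A σ τ ∧ StackAt τ A (τ.w 20) l ∧
      (∀ it ∈ l, it.Valid P ∧ it.r ≤ R) ∧
      (∀ x y, P.IsPair x y → (∃ it ∈ l₀, it.Covers P x y) → Good P τ x y ∨ ∃ it ∈ l, it.Covers P x y) ∧
      τ.w 99 + stackPot P (R + P.d + 10) l ≤ σ.w 99 + stackPot P (R + P.d + 10) l₀)
    (fun l => stackPot P (R + P.d + 10) l) ?_ ?_ l₀ ?_ ?_
  · intro a τ _
    simp only [rules, and_true]; omega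
  · rintro l τ ⟨hS, hl, hV', hcov, hal⟩ hlt
    simp only [rules] at hlt
    rcases l with _ | ⟨it, l⟩
    · exact absurd hl (by simp [StackAt]; omega)
    have hIτ := hI.step (by omega) hS
    obtain ⟨hv, hr⟩ := hV' it (by simp)
    have hkD : it.els.length * (it.r + 7) + it.els.length * (P.d + 1) + 2 * it.els.length ≤
        it.els.length * (R + P.d + 10) := by
      have := Nat.mul_le_mul_left it.els.length (show (it.r + 7) + (P.d + 1) + 2 ≤ R + P.d + 10 by omega)
      rw [Nat.mul_add, Nat.mul_add] at this
      omega
    have hbud := Nat.mul_le_mul_left it.els.length (le_budget (R + P.d + 10) it.r (it.height P.d))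
    have hpot : it.pot P (R + P.d + 10) = 200 + 400 * (it.els.length * budget (R + P.d + 10) it.r (it.height P.d)) +
      100 * pairs P.yb it.els := rfl
    simp only [stackPot_cons] at hal ⊢
    generalize hQ' : (fun (k : ℕ) (τ' : St) => ∃ a', _ ∧ _) = Q'
    rw [wp_seq]
    refine wp_mono (popItem_spec τ it l hl (by omega)) ?_
    rintro t1 υ ⟨ht1, k1, hload, hst1, al1, wm1⟩
    have hIυ := hIτ.keeps (by omega) k1
    have hSυ : Step 20 A σ υ := hS.trans (k1.step A)
    have hGυ : GoodMono P τ υ := k1.goodMono hIτ hd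
    have hlen := hload.len
    have hvl : ∀ it' ∈ l, it'.Valid P ∧ it'.r ≤ R := fun it' h => hV' it' (by simp [h])
    have hdk : it.els.length = 0 ∨ P.d + 1 ≤ it.els.length * (P.d + 1) := by
      rcases Nat.eq_zero_or_pos it.els.length with h | h
      · exact Or.inl h
      · exact Or.inr (Nat.le_mul_of_pos_left _ h)
    simp only [wp_ite, wp_skip, rules, true_and, hlen]
    refine ⟨by omega, fun hk => ?_, fun hk => ?_⟩
    · rw [← hQ']
      refine ⟨l, ⟨hSυ, hst1, hvl, ?_, by omega⟩, by simp only [rules]; omega⟩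
      intro x y hp hc
      rcases hcov x y hp hc with h | ⟨it', hit', h⟩
      · exact Or.inl (hGυ x y hp h)
      · rcases List.mem_cons.1 hit' with rfl | h'
        · exfalso
          obtain ⟨h1, h2, h3, h4⟩ := h
          match hq : it'.els, hk, h1, h3 with
          | [e], _, h1, h3 =>
            simp at h1 h3
            omega
        · exact Or.inr ⟨it', h', h⟩
    have hp1 := hload.p
    have hp2 := hload.lo
    have hp3 := hload.hi
    have hd1 := hIυ.d
    rw [hp1, hp2, hp3, hd1]
    refine ⟨fun hpd => ⟨fun hlohi => ?_, fun hlohi => ?_⟩, fun hpd => ?_⟩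
    · refine compareStep_spec υ P it l hv hIυ hload hpd hlohi (by omega) hst1 (by omega) ?_
      intro t2 ω L k2 hL st2 m2 ht2
      have hpc := pot_compare (mid := (it.lo + it.hi) / 2) hv hL.perm (by omega) hpd (by omega) (by omega) (by omega) (by omega)
        (R + P.d + 10)
      obtain ⟨v1, v2, v3, v4⟩ := hv.compare (mid := (it.lo + it.hi) / 2) hL.perm (by omega) hpd (by omega) (by omega) hL.sorted
      generalize (it.lo + it.hi) / 2 = mid at *
      rw [← hQ']
      refine ⟨_, ⟨hSυ.trans (k2.step A), st2, ?_, ?_, ?_⟩, ?_⟩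
      · intro it' hit'
        simp only [List.mem_cons] at hit'
        rcases hit' with rfl | rfl | rfl | rfl | h
        · exact ⟨v4, hr⟩
        · exact ⟨v3, hr⟩
        · exact ⟨v2, (Nat.sub_le _ _).trans hr⟩
        · exact ⟨v1, (Nat.sub_le _ _).trans hr⟩
        · exact hvl _ h
      · intro x y hp hc
        rcases hcov x y hp hc with h | ⟨it', hit', h⟩
        · exact Or.inl (k2.goodMono hIυ hd x y hp (hGυ x y hp h))
        · right
          rcases List.mem_cons.1 hit' with rfl | h'
          · rcases h.compare (mid := mid) hL.perm with h | h | h | h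
            · exact ⟨_, by simp, h⟩
            · exact ⟨_, List.mem_cons_of_mem _ (List.mem_cons_of_mem _ List.mem_cons_self), h⟩
            · exact ⟨_, List.mem_cons_of_mem _ List.mem_cons_self, h⟩
            · exact ⟨_, List.mem_cons_self, h⟩
          · exact ⟨it', by simp [h'], h⟩
      · simp only [stackPot_cons]; omega
      · simp only [stackPot_cons, rules]; omega
    · refine insertStep_spec υ P it l hv hIυ hload hpd (by omega) hst1 (by omega) ?_
      intro t2 ω k2 st2 m2 ht2
      have hpc := pot_insert hv (by omega) hpd (R + P.d + 10)
      rw [← hQ']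
      refine ⟨_, ⟨hSυ.trans (k2.step A), st2, ?_, ?_, ?_⟩, ?_⟩
      · intro it' hit'
        rcases List.mem_cons.1 hit' with rfl | h
        · exact ⟨hv.insert hpd (by omega), hr⟩
        · exact hvl _ h
      · intro x y hp hc
        rcases hcov x y hp hc with h | ⟨it', hit', h⟩
        · exact Or.inl (k2.goodMono hIυ hd x y hp (hGυ x y hp h))
        · right
          rcases List.mem_cons.1 hit' with rfl | h'
          · exact ⟨_, List.mem_cons_self, h⟩
          · exact ⟨it', by simp [h'], h⟩
      · simp only [stackPot_cons]; omega
      · simp only [stackPot_cons, rules]; omega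
    · refine leafStep_spec υ P it hv hIυ hload (by omega) hd (by omega) ?_
      intro t2 ω k2 hG2 hgood m2 ht2
      rw [← hQ']
      refine ⟨l, ⟨hSυ.trans (k2.mono), ?_, hvl, ?_, by omega⟩, ?_⟩
      · rw [k2.w 20]; exact k2.ext.stackAt hst1
      · intro x y hp hc
        rcases hcov x y hp hc with h | ⟨it', hit', h⟩
        · exact Or.inl (hG2 x y hp (hGυ x y hp h))
        · rcases List.mem_cons.1 hit' with rfl | h'
          · exact Or.inl (hgood x y h)
          · exact Or.inr ⟨it', h', h⟩
      · simp only [rules]; omega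
  · exact ⟨Keeps.rfl'.step A, hst, hV, fun x y _ hc => Or.inr hc, le_rfl⟩
  · rintro l k τ ⟨hS, hl, hV', hcov, hal⟩ hlt ht
    simp only [rules] at hlt ht
    have hnil : l = [] := by
      rcases l with _ | ⟨it, l⟩
      · rfl
      · exact absurd hl.1 hlt
    subst hnil
    refine hQ _ τ hS (fun x y hp hc => ?_) (by omega) (by omega)
    rcases hcov x y hp hc with h | ⟨it, h, _⟩
    · exact h
    · simp at h

end RealRAM

namespace RealRAM

/-! ## Selection in sorted rows -/

/-- `m` sorted rows of `d` real numbers. -/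
structure Rows where
  m : ℕ
  d : ℕ
  val : ℕ → ℕ → ℝ
  sorted : ∀ a < m, ∀ u v, u ≤ v → v < d → val a u ≤ val a v

namespace Rows
variable (R : Rows)

/-- The entries, made distinct by their positions. -/
def key (a u : ℕ) : ℝ ×ₗ ℕ := toLex (R.val a u, a * R.d + u)

open Classical in
/-- The number of entries of row `a` in `s`. -/
noncomputable def rank (a : ℕ) (s : Set (ℝ ×ₗ ℕ)) : ℕ := ((Finset.range R.d).filter fun u => R.key a u ∈ s).card

variable {R}

theorem key_lt {a u v : ℕ} (ha : a < R.m) (huv : u < v) (hv : v < R.d) : R.key a u < R.key a v := by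
  rw [key, key, Prod.Lex.toLex_lt_toLex]
  rcases (R.sorted a ha u v huv.le hv).lt_or_eq with h | h
  · exact Or.inl h
  · exact Or.inr ⟨h, by simpa using huv⟩

theorem key_inj {a u b v : ℕ} (hu : u < R.d) (hv : v < R.d) (h : R.key a u = R.key b v) : a = b ∧ u = v := by
  have h2 : a * R.d + u = b * R.d + v := congrArg (fun x => (ofLex x).2) h
  have hd : 0 < R.d := by omega
  have q := congrArg (· / R.d) h2
  have r := congrArg (· % R.d) h2
  simp only [mul_comm _ R.d, Nat.mul_add_div hd, Nat.mul_add_mod] at q r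
  rw [Nat.div_eq_of_lt hu, Nat.div_eq_of_lt hv] at q
  rw [Nat.mod_eq_of_lt hu, Nat.mod_eq_of_lt hv] at r
  omega

theorem rank_eq (a : ℕ) (s : Set (ℝ ×ₗ ℕ)) [DecidablePred fun u => R.key a u ∈ s] :
    R.rank a s = ((Finset.range R.d).filter fun u => R.key a u ∈ s).card := by
  unfold rank; congr

theorem rank_le (a : ℕ) (s : Set (ℝ ×ₗ ℕ)) : R.rank a s ≤ R.d := by
  classical
  unfold rank
  exact (Finset.card_filter_le _ _).trans (by simp)

theorem lt_rank {a u : ℕ} {s : Set (ℝ ×ₗ ℕ)} (hs : IsLowerSet s) (ha : a < R.m) (hu : u < R.d) :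
    u < R.rank a s ↔ R.key a u ∈ s := by
  classical
  have hmono : ∀ i j, i ≤ j → j < R.d → R.key a j ∈ s → R.key a i ∈ s := by
    intro i j hij hj h
    rcases hij.lt_or_eq with h' | rfl
    · exact hs (key_lt ha h' hj).le h
    · exact h
  constructor
  · intro h
    by_contra hc
    have : ((Finset.range R.d).filter fun u => R.key a u ∈ s) ⊆ Finset.range u := by
      intro v hv
      simp only [Finset.mem_filter, Finset.mem_range] at hv ⊢
      by_contra hle
      exact hc (hmono u v (by omega) hv.1 hv.2)
    have := Finset.card_le_card this
    rw [Finset.card_range, rank_eq] at *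
    omega
  · intro h
    have : Finset.range (u + 1) ⊆ ((Finset.range R.d).filter fun u => R.key a u ∈ s) := by
      intro v hv
      simp only [Finset.mem_filter, Finset.mem_range] at hv ⊢
      exact ⟨by omega, hmono v u (by omega) hu h⟩
    have := Finset.card_le_card this
    rw [Finset.card_range] at this
    rw [rank_eq]
    omega

theorem rank_mono {a : ℕ} {s t : Set (ℝ ×ₗ ℕ)} (h : s ⊆ t) : R.rank a s ≤ R.rank a t := by
  classical
  unfold rank
  refine Finset.card_le_card fun u hu => ?_
  simp only [Finset.mem_filter] at hu ⊢
  exact ⟨hu.1, h hu.2⟩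

theorem sum_rank (s : Set (ℝ ×ₗ ℕ)) [DecidablePred fun p : ℕ × ℕ => R.key p.1 p.2 ∈ s] :
    ∑ a ∈ Finset.range R.m, R.rank a s =
      ((Finset.range R.m ×ˢ Finset.range R.d).filter fun p => R.key p.1 p.2 ∈ s).card := by
  classical
  rw [Finset.card_filter, Finset.sum_product]
  refine Finset.sum_congr rfl fun a _ => ?_
  unfold rank
  rw [Finset.card_filter]
  refine Finset.sum_congr rfl fun u _ => ?_
  congr

theorem exists_rank {α : Type*} [LinearOrder α] (K : Finset α) {k : ℕ} (hk : k < K.card) :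
    ∃ x ∈ K, (K.filter (· < x)).card = k := by
  refine ⟨K.orderEmbOfFin rfl ⟨k, hk⟩, K.orderEmbOfFin_mem rfl _, ?_⟩
  have : K.filter (· < K.orderEmbOfFin rfl ⟨k, hk⟩) =
      (Finset.univ.filter (· < (⟨k, hk⟩ : Fin K.card))).map (K.orderEmbOfFin rfl).toEmbedding := by
    ext x
    simp only [Finset.mem_filter, Finset.mem_map, Finset.mem_univ, true_and]
    constructor
    · rintro ⟨hx, hlt⟩
      have hx' : x ∈ Set.range (K.orderEmbOfFin rfl) := by rw [Finset.range_orderEmbOfFin]; exact hx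
      obtain ⟨i, rfl⟩ := hx'
      exact ⟨i, by simpa using hlt, rfl⟩
    · rintro ⟨i, hi, rfl⟩
      exact ⟨K.orderEmbOfFin_mem rfl _, by simpa using hi⟩
  rw [this, Finset.card_map]
  have : (Finset.univ.filter (· < (⟨k, hk⟩ : Fin K.card))) = Finset.Iio ⟨k, hk⟩ := by ext; simp
  rw [this, Fin.card_Iio]

/-- The entry of rank `k` among all entries. -/
theorem exists_key {k : ℕ} (hk : k < R.m * R.d) :
    ∃ a < R.m, ∃ u < R.d, ∑ b ∈ Finset.range R.m, R.rank b (Set.Iio (R.key a u)) = k ∧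
      ∑ b ∈ Finset.range R.m, R.rank b (Set.Iic (R.key a u)) = k + 1 := by
  classical
  set I := Finset.range R.m ×ˢ Finset.range R.d with hI
  have hinj : Set.InjOn (fun p : ℕ × ℕ => R.key p.1 p.2) I := by
    rintro ⟨a, u⟩ h ⟨b, v⟩ h' he
    simp only [hI, Finset.coe_product, Set.mem_prod, Finset.mem_coe, Finset.mem_range] at h h'
    obtain ⟨rfl, rfl⟩ := key_inj h.2 h'.2 he
    rfl
  obtain ⟨x, hx, hc⟩ := exists_rank (I.image fun p : ℕ × ℕ => R.key p.1 p.2) (k := k) (by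
    rw [Finset.card_image_of_injOn hinj]; simpa [hI] using hk)
  obtain ⟨⟨a, u⟩, hau, rfl⟩ := Finset.mem_image.1 hx
  have hau' : a < R.m ∧ u < R.d := by simpa [hI] using hau
  have hcount : ∀ s : Set (ℝ ×ₗ ℕ), ∑ b ∈ Finset.range R.m, R.rank b s =
      ((I.image fun p : ℕ × ℕ => R.key p.1 p.2).filter (· ∈ s)).card := by
    intro s
    rw [sum_rank, Finset.filter_image, Finset.card_image_of_injOn]
    exact hinj.mono (Finset.coe_subset.2 (Finset.filter_subset _ _))
  refine ⟨a, hau'.1, u, hau'.2, ?_, ?_⟩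
  · rw [hcount]; simpa using hc
  · rw [hcount]
    have : (I.image fun p : ℕ × ℕ => R.key p.1 p.2).filter (· ∈ Set.Iic (R.key a u)) =
        insert (R.key a u) ((I.image fun p : ℕ × ℕ => R.key p.1 p.2).filter (· < R.key a u)) := by
      ext y
      simp only [Finset.mem_filter, Finset.mem_insert, Set.mem_Iic]
      constructor
      · rintro ⟨h1, h2⟩
        rcases h2.lt_or_eq with h | h
        · exact Or.inr ⟨h1, h⟩
        · exact Or.inl h
      · rintro (rfl | ⟨h1, h2⟩)
        · exact ⟨hx, le_rfl⟩
        · exact ⟨h1, h2.le⟩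
    rw [← hc, ← Finset.card_insert_of_notMem (a := R.key a u) (by simp), ← this]
    congr!

/-- The entry `τ` to be selected lies in the segments from `lo` to `hi`, and has rank `k` there. -/
structure Sel (R : Rows) (τ : ℝ ×ₗ ℕ) (lo hi : ℕ → ℕ) (k : ℕ) : Prop where
  lo_le : ∀ a < R.m, lo a ≤ R.rank a (Set.Iio τ)
  le_hi : ∀ a < R.m, R.rank a (Set.Iic τ) ≤ hi a
  hi_le : ∀ a < R.m, hi a ≤ R.d
  k_eq : k + ∑ a ∈ Finset.range R.m, lo a = ∑ a ∈ Finset.range R.m, R.rank a (Set.Iio τ)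
  succ : ∑ a ∈ Finset.range R.m, R.rank a (Set.Iic τ) = ∑ a ∈ Finset.range R.m, R.rank a (Set.Iio τ) + 1

/-- The number of entries `≤ v` in the segment of row `a`. -/
noncomputable def cnt (R : Rows) (lo hi : ℕ → ℕ) (a : ℕ) (v : ℝ ×ₗ ℕ) : ℕ := min (R.rank a (Set.Iic v)) (hi a) - lo a

/-- The total length of the segments. -/
def width (R : Rows) (lo hi : ℕ → ℕ) : ℕ := ∑ a ∈ Finset.range R.m, (hi a - lo a)

section Sel
variable {τ p : ℝ ×ₗ ℕ} {lo hi : ℕ → ℕ} {k : ℕ}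

theorem Sel.pivot_ge (h : Sel R τ lo hi k) (hp : k + 1 ≤ ∑ a ∈ Finset.range R.m, R.cnt lo hi a p) : τ ≤ p := by
  by_contra hc
  have hsub : Set.Iic p ⊆ Set.Iio τ := fun x hx => lt_of_le_of_lt hx (not_le.1 hc)
  have h1 : ∑ a ∈ Finset.range R.m, (R.cnt lo hi a p + lo a) ≤ ∑ a ∈ Finset.range R.m, R.rank a (Set.Iio τ) := by
    refine Finset.sum_le_sum fun a ha => ?_
    have ha := Finset.mem_range.1 ha
    have := rank_mono (R := R) (a := a) hsub
    have := h.lo_le a ha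
    unfold cnt; omega
  rw [Finset.sum_add_distrib] at h1
  have := h.k_eq
  omega

theorem Sel.pivot_lt (h : Sel R τ lo hi k) (hp : ∑ a ∈ Finset.range R.m, R.cnt lo hi a p ≤ k) : p < τ := by
  by_contra hc
  have hsub : Set.Iic τ ⊆ Set.Iic p := Set.Iic_subset_Iic.2 (not_lt.1 hc)
  have h1 : ∑ a ∈ Finset.range R.m, R.rank a (Set.Iic τ) ≤ ∑ a ∈ Finset.range R.m, (R.cnt lo hi a p + lo a) := by
    refine Finset.sum_le_sum fun a ha => ?_
    have ha := Finset.mem_range.1 ha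
    have := rank_mono (R := R) (a := a) hsub
    have := h.le_hi a ha
    unfold cnt; omega
  rw [Finset.sum_add_distrib] at h1
  have := h.k_eq
  have := h.succ
  omega

theorem Sel.lo_le_hi (h : Sel R τ lo hi k) {a : ℕ} (ha : a < R.m) : lo a ≤ hi a :=
  (h.lo_le a ha).trans ((rank_mono Set.Iio_subset_Iic_self).trans (h.le_hi a ha))

theorem Sel.lt_width (h : Sel R τ lo hi k) : k < R.width lo hi := by
  have h1 : ∑ a ∈ Finset.range R.m, R.rank a (Set.Iic τ) ≤ ∑ a ∈ Finset.range R.m, ((hi a - lo a) + lo a) := by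
    refine Finset.sum_le_sum fun a ha => ?_
    have ha := Finset.mem_range.1 ha
    have := h.lo_le_hi ha
    have := h.le_hi a ha
    omega
  rw [Finset.sum_add_distrib] at h1
  have := h.k_eq
  have := h.succ
  unfold width
  omega

/-- Every `h`-th entry of a segment. -/
def sampleRow (R : Rows) (lo hi : ℕ → ℕ) (h a : ℕ) : List (ℝ ×ₗ ℕ) :=
  (List.range ((hi a - lo a) / h)).map fun i => R.key a (lo a + i * h + (h - 1))

/-- Every `h`-th entry of all segments. -/
def sample (R : Rows) (lo hi : ℕ → ℕ) (h m : ℕ) : List (ℝ ×ₗ ℕ) :=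
  (List.range m).flatMap (R.sampleRow lo hi h)

theorem sample_succ (h m : ℕ) : R.sample lo hi h (m + 1) = R.sample lo hi h m ++ R.sampleRow lo hi h m := by
  simp [sample, List.range_succ]

theorem countP_range_lt (n c : ℕ) : (List.range n).countP (fun i => decide (i < c)) = min c n := by
  induction n with
  | zero => simp
  | succ n ih =>
    rw [List.range_succ, List.countP_append, ih]
    by_cases h : n < c
    · simp [h]; omega
    · simp [h]; omega

theorem cntLE_sampleRow {h a : ℕ} (hh : 0 < h) (ha : a < R.m) (hi_le : hi a ≤ R.d) (v : ℝ ×ₗ ℕ) :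
    cntLE v (R.sampleRow lo hi h a) = R.cnt lo hi a v / h := by
  unfold cntLE sampleRow
  rw [List.countP_map]
  have : (List.range ((hi a - lo a) / h)).countP
      ((fun b => decide (b ≤ v)) ∘ fun i => R.key a (lo a + i * h + (h - 1))) =
      (List.range ((hi a - lo a) / h)).countP (fun i => decide (i < R.cnt lo hi a v / h)) := by
    refine List.countP_congr fun i hi' => ?_
    have hi'' : (i + 1) * h ≤ hi a - lo a := (Nat.le_div_iff_mul_le hh).1 (List.mem_range.1 hi')
    have e : (i + 1) * h = i * h + h := by ring
    simp only [Function.comp, decide_eq_true_eq]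
    have hlt := lt_rank (R := R) (isLowerSet_Iic v) ha (u := lo a + i * h + (h - 1)) (by omega)
    rw [Set.mem_Iic] at hlt
    rw [← hlt, Nat.lt_iff_add_one_le, Nat.lt_iff_add_one_le, Nat.le_div_iff_mul_le hh]
    unfold cnt
    omega
  rw [this, countP_range_lt]
  refine min_eq_left (Nat.div_le_div_right ?_)
  unfold cnt; omega

theorem cntLE_sample {h : ℕ} (hh : 0 < h) (hi_le : ∀ a < R.m, hi a ≤ R.d) (v : ℝ ×ₗ ℕ) :
    cntLE v (R.sample lo hi h R.m) = ∑ a ∈ Finset.range R.m, R.cnt lo hi a v / h := by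
  suffices H : ∀ m ≤ R.m, cntLE v (R.sample lo hi h m) = ∑ a ∈ Finset.range m, R.cnt lo hi a v / h from H _ le_rfl
  intro m hm
  induction m with
  | zero => simp [sample]
  | succ m ih =>
    rw [sample_succ, cntLE_append, ih (by omega), Finset.sum_range_succ, cntLE_sampleRow hh hm (hi_le m hm)]

theorem length_sample (h m : ℕ) : (R.sample lo hi h m).length = ∑ a ∈ Finset.range m, (hi a - lo a) / h := by
  induction m with
  | zero => simp [sample]
  | succ m ih => rw [sample_succ, List.length_append, ih, Finset.sum_range_succ]; simp [sampleRow]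

theorem nodup_sample {h : ℕ} (hh : 0 < h) (hi_le : ∀ a < R.m, hi a ≤ R.d) : (R.sample lo hi h R.m).Nodup := by
  have hlt : ∀ a < R.m, ∀ i < (hi a - lo a) / h, lo a + i * h + (h - 1) < R.d := by
    intro a ha i hi'
    have h1 : (i + 1) * h ≤ hi a - lo a := (Nat.le_div_iff_mul_le hh).1 hi'
    have e : (i + 1) * h = i * h + h := by ring
    have := hi_le a ha
    omega
  unfold sample
  rw [List.nodup_flatMap]
  refine ⟨fun a ha => ?_, ?_⟩
  · have ha := List.mem_range.1 ha
    unfold sampleRow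
    refine List.Nodup.map_on ?_ List.nodup_range
    intro i hi' j hj he
    have := (key_inj (hlt a ha i (List.mem_range.1 hi')) (hlt a ha j (List.mem_range.1 hj)) he).2
    have : i * h = j * h := by omega
    exact Nat.eq_of_mul_eq_mul_right hh this
  · refine List.Pairwise.imp_of_mem ?_ (List.nodup_range (n := R.m))
    intro a b ha hb hab
    have ha := List.mem_range.1 ha
    have hb := List.mem_range.1 hb
    rw [Function.onFun, List.disjoint_left]
    intro x hx hx'
    simp only [sampleRow, List.mem_map, List.mem_range] at hx hx'
    obtain ⟨i, hi', rfl⟩ := hx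
    obtain ⟨j, hj, he⟩ := hx'
    exact hab (key_inj (hlt b hb j hj) (hlt a ha i hi') he).1.symm

theorem length_sample_le (h : ℕ) : h * (R.sample lo hi h R.m).length ≤ R.width lo hi := by
  rw [length_sample, width, Finset.mul_sum]
  exact Finset.sum_le_sum fun a _ => Nat.mul_div_le _ _

variable {h w err T E : ℕ} {S : List (ℝ ×ₗ ℕ)}

theorem sample_bounds (hh : 0 < h) (hi_le : ∀ a < R.m, hi a ≤ R.d)
    (hS : IsSample T (R.sample lo hi h R.m) w err S) (v : ℝ ×ₗ ℕ) :
    h * (w * cntLE v S) ≤ ∑ a ∈ Finset.range R.m, R.cnt lo hi a v ∧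
      ∑ a ∈ Finset.range R.m, R.cnt lo hi a v ≤ h * (w * cntLE v S) + h * err + R.m * (h - 1) := by
  have h1 := Nat.mul_le_mul_left h (hS.lower v)
  have h2 := Nat.mul_le_mul_left h (hS.upper v)
  rw [cntLE_sample hh hi_le] at h1 h2
  have h3 : h * ∑ a ∈ Finset.range R.m, R.cnt lo hi a v / h ≤ ∑ a ∈ Finset.range R.m, R.cnt lo hi a v := by
    rw [Finset.mul_sum]; exact Finset.sum_le_sum fun a _ => Nat.mul_div_le _ _
  have h4 : ∑ a ∈ Finset.range R.m, R.cnt lo hi a v ≤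
      h * ∑ a ∈ Finset.range R.m, R.cnt lo hi a v / h + R.m * (h - 1) := by
    rw [Finset.mul_sum]
    have : R.m * (h - 1) = ∑ a ∈ Finset.range R.m, (h - 1) := by simp
    rw [this, ← Finset.sum_add_distrib]
    refine Finset.sum_le_sum fun a _ => ?_
    have := Nat.div_add_mod (R.cnt lo hi a v) h
    have := Nat.mod_lt (R.cnt lo hi a v) hh
    omega
  rw [Nat.mul_add] at h2
  exact ⟨h1.trans h3, by omega⟩

theorem cntLE_getElem (hs : S.Pairwise (· ≤ ·)) (hn : S.Nodup) {i : ℕ} (hi : i < S.length) :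
    cntLE S[i] S = i + 1 := by
  have hlt : S.Pairwise (· < ·) := (hs.and hn).imp fun h => lt_of_le_of_ne h.1 h.2
  have h1 : cntLE S[i] (S.take (i + 1)) = i + 1 := by
    unfold cntLE
    rw [List.countP_eq_length.2]
    · simp; omega
    · intro x hx
      obtain ⟨j, hj, rfl⟩ := List.getElem_of_mem hx
      simp only [List.length_take] at hj
      simp only [List.getElem_take, decide_eq_true_eq]
      rcases Nat.lt_or_ge j i with h | h
      · exact (List.pairwise_iff_getElem.1 hlt j i (by omega) hi h).le
      · obtain rfl : j = i := by omega
        exact le_rfl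
  have h2 : cntLE S[i] (S.drop (i + 1)) = 0 := by
    unfold cntLE
    rw [List.countP_eq_zero]
    intro x hx
    obtain ⟨j, hj, rfl⟩ := List.getElem_of_mem hx
    simp only [List.length_drop] at hj
    simp only [List.getElem_drop, decide_eq_true_eq, not_le]
    exact List.pairwise_iff_getElem.1 hlt i (i + 1 + j) hi (by omega) (by omega)
  have h3 := cntLE_append S[i] (S.take (i + 1)) (S.drop (i + 1))
  rwa [List.take_append_drop, h1, h2] at h3

theorem IsSample.nodup {l₀ l : List (ℝ ×ₗ ℕ)} (hS : IsSample T l₀ w err l) (hn : l₀.Nodup) : l.Nodup := by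
  obtain ⟨l', hp, hsl⟩ := hS.sub
  exact hp.nodup_iff.1 (hn.sublist hsl)

theorem exists_cnt_eq (hi_le : ∀ a < R.m, hi a ≤ R.d) :
    ∃ v, ∑ a ∈ Finset.range R.m, R.cnt lo hi a v = R.width lo hi := by
  classical
  obtain ⟨v, hv⟩ := Finset.exists_le ((Finset.range R.m ×ˢ Finset.range R.d).image fun p : ℕ × ℕ => R.key p.1 p.2)
  refine ⟨v, Finset.sum_congr rfl fun a ha => ?_⟩
  have ha := Finset.mem_range.1 ha
  have : R.rank a (Set.Iic v) = R.d := by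
    rw [rank_eq, Finset.filter_true_of_mem, Finset.card_range]
    exact fun u hu => hv _ (Finset.mem_image.2 ⟨(a, u), by simpa [ha] using hu, rfl⟩)
  have := hi_le a ha
  unfold cnt; omega

theorem Sel.high_pivot (hsel : Sel R τ lo hi k) (hh : 0 < h) (hS : IsSample T (R.sample lo hi h R.m) w err S)
    (hs : S.Pairwise (· ≤ ·)) (hi' : k / (h * w) < S.length) :
    τ ≤ S[k / (h * w)] ∧ ∑ a ∈ Finset.range R.m, R.cnt lo hi a S[k / (h * w)] ≤
      k + h * w + h * err + R.m * (h - 1) := by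
  have hw := hS.pos
  have hb := sample_bounds hh hsel.hi_le hS S[k / (h * w)]
  rw [cntLE_getElem hs (IsSample.nodup hS (nodup_sample hh hsel.hi_le)) hi'] at hb
  have hpos : 0 < h * w := Nat.mul_pos hh hw
  have h1 := Nat.lt_mul_div_succ k hpos
  have h2 := Nat.mul_div_le k (h * w)
  have e : h * (w * (k / (h * w) + 1)) = h * w * (k / (h * w)) + h * w := by ring
  rw [e] at hb
  rw [Nat.mul_add, mul_one] at h1
  exact ⟨hsel.pivot_ge (by omega), by omega⟩

theorem Sel.no_high_pivot (hsel : Sel R τ lo hi k) (hh : 0 < h) (hS : IsSample T (R.sample lo hi h R.m) w err S)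
    (hi' : S.length ≤ k / (h * w)) : R.width lo hi ≤ k + h * w + h * err + R.m * (h - 1) := by
  obtain ⟨v, hv⟩ := exists_cnt_eq (lo := lo) hsel.hi_le
  have hb := (sample_bounds hh hsel.hi_le hS v).2
  rw [← hv]
  have h1 : h * (w * cntLE v S) ≤ k := by
    have h2 := Nat.mul_div_le k (h * w)
    calc h * (w * cntLE v S) = h * w * cntLE v S := by ring
      _ ≤ h * w * (k / (h * w)) := Nat.mul_le_mul_left _ ((cntLE_le_length v S).trans hi')
      _ ≤ k := h2
  omega

/-- The number of sample entries that are certainly below the entry of rank `k`. -/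
def lowIndex (m k h w E : ℕ) : ℕ := ((k - m * (h - 1)) / h - E) / w

theorem lowIndex_lt (m k : ℕ) (hh : 0 < h) (hw : 0 < w) (E : ℕ) :
    k < h * (w * lowIndex m k h w E) + h * w + h * E + m * (h - 1) + h := by
  have h1 := Nat.lt_mul_div_succ (k - m * (h - 1)) hh
  have h2 := Nat.lt_mul_div_succ ((k - m * (h - 1)) / h - E) hw
  change _ < w * (lowIndex m k h w E + 1) at h2
  have h3 : h * ((k - m * (h - 1)) / h + 1) ≤ h * (w * lowIndex m k h w E + w + E + 1) :=
    Nat.mul_le_mul_left _ (by rw [Nat.mul_add, mul_one] at h2; omega)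
  have e : h * (w * lowIndex m k h w E + w + E + 1) = h * (w * lowIndex m k h w E) + h * w + h * E + h := by ring
  omega

theorem le_of_lowIndex {m k : ℕ} (hh : 0 < h) (hw : 0 < w) (hj : 0 < lowIndex m k h w E) :
    h * (w * lowIndex m k h w E) + h * E + m * (h - 1) ≤ k := by
  have h1 := Nat.mul_div_le (k - m * (h - 1)) h
  have h2 := Nat.mul_div_le ((k - m * (h - 1)) / h - E) w
  change w * lowIndex m k h w E ≤ _ at h2
  have h3 : 0 < w * lowIndex m k h w E := Nat.mul_pos hw hj
  have h4 : h * (w * lowIndex m k h w E + E) ≤ h * ((k - m * (h - 1)) / h) := Nat.mul_le_mul_left _ (by omega)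
  rw [Nat.mul_add] at h4
  have h5 : 0 < h * (w * lowIndex m k h w E) := Nat.mul_pos hh h3
  omega

theorem Sel.low_pivot (hsel : Sel R τ lo hi k) (hh : 0 < h) (hS : IsSample T (R.sample lo hi h R.m) w err S)
    (hs : S.Pairwise (· ≤ ·)) (hE : err ≤ E) (hj : 0 < lowIndex R.m k h w E) :
    ∃ hlt : lowIndex R.m k h w E - 1 < S.length, S[lowIndex R.m k h w E - 1] < τ ∧
      h * (w * lowIndex R.m k h w E) ≤ ∑ a ∈ Finset.range R.m, R.cnt lo hi a S[lowIndex R.m k h w E - 1] := by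
  have hle := le_of_lowIndex hh hS.pos hj
  have hhE := Nat.mul_le_mul_left h hE
  generalize lowIndex R.m k h w E = j at *
  have hlt : j - 1 < S.length := by
    by_contra hc
    have hk := hsel.lt_width
    have h1 : R.width lo hi ≤ h * (w * S.length) + h * err + R.m * (h - 1) := by
      obtain ⟨v, hv⟩ := exists_cnt_eq (lo := lo) hsel.hi_le
      have hb := (sample_bounds hh hsel.hi_le hS v).2
      rw [← hv]
      refine hb.trans ?_
      have := Nat.mul_le_mul_left h (Nat.mul_le_mul_left w (cntLE_le_length v S))
      omega
    have h2 := Nat.mul_le_mul_left h (Nat.mul_le_mul_left w (show S.length ≤ j by omega))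
    omega
  have hb := sample_bounds hh hsel.hi_le hS S[j - 1]
  rw [cntLE_getElem hs (IsSample.nodup hS (nodup_sample hh hsel.hi_le)) hlt, Nat.sub_add_cancel hj] at hb
  exact ⟨hlt, hsel.pivot_lt (by omega), hb.1⟩

/-- How the width of the segments decreases in one round. -/
theorem width_bound {lo' hi' Cp Cq : ℕ → ℕ} {N W' : ℕ} (hh : 0 < h) (hw : 0 < w)
    (hrow : ∀ a < R.m, hi' a - lo' a + Cq a ≤ Cp a + 2 * (h - 1))
    (hCp : ∑ a ∈ Finset.range R.m, Cp a ≤ k + h * w + h * E + R.m * (h - 1))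
    (hCq : h * (w * lowIndex R.m k h w E) ≤ ∑ a ∈ Finset.range R.m, Cq a)
    (hE : 64 * E ≤ N + 64 * w) (hw2 : 128 * w * w ≤ 128 + 8 * N) (hN : h * N ≤ R.width lo hi)
    (hW' : R.width lo' hi' = W') :
    16 * W' ≤ R.width lo hi + 152 * h + 64 * (R.m * (h - 1)) := by
  have h1 : W' + ∑ a ∈ Finset.range R.m, Cq a ≤ ∑ a ∈ Finset.range R.m, Cp a + R.m * (2 * (h - 1)) := by
    have : R.m * (2 * (h - 1)) = ∑ a ∈ Finset.range R.m, 2 * (h - 1) := by simp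
    rw [← hW', width, this, ← Finset.sum_add_distrib, ← Finset.sum_add_distrib]
    exact Finset.sum_le_sum fun a ha => hrow a (Finset.mem_range.1 ha)
  have h2 := lowIndex_lt R.m k hh hw E
  have e : R.m * (2 * (h - 1)) = 2 * (R.m * (h - 1)) := by ring
  have h3 := Nat.mul_le_mul_left h hE
  have h4 : h * (128 * w) ≤ h * (N + 272) := Nat.mul_le_mul_left _ (by
    zify at hw2 ⊢
    nlinarith [sq_nonneg ((w : ℤ) - 4)])
  have e1 : h * (64 * E) = 64 * (h * E) := by ring
  have e2 : h * (N + 64 * w) = h * N + 64 * (h * w) := by ring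
  have e3 : h * (128 * w) = 128 * (h * w) := by ring
  have e4 : h * (N + 272) = h * N + 272 * h := by ring
  omega

end Sel
end Rows

end RealRAM

namespace RealRAM

/-! ## Loops over the rows -/

/-- Call `body` for the rows `0, …, w2 - 1`. Row `a` is given by the memory cell at `w10 + a * w7`
and the next cell, which hold the addresses of two records. The words at `w14 + a` and `w15 + a`
delimit a segment of the row. -/
def rowLoop (body : Stmt) : Stmt :=
  .wset 80 0 ;;
  .wset 81 (.reg 10) ;;
  .wset 84 0 ;;
  .loop (.wlt (.reg 80) (.reg 2))
    (.wset 82 (.mem (.reg 81)) ;;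
    .wset 83 (.mem (.reg 81 + 1)) ;;
    .wset 85 (.mem (.reg 14 + .reg 80)) ;;
    .wset 86 (.mem (.reg 15 + .reg 80)) ;;
    body ;;
    .wset 80 (.reg 80 + 1) ;;
    .wset 81 (.reg 81 + .reg 7) ;;
    .wset 84 (.reg 84 + .reg 1))

/-- The rows `R` are accessible through the records in memory. -/
structure RowsAt (R : Rows) (B : ℕ) (σ : St) : Prop where
  d : σ.w 1 = R.d
  m : σ.w 2 = R.m
  slot : ∀ a < R.m, σ.w 10 + a * σ.w 7 + 1 < σ.w 99
  x : ∀ a < R.m, σ.wm (σ.w 10 + a * σ.w 7) + R.d < σ.w 99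
  y : ∀ a < R.m, σ.wm (σ.w 10 + a * σ.w 7 + 1) + R.d < σ.w 99
  val : ∀ a < R.m, ∀ u < R.d, R.val a u =
    (σ.rm (σ.wm (σ.w 10 + a * σ.w 7 + 1) + u + 1) - σ.rm (σ.wm (σ.w 10 + a * σ.w 7 + 1) + u)) -
    (σ.rm (σ.wm (σ.w 10 + a * σ.w 7) + u + 1) - σ.rm (σ.wm (σ.w 10 + a * σ.w 7) + u))
  big : σ.w 10 + R.m * σ.w 7 + R.m * R.d + 2 * R.d < B

theorem RowsAt.keeps {R : Rows} {B : ℕ} {σ τ : St} (h : RowsAt R B σ) (hK : Keeps 13 σ τ) : RowsAt R B τ := by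
  have hal := hK.al
  constructor
  · rw [hK.w 1, h.d]
  · rw [hK.w 2, h.m]
  · intro a ha
    rw [hK.w 10, hK.w 7]
    have := h.slot a ha
    omega
  · intro a ha
    have := h.slot a ha
    have := h.x a ha
    rw [hK.w 10, hK.w 7, hK.wm _ (by omega)]
    omega
  · intro a ha
    have := h.slot a ha
    have := h.y a ha
    rw [hK.w 10, hK.w 7, hK.wm _ (by omega)]
    omega
  · intro a ha u hu
    have := h.slot a ha
    have := h.x a ha
    have := h.y a ha
    rw [hK.w 10, hK.w 7, hK.wm _ (by omega), hK.wm _ (by omega), hK.rm _ (by omega),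
      hK.rm _ (by omega), hK.rm _ (by omega), hK.rm _ (by omega)]
    exact h.val a ha u hu
  · rw [hK.w 10, hK.w 7]
    exact h.big

/-- The variables of `rowLoop` describe row `a`. -/
structure InRow (R : Rows) (B a : ℕ) (τ : St) : Prop where
  lt : a < R.m
  d : τ.w 1 = R.d
  label : τ.w 84 = a * R.d
  x : τ.w 82 + R.d < τ.w 99
  y : τ.w 83 + R.d < τ.w 99
  val : ∀ u < R.d, R.val a u =
    (τ.rm (τ.w 83 + u + 1) - τ.rm (τ.w 83 + u)) - (τ.rm (τ.w 82 + u + 1) - τ.rm (τ.w 82 + u))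
  big : a * R.d + 2 * R.d < B

theorem InRow.keeps {R : Rows} {B a : ℕ} {σ τ : St} (h : InRow R B a σ) (hK : Keeps 87 σ τ) : InRow R B a τ := by
  have hal := hK.al
  have hx := h.x
  have hy := h.y
  constructor
  · exact h.lt
  · rw [hK.w 1, h.d]
  · rw [hK.w 84, h.label]
  · rw [hK.w 82]; omega
  · rw [hK.w 83]; omega
  · intro u hu
    rw [hK.w 82, hK.w 83, hK.rm _ (by omega), hK.rm _ (by omega), hK.rm _ (by omega),
      hK.rm _ (by omega)]
    exact h.val u hu
  · exact h.big

theorem rowLoop_spec {B : ℕ} {Q : ℕ → St → Prop} {body : Stmt} {R : Rows} (σ : St) (I : ℕ → St → Prop)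
    (cst : ℕ → ℕ) (hR : RowsAt R B σ) (hlo : σ.w 14 + R.m ≤ σ.w 99) (hhi : σ.w 15 + R.m ≤ σ.w 99)
    (hB : σ.w 99 < B)
    (hI : ∀ a τ i v, 80 ≤ i → i < 87 → I a τ → I a (τ.setW i v)) (h0 : I 0 σ)
    (hbody : ∀ a τ, InRow R B a τ → Keeps 80 σ τ → τ.w 85 = σ.wm (σ.w 14 + a) → τ.w 86 = σ.wm (σ.w 15 + a) →
      I a τ → wp B body (fun t υ => Keeps 87 τ υ ∧ I (a + 1) υ ∧ t ≤ cst a) τ)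
    (hQ : ∀ t τ, Keeps 80 σ τ → I R.m τ → t ≤ ∑ a ∈ Finset.range R.m, cst a + 40 * R.m + 10 → Q t τ) :
    wp B (rowLoop body) Q σ := by
  unfold rowLoop
  simp only [wp_seq, wp_wset, rules, true_and]
  refine ⟨by omega, by omega, ?_⟩
  generalize h1 : ((σ.setW 80 0).setW 81 _).setW 84 0 = σ1
  refine wp_loop (fun (b : ℕ) τ => Keeps 80 σ τ ∧ τ.w 80 + b = R.m ∧ τ.w 81 = σ.w 10 + τ.w 80 * σ.w 7 ∧
    τ.w 84 = τ.w 80 * R.d ∧ I (τ.w 80) τ)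
    (fun b => ∑ a ∈ Finset.Ico (R.m - b) R.m, cst a + 40 * b) ?_ ?_ R.m ?_ ?_
  · intros; simp
  · rintro b τ ⟨hK, hb, h81, h84, hIa⟩ hc
    simp only [rules] at hc
    rw [hK.w 2, hR.m] at hc
    generalize ha : τ.w 80 = a at *
    generalize hQ' : (fun (k : ℕ) (τ' : St) => ∃ a', _ ∧ _) = Q'
    have hs := hR.slot a hc
    have hmul : (a + 1) * σ.w 7 ≤ R.m * σ.w 7 := Nat.mul_le_mul_right _ hc
    have hmul2 : (a + 1) * R.d ≤ R.m * R.d := Nat.mul_le_mul_right _ hc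
    have hbig := hR.big
    rw [Nat.add_mul, one_mul] at hmul hmul2
    have hK13 : Keeps 13 σ τ := hK.mono
    simp only [wp_seq, wp_wset, rules, true_and, St.setW_w, St.setW_wm]
    simp only [Nat.reduceEqDiff, if_false, h81, ha, hK.w 14, hK.w 15]
    rw [hK.wm _ (by omega), hK.wm _ (by omega), hK.wm (σ.w 14 + a) (by omega), hK.wm (σ.w 15 + a) (by omega)]
    refine ⟨by omega, by omega, by omega, ?_⟩
    generalize h2 : (((τ.setW 82 _).setW 83 _).setW 85 _).setW 86 _ = τ2
    have hK2 : Keeps 80 σ τ2 := by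
      rw [← h2]
      exact (((hK.setW).setW).setW).setW
    have hal := hK2.al
    refine wp_mono (hbody a τ2 ?_ hK2 (by simp [← h2]) (by simp [← h2]) ?_) ?_
    · have hx := hR.x a hc
      have hy := hR.y a hc
      constructor
      · exact hc
      · rw [hK2.w 1, hR.d]
      · simp [← h2, h84]
      · have : τ2.w 82 = σ.wm (σ.w 10 + a * σ.w 7) := by simp [← h2]
        omega
      · have : τ2.w 83 = σ.wm (σ.w 10 + a * σ.w 7 + 1) := by simp [← h2]
        omega
      · intro u hu
        have e1 : τ2.w 82 = σ.wm (σ.w 10 + a * σ.w 7) := by simp [← h2]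
        have e2 : τ2.w 83 = σ.wm (σ.w 10 + a * σ.w 7 + 1) := by simp [← h2]
        rw [e1, e2, hK2.rm _ (by omega), hK2.rm _ (by omega), hK2.rm _ (by omega), hK2.rm _ (by omega)]
        exact hR.val a hc u hu
      · omega
    · rw [← h2]
      exact hI _ _ _ _ (by omega) (by omega) (hI _ _ _ _ (by omega) (by omega) (hI _ _ _ _ (by omega) (by omega)
        (hI _ _ _ _ (by omega) (by omega) hIa)))
    · rintro t υ ⟨hKυ, hIυ, ht⟩
      have e80 : υ.w 80 = a := by rw [hKυ.w 80]; simp [← h2, ha]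
      have e81 : υ.w 81 = σ.w 10 + a * σ.w 7 := by rw [hKυ.w 81]; simp [← h2, h81]
      have e84 : υ.w 84 = a * R.d := by rw [hKυ.w 84]; simp [← h2, h84]
      have e7 : υ.w 7 = σ.w 7 := by rw [hKυ.w 7, hK2.w 7]
      have e1 : υ.w 1 = R.d := by rw [hKυ.w 1, hK2.w 1, hR.d]
      simp only [e80, e81, e84, e7, e1]
      refine ⟨by omega, by omega, by omega, ?_⟩
      rw [← hQ']
      refine ⟨b - 1, ⟨?_, ?_, ?_, ?_, ?_⟩, ?_⟩
      · exact ((((hK2.trans (hKυ.mono)).setW).setW).setW)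
      · simp; omega
      · simp; ring
      · simp; ring
      · simp only [St.setW_w, Nat.reduceEqDiff, if_true, if_false]
        exact hI _ _ _ _ (by omega) (by omega) (hI _ _ _ _ (by omega) (by omega) (hI _ _ _ _ (by omega) (by omega) hIυ))
      · have e1 : R.m - b = a := by omega
        have e2 : R.m - (b - 1) = a + 1 := by omega
        rw [e1, e2, Finset.sum_eq_sum_Ico_succ_bot hc]
        simp only [rules]
        omega
  · refine ⟨?_, by simp [← h1], by simp [← h1], by simp [← h1], ?_⟩
    · rw [← h1]
      exact ((Keeps.rfl'.setW).setW).setW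
    · have : σ1.w 80 = 0 := by simp [← h1]
      rw [this, ← h1]
      exact hI _ _ _ _ (by omega) (by omega) (hI _ _ _ _ (by omega) (by omega) (hI _ _ _ _ (by omega) (by omega) h0))
  · rintro b t τ ⟨hK, hb, h81, h84, hIa⟩ hc ht
    simp only [rules, not_lt] at hc ht
    rw [hK.w 2, hR.m] at hc
    obtain rfl : b = 0 := by omega
    rw [add_zero] at hb
    rw [hb] at hIa
    rw [Nat.sub_self, ← Finset.range_eq_Ico] at ht
    exact hQ _ τ hK hIa (by omega)

/-- The entry `u` of the current row. -/
def keyVal (u : WExp) : RExp :=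
  (.mem (.reg 83 + u + 1) - .mem (.reg 83 + u)) - (.mem (.reg 82 + u + 1) - .mem (.reg 82 + u))

/-- The entry `u` of the current row is greater than the pivot. -/
def keyGt (u : WExp) : Cond :=
  .not (.and (.not (.rlt (.reg 20) (keyVal u)))
    (.not (.and (.not (.rlt (keyVal u) (.reg 20))) (.wlt (.reg 19) (.reg 84 + u)))))

theorem keyVal_eval {R : Rows} {B a : ℕ} {τ : St} (h : InRow R B a τ) {u : WExp} (hu : u.eval τ < R.d) :
    (keyVal u).eval τ = R.val a (u.eval τ) := by
  rw [h.val _ hu]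
  simp [keyVal]

theorem keyVal_ok {R : Rows} {B a : ℕ} {τ : St} (h : InRow R B a τ) {u : WExp} (hu : u.eval τ < R.d)
    (hok : u.ok B τ) (hB : τ.w 99 < B) : (keyVal u).ok B τ := by
  have := h.x
  have := h.y
  simp [keyVal, hok]
  omega

theorem keyVal_cost (u : WExp) : (keyVal u).cost = 4 * u.cost + 19 := by
  simp [keyVal]; omega

theorem keyGt_eval {R : Rows} {B a : ℕ} {τ : St} (h : InRow R B a τ) {u : WExp} (hu : u.eval τ < R.d) :
    (keyGt u).eval τ ↔ toLex (τ.r 20, τ.w 19) < R.key a (u.eval τ) := by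
  simp only [keyGt, rules, keyVal_eval h hu, h.label, Rows.key, Prod.Lex.toLex_lt_toLex]
  rcases lt_trichotomy (τ.r 20) (R.val a (u.eval τ)) with h1 | h1 | h1
  · simp [h1]
  · simp [h1]
  · simp [h1, h1.not_gt, h1.ne']

theorem keyGt_ok {R : Rows} {B a : ℕ} {τ : St} (h : InRow R B a τ) {u : WExp} (hu : u.eval τ < R.d)
    (hok : u.ok B τ) (hB : τ.w 99 < B) : (keyGt u).ok B τ := by
  have := h.big
  have := h.label
  simp [keyGt, rules, hok, keyVal_ok h hu hok hB]
  omega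

theorem keyGt_cost (u : WExp) : (keyGt u).cost ≤ 9 * u.cost + 60 := by
  simp [keyGt, rules, keyVal_cost]; omega

end RealRAM

namespace RealRAM

/-- Append every `w17`-th entry of the segment to the memory. -/
def sampleBody : Stmt :=
  .wset 87 (.reg 85 + .reg 17) ;;
  .loop (.not (.wlt (.reg 86) (.reg 87)))
    (.rput (.reg 99) (keyVal (.reg 87 - 1)) ;;
    .wput (.reg 99) (.reg 84 + (.reg 87 - 1)) ;;
    .wset 99 (.reg 99 + 1) ;;
    .wset 87 (.reg 87 + .reg 17))

/-- Shorten the segment from above in steps of `w17` as long as the entries exceed the pivot, and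
append the new end to the memory. -/
def cutHighBody : Stmt :=
  .wset 87 (.reg 86) ;;
  .loop (.and (.not (.wlt (.reg 87) (.reg 85 + .reg 17))) (keyGt (.reg 87 - .reg 17)))
    (.wset 87 (.reg 87 - .reg 17)) ;;
  .wput (.reg 99) (.reg 87) ;;
  .wset 99 (.reg 99 + 1)

/-- Shorten the segment from below in steps of `w17` as long as the entries do not exceed the pivot,
append the new start to the memory and count the deleted entries. -/
def cutLowBody : Stmt :=
  .wset 87 (.reg 85) ;;
  .loop (.and (.not (.wlt (.reg 86) (.reg 87 + .reg 17))) (.not (keyGt (.reg 87 + .reg 17 - 1))))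
    (.wset 87 (.reg 87 + .reg 17)) ;;
  .wput (.reg 99) (.reg 87) ;;
  .wset 99 (.reg 99 + 1) ;;
  .wset 88 (.reg 88 + (.reg 87 - .reg 85))

section bodies
variable {B a h : ℕ} {R : Rows} {lo hi : ℕ → ℕ}

theorem sampleBody_spec (hh : 0 < h) (hd : h ≤ R.d) (τ : St) (hr : InRow R B a τ) (h85 : τ.w 85 = lo a)
    (h86 : τ.w 86 = hi a) (hlo : lo a ≤ hi a) (hhi : hi a ≤ R.d) (h17 : τ.w 17 = h)
    (hB : τ.w 99 + (hi a - lo a) / h + 1 < B) :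
    wp B sampleBody (fun t υ => Keeps 87 τ υ ∧ υ.w 99 = τ.w 99 + (hi a - lo a) / h ∧
      arr υ.cell (τ.w 99) ((hi a - lo a) / h) = R.sampleRow lo hi h a ∧
      t ≤ 70 * ((hi a - lo a) / h) + 20) τ := by
  unfold sampleBody Rows.sampleRow
  have hbig := hr.big
  generalize hn : (hi a - lo a) / h = n at *
  have hdm := Nat.mul_div_le (hi a - lo a) h
  have hlt := Nat.lt_mul_div_succ (hi a - lo a) hh
  rw [hn] at hdm hlt
  simp only [wp_seq, wp_wset, rules, true_and, h85, h17]
  refine ⟨by omega, ?_⟩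
  refine wp_loop (fun (i : ℕ) υ => Keeps 87 τ υ ∧ υ.w 87 = lo a + i * h + h ∧ υ.w 99 = τ.w 99 + i ∧ i ≤ n ∧
    arr υ.cell (τ.w 99) i = (List.range i).map fun i => R.key a (lo a + i * h + (h - 1)))
    (fun i => 70 * (n - i)) ?_ ?_ 0 ?_ ?_
  · intros; simp [rules]
  · rintro i υ ⟨hK, e87, e99, hin, harr⟩ hc
    simp only [rules, hK.w 86, h86, e87, not_lt] at hc
    have hi' : i < n := by
      by_contra hcon
      obtain rfl : i = n := by omega
      rw [Nat.mul_add, mul_one, mul_comm] at hlt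
      omega
    generalize hQ' : (fun (k : ℕ) (τ' : St) => ∃ a', _ ∧ _) = Q'
    have hrow := hr.keeps hK
    have hbig' := hrow.big
    have hlab := hrow.label
    have e17 := hK.w 17
    have e84 := hK.w 84
    have heval : (WExp.reg 87 - 1).eval υ = lo a + i * h + (h - 1) := by simp [e87]; omega
    have hok := keyVal_ok hrow (u := .reg 87 - 1) (by rw [heval]; omega) (by simp; omega) (by omega)
    simp only [wp_seq, wp_rput, wp_wput, wp_wset, rules, true_and, hok,
        keyVal_eval hrow (show (WExp.reg 87 - 1).eval υ < R.d by rw [heval]; omega), heval, and_true]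
    simp only [St.putW_w, St.putR_w, St.setW_w, Nat.reduceEqDiff, if_false, e87, e99, e17, h17, hlab]
    refine ⟨by omega, by omega, by omega, ?_⟩
    rw [← hQ']
    refine ⟨i + 1, ⟨?_, ?_, ?_, hi', ?_⟩, ?_⟩
    · exact ((((hK.putR (by omega)).putW (by omega)).setAl (by omega)).setW)
    · simp; ring
    · simp; omega
    · rw [arr_succ, List.range_succ, List.map_append, ← harr]
      congr 1
      · refine arr_congr fun p _ hp => ?_
        have h1 : p ≠ τ.w 99 + i := by omega
        simp [St.cell, h1]
      · have : lo a + i * h + h - 1 = lo a + i * h + (h - 1) := by omega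
        simp [St.cell, Rows.key, this]
    · simp only [rules, keyVal_cost]
      omega
  · exact ⟨Keeps.rfl'.setW, by simp, by simp, by omega, by simp⟩
  · rintro i t υ ⟨hK, e87, e99, hin, harr⟩ hc ht
    simp only [rules, hK.w 86, h86, e87, not_lt, not_le] at hc ht
    have hi' : i = n := by
      by_contra hcon
      have : h * (i + 1) ≤ h * n := Nat.mul_le_mul_left _ (by omega)
      rw [Nat.mul_add, mul_one, mul_comm] at this
      omega
    subst hi'
    exact ⟨hK, e99, harr, by omega⟩

/-- `f` is a new end of the segment from `lo` to `hi` after cutting off entries that are greater than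
the pivot, when `r` entries of the row are not. -/
structure CutHigh (h lo hi r f : ℕ) : Prop where
  le : f ≤ hi
  ge : lo ≤ f
  rank : min r hi ≤ f
  lt : f < lo + h ∨ f < r + h

/-- `f` is a new start of the segment from `lo` to `hi` after cutting off entries that are not greater
than the pivot. -/
structure CutLow (h lo hi r f : ℕ) : Prop where
  le : f ≤ hi
  ge : lo ≤ f
  rank : f = lo ∨ f ≤ r
  lt : hi < f + h ∨ r < f + h

theorem cutHighBody_spec (hh : 0 < h) (hd : h ≤ R.d) (τ : St) (hr : InRow R B a τ) (h85 : τ.w 85 = lo a)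
    (h86 : τ.w 86 = hi a) (hlo : lo a ≤ hi a) (hhi : hi a ≤ R.d) (h17 : τ.w 17 = h) (hB : τ.w 99 + 1 < B) :
    wp B cutHighBody (fun t υ => Keeps 87 τ υ ∧ υ.w 99 = τ.w 99 + 1 ∧
      CutHigh h (lo a) (hi a) (R.rank a (Set.Iic (toLex (τ.r 20, τ.w 19)))) (υ.wm (τ.w 99)) ∧
      (∀ p < τ.w 99, υ.wm p = τ.wm p) ∧ t ≤ 100 * ((hi a - lo a) / h) + 120) τ := by
  unfold cutHighBody
  have hbig := hr.big
  simp only [wp_seq, wp_wset, rules, true_and, h86]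
  refine wp_loop (fun (i : ℕ) υ => Keeps 87 τ υ ∧ υ.w 99 = τ.w 99 ∧ υ.w 87 = i ∧ i ≤ hi a ∧ lo a ≤ i ∧
    min (R.rank a (Set.Iic (toLex (τ.r 20, τ.w 19)))) (hi a) ≤ i) (fun i => 100 * ((i - lo a) / h)) ?_ ?_ (hi a) ?_ ?_
  · rintro i υ ⟨hK, e99, e87, h1, h2, h3⟩
    have hrow := hr.keeps hK
    have hx := hrow.x
    simp only [rules, true_and, hK.w 85, hK.w 17, h85, h17, e87, not_lt]
    refine ⟨by omega, fun hle => keyGt_ok hrow ?_ (by simp) (by omega)⟩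
    simp [e87, hK.w 17, h17]; omega
  · rintro i υ ⟨hK, e99, e87, h1, h2, h3⟩ hc
    have hrow := hr.keeps hK
    simp only [rules, hK.w 85, hK.w 17, h85, h17, e87, not_lt] at hc
    have hev : (WExp.reg 87 - WExp.reg 17).eval υ = i - h := by simp [e87, hK.w 17, h17]
    have hlt : i - h < R.d := by omega
    rw [keyGt_eval hrow (by rwa [hev]), hev, hK.r 20, hK.w 19] at hc
    simp only [wp_wset, rules, true_and, hev]
    refine ⟨i - h, ⟨hK.setW, by simpa using e99, by simp, by omega, by omega, ?_⟩, ?_⟩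
    · have := (Rows.lt_rank (R := R) (isLowerSet_Iic (toLex (τ.r 20, τ.w 19))) hr.lt hlt).not.2 (by
        rw [Set.mem_Iic]; exact not_le.2 hc.2)
      omega
    · have e : (i - lo a) / h = (i - h - lo a) / h + 1 := by
        rw [show i - lo a = i - h - lo a + h by omega, Nat.add_div_right _ hh]
      have hcost := keyGt_cost (WExp.reg 87 - WExp.reg 17)
      simp only [rules] at hcost ⊢
      omega
  · exact ⟨Keeps.rfl'.setW, by simp, by simp, le_rfl, hlo, min_le_right _ _⟩
  · rintro i t υ ⟨hK, e99, e87, h1, h2, h3⟩ hc ht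
    have hrow := hr.keeps hK
    simp only [rules, hK.w 85, hK.w 17, h85, h17, e87, not_lt] at hc
    have hev : (WExp.reg 87 - WExp.reg 17).eval υ = i - h := by simp [e87, hK.w 17, h17]
    have hcost := keyGt_cost (WExp.reg 87 - WExp.reg 17)
    simp only [rules] at hcost ht
    simp only [wp_wput, rules, true_and, St.putW_w, e99, e87]
    refine ⟨by omega, (hK.putW (by omega)).setAl (by omega), by simp, ?_, ?_, by omega⟩
    · simp only [St.setW_wm, St.putW_wm, if_true]
      refine ⟨h1, h2, h3, ?_⟩
      by_contra hcon
      push Not at hcon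
      have hlt : i - h < R.d := by omega
      refine hc ⟨by omega, ?_⟩
      rw [keyGt_eval hrow (by rwa [hev]), hev, hK.r 20, hK.w 19]
      have := (Rows.lt_rank (R := R) (isLowerSet_Iic (toLex (τ.r 20, τ.w 19))) hr.lt hlt).not.1 (by omega)
      rw [Set.mem_Iic] at this
      exact not_le.1 this
    · intro p hp
      simp [show p ≠ τ.w 99 by omega, hK.wm p hp]

theorem cutLowBody_spec (hh : 0 < h) (hd : h ≤ R.d) (τ : St) (hr : InRow R B a τ) (h85 : τ.w 85 = lo a)
    (h86 : τ.w 86 = hi a) (hlo : lo a ≤ hi a) (hhi : hi a ≤ R.d) (h17 : τ.w 17 = h) (hB : τ.w 99 + 1 < B)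
    (h88 : τ.w 88 + R.d < B) :
    wp B cutLowBody (fun t υ => Keeps 87 τ υ ∧ υ.w 99 = τ.w 99 + 1 ∧
      CutLow h (lo a) (hi a) (R.rank a (Set.Iic (toLex (τ.r 20, τ.w 19)))) (υ.wm (τ.w 99)) ∧
      (∀ p < τ.w 99, υ.wm p = τ.wm p) ∧ υ.w 88 = τ.w 88 + (υ.wm (τ.w 99) - lo a) ∧
      t ≤ 120 * ((hi a - lo a) / h) + 140) τ := by
  unfold cutLowBody
  have hbig := hr.big
  simp only [wp_seq, wp_wset, rules, true_and, h85]
  refine wp_loop (fun (i : ℕ) υ => Keeps 87 τ υ ∧ υ.w 99 = τ.w 99 ∧ υ.w 88 = τ.w 88 ∧ υ.w 87 = i ∧ i ≤ hi a ∧ lo a ≤ i ∧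
    (i = lo a ∨ i ≤ R.rank a (Set.Iic (toLex (τ.r 20, τ.w 19))))) (fun i => 120 * ((hi a - i) / h)) ?_ ?_ (lo a) ?_ ?_
  · rintro i υ ⟨hK, e99, e88, e87, h1, h2, h3⟩
    have hrow := hr.keeps hK
    have hx := hrow.x
    simp only [rules, true_and, hK.w 86, hK.w 17, h86, h17, e87, not_lt]
    refine ⟨by omega, fun hle => keyGt_ok hrow ?_ ?_ (by omega)⟩
    · simp [e87, hK.w 17, h17]; omega
    · simp [e87, hK.w 17, h17]; omega
  · rintro i υ ⟨hK, e99, e88, e87, h1, h2, h3⟩ hc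
    have hrow := hr.keeps hK
    simp only [rules, hK.w 86, hK.w 17, h86, h17, e87, not_lt] at hc
    have hev : (WExp.reg 87 + WExp.reg 17 - 1).eval υ = i + h - 1 := by simp [e87, hK.w 17, h17]
    have hlt : i + h - 1 < R.d := by omega
    rw [keyGt_eval hrow (by rwa [hev]), hev, hK.r 20, hK.w 19] at hc
    simp only [wp_wset, rules, true_and, e87, hK.w 17, h17]
    refine ⟨by omega, i + h, ⟨hK.setW, by simpa using e99, by simpa using e88, by simp, by omega,
        by omega, ?_⟩, ?_⟩
    · have := (Rows.lt_rank (R := R) (isLowerSet_Iic (toLex (τ.r 20, τ.w 19))) hr.lt hlt).2 (by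
        rw [Set.mem_Iic]; exact not_lt.1 hc.2)
      omega
    · have e : (hi a - i) / h = (hi a - (i + h)) / h + 1 := by
        rw [show hi a - i = hi a - (i + h) + h by omega, Nat.add_div_right _ hh]
      have hcost := keyGt_cost (WExp.reg 87 + WExp.reg 17 - 1)
      simp only [rules] at hcost ⊢
      omega
  · exact ⟨Keeps.rfl'.setW, by simp, by simp, by simp, hlo, le_rfl, Or.inl rfl⟩
  · rintro i t υ ⟨hK, e99, e88, e87, h1, h2, h3⟩ hc ht
    have hrow := hr.keeps hK
    simp only [rules, hK.w 86, hK.w 17, h86, h17, e87, not_lt] at hc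
    have hev : (WExp.reg 87 + WExp.reg 17 - 1).eval υ = i + h - 1 := by simp [e87, hK.w 17, h17]
    have hcost := keyGt_cost (WExp.reg 87 + WExp.reg 17 - 1)
    have e85 := hK.w 85
    simp only [rules] at hcost ht
    simp only [wp_wput, rules, true_and, St.putW_w, St.setW_w, e99, e87]
    simp only [Nat.reduceEqDiff, if_false, e88, e85, h85]
    refine ⟨by omega, by omega, ((hK.putW (by omega)).setAl (by omega)).setW, by simp, ?_, ?_,
        by simp, by omega⟩
    · simp only [St.setW_wm, St.putW_wm, if_true]
      refine ⟨h1, h2, h3, ?_⟩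
      by_contra hcon
      push Not at hcon
      have hlt : i + h - 1 < R.d := by omega
      refine hc ⟨by omega, ?_⟩
      rw [keyGt_eval hrow (by rwa [hev]), hev, hK.r 20, hK.w 19]
      have := (Rows.lt_rank (R := R) (isLowerSet_Iic (toLex (τ.r 20, τ.w 19))) hr.lt hlt).1 (by omega)
      rw [Set.mem_Iic] at this
      exact not_lt.2 this
    · intro p hp
      simp [show p ≠ τ.w 99 by omega, hK.wm p hp]

end bodies

section rows
variable {B h : ℕ} {R : Rows} {Q : ℕ → St → Prop}

theorem sampleRows_spec (σ : St) (lo hi : ℕ → ℕ) (hh : 0 < h) (hd : h ≤ R.d) (hR : RowsAt R B σ)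
    (hlo : σ.w 14 + R.m ≤ σ.w 99) (hhi : σ.w 15 + R.m ≤ σ.w 99) (h14 : ∀ a < R.m, σ.wm (σ.w 14 + a) = lo a)
    (h15 : ∀ a < R.m, σ.wm (σ.w 15 + a) = hi a) (h1 : ∀ a < R.m, lo a ≤ hi a) (h2 : ∀ a < R.m, hi a ≤ R.d)
    (h17 : σ.w 17 = h) (hB : σ.w 99 + (R.sample lo hi h R.m).length + 1 < B)
    (hQ : ∀ t τ, Keeps 80 σ τ → τ.w 99 = σ.w 99 + (R.sample lo hi h R.m).length →
      arr τ.cell (σ.w 99) (R.sample lo hi h R.m).length = R.sample lo hi h R.m →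
      t ≤ 70 * (R.sample lo hi h R.m).length + 60 * R.m + 10 → Q t τ) :
    wp B (rowLoop sampleBody) Q σ := by
  have hmono : ∀ a < R.m, (R.sample lo hi h a).length + (hi a - lo a) / h ≤ (R.sample lo hi h R.m).length := by
    intro a ha
    rw [Rows.length_sample, Rows.length_sample, ← Finset.sum_range_succ (fun a => (hi a - lo a) / h)]
    exact Finset.sum_le_sum_of_subset (by simpa using ha)
  refine rowLoop_spec σ (fun a τ => τ.w 99 = σ.w 99 + (R.sample lo hi h a).length ∧
    arr τ.cell (σ.w 99) (R.sample lo hi h a).length = R.sample lo hi h a)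
    (fun a => 70 * ((hi a - lo a) / h) + 20) hR hlo hhi (by omega) ?_ ?_ ?_ ?_
  · rintro a τ i v h80 h87 ⟨h3, h4⟩
    exact ⟨by simp [show 99 ≠ i by omega, h3], by simpa using h4⟩
  · simp [Rows.sample]
  · rintro a τ hr hK h85 h86 ⟨h3, h4⟩
    have := hmono a hr.lt
    rw [h14 a hr.lt] at h85
    rw [h15 a hr.lt] at h86
    refine wp_mono (sampleBody_spec hh hd τ hr h85 h86 (h1 a hr.lt) (h2 a hr.lt) (by rw [hK.w 17, h17])
      (by omega)) ?_
    rintro t υ ⟨hKυ, h5, h6, h7⟩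
    have hl : (R.sampleRow lo hi h a).length = (hi a - lo a) / h := by simp [Rows.sampleRow]
    refine ⟨hKυ, ⟨?_, ?_⟩, h7⟩
    · rw [h5, h3, Rows.sample_succ, List.length_append, hl, add_assoc]
    · rw [Rows.sample_succ, List.length_append, hl, arr_add, hKυ.arr_cell (by omega), h4, ← h3, h6]
  · rintro t τ hK ⟨h3, h4⟩ ht
    refine hQ t τ hK h3 h4 (ht.trans ?_)
    rw [Finset.sum_add_distrib, ← Finset.mul_sum, ← Rows.length_sample (R := R)]
    simp
    omega

theorem cutHighRows_spec (σ : St) (lo hi : ℕ → ℕ) (hh : 0 < h) (hd : h ≤ R.d) (hR : RowsAt R B σ)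
    (hlo : σ.w 14 + R.m ≤ σ.w 99) (hhi : σ.w 15 + R.m ≤ σ.w 99) (h14 : ∀ a < R.m, σ.wm (σ.w 14 + a) = lo a)
    (h15 : ∀ a < R.m, σ.wm (σ.w 15 + a) = hi a) (h1 : ∀ a < R.m, lo a ≤ hi a) (h2 : ∀ a < R.m, hi a ≤ R.d)
    (h17 : σ.w 17 = h) (hB : σ.w 99 + R.m + 1 < B)
    (hQ : ∀ t τ, Keeps 80 σ τ → τ.w 99 = σ.w 99 + R.m →
      (∀ a < R.m, CutHigh h (lo a) (hi a) (R.rank a (Set.Iic (toLex (σ.r 20, σ.w 19)))) (τ.wm (σ.w 99 + a))) →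
      t ≤ 100 * (R.sample lo hi h R.m).length + 160 * R.m + 10 → Q t τ) :
    wp B (rowLoop cutHighBody) Q σ := by
  refine rowLoop_spec σ (fun a τ => τ.w 99 = σ.w 99 + a ∧
    ∀ b < a, CutHigh h (lo b) (hi b) (R.rank b (Set.Iic (toLex (σ.r 20, σ.w 19)))) (τ.wm (σ.w 99 + b)))
    (fun a => 100 * ((hi a - lo a) / h) + 120) hR hlo hhi (by omega) ?_ ?_ ?_ ?_
  · rintro a τ i v h80 h87 ⟨h3, h4⟩
    exact ⟨by simp [show 99 ≠ i by omega, h3], by simpa using h4⟩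
  · simp
  · rintro a τ hr hK h85 h86 ⟨h3, h4⟩
    have := hr.lt
    rw [h14 a hr.lt] at h85
    rw [h15 a hr.lt] at h86
    refine wp_mono (cutHighBody_spec hh hd τ hr h85 h86 (h1 a hr.lt) (h2 a hr.lt) (by rw [hK.w 17, h17])
      (by omega)) ?_
    rintro t υ ⟨hKυ, h5, h6, h7, h8⟩
    rw [hK.r 20, hK.w 19] at h6
    refine ⟨hKυ, ⟨by omega, fun b hb => ?_⟩, h8⟩
    rcases (Nat.lt_succ_iff_lt_or_eq.1 hb) with hb | rfl
    · rw [h7 _ (by omega)]; exact h4 b hb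
    · rw [← h3]; exact h6
  · rintro t τ hK ⟨h3, h4⟩ ht
    refine hQ t τ hK h3 h4 (ht.trans ?_)
    rw [Finset.sum_add_distrib, ← Finset.mul_sum, ← Rows.length_sample (R := R)]
    simp
    omega

theorem cutLowRows_spec (σ : St) (lo hi : ℕ → ℕ) (hh : 0 < h) (hd : h ≤ R.d) (hR : RowsAt R B σ)
    (hlo : σ.w 14 + R.m ≤ σ.w 99) (hhi : σ.w 15 + R.m ≤ σ.w 99) (h14 : ∀ a < R.m, σ.wm (σ.w 14 + a) = lo a)
    (h15 : ∀ a < R.m, σ.wm (σ.w 15 + a) = hi a) (h1 : ∀ a < R.m, lo a ≤ hi a) (h2 : ∀ a < R.m, hi a ≤ R.d)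
    (h17 : σ.w 17 = h) (h88 : σ.w 88 = 0) (hB : σ.w 99 + R.m + 1 < B)
    (hQ : ∀ t τ, Keeps 80 σ τ → τ.w 99 = σ.w 99 + R.m →
      (∀ a < R.m, CutLow h (lo a) (hi a) (R.rank a (Set.Iic (toLex (σ.r 20, σ.w 19)))) (τ.wm (σ.w 99 + a))) →
      τ.w 88 = ∑ a ∈ Finset.range R.m, (τ.wm (σ.w 99 + a) - lo a) →
      t ≤ 120 * (R.sample lo hi h R.m).length + 180 * R.m + 10 → Q t τ) :
    wp B (rowLoop cutLowBody) Q σ := by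
  have hbig := hR.big
  refine rowLoop_spec σ (fun a τ => τ.w 99 = σ.w 99 + a ∧ τ.w 88 ≤ a * R.d ∧
    (∀ b < a, CutLow h (lo b) (hi b) (R.rank b (Set.Iic (toLex (σ.r 20, σ.w 19)))) (τ.wm (σ.w 99 + b))) ∧
    τ.w 88 = ∑ b ∈ Finset.range a, (τ.wm (σ.w 99 + b) - lo b))
    (fun a => 120 * ((hi a - lo a) / h) + 140) hR hlo hhi (by omega) ?_ ?_ ?_ ?_
  · rintro a τ i v h80 h87 ⟨h3, h5, h4, h6⟩
    exact ⟨by simp [show 99 ≠ i by omega, h3], by simp [show 88 ≠ i by omega, h5], by simpa using h4,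
      by simp [show 88 ≠ i by omega, h6]⟩
  · simp [h88]
  · rintro a τ hr hK h85 h86 ⟨h3, h9, h4, h10⟩
    have := hr.lt
    have hm : (a + 1) * R.d ≤ R.m * R.d := Nat.mul_le_mul_right _ hr.lt
    have hm' : (a + 1) * R.d = a * R.d + R.d := by ring
    rw [h14 a hr.lt] at h85
    rw [h15 a hr.lt] at h86
    refine wp_mono (cutLowBody_spec hh hd τ hr h85 h86 (h1 a hr.lt) (h2 a hr.lt) (by rw [hK.w 17, h17])
      (by omega) (by omega)) ?_
    rintro t υ ⟨hKυ, h5, h6, h7, h8, h11⟩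
    rw [hK.r 20, hK.w 19] at h6
    have h2a := h2 a hr.lt
    have hle := h6.le
    refine ⟨hKυ, ⟨by omega, by omega, fun b hb => ?_, ?_⟩, h11⟩
    · rcases (Nat.lt_succ_iff_lt_or_eq.1 hb) with hb | rfl
      · rw [h7 _ (by omega)]; exact h4 b hb
      · rw [← h3]; exact h6
    · rw [Finset.sum_range_succ, h8, ← h3, h10]
      congr 1
      refine Finset.sum_congr rfl fun b hb => ?_
      rw [h7 _ (by have := Finset.mem_range.1 hb; omega)]
  · rintro t τ hK ⟨h3, h9, h4, h10⟩ ht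
    refine hQ t τ hK h3 h4 h10 (ht.trans ?_)
    rw [Finset.sum_add_distrib, ← Finset.mul_sum, ← Rows.length_sample (R := R)]
    simp
    omega

end rows
end RealRAM

namespace RealRAM

/-! ## Selection -/

/-- The state of the selection of the entry `p` of the rows `R`. -/
structure SelAt (R : Rows) (p : ℝ ×ₗ ℕ) (lo hi : ℕ → ℕ) (k h : ℕ) (σ : St) : Prop where
  sel : Rows.Sel R p lo hi k
  pos : 0 < h
  h_le : h ≤ R.d
  k : σ.w 13 = k
  h : σ.w 17 = h
  lo_al : σ.w 14 + R.m ≤ σ.w 99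
  hi_al : σ.w 15 + R.m ≤ σ.w 99
  lo : ∀ a < R.m, σ.wm (σ.w 14 + a) = lo a
  hi : ∀ a < R.m, σ.wm (σ.w 15 + a) = hi a

theorem SelAt.congr {R : Rows} {p : ℝ ×ₗ ℕ} {lo hi : ℕ → ℕ} {k h : ℕ} {σ τ : St} (hs : SelAt R p lo hi k h σ)
    (hK : Keeps 13 σ τ) (h13 : τ.w 13 = σ.w 13) (h14 : τ.w 14 = σ.w 14) (h15 : τ.w 15 = σ.w 15)
    (h17 : τ.w 17 = σ.w 17) : SelAt R p lo hi k h τ := by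
  have hal := hK.al
  have hlo := hs.lo_al
  have hhi := hs.hi_al
  refine ⟨hs.sel, hs.pos, hs.h_le, by rw [h13, hs.k], by rw [h17, hs.h], by omega, by omega, ?_, ?_⟩
  · intro a ha
    rw [h14, hK.wm _ (by omega), hs.lo a ha]
  · intro a ha
    rw [h15, hK.wm _ (by omega), hs.hi a ha]

/-- Load the pivot from the `i`-th cell of the sample. -/
def loadPivot (i : WExp) : Stmt := .rset 20 (.mem (.reg 50 + i)) ;; .wset 19 (.mem (.reg 50 + i))

def highStep : Stmt :=
  .ite (.wlt (.reg 22) (.reg 51))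
    (loadPivot (.reg 22) ;; .wset 18 (.reg 99) ;; rowLoop cutHighBody ;; .wset 15 (.reg 18)) .skip

def lowStep : Stmt :=
  .ite (.wlt 0 (.reg 21))
    (loadPivot (.reg 21 - 1) ;; .wset 18 (.reg 99) ;; .wset 88 0 ;; rowLoop cutLowBody ;; .wset 14 (.reg 18) ;;
      .wset 13 (.reg 13 - .reg 88)) .skip

/-- The segments have been cut off above: `C a` bounds the number of entries of row `a` at most the pivot. -/
structure HighCut (R : Rows) (p : ℝ ×ₗ ℕ) (lo hi hi' C : ℕ → ℕ) (h : ℕ) : Prop where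
  le : ∀ a < R.m, hi' a ≤ hi a
  ge : ∀ a < R.m, R.rank a (Set.Iic p) ≤ hi' a
  lt : ∀ a < R.m, hi' a ≤ lo a + C a + (h - 1)
  cnt : ∀ v < p, ∀ a < R.m, R.cnt lo hi a v ≤ C a

section steps
variable {B h k w err T : ℕ} {R : Rows} {Q : ℕ → St → Prop} {p : ℝ ×ₗ ℕ} {lo hi hi' C : ℕ → ℕ} {S : List (ℝ ×ₗ ℕ)}

theorem loadPivot_spec {i : WExp} {j : ℕ} (σ : St) (hi : i.eval σ = j) (hok : i.ok B σ) (hc : i.cost ≤ 3)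
    (hj : j < σ.w 51) (hal : σ.w 50 + σ.w 51 ≤ σ.w 99) (hB : σ.w 99 < B)
    (hQ : ∀ t, t ≤ 16 → Q t ((σ.setR 20 (σ.rm (σ.w 50 + j))).setW 19 (σ.wm (σ.w 50 + j)))) (hcongr : ∀ x, i.eval (σ.setR 20 x) = j ∧ i.ok B (σ.setR 20 x)) :
    wp B (loadPivot i) Q σ := by
  unfold loadPivot
  simp only [wp_seq, wp_rset, wp_wset, rules, hi, hok, hcongr, true_and, St.setR_w, St.setR_wm]
  refine ⟨by omega, by omega, hQ _ ?_⟩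
  omega

theorem highStep_spec (σ : St) (hR : RowsAt R B σ) (hs : SelAt R p lo hi k h σ)
    (hS : IsSample T (R.sample lo hi h R.m) w err S) (hsort : S.Pairwise (· ≤ ·))
    (harr : arr σ.cell (σ.w 50) (σ.w 51) = S) (hal : σ.w 50 + σ.w 51 ≤ σ.w 99) (h22 : σ.w 22 = k / (h * w))
    (hB : σ.w 99 + R.m + 1 < B)
    (hQ : ∀ t τ hi' C, Keeps 13 σ τ → (∀ i, 13 ≤ i → i < 80 → i ≠ 15 → i ≠ 18 → i ≠ 19 → τ.w i = σ.w i) →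
      SelAt R p lo hi' k h τ → HighCut R p lo hi hi' C h →
      ∑ a ∈ Finset.range R.m, C a ≤ k + h * w + h * err + R.m * (h - 1) →
      τ.w 99 ≤ σ.w 99 + R.m → t ≤ 100 * (R.sample lo hi h R.m).length + 160 * R.m + 50 → Q t τ) :
    wp B highStep Q σ := by
  have hlen : S.length = σ.w 51 := by rw [← harr]; simp
  have hsel := hs.sel
  unfold highStep
  simp only [wp_ite, wp_skip, rules, and_self, true_and]
  refine ⟨fun hlt => ?_, fun hge => ?_⟩
  · rw [wp_seq]
    refine loadPivot_spec σ (j := σ.w 22) (by simp) (by simp) (by simp) hlt hal (by omega) ?_ (by simp)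
    intro t1 ht1
    simp only [wp_seq, wp_wset, rules, true_and]
    generalize hσ1 : ((σ.setR 20 _).setW 19 _).setW 18 _ = σ1
    have hK1 : Keeps 13 σ σ1 := by
      rw [← hσ1]
      exact ((Keeps.rfl'.setR).setW).setW
    have hw : ∀ i, 13 ≤ i → i ≠ 18 → i ≠ 19 → σ1.w i = σ.w i := by
      intro i _ h1 h2; simp [← hσ1, h1, h2]
    have hs1 := hs.congr hK1 (hw _ (by omega) (by omega) (by omega)) (hw _ (by omega) (by omega) (by omega))
      (hw _ (by omega) (by omega) (by omega)) (hw _ (by omega) (by omega) (by omega))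
    have e99 := hw 99 (by omega) (by omega) (by omega)
    have e18 : σ1.w 18 = σ.w 99 := by simp [← hσ1]
    have hlt' : k / (h * w) < S.length := by omega
    have hp : toLex (σ1.r 20, σ1.w 19) = S[k / (h * w)] := by
      simp [← hσ1, ← harr, getElem_arr, h22, St.cell]
    have hpiv := hsel.high_pivot hs.pos hS hsort hlt'
    rw [← hp] at hpiv
    refine cutHighRows_spec σ1 lo hi hs.pos hs.h_le (hR.keeps hK1) hs1.lo_al hs1.hi_al hs1.lo hs1.hi
      (fun a ha => hsel.lo_le_hi ha) hsel.hi_le hs1.h (by omega) ?_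
    intro t τ hK h99 hcut ht
    have g18 : τ.w 18 = σ.w 99 := by rw [hK.w 18, e18]
    rw [e99] at h99 hcut
    generalize hτ' : τ.setW 15 (τ.w 18) = τ'
    have hK' : Keeps 13 σ τ' := by
      rw [← hτ']; exact (hK1.trans (hK.mono)).setW
    have hw' : ∀ i, 13 ≤ i → i < 80 → i ≠ 15 → i ≠ 18 → i ≠ 19 → τ'.w i = σ.w i := by
      intro i h1 h2 h3 h4 h5
      rw [← hτ', ← hw i h1 h4 h5, ← hK.w i h2]; simp [h3]
    have f99 : τ'.w 99 = σ.w 99 + R.m := by rw [← hτ']; simpa using h99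
    have f15 : τ'.w 15 = σ.w 99 := by rw [← hτ']; simpa using g18
    have hge : ∀ a < R.m, R.rank a (Set.Iic p) ≤ τ.wm (σ.w 99 + a) := by
      intro a ha
      have h1 := (hcut a ha).rank
      have h2 := Rows.rank_mono (R := R) (a := a) (Set.Iic_subset_Iic.2 hpiv.1)
      have h3 := hsel.le_hi a ha
      omega
    refine hQ _ τ' (fun a => τ.wm (σ.w 99 + a)) (fun a => R.cnt lo hi a (toLex (σ1.r 20, σ1.w 19))) hK' hw' ?_ ?_ hpiv.2
      (by omega) (by omega)
    · have hlo := hs.lo_al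
      refine ⟨⟨hsel.lo_le, hge, fun a ha => (hcut a ha).le.trans (hsel.hi_le a ha), hsel.k_eq, hsel.succ⟩, hs.pos,
        hs.h_le, ?_, ?_, ?_, ?_, ?_, ?_⟩
      · rw [hw' 13 (by omega) (by omega) (by omega) (by omega) (by omega), hs.k]
      · rw [hw' 17 (by omega) (by omega) (by omega) (by omega) (by omega), hs.h]
      · rw [hw' 14 (by omega) (by omega) (by omega) (by omega) (by omega)]; omega
      · omega
      · intro a ha
        rw [hw' 14 (by omega) (by omega) (by omega) (by omega) (by omega), hK'.wm _ (by omega), hs.lo a ha]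
      · intro a ha
        rw [f15, ← hτ']; rfl
    · refine ⟨fun a ha => (hcut a ha).le, hge, fun a ha => ?_, fun v hv a ha => ?_⟩
      · have h1 := (hcut a ha).lt
        have h2 := (hcut a ha).le
        have := hs.pos
        unfold Rows.cnt
        omega
      · have := Rows.rank_mono (R := R) (a := a) (Set.Iic_subset_Iic.2 (hv.le.trans hpiv.1))
        unfold Rows.cnt
        omega
  · have hno := hsel.no_high_pivot hs.pos hS (by omega)
    refine hQ _ σ hi (fun a => hi a - lo a) Keeps.rfl' (fun _ _ _ _ _ _ => rfl) hs ?_ hno (by omega) (by omega)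
    refine ⟨fun _ _ => le_rfl, hsel.le_hi, fun a _ => ?_, fun v hv a ha => ?_⟩
    · omega
    · unfold Rows.cnt; omega

theorem lowStep_spec {E : ℕ} (σ : St) (hR : RowsAt R B σ) (hs : SelAt R p lo hi' k h σ) (hsel : Rows.Sel R p lo hi k)
    (hcut : HighCut R p lo hi hi' C h)
    (hS : IsSample T (R.sample lo hi h R.m) w err S) (hsort : S.Pairwise (· ≤ ·)) (hE : err ≤ E)
    (harr : arr σ.cell (σ.w 50) (σ.w 51) = S) (hal : σ.w 50 + σ.w 51 ≤ σ.w 99)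
    (h21 : σ.w 21 = Rows.lowIndex R.m k h w E)
    (hB : σ.w 99 + R.m + 1 < B)
    (hQ : ∀ t τ lo' k' (D : ℕ → ℕ), Keeps 13 σ τ → (∀ i, 15 ≤ i → i < 80 → i ≠ 18 → i ≠ 19 → τ.w i = σ.w i) →
      SelAt R p lo' hi' k' h τ → (∀ a < R.m, hi' a - lo' a + D a ≤ C a + 2 * (h - 1)) →
      h * (w * Rows.lowIndex R.m k h w E) ≤ ∑ a ∈ Finset.range R.m, D a →
      τ.w 99 ≤ σ.w 99 + R.m → t ≤ 120 * (R.sample lo hi h R.m).length + 180 * R.m + 50 → Q t τ) :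
    wp B lowStep Q σ := by
  have hlen : S.length = σ.w 51 := by rw [← harr]; simp
  have hsel' := hs.sel
  have hpos := hs.pos
  unfold lowStep
  simp only [wp_ite, wp_skip, rules, and_true]
  refine ⟨by omega, fun hlt => ?_, fun hge => ?_⟩
  · rw [h21] at hlt
    obtain ⟨hl, hpiv, hsum⟩ := hsel.low_pivot hpos hS hsort hE hlt
    rw [wp_seq]
    refine loadPivot_spec σ (j := σ.w 21 - 1) (by simp) (by simp; omega) (by simp) (by omega) hal (by omega) ?_ (by simp; omega)
    intro t1 ht1
    simp only [wp_seq, wp_wset, rules, true_and]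
    refine ⟨by omega, ?_⟩
    generalize hσ1 : (((σ.setR 20 _).setW 19 _).setW 18 _).setW 88 _ = σ1
    have hK1 : Keeps 13 σ σ1 := by
      rw [← hσ1]
      exact (((Keeps.rfl'.setR).setW).setW).setW
    have hw : ∀ i, 13 ≤ i → i ≠ 18 → i ≠ 19 → i ≠ 88 → σ1.w i = σ.w i := by
      intro i _ h1 h2 h3; simp [← hσ1, h1, h2, h3]
    have hs1 := hs.congr hK1 (hw _ (by omega) (by omega) (by omega) (by omega))
      (hw _ (by omega) (by omega) (by omega) (by omega))
      (hw _ (by omega) (by omega) (by omega) (by omega)) (hw _ (by omega) (by omega) (by omega) (by omega))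
    have e99 := hw 99 (by omega) (by omega) (by omega) (by omega)
    have e18 : σ1.w 18 = σ.w 99 := by simp [← hσ1]
    have e88 : σ1.w 88 = 0 := by simp [← hσ1]
    have hp : toLex (σ1.r 20, σ1.w 19) = S[Rows.lowIndex R.m k h w E - 1] := by
      simp [← hσ1, ← harr, getElem_arr, h21, St.cell]
    rw [← hp] at hpiv hsum
    have hlen2 : (R.sample lo hi' h R.m).length ≤ (R.sample lo hi h R.m).length := by
      rw [Rows.length_sample, Rows.length_sample]
      refine Finset.sum_le_sum fun a ha => Nat.div_le_div_right ?_
      have := hcut.le a (Finset.mem_range.1 ha)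
      omega
    refine cutLowRows_spec σ1 lo hi' hs.pos hs.h_le (hR.keeps hK1) hs1.lo_al hs1.hi_al hs1.lo hs1.hi
      (fun a ha => hsel'.lo_le_hi ha) hsel'.hi_le hs1.h e88 (by omega) ?_
    intro t τ hK h99 hcutl h88 ht
    have g18 : τ.w 18 = σ.w 99 := by rw [hK.w 18, e18]
    have g13 : τ.w 13 = k := by rw [hK.w 13, hs1.k]
    rw [e99] at h99 hcutl h88
    simp only [St.setW_w]
    simp only [Nat.reduceEqDiff, if_false]
    generalize hτ' : (τ.setW 14 (τ.w 18)).setW 13 (τ.w 13 - τ.w 88) = τ'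
    have hK' : Keeps 13 σ τ' := by
      rw [← hτ']
      exact ((hK1.trans (hK.mono)).setW).setW
    have hw' : ∀ i, 15 ≤ i → i < 80 → i ≠ 18 → i ≠ 19 → τ'.w i = σ.w i := by
      intro i h1 h2 h4 h5
      rw [← hτ', ← hw i (by omega) h4 h5 (by omega), ← hK.w i h2]
      simp [show i ≠ 14 by omega, show i ≠ 13 by omega]
    have f99 : τ'.w 99 = σ.w 99 + R.m := by rw [← hτ']; simpa using h99
    have f14 : τ'.w 14 = σ.w 99 := by rw [← hτ']; simpa using g18
    have f13 : τ'.w 13 = k - τ.w 88 := by rw [← hτ']; simp [g13]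
    have hle : ∀ a < R.m, τ.wm (σ.w 99 + a) ≤ R.rank a (Set.Iio p) := by
      intro a ha
      have h1 := (hcutl a ha).rank
      have h2 : R.rank a (Set.Iic (toLex (σ1.r 20, σ1.w 19))) ≤ R.rank a (Set.Iio p) :=
        Rows.rank_mono fun x hx => lt_of_le_of_lt hx hpiv
      have h3 := hsel.lo_le a ha
      omega
    have hsum1 : ∑ a ∈ Finset.range R.m, τ.wm (σ.w 99 + a) = τ.w 88 + ∑ a ∈ Finset.range R.m, lo a := by
      rw [h88, ← Finset.sum_add_distrib]
      refine Finset.sum_congr rfl fun a ha => ?_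
      have := (hcutl a (Finset.mem_range.1 ha)).ge
      omega
    have hsum2 : ∑ a ∈ Finset.range R.m, τ.wm (σ.w 99 + a) ≤ ∑ a ∈ Finset.range R.m, R.rank a (Set.Iio p) :=
      Finset.sum_le_sum fun a ha => hle a (Finset.mem_range.1 ha)
    have hk := hsel.k_eq
    refine hQ _ τ' (fun a => τ.wm (σ.w 99 + a)) (k - τ.w 88) (fun a => R.cnt lo hi a (toLex (σ1.r 20, σ1.w 19))) hK' hw'
      ?_ ?_ hsum (by omega) (by omega)
    · have hhi := hs.hi_al
      refine ⟨⟨hle, hsel'.le_hi, hsel'.hi_le, ?_, hsel'.succ⟩, hs.pos, hs.h_le, f13, ?_, by omega, ?_, ?_, ?_⟩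
      · omega
      · rw [hw' 17 (by omega) (by omega) (by omega) (by omega), hs.h]
      · rw [hw' 15 (by omega) (by omega) (by omega) (by omega)]; omega
      · intro a ha
        rw [f14, ← hτ']; rfl
      · intro a ha
        rw [hw' 15 (by omega) (by omega) (by omega) (by omega), hK'.wm _ (by omega), hs.hi a ha]
    · intro a ha
      have h1 := hcutl a ha
      have h2 := hcut.lt a ha
      have h3 := hcut.le a ha
      have h4 := hcut.cnt _ hpiv a ha
      have h5 := h1.lt
      have h6 := h1.ge
      unfold Rows.cnt at h4 ⊢
      omega
  · have h0 : σ.w 21 = 0 := by omega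
    refine hQ _ σ lo k (fun _ => 0) Keeps.rfl' (fun _ _ _ _ _ => rfl) hs (fun a ha => ?_) ?_ (by omega) (by omega)
    · have := hcut.lt a ha
      omega
    · rw [← h21, h0]; simp

end steps
end RealRAM

namespace RealRAM

/-- A round of the selection: all segments are shortened with the help of a sorted sample. -/
def roundStep : Stmt :=
  .wset 18 (.reg 99) ;;
  rowLoop sampleBody ;;
  .wset 20 (.reg 99 - .reg 18) ;;
  .wset 51 (.reg 20) ;;
  .wset 50 (.reg 18) ;;
  .wset 54 128 ;;
  mergeSort ;;
  .wset 20 ((.reg 20 + .reg 20 + 128 * .reg 53) / 128) ;;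
  .wset 21 (((.reg 13 - .reg 2 * (.reg 17 - 1)) / .reg 17 - .reg 20) / .reg 53) ;;
  .wset 22 (.reg 13 / (.reg 17 * .reg 53)) ;;
  highStep ;;
  lowStep

theorem Rows.Sel.width_le {R : Rows} {p : ℝ ×ₗ ℕ} {lo hi : ℕ → ℕ} {k : ℕ} (h : Rows.Sel R p lo hi k) :
    R.width lo hi ≤ R.m * R.d := by
  unfold Rows.width
  refine (Finset.sum_le_sum (g := fun _ => R.d) fun a ha => ?_).trans (by simp)
  have := h.hi_le a (Finset.mem_range.1 ha)
  omega

theorem roundStep_spec {B h k : ℕ} {R : Rows} {Q : ℕ → St → Prop} {p : ℝ ×ₗ ℕ} {lo hi : ℕ → ℕ} (σ : St)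
    (hR : RowsAt R B σ) (hs : SelAt R p lo hi k h σ)
    (hB : σ.w 99 + 200 * (R.sample lo hi h R.m).length + 2 * R.m + 300 < B)
    (hQ : ∀ t τ lo' hi' k', Keeps 13 σ τ → τ.w 16 = σ.w 16 → SelAt R p lo' hi' k' h τ →
      16 * R.width lo' hi' ≤ R.width lo hi + 152 * h + 64 * (R.m * (h - 1)) →
      τ.w 99 ≤ σ.w 99 + 13 * (R.sample lo hi h R.m).length + 2 * R.m →
      t ≤ 4000 * ((R.sample lo hi h R.m).length + R.m + 1) → Q t τ) :
    wp B roundStep Q σ := by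
  have hsel := hs.sel
  have hpos := hs.pos
  have hbig := hR.big
  have hWd := hsel.width_le
  have hNW := Rows.length_sample_le (R := R) (lo := lo) (hi := hi) h
  unfold roundStep
  rw [wp_seq]
  simp only [wp_wset, rules, true_and]
  generalize hσ0 : σ.setW 18 (σ.w 99) = σ0
  have hK0 : Keeps 13 σ σ0 := by rw [← hσ0]; exact Keeps.rfl'.setW
  have hw0 : ∀ i, i ≠ 18 → σ0.w i = σ.w i := by intro i h1; simp [← hσ0, h1]
  have e18 : σ0.w 18 = σ.w 99 := by simp [← hσ0]
  have hs0 := hs.congr hK0 (hw0 _ (by omega)) (hw0 _ (by omega)) (hw0 _ (by omega)) (hw0 _ (by omega))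
  rw [wp_seq]
  have e99 := hw0 99 (by omega)
  refine sampleRows_spec σ0 lo hi hpos hs.h_le (hR.keeps hK0) hs0.lo_al hs0.hi_al hs0.lo hs0.hi
    (fun a ha => hsel.lo_le_hi ha) hsel.hi_le hs0.h (by omega) ?_
  intro t1 σ1 hK1 h991 harr1 ht1
  rw [e99] at h991 harr1
  have g18 : σ1.w 18 = σ.w 99 := by rw [hK1.w 18, e18]
  generalize hl₀ : R.sample lo hi h R.m = l₀ at *
  generalize hN : l₀.length = N at *
  simp only [wp_seq, wp_wset, rules, true_and, St.setW_w]
  simp only [Nat.reduceEqDiff, if_false, if_true, h991, g18, Nat.add_sub_cancel_left]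
  refine ⟨by omega, ?_⟩
  generalize hσ2 : (((σ1.setW 20 _).setW 51 _).setW 50 _).setW 54 _ = σ2
  have hK2 : Keeps 13 σ σ2 := by
    rw [← hσ2]
    exact ((((hK0.trans (hK1.mono)).setW).setW).setW).setW
  have hw2 : ∀ i, 13 ≤ i → i < 50 → i ≠ 18 → i ≠ 20 → σ2.w i = σ.w i := by
    intro i h1 h2 h3 h4
    rw [← hw0 i h3, ← hK1.w i, ← hσ2]
    simp [h4, show i ≠ 51 by omega, show i ≠ 50 by omega, show i ≠ 54 by omega]
  have f20 : σ2.w 20 = N := by simp [← hσ2]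
  have f51 : σ2.w 51 = N := by simp [← hσ2]
  have f50 : σ2.w 50 = σ.w 99 := by simp [← hσ2]
  have f54 : σ2.w 54 = 128 := by simp [← hσ2]
  have f99 : σ2.w 99 = σ.w 99 + N := by simp [← hσ2, h991]
  have fc : arr σ2.cell (σ2.w 50) (σ2.w 51) = l₀ := by
    rw [f50, f51, ← harr1, ← hσ2]; rfl
  refine mergeSort_spec σ2 7 (by omega) (by omega) (by omega) (by omega) ?_
  intro t3 σ3 err hK3 hb3 hal3 hS hsort h993 ht3
  rw [f54, fc] at hS
  generalize hSl : arr σ3.cell (σ3.w 50) (σ3.w 51) = S at *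
  have hwle := hS.w_le
  have herr := hS.err_le'
  have hwpos := hS.pos
  generalize hw : σ3.w 53 = w at *
  rw [hN] at hwle herr
  have hwN : w ≤ N + 1 := by
    by_contra hc
    have : (N + 2) * w ≤ w * w := Nat.mul_le_mul_right _ (by omega)
    have : (N + 2) * 2 ≤ (N + 2) * w := Nat.mul_le_mul_left _ (by omega)
    have : 128 * w * w = 128 * (w * w) := by ring
    omega
  have hhw : h * w ≤ h * N + h := by rw [← Nat.mul_succ]; exact Nat.mul_le_mul_left _ hwN
  have hmh : R.m * (h - 1) ≤ R.m * R.d := Nat.mul_le_mul_left _ (by have := hs.h_le; omega)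
  have hhd := hs.h_le
  have hK3' : Keeps 13 σ σ3 := hK2.trans (hK3.mono)
  have i20 : σ3.w 20 = N := by rw [hK3.w 20, f20]
  have i13 : σ3.w 13 = k := by rw [hK3.w 13, hw2 13 (by omega) (by omega) (by omega) (by omega), hs.k]
  have i17 : σ3.w 17 = h := by rw [hK3.w 17, hw2 17 (by omega) (by omega) (by omega) (by omega), hs.h]
  have i2 : σ3.w 2 = R.m := by rw [hK3'.w 2, hR.m]
  simp only [i20, i13, i17, i2]
  have hhw0 := Nat.mul_pos hpos hwpos
  refine ⟨by omega, ?_, by omega, ?_⟩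
  · simp only [and_true]; omega
  generalize hE : (N + N + 128 * w) / 128 = E
  generalize hσ4 : ((σ3.setW 20 _).setW 21 _).setW 22 _ = σ4
  have hK4 : Keeps 13 σ σ4 := by
    rw [← hσ4]
    exact ((hK3'.setW).setW).setW
  have hw4 : ∀ i, i ≠ 20 → i ≠ 21 → i ≠ 22 → σ4.w i = σ3.w i := by
    intro i h1 h2 h3; simp [← hσ4, h1, h2, h3]
  have hw4' : ∀ i, 13 ≤ i → i < 18 → σ4.w i = σ.w i := by
    intro i h1 h2
    rw [hw4 i (by omega) (by omega) (by omega), hK3.w i, hw2 i h1 (by omega) (by omega) (by omega)]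
  have j21 : σ4.w 21 = Rows.lowIndex R.m k h w E := by simp [← hσ4, Rows.lowIndex]
  have j22 : σ4.w 22 = k / (h * w) := by simp [← hσ4]
  have j50 := hw4 50 (by omega) (by omega) (by omega)
  have j51 := hw4 51 (by omega) (by omega) (by omega)
  have j99 := hw4 99 (by omega) (by omega) (by omega)
  have jc : arr σ4.cell (σ4.w 50) (σ4.w 51) = S := by rw [j50, j51, ← hSl, ← hσ4]; rfl
  have hs4 := hs.congr hK4 (hw4' _ (by omega) (by omega)) (hw4' _ (by omega) (by omega)) (hw4' _ (by omega) (by omega))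
    (hw4' _ (by omega) (by omega))
  rw [← hl₀] at hS
  refine highStep_spec σ4 (hR.keeps hK4) hs4 hS hsort jc (by omega) j22 (by omega) ?_
  intro t5 σ5 hi' C hK5 hw5 hs5 hcut hC h995 ht5
  have k50 := hw5 50 (by omega) (by omega) (by omega) (by omega) (by omega)
  have k51 := hw5 51 (by omega) (by omega) (by omega) (by omega) (by omega)
  have k21 := hw5 21 (by omega) (by omega) (by omega) (by omega) (by omega)
  have k16 := hw5 16 (by omega) (by omega) (by omega) (by omega) (by omega)
  have kal := hK5.al
  rw [hl₀, hN] at ht5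
  refine lowStep_spec (E := E) σ5 (hR.keeps (hK4.trans hK5)) hs5 hsel hcut hS hsort (by omega) ?_ (by omega) (by omega) (by omega) ?_
  · rw [k50, k51, hK5.arr_cell (by omega), jc]
  intro t6 σ6 lo' k' D hK6 hw6 hs6 hrow hD h996 ht6
  rw [hl₀, hN] at ht6
  refine hQ _ σ6 lo' hi' k' ((hK4.trans hK5).trans hK6) ?_ hs6 ?_ (by omega) (by omega)
  · rw [hw6 16 (by omega) (by omega) (by omega) (by omega), k16, hw4' 16 (by omega) (by omega)]
  · refine Rows.width_bound hpos hwpos hrow (E := E) ?_ hD (by omega) (by omega) hNW rfl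
    have : h * err ≤ h * E := Nat.mul_le_mul_left _ (by omega)
    omega

/-! The last round. -/

theorem cntLE_le_of_lt {S : List (ℝ ×ₗ ℕ)} (hs : S.Pairwise (· ≤ ·)) {i : ℕ} (hi : i < S.length) {v : ℝ ×ₗ ℕ}
    (hv : v < S[i]) : cntLE v S ≤ i := by
  have h := cntLE_append v (S.take i) (S.drop i)
  rw [List.take_append_drop] at h
  have h1 : cntLE v (S.take i) ≤ i := (cntLE_le_length _ _).trans (List.length_take_le _ _)
  have h2 : cntLE v (S.drop i) = 0 := by
    unfold cntLE
    rw [List.countP_eq_zero]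
    intro x hx
    obtain ⟨j, hj, rfl⟩ := List.getElem_of_mem hx
    simp only [List.length_drop] at hj
    simp only [List.getElem_drop, decide_eq_true_eq, not_le]
    rcases Nat.eq_zero_or_pos j with rfl | h0
    · simpa using hv
    · exact hv.trans_le (List.pairwise_iff_getElem.1 hs i (i + j) hi (by omega) (by omega))
  omega

/-- Sort the remaining entries and cut off the segments above the selected one. -/
def lastStep : Stmt :=
  .wset 18 (.reg 99) ;;
  rowLoop sampleBody ;;
  .wset 51 (.reg 99 - .reg 18) ;;
  .wset 50 (.reg 18) ;;
  .wset 54 (.reg 51 + .reg 51 + 128) ;;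
  mergeSort ;;
  loadPivot (.reg 13) ;;
  .wset 18 (.reg 99) ;;
  rowLoop cutHighBody ;;
  .wset 15 (.reg 18)

theorem Rows.Sel.eq_getElem {R : Rows} {p : ℝ ×ₗ ℕ} {lo hi : ℕ → ℕ} {k err w T : ℕ} {S : List (ℝ ×ₗ ℕ)}
    (hsel : Rows.Sel R p lo hi k) (hS : IsSample T (R.sample lo hi 1 R.m) w err S) (hs : S.Pairwise (· ≤ ·))
    (hT : 2 * (R.sample lo hi 1 R.m).length ≤ T) : ∃ hk : k < S.length, S[k] = p := by
  obtain ⟨-, hperm⟩ := hS.perm hT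
  have hlen : S.length = R.width lo hi := by
    rw [hperm.length_eq, Rows.length_sample]
    simp [Rows.width]
  have hk : k < S.length := by rw [hlen]; exact hsel.lt_width
  have hcnt : ∀ v, ∑ a ∈ Finset.range R.m, R.cnt lo hi a v = cntLE v S := by
    intro v
    rw [cntLE_perm hperm, Rows.cntLE_sample one_pos hsel.hi_le]
    simp
  refine ⟨hk, le_antisymm ?_ ?_⟩
  · by_contra hc
    have h1 := cntLE_le_of_lt hs hk (not_le.1 hc)
    rw [← hcnt] at h1
    exact lt_irrefl _ (hsel.pivot_lt h1)
  · refine hsel.pivot_ge ?_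
    rw [hcnt, Rows.cntLE_getElem hs (Rows.IsSample.nodup hS (Rows.nodup_sample one_pos hsel.hi_le)) hk]

theorem lastStep_spec {B k g : ℕ} {R : Rows} {Q : ℕ → St → Prop} {p : ℝ ×ₗ ℕ} {lo hi : ℕ → ℕ} (σ : St)
    (hR : RowsAt R B σ) (hs : SelAt R p lo hi k 1 σ) (hg : 2 * R.width lo hi + 128 ≤ 2 ^ g)
    (hB : σ.w 99 + R.width lo hi * (g + 20) + R.m + 300 < B)
    (hQ : ∀ t τ, Keeps 13 σ τ → τ.r 20 = (ofLex p).1 → τ.w 15 + R.m ≤ τ.w 99 →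
      (∀ a < R.m, τ.wm (τ.w 15 + a) = R.rank a (Set.Iic p)) →
      τ.w 99 ≤ σ.w 99 + R.width lo hi * (g + 6) + R.m →
      t ≤ 500 * (R.width lo hi * (g + 5) + R.m + 1) → Q t τ) :
    wp B lastStep Q σ := by
  have hsel := hs.sel
  have hbig := hR.big
  have hlen : (R.sample lo hi 1 R.m).length = R.width lo hi := by
    rw [Rows.length_sample]; simp [Rows.width]
  unfold lastStep
  rw [wp_seq]
  simp only [wp_wset, rules, true_and]
  generalize hσ0 : σ.setW 18 (σ.w 99) = σ0
  have hK0 : Keeps 13 σ σ0 := by rw [← hσ0]; exact Keeps.rfl'.setW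
  have hw0 : ∀ i, i ≠ 18 → σ0.w i = σ.w i := by intro i h1; simp [← hσ0, h1]
  have e18 : σ0.w 18 = σ.w 99 := by simp [← hσ0]
  have hs0 := hs.congr hK0 (hw0 _ (by omega)) (hw0 _ (by omega)) (hw0 _ (by omega)) (hw0 _ (by omega))
  rw [wp_seq]
  have e99 := hw0 99 (by omega)
  have eg : R.width lo hi * (g + 20) = R.width lo hi * (g + 15) + 5 * R.width lo hi := by ring
  have eg2 : R.width lo hi * (g + 6) = R.width lo hi * (g + 5) + R.width lo hi := by ring
  have eg4 : R.width lo hi ≤ R.width lo hi * (g + 5) := Nat.le_mul_of_pos_right _ (by omega)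
  have eg3 : R.width lo hi * (g + 15) = R.width lo hi * (g + 5) + 10 * R.width lo hi := by ring
  refine sampleRows_spec σ0 lo hi one_pos hs.h_le (hR.keeps hK0) hs0.lo_al hs0.hi_al hs0.lo hs0.hi
    (fun a ha => hsel.lo_le_hi ha) hsel.hi_le hs0.h (by omega) ?_
  intro t1 σ1 hK1 h991 harr1 ht1
  rw [e99] at h991 harr1
  have g18 : σ1.w 18 = σ.w 99 := by rw [hK1.w 18, e18]
  rw [hlen] at h991 harr1 ht1
  generalize hN : R.width lo hi = N at *
  simp only [wp_seq, wp_wset, rules, true_and, St.setW_w]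
  simp only [Nat.reduceEqDiff, if_false, if_true, h991, g18, Nat.add_sub_cancel_left]
  refine ⟨by omega, ?_⟩
  generalize hσ2 : ((σ1.setW 51 _).setW 50 _).setW 54 _ = σ2
  have hK2 : Keeps 13 σ σ2 := by
    rw [← hσ2]
    exact (((hK0.trans (hK1.mono)).setW).setW).setW
  have hw2 : ∀ i, 13 ≤ i → i < 50 → i ≠ 18 → σ2.w i = σ.w i := by
    intro i h1 h2 h3
    rw [← hw0 i h3, ← hK1.w i, ← hσ2]
    simp [show i ≠ 51 by omega, show i ≠ 50 by omega, show i ≠ 54 by omega]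
  have f51 : σ2.w 51 = N := by simp [← hσ2]
  have f50 : σ2.w 50 = σ.w 99 := by simp [← hσ2]
  have f54 : σ2.w 54 = N + N + 128 := by simp [← hσ2]
  have f99 : σ2.w 99 = σ.w 99 + N := by simp [← hσ2, h991]
  have fc : arr σ2.cell (σ2.w 50) (σ2.w 51) = R.sample lo hi 1 R.m := by
    rw [f50, f51, ← harr1, ← hσ2]; rfl
  refine mergeSort_spec σ2 g (by omega) (by omega) (by omega) (by rw [f51, f99]; omega) ?_
  intro t3 σ3 err hK3 hb3 hal3 hS hsort h993 ht3
  rw [f54, fc] at hS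
  rw [f51] at h993 ht3
  have hK3' : Keeps 13 σ σ3 := hK2.trans (hK3.mono)
  have hw3 : ∀ i, 13 ≤ i → i < 18 → σ3.w i = σ.w i := by
    intro i h1 h2
    rw [hK3.w i, hw2 i h1 (by omega) (by omega)]
  obtain ⟨hk, hp⟩ := hsel.eq_getElem hS hsort (by omega)
  have i13 : σ3.w 13 = k := by rw [hw3 13 (by omega) (by omega), hs.k]
  have hk' : k < σ3.w 51 := by simpa using hk
  refine loadPivot_spec σ3 (j := k) (by simp [i13]) (by simp) (by simp) hk' hal3 (by omega) ?_ (by simp [i13])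
  intro t4 ht4
  generalize hσ4 : ((σ3.setR 20 _).setW 19 _).setW 18 _ = σ4
  have hK4 : Keeps 13 σ σ4 := by
    rw [← hσ4]
    exact ((hK3'.setR).setW).setW
  have hw4 : ∀ i, 13 ≤ i → i < 18 → σ4.w i = σ.w i := by
    intro i h1 h2
    rw [← hw3 i h1 h2]
    simp [← hσ4, show i ≠ 18 by omega, show i ≠ 19 by omega]
  have j99 : σ4.w 99 = σ3.w 99 := by simp [← hσ4]
  have j18 : σ4.w 18 = σ3.w 99 := by simp [← hσ4]
  have hpiv : toLex (σ4.r 20, σ4.w 19) = p := by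
    rw [← hp, getElem_arr, ← hσ4]; simp [St.cell]
  have j20 : σ4.r 20 = (ofLex p).1 := by rw [← hpiv]; rfl
  have hs4 := hs.congr hK4 (hw4 _ (by omega) (by omega)) (hw4 _ (by omega) (by omega)) (hw4 _ (by omega) (by omega))
    (hw4 _ (by omega) (by omega))
  refine cutHighRows_spec σ4 lo hi one_pos hs.h_le (hR.keeps hK4) hs4.lo_al hs4.hi_al hs4.lo hs4.hi
    (fun a ha => hsel.lo_le_hi ha) hsel.hi_le hs4.h (by omega) ?_
  intro t5 σ5 hK5 h995 hcut ht5
  rw [hpiv, j99] at hcut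
  rw [hlen] at ht5
  have k18 : σ5.w 18 = σ3.w 99 := by rw [hK5.w 18, j18]
  have k20 : σ5.r 20 = (ofLex p).1 := by rw [hK5.r 20, j20]
  refine hQ _ _ ?_ (by simpa using k20) (by simp; omega) ?_ (by simp; omega) (by omega)
  · exact (hK4.trans (hK5.mono)).setW
  · intro a ha
    have h1 := hcut a ha
    have h2 := hsel.le_hi a ha
    have h3 := hsel.lo_le a ha
    have h4 := Rows.rank_mono (R := R) (a := a) (Set.Iio_subset_Iic_self (a := p))
    have h5 := h1.rank
    have h6 := h1.lt
    simp only [St.setW_wm, St.setW_w, if_true, k18]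
    omega

end RealRAM

namespace RealRAM

/-- Append `w2` copies of the variable `i` to the memory. -/
def fill (i : ℕ) : Stmt :=
  .wset 16 0 ;;
  .loop (.wlt (.reg 16) (.reg 2)) (.wput (.reg 99) (.reg i) ;; .wset 99 (.reg 99 + 1) ;; .wset 16 (.reg 16 + 1))

theorem fill_spec {B m i : ℕ} {Q : ℕ → St → Prop} (hi : i ≠ 16) (hi' : i ≠ 99) (σ : St) (hm : σ.w 2 = m)
    (hB : σ.w 99 + m + 1 < B)
    (hQ : ∀ t τ, Keeps 13 σ τ → (∀ j, j ≠ 16 → j ≠ 99 → τ.w j = σ.w j) → τ.w 99 = σ.w 99 + m →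
      (∀ a < m, τ.wm (σ.w 99 + a) = σ.w i) → t ≤ 20 * m + 10 → Q t τ) : wp B (fill i) Q σ := by
  unfold fill
  simp only [wp_seq, wp_wset, rules]
  refine ⟨by omega, ?_⟩
  refine wp_loop (fun (a : ℕ) τ => Keeps 13 σ τ ∧ (∀ j, j ≠ 16 → j ≠ 99 → τ.w j = σ.w j) ∧ τ.w 99 = σ.w 99 + a ∧
    τ.w 16 = a ∧ a ≤ m ∧ ∀ b < a, τ.wm (σ.w 99 + b) = σ.w i) (fun a => 20 * (m - a)) ?_ ?_ 0 ?_ ?_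
  · intros; simp
  · rintro a τ ⟨hK, hw, h99, h16, ham, harr⟩ hc
    simp only [rules, h16, hK.w 2, hm] at hc
    simp [hw i hi hi', h99, h16]
    refine ⟨by omega, by omega, ⟨?_, ?_, by omega, hc, ?_⟩, by omega⟩
    · exact ((hK.putW (by omega)).setAl (by omega)).setW
    · intro j h1 h2; rw [if_neg h1, if_neg h2, hw j h1 h2]
    · intro b hb hne; exact harr b (by omega)
  · exact ⟨Keeps.rfl'.setW, by intro j h1 h2; simp [h1], by simp, by simp, by omega, by omega⟩
  · rintro a t τ ⟨hK, hw, h99, h16, ham, harr⟩ hc ht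
    simp only [rules, h16, hK.w 2, hm, not_lt] at hc ht
    obtain rfl : a = m := by omega
    exact hQ _ τ hK hw h99 harr (by omega)

/-- Select the entry of rank `w13` of all rows. -/
def select : Stmt :=
  .wset 18 0 ;;
  .wset 14 (.reg 99) ;;
  fill 18 ;;
  .wset 15 (.reg 99) ;;
  fill 1 ;;
  .wset 17 (.reg 1) ;;
  .wset 16 (.reg 8) ;;
  .loop (.wlt 0 (.reg 16)) (roundStep ;; .wset 17 ((.reg 17 + 1) / 2) ;; .wset 16 (.reg 16 - 1)) ;;
  lastStep

/-- The state after `e` rounds. -/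
structure Round (R : Rows) (p : ℝ ×ₗ ℕ) (s e : ℕ) (lo hi : ℕ → ℕ) (k h : ℕ) (τ : St) : Prop where
  at_ : SelAt R p lo hi k h τ
  width : R.width lo hi ≤ (12 * R.m + 40) * h
  h_le : (h - 1) * 2 ^ e ≤ R.d - 1
  late : ∀ j, e = s + j → 16 ^ j * R.width lo hi ≤ 12 * R.m + 40 + 11 * 16 ^ j

theorem Round.h_eq {R : Rows} {p : ℝ ×ₗ ℕ} {s j : ℕ} {lo hi : ℕ → ℕ} {k h : ℕ} {τ : St}
    (hr : Round R p s (s + j) lo hi k h τ) (hs : R.d ≤ 2 ^ s) : h = 1 := by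
  have h1 := hr.h_le
  have h2 := hr.at_.pos
  have h3 := hr.at_.h_le
  by_contra hc
  have h4 : 2 ^ s ≤ 2 ^ (s + j) := Nat.pow_le_pow_right (by omega) (by omega)
  have h5 : 1 * 2 ^ (s + j) ≤ (h - 1) * 2 ^ (s + j) := Nat.mul_le_mul_right _ (by omega)
  omega

theorem Round.next {R : Rows} {p : ℝ ×ₗ ℕ} {s e : ℕ} {lo hi lo' hi' : ℕ → ℕ} {k h k' : ℕ} {τ υ : St}
    (hr : Round R p s e lo hi k h τ) (hs : R.d ≤ 2 ^ s) (ha : SelAt R p lo' hi' k' ((h + 1) / 2) υ)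
    (hW : 16 * R.width lo' hi' ≤ R.width lo hi + 152 * h + 64 * (R.m * (h - 1))) :
    Round R p s (e + 1) lo' hi' k' ((h + 1) / 2) υ := by
  have h0 := hr.at_.pos
  have hw : R.width lo' hi' ≤ (12 * R.m + 40) * ((h + 1) / 2) := by
    have h1 := hr.width
    have h2 : (12 * R.m + 40) * h ≤ (12 * R.m + 40) * (2 * ((h + 1) / 2)) := Nat.mul_le_mul_left _ (by omega)
    have h3 : R.m * (h - 1) ≤ R.m * h := Nat.mul_le_mul_left _ (by omega)
    have e1 : (12 * R.m + 40) * h = 12 * (R.m * h) + 40 * h := by ring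
    have e2 : (12 * R.m + 40) * (2 * ((h + 1) / 2)) = 2 * ((12 * R.m + 40) * ((h + 1) / 2)) := by ring
    omega
  refine ⟨ha, hw, ?_, ?_⟩
  · refine le_trans ?_ hr.h_le
    rw [pow_succ, mul_comm (2 ^ e) 2, ← mul_assoc]
    exact Nat.mul_le_mul_right _ (by omega)
  · rintro (_ | j) hj
    · have h1 : ((h + 1) / 2 - 1) * 2 ^ s ≤ R.d - 1 := by
        refine le_trans ?_ hr.h_le
        rw [show s = e + 1 by omega, pow_succ, mul_comm (2 ^ e) 2, ← mul_assoc]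
        exact Nat.mul_le_mul_right _ (by omega)
      have h2 : (h + 1) / 2 = 1 := by
        by_contra hc
        have h5 : 1 * 2 ^ s ≤ ((h + 1) / 2 - 1) * 2 ^ s := Nat.mul_le_mul_right _ (by omega)
        have := ha.h_le
        omega
      rw [h2] at hw
      simp only [pow_zero]; omega
    · obtain rfl : e = s + j := by omega
      have h1 := hr.h_eq hs
      subst h1
      have h2 := hr.late j rfl
      have h3 := Nat.mul_le_mul_left (16 ^ j) hW
      simp only [Nat.sub_self, Nat.mul_zero, Nat.add_zero, Nat.mul_one, Nat.mul_add] at h3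
      rw [pow_succ, mul_assoc]
      omega

theorem Round.length_le {R : Rows} {p : ℝ ×ₗ ℕ} {s e : ℕ} {lo hi : ℕ → ℕ} {k h : ℕ} {τ : St}
    (hr : Round R p s e lo hi k h τ) : (R.sample lo hi h R.m).length ≤ 12 * R.m + 40 := by
  have h1 := Rows.length_sample_le (R := R) (lo := lo) (hi := hi) h
  have h2 := hr.width
  refine Nat.le_of_mul_le_mul_left ?_ hr.at_.pos
  rw [mul_comm h (12 * R.m + 40)]
  omega

theorem select_spec {B k s q g X : ℕ} {R : Rows} {Q : ℕ → St → Prop} {p : ℝ ×ₗ ℕ} (σ : St)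
    (hR : RowsAt R B σ) (hd : 0 < R.d) (hsel : Rows.Sel R p (fun _ => 0) (fun _ => R.d) k) (hk : σ.w 13 = k)
    (h8 : σ.w 8 = s + q) (hs : R.d ≤ 2 ^ s) (hg : 24 * R.m + 230 ≤ 2 ^ g)
    (hX : ∀ N, 16 ^ q * N ≤ 12 * R.m + 40 + 11 * 16 ^ q → N * (g + 6) ≤ X)
    (hB : σ.w 99 + (s + q) * (160 * (R.m + 4)) + 3000 * (R.m + 4) + 4 * X < B)
    (hQ : ∀ t τ, Keeps 13 σ τ → τ.r 20 = (ofLex p).1 → τ.w 15 + R.m ≤ τ.w 99 →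
      (∀ a < R.m, τ.wm (τ.w 15 + a) = R.rank a (Set.Iic p)) →
      τ.w 99 ≤ σ.w 99 + (s + q) * (160 * (R.m + 4)) + 3 * R.m + X →
      t ≤ (s + q) * (60000 * (R.m + 4)) + 1000 * (X + R.m + 1) → Q t τ) :
    wp B select Q σ := by
  have hbig := hR.big
  unfold select
  simp only [wp_seq, wp_wset, rules, true_and]
  refine ⟨by omega, ?_⟩
  generalize hσ1 : (σ.setW 18 0).setW 14 _ = σ1
  have hK1 : Keeps 13 σ σ1 := by
    rw [← hσ1]; exact (Keeps.rfl'.setW).setW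
  have a99 : σ1.w 99 = σ.w 99 := by simp [← hσ1]
  have a14 : σ1.w 14 = σ.w 99 := by simp [← hσ1]
  have a18 : σ1.w 18 = 0 := by simp [← hσ1]
  have a13 : σ1.w 13 = k := by simp [← hσ1, hk]
  refine fill_spec (by omega) (by omega) σ1 (by rw [hK1.w 2, hR.m]) (by omega) ?_
  intro t2 σ2 hK2 hw2 h992 hz ht2
  generalize hσ3 : σ2.setW 15 _ = σ3
  have hK3 : Keeps 13 σ σ3 := by
    rw [← hσ3]; exact (hK1.trans hK2).setW
  have b99 : σ3.w 99 = σ.w 99 + R.m := by simp [← hσ3, h992, a99]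
  have b15 : σ3.w 15 = σ.w 99 + R.m := by simp [← hσ3, h992, a99]
  have b14 : σ3.w 14 = σ.w 99 := by rw [← hσ3, ← a14, ← hw2 14 (by omega) (by omega)]; simp
  have b13 : σ3.w 13 = k := by rw [← hσ3, ← a13, ← hw2 13 (by omega) (by omega)]; simp
  have bz : ∀ a < R.m, σ3.wm (σ.w 99 + a) = 0 := by
    intro a ha; rw [← hσ3, ← a18, ← hz a ha, a99]; rfl
  refine fill_spec (by omega) (by omega) σ3 (by rw [hK3.w 2, hR.m]) (by omega) ?_
  intro t4 σ4 hK4 hw4 h994 hfd ht4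
  generalize hσ5 : (σ4.setW 17 _).setW 16 _ = σ5
  have hK5 : Keeps 13 σ σ5 := by
    rw [← hσ5]; exact ((hK3.trans hK4).setW).setW
  have d4 : σ4.w 1 = R.d := by rw [hK4.w 1, hK3.w 1, hR.d]
  have c99 : σ5.w 99 = σ.w 99 + R.m + R.m := by simp [← hσ5, h994, b99]
  have hw5 : ∀ j, j ≠ 16 → j ≠ 17 → j ≠ 99 → σ5.w j = σ3.w j := by
    intro j h1 h2 h3; rw [← hw4 j h1 h3, ← hσ5]; simp [h1, h2]
  have c16 : σ5.w 16 = s + q := by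
    rw [← h8, ← hK3.w 8, ← hK4.w 8]; simp [← hσ5]
  have c17 : σ5.w 17 = R.d := by rw [← d4]; simp [← hσ5]
  have c14 := hw5 14 (by omega) (by omega) (by omega)
  have c15 := hw5 15 (by omega) (by omega) (by omega)
  have c13 := hw5 13 (by omega) (by omega) (by omega)
  have hinit : SelAt R p (fun _ => 0) (fun _ => R.d) k R.d σ5 := by
    refine ⟨hsel, hd, le_rfl, by omega, c17, by omega, by omega, ?_, ?_⟩
    · intro a ha
      rw [c14, b14]
      have : σ5.wm (σ.w 99 + a) = σ4.wm (σ.w 99 + a) := by rw [← hσ5]; rfl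
      rw [this, hK4.wm _ (by omega), bz a ha]
    · intro a ha
      rw [c15, b15]
      have : σ5.wm (σ.w 99 + R.m + a) = σ4.wm (σ.w 99 + R.m + a) := by rw [← hσ5]; rfl
      rw [this, ← b99, hfd a ha, hK3.w 1, hR.d]
  refine wp_loop (fun (e : ℕ) τ => Keeps 13 σ τ ∧ τ.w 16 + e = s + q ∧
    τ.w 99 + τ.w 16 * (160 * (R.m + 4)) ≤ σ.w 99 + R.m + R.m + (s + q) * (160 * (R.m + 4)) ∧
    ∃ lo hi k h, Round R p s e lo hi k h τ) (fun e => (s + q - e) * (60000 * (R.m + 4))) ?_ ?_ 0 ?_ ?_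
  · intros; simp [rules]; omega
  · rintro e τ ⟨hK, h16, hal, lo, hi, k, h, hr⟩ hc
    simp only [rules] at hc
    have hN := hr.length_le
    obtain ⟨c, hc'⟩ : ∃ c, τ.w 16 = c + 1 := ⟨τ.w 16 - 1, by omega⟩
    rw [hc', Nat.add_mul c 1] at hal
    have hbig' := hr.at_.h_le
    generalize hQ' : (fun (k : ℕ) (τ' : St) => ∃ a', _ ∧ _) = Q'
    rw [wp_seq]
    refine roundStep_spec τ (hR.keeps hK) hr.at_ (by omega) ?_
    intro t υ lo' hi' k' hKυ e16 hs' hW hal' ht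
    simp only [wp_seq, wp_wset, rules, true_and, St.setW_w]
    simp only [Nat.reduceEqDiff, if_false, e16, hs'.h]
    refine ⟨by omega, by omega, ?_⟩
    rw [← hQ']
    have h9 := hs'.pos
    have h10 := hs'.h_le
    refine ⟨e + 1, ⟨((hK.trans hKυ).setW).setW, ?_, ?_, lo', hi', k',
      (h + 1) / 2, hr.next hs ?_ hW⟩, ?_⟩
    · simp; omega
    · simp [hc']; omega
    · refine ⟨hs'.sel, by omega, by omega, ?_, ?_, ?_, ?_, ?_, ?_⟩
      · simpa using hs'.k
      · simp
      · simpa using hs'.lo_al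
      · simpa using hs'.hi_al
      · simpa using hs'.lo
      · simpa using hs'.hi
    · have e1 : s + q - e = (s + q - (e + 1)) + 1 := by omega
      rw [e1, Nat.add_mul (s + q - (e + 1)) 1]
      simp only [rules]
      omega
  · refine ⟨hK5, by omega, by rw [c99, c16], fun _ => 0, fun _ => R.d, k, R.d, hinit, ?_, by simp, ?_⟩
    · refine hsel.width_le.trans (Nat.mul_le_mul_right _ (by omega))
    · intro j hj
      obtain ⟨rfl, rfl⟩ : s = 0 ∧ j = 0 := by omega
      simp only [pow_zero] at hs ⊢
      have := hsel.width_le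
      have e : R.m * R.d = R.m := by rw [show R.d = 1 by omega, mul_one]
      omega
  · rintro e t τ ⟨hK, h16, hal, lo, hi, k, h, hr⟩ hc ht
    simp only [rules, not_lt] at hc ht
    obtain rfl : e = s + q := by omega
    have h1 := hr.h_eq hs
    subst h1
    have hWX := hX _ (hr.late q rfl)
    have hW := hr.width
    rw [Nat.le_zero.1 hc, Nat.zero_mul] at hal
    have eg : R.width lo hi * (g + 20) ≤ 4 * (R.width lo hi * (g + 6)) := by
      rw [← mul_assoc, mul_comm 4, mul_assoc]
      exact Nat.mul_le_mul_left _ (by omega)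
    have eg2 : R.width lo hi * (g + 5) ≤ R.width lo hi * (g + 6) := Nat.mul_le_mul_left _ (by omega)
    refine lastStep_spec (g := g) τ (hR.keeps hK) hr.at_ (by omega) (by omega) ?_
    intro t' υ hKυ h20 h15 hrank hal' ht'
    rw [Nat.sub_zero, Nat.sub_self, Nat.zero_mul] at ht
    refine hQ _ υ (hK.trans hKυ) h20 h15 hrank (by omega) (by omega)

end RealRAM

namespace RealRAM

/-! ## The rows of a shift -/

theorem sum_range_mul_eq (g : ℕ → ℝ) (m d : ℕ) :
    ∑ a ∈ Finset.range m, ∑ t ∈ Finset.range d, g (a * d + t) = ∑ i ∈ Finset.range (m * d), g i := by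
  induction m with
  | zero => simp
  | succ m ih => rw [Finset.sum_range_succ, ih, Nat.add_mul, one_mul, Finset.sum_range_add]

theorem sum_getD_perm {π : List ℕ} {d : ℕ} (h : π.Perm (List.range d)) (g : ℕ → ℝ) :
    ∑ u ∈ Finset.range d, g (π.getD u 0) = ∑ t ∈ Finset.range d, g t := by
  have hl : π.length = d := by rw [h.length_eq]; simp
  have h1 : ∀ l : List ℕ, ∑ u ∈ Finset.range l.length, g (l.getD u 0) = (l.map g).sum := by
    intro l
    induction l with
    | nil => simp
    | cons a l ih => rw [List.length_cons, Finset.sum_range_succ', List.map_cons, List.sum_cons, ← ih]; simp [add_comm]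
  rw [← hl, h1, (h.map g).sum_eq, ← h1]
  simp only [List.length_range]
  rw [hl]
  refine Finset.sum_congr rfl fun t ht => ?_
  have := Finset.mem_range.1 ht
  simp [this]

theorem IsRecord.sub {v : ℕ → ℝ} {π : List ℕ} {e q u : ℕ} {σ : St} (h : IsRecord v π e σ q) (hu : u < π.length) :
    σ.rm (q + u + 1) - σ.rm (q + u) = v (e + π.getD u 0) := by
  rw [add_assoc, h (u + 1) hu, h u hu.le, List.take_succ_eq_append_getElem hu]
  simp [hu]

/-- The rows for the shift `s`. -/
structure RowsFor (P : Data) (B m s : ℕ) (σ : St) (R : Rows) : Prop where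
  m_eq : R.m = m
  d_eq : R.d = P.d
  at_ : RowsAt R B σ
  sum : ∀ f : ℝ → ℝ, ∑ a ∈ Finset.range R.m, ∑ u ∈ Finset.range R.d, f (R.val a u) =
    ∑ i ∈ Finset.range (m * P.d), f (P.z P.xb (P.yb + s) i)

theorem exists_rows {P : Data} {B m s A : ℕ} (σ : St) (hI : P.In A σ) (hd : 0 < P.d) (hmb : P.mb = 0)
    (hm : σ.w 2 = m) (hyb : P.xb + m * P.d ≤ P.yb) (hJ : s + m * P.d < P.J + P.d)
    (h7 : σ.w 7 = 2 * (P.d * (P.J + 1))) (h10 : σ.w 10 = 2 * s)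
    (hbig : 2 * s + m * (2 * (P.d * (P.J + 1))) + m * P.d + 2 * P.d < B)
    (hg : ∀ a < m, ∀ j < P.J, Good P σ (P.xb + a * P.d) (P.yb + j)) : ∃ R, RowsFor P B m s σ R := by
  have hmul : ∀ a < m, a * P.d + P.d ≤ m * P.d := by
    intro a ha
    rw [← Nat.succ_mul]; exact Nat.mul_le_mul_right _ ha
  have hpair : ∀ a < m, P.IsPair (P.xb + a * P.d) (P.yb + s + a * P.d) := by
    intro a ha
    have := hmul a ha
    exact ⟨⟨by omega, by omega⟩, by omega, by omega⟩
  have hslot : ∀ a < m, P.slot (P.xb + a * P.d) (P.yb + s + a * P.d) = σ.w 10 + a * σ.w 7 := by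
    intro a _
    rw [Data.slot, h10, h7, hmb, Nat.add_sub_cancel_left, show P.yb + s + a * P.d - P.yb = s + a * P.d by omega]
    ring
  have hgood : ∀ a < m, Good P σ (P.xb + a * P.d) (P.yb + s + a * P.d) := by
    intro a ha
    have := hmul a ha
    rw [add_assoc]
    exact hg a ha _ (by omega)
  choose! π hperm hsort hrx hry using hgood
  have hlen : ∀ a < m, (π a).length = P.d := by
    intro a ha; rw [(hperm a ha).length_eq]; simp
  have hpos : ∀ u v, ∀ a < m, u ≤ v → v < P.d → P.z (P.xb + a * P.d) (P.yb + s + a * P.d) ((π a).getD u 0) ≤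
      P.z (P.xb + a * P.d) (P.yb + s + a * P.d) ((π a).getD v 0) := by
    intro u v a ha huv hv
    rcases huv.lt_or_eq with h | rfl
    · have := List.pairwise_iff_getElem.1 (hsort a ha) u v (by rw [hlen a ha]; omega) (by rw [hlen a ha]; omega) h
      simpa [hlen a ha, hv, h.trans hv] using this
    · exact le_rfl
  refine ⟨⟨m, P.d, fun a u => P.z (P.xb + a * P.d) (P.yb + s + a * P.d) ((π a).getD u 0),
    fun a ha u v huv hv => hpos u v a ha huv hv⟩, rfl, rfl, ⟨hI.d, hm, ?_, ?_, ?_, ?_, ?_⟩, ?_⟩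
  · intro a ha
    rw [← hslot a ha]
    have h1 := Data.slot_lt (hpair a ha) hd
    have h2 := hI.matrix
    have h3 := hI.al
    omega
  · intro a ha
    have := (hrx a ha).2
    rw [hlen a ha, hslot a ha] at this
    exact this
  · intro a ha
    have := (hry a ha).2
    rw [hlen a ha, hslot a ha] at this
    exact this
  · intro a ha u hu
    have hx := (hrx a ha).1.sub (u := u) (by rw [hlen a ha]; exact hu)
    have hy := (hry a ha).1.sub (u := u) (by rw [hlen a ha]; exact hu)
    rw [hslot a ha] at hx hy
    rw [hx, hy]
    rfl
  · rw [h10, h7]; exact hbig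
  · intro f
    rw [← sum_range_mul_eq]
    refine Finset.sum_congr rfl fun a ha => ?_
    have ha := Finset.mem_range.1 ha
    rw [sum_getD_perm (hperm a ha) (fun t => f (P.z (P.xb + a * P.d) (P.yb + s + a * P.d) t))]
    refine Finset.sum_congr rfl fun t _ => ?_
    simp only [Data.z, add_assoc]

/-! ## The median -/

open Classical in
theorem Rows.sum_rank_eq {R : Rows} (s : Set (ℝ ×ₗ ℕ)) :
    ((∑ a ∈ Finset.range R.m, R.rank a s : ℕ) : ℝ) =
      ∑ a ∈ Finset.range R.m, ∑ u ∈ Finset.range R.d, if R.key a u ∈ s then (1 : ℝ) else 0 := by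
  classical
  push_cast
  refine Finset.sum_congr rfl fun a _ => ?_
  rw [Rows.rank_eq, Finset.card_filter]
  push_cast
  refine Finset.sum_congr rfl fun u _ => ?_
  congr

/-- The sum of the distances to the pivot in a row. -/
theorem Rows.sum_abs {R : Rows} {a : ℕ} (ha : a < R.m) (p : ℝ ×ₗ ℕ) :
    ∑ u ∈ Finset.range R.d, |R.val a u - (ofLex p).1| =
      ((ofLex p).1 * (R.rank a (Set.Iic p)) + (ofLex p).1 * (R.rank a (Set.Iic p)) - (ofLex p).1 * R.d) +
      ((∑ u ∈ Finset.range R.d, R.val a u - ∑ u ∈ Finset.range (R.rank a (Set.Iic p)), R.val a u) -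
        ∑ u ∈ Finset.range (R.rank a (Set.Iic p)), R.val a u) := by
  have hr := Rows.rank_le (R := R) a (Set.Iic p)
  have h0 := fun u (hu : u < R.d) => Rows.lt_rank (R := R) (isLowerSet_Iic p) ha hu
  generalize R.rank a (Set.Iic p) = r at *
  have hle : ∀ u < R.d, u < r → R.val a u ≤ (ofLex p).1 := by
    intro u hu h
    have := (h0 u hu).1 h
    rw [Set.mem_Iic, Rows.key, Prod.Lex.le_iff] at this
    rcases this with h | h
    · exact le_of_lt h
    · exact le_of_eq h.1
  have hge : ∀ u < R.d, r ≤ u → (ofLex p).1 ≤ R.val a u := by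
    intro u hu h
    have := (h0 u hu).not.1 (by omega)
    rw [Set.mem_Iic, not_le, Rows.key, Prod.Lex.lt_iff] at this
    rcases this with h | h
    · exact le_of_lt h
    · exact le_of_eq h.1
  obtain ⟨e, he⟩ := Nat.exists_eq_add_of_le hr
  have h1 : ∀ f : ℕ → ℝ, ∑ u ∈ Finset.range R.d, f u = ∑ u ∈ Finset.range r, f u + ∑ u ∈ Finset.range e, f (r + u) := by
    intro f; rw [he, Finset.sum_range_add]
  rw [h1, h1]
  have h2 : ∑ u ∈ Finset.range r, |R.val a u - (ofLex p).1| = (ofLex p).1 * r - ∑ u ∈ Finset.range r, R.val a u := by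
    rw [Finset.sum_congr rfl (g := fun u => (ofLex p).1 - R.val a u) fun u hu => by
      have := Finset.mem_range.1 hu
      rw [abs_of_nonpos (by linarith [hle u (by omega) this])]; ring]
    rw [Finset.sum_sub_distrib]; simp; ring
  have h3 : ∑ u ∈ Finset.range e, |R.val a (r + u) - (ofLex p).1| =
      ∑ u ∈ Finset.range e, R.val a (r + u) - (ofLex p).1 * e := by
    rw [Finset.sum_congr rfl (g := fun u => R.val a (r + u) - (ofLex p).1) fun u hu => by
      have := Finset.mem_range.1 hu
      rw [abs_of_nonneg (by linarith [hge (r + u) (by omega) (by omega)])]]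
    rw [Finset.sum_sub_distrib]; simp; ring
  rw [h2, h3, he]
  push_cast; ring

/-- A median minimizes the sum of the distances. -/
theorem sum_abs_median {n : ℕ} {z : ℕ → ℝ} {c : ℝ}
    (h1 : (n : ℝ) ≤ 2 * ∑ i ∈ Finset.range n, if z i ≤ c then (1 : ℝ) else 0)
    (h2 : 2 * ∑ i ∈ Finset.range n, (if z i < c then (1 : ℝ) else 0) ≤ n) (c' : ℝ) :
    ∑ i ∈ Finset.range n, |z i - c| ≤ ∑ i ∈ Finset.range n, |z i - c'| := by
  rcases le_total c c' with h | h
  · have key : ∑ i ∈ Finset.range n, (|z i - c| + (c' - c) * (2 * (if z i ≤ c then (1 : ℝ) else 0) - 1)) ≤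
        ∑ i ∈ Finset.range n, |z i - c'| := by
      refine Finset.sum_le_sum fun i _ => ?_
      split_ifs with h3
      · rw [abs_of_nonpos (by linarith), abs_of_nonpos (by linarith)]; linarith
      · have := abs_sub_abs_le_abs_sub (z i - c) (z i - c')
        rw [show z i - c - (z i - c') = c' - c by ring, abs_of_nonneg (sub_nonneg.2 h)] at this
        linarith
    rw [Finset.sum_add_distrib, ← Finset.mul_sum, Finset.sum_sub_distrib, ← Finset.mul_sum] at key
    simp only [Finset.sum_const, Finset.card_range, nsmul_eq_mul, mul_one] at key
    have := mul_nonneg (sub_nonneg.2 h) (sub_nonneg.2 h1)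
    linarith
  · have key : ∑ i ∈ Finset.range n, (|z i - c| + (c - c') * (1 - 2 * (if z i < c then (1 : ℝ) else 0))) ≤
        ∑ i ∈ Finset.range n, |z i - c'| := by
      refine Finset.sum_le_sum fun i _ => ?_
      split_ifs with h3
      · have := abs_sub_abs_le_abs_sub (z i - c) (z i - c')
        rw [show z i - c - (z i - c') = -(c - c') by ring, abs_neg, abs_of_nonneg (sub_nonneg.2 h)] at this
        linarith
      · rw [abs_of_nonneg (by linarith), abs_of_nonneg (by linarith)]; linarith
    rw [Finset.sum_add_distrib, ← Finset.mul_sum, Finset.sum_sub_distrib, ← Finset.mul_sum] at key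
    simp only [Finset.sum_const, Finset.card_range, nsmul_eq_mul, mul_one] at key
    have := mul_nonneg (sub_nonneg.2 h) (sub_nonneg.2 h2)
    linarith

/-- The entry of rank `D + n / 2` of the rows is a median of the first `n` entries, if the other `D` entries are
small. -/
theorem Rows.median {R : Rows} {z : ℕ → ℝ} {n D : ℕ} {p : ℝ ×ₗ ℕ}
    (hn : 0 < n) (hlt : ∀ i < n, -1 < z i ∧ z i < 2) (hD : ∀ i, n ≤ i → i < n + D → z i < -1)
    (hsum : ∀ f : ℝ → ℝ, ∑ a ∈ Finset.range R.m, ∑ u ∈ Finset.range R.d, f (R.val a u) =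
      ∑ i ∈ Finset.range (n + D), f (z i))
    (h1 : ∑ b ∈ Finset.range R.m, R.rank b (Set.Iio p) = D + n / 2)
    (h2 : ∑ b ∈ Finset.range R.m, R.rank b (Set.Iic p) = D + n / 2 + 1) :
    (-1 < (ofLex p).1 ∧ (ofLex p).1 < 2) ∧ ∀ c', ∑ i ∈ Finset.range n, |z i - (ofLex p).1| ≤ ∑ i ∈ Finset.range n, |z i - c'| := by
  classical
  set c := (ofLex p).1 with hc
  have hle : (D : ℝ) + (n / 2 : ℕ) + 1 ≤ ∑ i ∈ Finset.range (n + D), if z i ≤ c then (1 : ℝ) else 0 := by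
    rw [← hsum (fun x => if x ≤ c then (1 : ℝ) else 0)]
    have h3 := Rows.sum_rank_eq (R := R) (Set.Iic p)
    rw [h2] at h3
    push_cast at h3 ⊢
    rw [h3]
    refine Finset.sum_le_sum fun a _ => Finset.sum_le_sum fun u _ => ?_
    split_ifs with h4 h5 h5
    · exact le_rfl
    · rw [Set.mem_Iic, Rows.key, Prod.Lex.le_iff] at h4
      rcases h4 with h | h
      · exact absurd (le_of_lt h) h5
      · exact absurd (le_of_eq h.1) h5
    · exact zero_le_one
    · exact le_rfl
  have hlt' : ∑ i ∈ Finset.range (n + D), (if z i < c then (1 : ℝ) else 0) ≤ D + (n / 2 : ℕ) := by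
    rw [← hsum (fun x => if x < c then (1 : ℝ) else 0)]
    have h3 := Rows.sum_rank_eq (R := R) (Set.Iio p)
    rw [h1] at h3
    push_cast at h3 ⊢
    rw [h3]
    refine Finset.sum_le_sum fun a _ => Finset.sum_le_sum fun u _ => ?_
    split_ifs with h4 h5 h5
    · exact le_rfl
    · rw [Set.mem_Iio, Rows.key, Prod.Lex.lt_iff] at h5
      exact absurd (Or.inl h4) h5
    · exact zero_le_one
    · exact le_rfl
  rw [Finset.sum_range_add] at hle hlt'
  have hn2 : ((n / 2 : ℕ) : ℝ) ≤ n / 2 := Nat.cast_div_le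
  have hn3 : (n : ℝ) ≤ 2 * (n / 2 : ℕ) + 1 := by
    exact_mod_cast (show n ≤ 2 * (n / 2) + 1 by omega)
  have hnpos : (1 : ℝ) ≤ n := by exact_mod_cast hn
  have hgt : -1 < c := by
    by_contra hcon
    have h5 : ∑ i ∈ Finset.range n, (if z i ≤ c then (1 : ℝ) else 0) = 0 := by
      refine Finset.sum_eq_zero fun i hi => if_neg ?_
      have := (hlt i (Finset.mem_range.1 hi)).1
      push Not; linarith
    have h6 : ∑ i ∈ Finset.range D, (if z (n + i) ≤ c then (1 : ℝ) else 0) ≤ ∑ i ∈ Finset.range D, 1 :=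
      Finset.sum_le_sum fun i _ => by split_ifs <;> norm_num
    simp only [Finset.sum_const, Finset.card_range, nsmul_eq_mul, mul_one] at h6
    have : (0 : ℝ) ≤ (n / 2 : ℕ) := Nat.cast_nonneg _
    linarith
  have h6 : ∑ i ∈ Finset.range D, (if z (n + i) ≤ c then (1 : ℝ) else 0) = D := by
    rw [Finset.sum_congr rfl fun i hi => if_pos (by
      have := hD (n + i) (by omega) (by have := Finset.mem_range.1 hi; omega)
      linarith)]
    simp
  have h7 : ∑ i ∈ Finset.range D, (if z (n + i) < c then (1 : ℝ) else 0) = D := by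
    rw [Finset.sum_congr rfl fun i hi => if_pos (by
      have := hD (n + i) (by omega) (by have := Finset.mem_range.1 hi; omega)
      linarith)]
    simp
  rw [h6] at hle
  rw [h7] at hlt'
  refine ⟨⟨hgt, ?_⟩, sum_abs_median (by linarith) (by linarith)⟩
  by_contra hcon
  have h5 : ∑ i ∈ Finset.range n, (if z i < c then (1 : ℝ) else 0) = n := by
    rw [Finset.sum_congr rfl fun i hi => if_pos (by
      have := (hlt i (Finset.mem_range.1 hi)).2
      linarith)]
    simp
  linarith

end RealRAM

namespace RealRAM

/-! ## The loop over all shifts -/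

/-- Difference of the records of the current row. -/
def prefixDiff (u : WExp) : RExp := .mem (.reg 83 + u) - .mem (.reg 82 + u)

/-- Add the distances of the entries of the row to the pivot. -/
def costBody : Stmt :=
  .rset 90 (.reg 90 + (((.reg 20 * .cast (.reg 86) + .reg 20 * .cast (.reg 86)) - .reg 20 * .cast (.reg 1)) +
    ((prefixDiff (.reg 1) - prefixDiff (.reg 86)) - (prefixDiff (.reg 86) - prefixDiff 0))))

theorem InRow.sum_val {R : Rows} {B a : ℕ} {τ : St} (h : InRow R B a τ) {t : ℕ} (ht : t ≤ R.d) :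
    ∑ u ∈ Finset.range t, R.val a u =
      (τ.rm (τ.w 83 + t) - τ.rm (τ.w 82 + t)) - (τ.rm (τ.w 83) - τ.rm (τ.w 82)) := by
  have := Finset.sum_range_sub (fun u => τ.rm (τ.w 83 + u) - τ.rm (τ.w 82 + u)) t
  simp only [add_zero] at this
  rw [← this]
  refine Finset.sum_congr rfl fun u hu => ?_
  rw [h.val u (by have := Finset.mem_range.1 hu; omega), add_assoc, add_assoc]
  ring

theorem costRows_spec {B : ℕ} {R : Rows} {Q : ℕ → St → Prop} {p : ℝ ×ₗ ℕ} (σ : St) (hR : RowsAt R B σ)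
    (hhi : σ.w 15 + R.m ≤ σ.w 99) (h14 : σ.w 14 = σ.w 15) (hrank : ∀ a < R.m, σ.wm (σ.w 15 + a) = R.rank a (Set.Iic p))
    (h20 : σ.r 20 = (ofLex p).1) (h90 : σ.r 90 = 0) (hB : σ.w 99 < B)
    (hQ : ∀ t τ, Keeps 80 σ τ → τ.w 99 = σ.w 99 →
      τ.r 90 = ∑ a ∈ Finset.range R.m, ∑ u ∈ Finset.range R.d, |R.val a u - (ofLex p).1| →
      t ≤ 140 * R.m + 10 → Q t τ) : wp B (rowLoop costBody) Q σ := by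
  refine rowLoop_spec σ (fun a τ => τ.w 99 = σ.w 99 ∧
    τ.r 90 = ∑ b ∈ Finset.range a, ∑ u ∈ Finset.range R.d, |R.val b u - (ofLex p).1|)
    (fun _ => 100) hR (by omega) hhi hB ?_ ?_ ?_ ?_
  · rintro a τ i v h1 h2 ⟨h3, h4⟩
    exact ⟨by simp [show 99 ≠ i by omega, h3], by simpa using h4⟩
  · simp [h90]
  · rintro a τ hr hK h85 h86 ⟨h3, h4⟩
    rw [hrank a hr.lt] at h86
    have hx := hr.x
    have hy := hr.y
    have hle := Rows.rank_le (R := R) a (Set.Iic p)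
    have hd := hr.d
    unfold costBody prefixDiff
    simp only [wp_rset, rules, true_and, hd, h86, add_zero]
    refine ⟨by omega, ?_, ⟨by simpa using h3, ?_⟩, by omega⟩
    · exact Keeps.rfl'.setR
    · rw [Finset.sum_range_succ, ← h4, Rows.sum_abs hr.lt, hr.sum_val le_rfl, hr.sum_val hle]
      simp [hK.r 20, h20]
  · rintro t τ hK ⟨h3, h4⟩ ht
    refine hQ t τ hK h3 h4 (ht.trans ?_)
    simp; omega

/-- The state is prepared for the loop over all shifts. -/
structure Ready (P : Data) (n m s₀ q A B : ℕ) (σ : St) : Prop where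
  mem : P.In A σ
  d_pos : 0 < P.d
  n_pos : 0 < n
  mb : P.mb = 0
  n_eq : σ.w 0 = n
  m_eq : σ.w 2 = m
  stride : σ.w 7 = 2 * (P.d * (P.J + 1))
  rounds : σ.w 8 = s₀ + q
  total : σ.w 9 = m * P.d
  n_le : n ≤ m * P.d
  xb_le : P.xb + m * P.d ≤ P.yb
  J_eq : P.J + P.d = n + m * P.d
  d_le : P.d ≤ 2 ^ s₀
  big : 2 * n + m * (2 * (P.d * (P.J + 1))) + m * P.d + 2 * P.d + n < B
  good : ∀ a < m, ∀ j < P.J, Good P σ (P.xb + a * P.d) (P.yb + j)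
  lt : ∀ s < n, ∀ i < n, -1 < P.z P.xb (P.yb + s) i ∧ P.z P.xb (P.yb + s) i < 2
  dummy : ∀ s < n, ∀ i, n ≤ i → i < m * P.d → P.z P.xb (P.yb + s) i < -1

theorem Ready.keeps {P : Data} {n m s₀ q A B : ℕ} {σ τ : St} (h : Ready P n m s₀ q A B σ) (hK : Keeps 10 σ τ) :
    Ready P n m s₀ q A B τ := by
  refine ⟨h.mem.keeps (by omega) hK, h.d_pos, h.n_pos, h.mb, (hK.w 0).trans h.n_eq, (hK.w 2).trans h.m_eq,
    (hK.w 7).trans h.stride, (hK.w 8).trans h.rounds, (hK.w 9).trans h.total, h.n_le,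
    h.xb_le, h.J_eq, h.d_le, h.big, fun a ha j hj => hK.goodMono h.mem h.d_pos _ _ ?_ (h.good a ha j hj), h.lt, h.dummy⟩
  have h1 : (a + 1) * P.d ≤ m * P.d := Nat.mul_le_mul_right _ ha
  have h2 := h.xb_le
  rw [Nat.add_mul, one_mul] at h1
  exact ⟨⟨by omega, by omega⟩, by omega, by omega⟩

/-- Compute the best offset for the shift `w11` and its cost. -/
def shiftCost : Stmt :=
  .wset 13 ((.reg 9 - .reg 0) + .reg 0 / 2) ;;
  select ;;
  .wset 14 (.reg 15) ;;
  .rset 90 (.cast 0) ;;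
  rowLoop costBody ;;
  .wset 22 (.reg 0) ;;
  .loop (.wlt (.reg 22) (.reg 9))
    (.rset 90 (.reg 90 - (.reg 20 - (.mem (.reg 6 + .reg 11 + .reg 22) - .mem (.reg 5 + .reg 22)))) ;;
    .wset 22 (.reg 22 + 1))

theorem shiftCost_spec {P : Data} {n m s₀ q A B s g X : ℕ} {Q : ℕ → St → Prop} (σ : St) (h : Ready P n m s₀ q A B σ)
    (hs : s < n) (h10 : σ.w 10 = 2 * s) (h11 : σ.w 11 = s) (hg : 24 * m + 230 ≤ 2 ^ g)
    (hX : ∀ N, 16 ^ q * N ≤ 12 * m + 40 + 11 * 16 ^ q → N * (g + 6) ≤ X)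
    (hB : σ.w 99 + (s₀ + q) * (160 * (m + 4)) + 3000 * (m + 4) + 4 * X < B)
    (hQ : ∀ t τ, Keeps 13 σ τ → -1 < τ.r 20 → τ.r 20 < 2 →
      τ.r 90 = ∑ i ∈ Finset.range n, |P.z P.xb (P.yb + s) i - τ.r 20| →
      (∀ c', τ.r 90 ≤ ∑ i ∈ Finset.range n, |P.z P.xb (P.yb + s) i - c'|) →
      τ.w 99 ≤ σ.w 99 + (s₀ + q) * (160 * (m + 4)) + 3 * m + X →
      t ≤ (s₀ + q) * (60000 * (m + 4)) + 1000 * (X + m + 1) + 140 * m + 40 * (m * P.d - n) + 100 → Q t τ) :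
    wp B shiftCost Q σ := by
  have hbig := h.big
  have hn := h.n_pos
  have hnm := h.n_le
  have hJ := h.J_eq
  have hxb := h.xb_le
  have hIle := h.mem.le
  have hIal := h.mem.al
  obtain ⟨R, hRF⟩ := exists_rows (B := B) (s := s) σ h.mem h.d_pos h.mb h.m_eq h.xb_le (by omega) h.stride h10 (by omega) h.good
  obtain ⟨hRm, hRd, hR, hRsum⟩ := hRF
  subst hRm
  rw [← hRd] at hnm hbig
  have hk0 : (R.m * R.d - n) + n / 2 < R.m * R.d := by omega
  obtain ⟨a₀, -, u₀, -, hk1, hk2⟩ := Rows.exists_key hk0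
  generalize R.key a₀ u₀ = p at hk1 hk2
  have hsel : Rows.Sel R p (fun _ => 0) (fun _ => R.d) ((R.m * R.d - n) + n / 2) :=
    ⟨fun _ _ => Nat.zero_le _, fun a _ => Rows.rank_le a _, fun _ _ => le_rfl, by simpa using hk1.symm, by rw [hk1, hk2]⟩
  have hmed := Rows.median (z := P.z P.xb (P.yb + s)) (D := R.m * R.d - n) hn (h.lt s hs)
    (fun i hi hi' => h.dummy s hs i hi (by rw [hRd] at hi' hnm; omega))
    (by rw [show n + (R.m * R.d - n) = R.m * R.d by omega, hRd]; rw [hRd] at hRsum; exact hRsum) hk1 hk2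
  unfold shiftCost
  rw [wp_seq]
  simp only [wp_wset, rules, true_and, and_true, h.total, h.n_eq]
  refine ⟨by rw [← hRd]; omega, ?_⟩
  generalize hσ1 : σ.setW 13 _ = σ1
  have hK1 : Keeps 13 σ σ1 := by rw [← hσ1]; exact Keeps.rfl'.setW
  have e99 : σ1.w 99 = σ.w 99 := by simp [← hσ1]
  rw [wp_seq]
  refine select_spec (s := s₀) (q := q) (g := g) (X := X) (p := p) (k := (R.m * R.d - n) + n / 2) σ1 (hR.keeps hK1)
    (by rw [hRd]; exact h.d_pos) hsel (by simp [← hσ1, hRd]) (by rw [hK1.w 8, h.rounds]) (by rw [hRd]; exact h.d_le)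
    hg hX (by rw [e99]; exact hB) ?_
  intro t2 σ2 hK2 h20 h15 hrank h992 ht2
  simp only [wp_seq, wp_wset, wp_rset, rules, true_and]
  refine ⟨by omega, ?_⟩
  generalize hσ3 : (σ2.setW 14 _).setR 90 _ = σ3
  have hK3 : Keeps 13 σ σ3 := by
    rw [← hσ3]; exact ((hK1.trans hK2).setW).setR
  have f99 : σ3.w 99 = σ2.w 99 := by simp [← hσ3]
  have f15 : σ3.w 15 = σ2.w 15 := by simp [← hσ3]
  refine costRows_spec (p := p) σ3 (hR.keeps hK3) (by omega) (by simp [← hσ3]) ?_ (by simp [← hσ3, h20]) (by simp [← hσ3])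
    (by omega) ?_
  · intro a ha
    rw [f15, ← hrank a ha, ← hσ3]; rfl
  intro t4 σ4 hK4 h994 h904 ht4
  have g20 : σ4.r 20 = (ofLex p).1 := by rw [hK4.r 20, ← h20]; simp [← hσ3]
  have hK4' : Keeps 13 σ σ4 := hK3.trans (hK4.mono)
  have hsum4 : σ4.r 90 = ∑ i ∈ Finset.range (R.m * R.d), |P.z P.xb (P.yb + s) i - (ofLex p).1| := by
    rw [h904, hRsum (fun x => |x - (ofLex p).1|), hRd]
  have hI4 := h.mem.keeps (by omega) hK4'
  rw [← hRd] at hxb hJ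
  refine wp_loop (fun (i : ℕ) τ => Keeps 13 σ τ ∧ τ.w 99 = σ4.w 99 ∧ τ.r 20 = (ofLex p).1 ∧ τ.w 22 = i ∧ n ≤ i ∧ i ≤ R.m * R.d ∧
    τ.r 90 + ∑ j ∈ Finset.Ico n i, ((ofLex p).1 - P.z P.xb (P.yb + s) j) = σ4.r 90)
    (fun i => 40 * (R.m * R.d - i)) ?_ ?_ n ?_ ?_
  · intros; simp
  · rintro i τ ⟨hK, h99, h20', h22, hni, him, hsum⟩ hc
    have hI := h.mem.keeps (by omega) hK
    simp only [rules, h22, hK.w 9, h.total, ← hRd] at hc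
    simp only [wp_seq, wp_wset, wp_rset, rules, true_and, St.setR_w, h22, hI.yb, hI.xb, hK.w 11, h11, h20']
    rw [hI.rm _ (by omega), hI.rm _ (by omega)]
    refine ⟨by omega, by omega, i + 1, ⟨(hK.setR).setW, by simpa using h99, by simpa using h20',
      by simp, by omega, by omega, ?_⟩, by omega⟩
    rw [Finset.sum_Ico_succ_top hni, ← hsum]
    simp [Data.z]
  · have h0 : σ4.w 0 = n := by rw [hK4'.w 0, h.n_eq]
    exact ⟨hK4'.setW, by simp, by simpa using g20, by simp [h0], le_rfl, hnm, by simp⟩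
  · rintro i t τ ⟨hK, h99, h20', h22, hni, him, hsum⟩ hc ht
    simp only [rules, h22, hK.w 9, h.total, ← hRd, not_lt] at hc ht
    obtain rfl : i = R.m * R.d := by omega
    have h90 : τ.r 90 = ∑ i ∈ Finset.range n, |P.z P.xb (P.yb + s) i - (ofLex p).1| := by
      have hdum : ∑ j ∈ Finset.Ico n (R.m * R.d), |P.z P.xb (P.yb + s) j - (ofLex p).1| =
          ∑ j ∈ Finset.Ico n (R.m * R.d), ((ofLex p).1 - P.z P.xb (P.yb + s) j) := by
        refine Finset.sum_congr rfl fun j hj => ?_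
        have hj := Finset.mem_Ico.1 hj
        have := h.dummy s hs j hj.1 (by rw [← hRd]; exact hj.2)
        rw [abs_of_nonpos (by linarith [hmed.1.1])]; ring
      rw [hsum4, ← Finset.sum_range_add_sum_Ico _ hnm, hdum] at hsum
      linarith
    refine hQ _ τ hK (by rw [h20']; exact hmed.1.1) (by rw [h20']; exact hmed.1.2) (by rw [h90, h20'])
      (fun c' => by rw [h90]; exact hmed.2 c') (by omega) ?_
    rw [← hRd]
    omega

/-- Try all shifts. -/
def shiftLoop : Stmt :=
  .wset 11 0 ;;
  .wset 10 0 ;;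
  .loop (.wlt (.reg 11) (.reg 0))
    (shiftCost ;;
    .ite (.and (.wlt 0 (.reg 11)) (.not (.rlt (.reg 90) (.reg 11)))) .skip
      (.rset 11 (.reg 90) ;; .rset 12 (.reg 20) ;; .wset 12 (.reg 11)) ;;
    .wset 11 (.reg 11 + 1) ;;
    .wset 10 (.reg 10 + 2))

theorem shiftLoop_spec {P : Data} {n m s₀ q A B g X : ℕ} {Q : ℕ → St → Prop} (σ : St) (h : Ready P n m s₀ q A B σ)
    (hg : 24 * m + 230 ≤ 2 ^ g) (hX : ∀ N, 16 ^ q * N ≤ 12 * m + 40 + 11 * 16 ^ q → N * (g + 6) ≤ X)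
    (hB : σ.w 99 + n * ((s₀ + q) * (160 * (m + 4)) + 3 * m + X) + 3000 * (m + 4) + 4 * X < B)
    (hQ : ∀ t τ, Keeps 10 σ τ → -1 < τ.r 12 → τ.r 12 < 2 → τ.w 12 < n →
      (∀ s < n, ∀ c', ∑ i ∈ Finset.range n, |P.z P.xb (P.yb + τ.w 12) i - τ.r 12| ≤
        ∑ i ∈ Finset.range n, |P.z P.xb (P.yb + s) i - c'|) →
      t ≤ n * ((s₀ + q) * (60000 * (m + 4)) + 1000 * (X + m + 1) + 140 * m + 40 * (m * P.d - n) + 200) + 20 → Q t τ) :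
    wp B shiftLoop Q σ := by
  have hbig := h.big
  have hn := h.n_pos
  unfold shiftLoop
  simp only [wp_seq, wp_wset, rules]
  refine ⟨by omega, by omega, ?_⟩
  generalize hAS : (s₀ + q) * (160 * (m + 4)) + 3 * m + X = U at hB
  generalize hTS : (s₀ + q) * (60000 * (m + 4)) + 1000 * (X + m + 1) + 140 * m + 40 * (m * P.d - n) + 200 = V at hQ
  refine wp_loop (fun (s : ℕ) τ => Keeps 10 σ τ ∧ s ≤ n ∧ τ.w 11 = s ∧ τ.w 10 = 2 * s ∧ τ.w 99 ≤ σ.w 99 + s * U ∧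
    (0 < s → -1 < τ.r 12 ∧ τ.r 12 < 2 ∧ τ.w 12 < s ∧ τ.r 11 = ∑ i ∈ Finset.range n, |P.z P.xb (P.yb + τ.w 12) i - τ.r 12| ∧
      ∀ s' < s, ∀ c', τ.r 11 ≤ ∑ i ∈ Finset.range n, |P.z P.xb (P.yb + s') i - c'|))
    (fun s => (n - s) * V) ?_ ?_ 0 ?_ ?_
  · intros; simp
  · rintro s τ ⟨hK, hsn, h11, h10, h99, hbest⟩ hc
    simp only [rules, h11, hK.w 0, h.n_eq] at hc
    have hmul : (s + 1) * U ≤ n * U := Nat.mul_le_mul_right _ hc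
    rw [Nat.add_mul, one_mul] at hmul
    generalize hQ' : (fun (k : ℕ) (τ' : St) => ∃ a', _ ∧ _) = Q'
    rw [wp_seq]
    have hb : τ.w 99 + (s₀ + q) * (160 * (m + 4)) + 3000 * (m + 4) + 4 * X < B := by
      linarith
    refine shiftCost_spec τ (h.keeps hK) hc h10 h11 hg hX hb ?_
    intro t υ hKυ hc1 hc2 hcost hopt h99' ht
    have i0 := hKυ.w 12
    have i10 : υ.w 10 = 2 * s := by rw [hKυ.w 10, h10]
    have i11 : υ.w 11 = s := by rw [hKυ.w 11, h11]
    have j11 : υ.r 11 = τ.r 11 := hKυ.r 11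
    have j12 : υ.r 12 = τ.r 12 := hKυ.r 12
    have hKυ' := hK.trans (hKυ.mono)
    have hV : (n - s) * V = (n - (s + 1)) * V + V := by
      rw [show n - s = n - (s + 1) + 1 by omega, Nat.add_mul, one_mul]
    simp only [wp_seq, wp_wset, wp_rset, wp_ite, wp_skip, rules, St.setW_w, St.setR_w, St.setR_r, true_and]
    simp only [Nat.reduceEqDiff, if_false, i10, i11, j11]
    refine ⟨by simp; omega, fun hkeep => ⟨by omega, by omega, ?_⟩, fun hnew => ⟨by omega, by omega, ?_⟩⟩
    · rw [← hQ']
      obtain ⟨b1, b2, b3, b4, b5⟩ := hbest hkeep.1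
      refine ⟨s + 1, ⟨(hKυ'.setW).setW, by omega, by simp, by simp; omega,
        by rw [Nat.add_mul, one_mul]; simp; omega, fun _ => ?_⟩, by simp only [rules]; omega⟩
      simp only [St.setW_r, St.setW_w, Nat.reduceEqDiff, if_false, j11, j12, i0]
      refine ⟨b1, b2, by omega, b4, fun s' hs' c' => ?_⟩
      rcases Nat.lt_succ_iff_lt_or_eq.1 hs' with h1 | rfl
      · exact b5 s' h1 c'
      · exact (not_lt.1 hkeep.2).trans (hopt c')
    · rw [← hQ']
      refine ⟨s + 1, ⟨(((((hKυ'.setR).setR).setW).setW).setW), by omega, by simp, by simp; omega,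
        by rw [Nat.add_mul, one_mul]; simp; omega, fun _ => ?_⟩, by simp only [rules]; omega⟩
      simp only [St.setW_r, St.setW_w, St.setR_r, Nat.reduceEqDiff, if_false, if_true]
      refine ⟨hc1, hc2, by omega, hcost, fun s' hs' c' => ?_⟩
      rcases Nat.lt_succ_iff_lt_or_eq.1 hs' with h1 | rfl
      · have h2 : 0 < s := by omega
        have h3 : υ.r 90 < τ.r 11 := by
          by_contra hcon
          exact hnew ⟨h2, hcon⟩
        exact h3.le.trans ((hbest h2).2.2.2.2 s' h1 c')
      · exact hopt c'
  · exact ⟨(Keeps.rfl'.setW).setW, by omega, by simp, by simp, by simp, by omega⟩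
  · rintro s t τ ⟨hK, hsn, h11, h10, h99, hbest⟩ hc ht
    simp only [rules, h11, hK.w 0, h.n_eq, not_lt] at hc ht
    obtain rfl : s = n := by omega
    obtain ⟨b1, b2, b3, b4, b5⟩ := hbest hn
    rw [Nat.sub_self, Nat.zero_mul] at ht
    rw [Nat.sub_zero] at ht
    refine hQ _ τ hK b1 b2 b3 (fun s' hs' c' => by rw [← b4]; exact b5 s' hs' c') (by omega)

end RealRAM

namespace RealRAM

/-! ## Setting up -/

/-- Append words and real numbers to the allocated memory until the counter `w20` reaches `b`. -/
def append (e : WExp) (e' : RExp) (b : WExp) : Stmt :=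
  .loop (.wlt (.reg 20) b) (.wput (.reg 99) e ;; .rput (.reg 99) e' ;; .wset 20 (.reg 20 + 1) ;; .wset 99 (.reg 99 + 1))

/-- The first `i` values of `f` and `g` have been appended to the memory `σ`, from `σ.w 99` on. -/
structure Appended (σ : St) (f : ℕ → ℕ) (g : ℕ → ℝ) (i : ℕ) (τ : St) : Prop where
  w : ∀ j, j ≠ 20 → j ≠ 99 → τ.w j = σ.w j
  r : τ.r = σ.r
  count : τ.w 20 = i
  al : τ.w 99 = σ.w 99 + i
  low : ∀ p < σ.w 99, τ.wm p = σ.wm p ∧ τ.rm p = σ.rm p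
  new : ∀ t < i, τ.wm (σ.w 99 + t) = f t ∧ τ.rm (σ.w 99 + t) = g t

theorem Appended.keeps {σ τ : St} {f : ℕ → ℕ} {g : ℕ → ℝ} {i : ℕ} (h : Appended σ f g i τ) : Keeps 20 σ τ :=
  ⟨fun i hi => h.w i (by omega) (by omega), fun i _ => by rw [h.r], by rw [h.al]; omega, fun p hp => (h.low p hp).1,
    fun p hp => (h.low p hp).2⟩

theorem Appended.zero {σ : St} {f : ℕ → ℕ} {g : ℕ → ℝ} : Appended σ f g 0 (σ.setW 20 0) :=
  ⟨by intros; simp [*], rfl, by simp, by simp, by simp, by simp⟩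

theorem append_spec {B N i : ℕ} {e : WExp} {e' : RExp} {b : WExp} {f : ℕ → ℕ} {g : ℕ → ℝ} {σ₀ σ : St} {Q : ℕ → St → Prop}
    (h : Appended σ₀ f g i σ) (hi : i ≤ N) (hce : e.cost ≤ 8 ∧ e'.cost ≤ 8) (hcb : b.cost ≤ 3) (hB : σ₀.w 99 + N + 1 < B)
    (hb : ∀ τ, Appended σ₀ f g (τ.w 20) τ → i ≤ τ.w 20 → τ.w 20 ≤ N → b.eval τ = N ∧ b.ok B τ)
    (he : ∀ τ, Appended σ₀ f g (τ.w 20) τ → i ≤ τ.w 20 → τ.w 20 < N → (e.eval τ = f (τ.w 20) ∧ e.ok B τ) ∧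
      ∀ v, e'.eval (τ.putW (τ.w 99) v) = g (τ.w 20) ∧ e'.ok B (τ.putW (τ.w 99) v))
    (hQ : ∀ t τ, Appended σ₀ f g N τ → t ≤ 40 * (N - i) + 10 → Q t τ) : wp B (append e e' b) Q σ := by
  unfold append
  refine wp_loop (fun k τ => Appended σ₀ f g k τ ∧ i ≤ k ∧ k ≤ N) (fun k => 40 * (N - k)) ?_ ?_ i ⟨h, le_rfl, hi⟩ ?_
  · rintro k τ ⟨hA, hik, hkN⟩
    obtain rfl := hA.count
    exact ⟨trivial, (hb τ hA hik hkN).2⟩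
  · rintro k τ ⟨hA, hik, hkN⟩ hc
    obtain rfl := hA.count
    simp only [rules, (hb τ hA hik hkN).1] at hc
    obtain ⟨⟨he1, he2⟩, he'⟩ := he τ hA hik hc
    have hal := hA.al
    generalize hQ' : (fun (k : ℕ) (τ' : St) => ∃ a', _ ∧ _) = Q'
    simp [he1, he2, he']
    refine ⟨by omega, by omega, ?_⟩
    rw [← hQ']
    refine ⟨τ.w 20 + 1, ⟨⟨fun j h1 h2 => by simp [h1, h2, hA.w j h1 h2], hA.r, by simp, by simp; omega,
      fun p hp => ?_, fun t ht => ?_⟩, by omega, by omega⟩, by simp; omega⟩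
    · simp [show p ≠ τ.w 99 by omega, hA.low p hp]
    · rcases Nat.lt_succ_iff_lt_or_eq.1 ht with h1 | rfl
      · simp [show σ₀.w 99 + t ≠ τ.w 99 by omega, hA.new t h1]
      · simp [hal]
  · rintro k t τ ⟨hA, hik, hkN⟩ hc ht
    have := (hb τ (hA.count ▸ hA) (hA.count ▸ hik) (hA.count ▸ hkN)).1
    simp only [rules, this, hA.count] at hc
    obtain rfl : k = N := by omega
    simp only [rules] at ht
    exact hQ t τ hA (by omega)

/-- Compute in `w20` the logarithm of `w_i`. -/
def logStmt (i : ℕ) : Stmt :=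
  .wset 20 0 ;; .wset 21 1 ;;
  .loop (.not (.wlt (.reg i) (.reg 21 + .reg 21))) (.wset 20 (.reg 20 + 1) ;; .wset 21 (.reg 21 + .reg 21))

theorem logStmt_spec {B i : ℕ} {Q : ℕ → St → Prop} (σ : St) (h20 : i ≠ 20) (h21 : i ≠ 21) (hB : 2 * σ.w i + 2 < B)
    (hQ : ∀ t τ, τ.w 20 = Nat.log 2 (σ.w i) → (∀ j, j ≠ 20 → j ≠ 21 → τ.w j = σ.w j) → τ.r = σ.r → τ.wm = σ.wm →
      τ.rm = σ.rm → t ≤ 20 * σ.w i + 20 → Q t τ) : wp B (logStmt i) Q σ := by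
  unfold logStmt
  simp only [wp_seq, wp_wset, rules]
  refine ⟨by omega, by omega, ?_⟩
  refine wp_loop (fun k τ => τ.w 20 = k ∧ τ.w 21 = 2 ^ k ∧ (k = 0 ∨ 2 ^ k ≤ σ.w i) ∧
    (∀ j, j ≠ 20 → j ≠ 21 → τ.w j = σ.w j) ∧ τ.r = σ.r ∧ τ.wm = σ.wm ∧ τ.rm = σ.rm) (fun k => 20 * (σ.w i - k)) ?_ ?_ 0 ?_ ?_
  · rintro k τ ⟨h0, h1, h2, h3, -⟩
    have : 2 ^ k ≤ σ.w i + 1 := by rcases h2 with rfl | h2 <;> [simp; omega]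
    simp [h1]; omega
  · rintro k τ ⟨h0, h1, h2, h3, h4, h5, h6⟩ hc
    simp only [rules, h1, h3 i h20 h21, not_lt] at hc
    have := Nat.lt_two_pow_self (n := k)
    generalize hQ' : (fun (k : ℕ) (τ' : St) => ∃ a', _ ∧ _) = Q'
    simp [h0, h1]
    refine ⟨by omega, by omega, ?_⟩
    rw [← hQ']
    refine ⟨k + 1, ⟨by simp, by simp [pow_succ]; omega, Or.inr (by rw [pow_succ]; omega),
      fun j hj hj' => by simp [hj, hj', h3], h4, h5, h6⟩, by simp; omega⟩
  · exact ⟨by simp, by simp, Or.inl rfl, fun j hj hj' => by simp [hj, hj'], rfl, rfl, rfl⟩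
  · rintro k t τ ⟨h0, h1, h2, h3, h4, h5, h6⟩ hc ht
    simp only [rules, h1, h3 i h20 h21, not_not] at hc
    simp at ht
    refine hQ _ τ ?_ h3 h4 h5 h6 (by omega)
    rw [h0]
    rcases h2 with rfl | h2
    · exact (Nat.log_of_lt (by simpa using hc)).symm
    · exact (Nat.log_eq_of_pow_le_of_lt_pow h2 (by rw [pow_succ]; omega)).symm

/-- Half the number of rounds of the selection, up to one. -/
def lglg (n : ℕ) : ℕ := Nat.log 2 (Nat.log 2 n)
/-- Length of the blocks. -/
def blockLen (n : ℕ) : ℕ := max 1 (Nat.log 2 n / (12 * (lglg n + 2)))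
/-- Number of blocks of the first necklace. -/
def numX (n : ℕ) : ℕ := (n + (blockLen n - 1)) / blockLen n
/-- Number of blocks of the second necklace. -/
def numY (n : ℕ) : ℕ := numX n * blockLen n - blockLen n + n

/-- Compute the parameters. -/
def params : Stmt :=
  logStmt 0 ;; .wset 22 (.reg 20) ;; logStmt 22 ;;
  .wset 8 (.reg 20 + .reg 20 + 2) ;;
  .wset 1 (.reg 22 / (12 * (.reg 20 + 2))) ;; .wset 1 (.reg 1 + (1 - .reg 1)) ;;
  .wset 2 ((.reg 0 + (.reg 1 - 1)) / .reg 1) ;; .wset 9 (.reg 2 * .reg 1) ;; .wset 4 ((.reg 9 - .reg 1) + .reg 0) ;;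
  .wset 7 (2 * (.reg 1 * (.reg 4 + 1))) ;; .wset 3 0 ;; .wset 5 (.reg 0 + .reg 0) ;; .wset 6 (.reg 5 + .reg 9) ;;
  .wset 99 (.reg 5)

/-- The parameters have been computed. -/
structure Params (n : ℕ) (σ : St) : Prop where
  w0 : σ.w 0 = n
  w1 : σ.w 1 = blockLen n
  w2 : σ.w 2 = numX n
  w3 : σ.w 3 = 0
  w4 : σ.w 4 = numY n
  w5 : σ.w 5 = 2 * n
  w6 : σ.w 6 = 2 * n + numX n * blockLen n
  w7 : σ.w 7 = 2 * (blockLen n * (numY n + 1))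
  w8 : σ.w 8 = (lglg n + 1) + (lglg n + 1)
  w9 : σ.w 9 = numX n * blockLen n

theorem blockLen_pos (n : ℕ) : 0 < blockLen n := by unfold blockLen; omega

theorem blockLen_le (n : ℕ) (hn : 0 < n) : blockLen n ≤ n := by
  have h1 : Nat.log 2 n ≤ n := Nat.log_le_self 2 n
  have h2 := Nat.div_le_self (Nat.log 2 n) (12 * (lglg n + 2))
  unfold blockLen
  omega

theorem le_numX_mul (n : ℕ) : n ≤ numX n * blockLen n := by
  have h := blockLen_pos n
  have h1 := Nat.div_add_mod (n + (blockLen n - 1)) (blockLen n)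
  have h2 := Nat.mod_lt (n + (blockLen n - 1)) h
  rw [numX, Nat.mul_comm]
  omega

theorem numX_mul_le (n : ℕ) : numX n * blockLen n ≤ n + (blockLen n - 1) := Nat.div_mul_le_self _ _

theorem params_spec {B n : ℕ} {Q : ℕ → St → Prop} (σ : St) (h0 : σ.w 0 = n) (hn : 0 < n)
    (hB : 40 * n + 40 + 2 * (blockLen n * (numY n + 1)) < B)
    (hQ : ∀ t τ, Params n τ → τ.w 99 = 2 * n → τ.rm = σ.rm → t ≤ 100 * n + 200 → Q t τ) :
    wp B params Q σ := by
  have hL : Nat.log 2 n ≤ n := Nat.log_le_self 2 n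
  have hl : lglg n ≤ Nat.log 2 n := Nat.log_le_self 2 _
  have hd := blockLen_pos n
  have hd' := blockLen_le n hn
  have h1 := le_numX_mul n
  have h2 := numX_mul_le n
  unfold params
  rw [wp_seq]
  refine logStmt_spec σ (by omega) (by omega) (by omega) fun t₁ τ h20 hw hr hwm hrm ht₁ => ?_
  rw [wp_seq, wp_wset, WExp.eval, h20, h0]
  refine ⟨trivial, ?_⟩
  rw [wp_seq]
  refine logStmt_spec _ (by omega) (by omega) (by simp; omega) fun t₂ υ i20 iw ir iwm irm ht₂ => ?_
  have e0 : υ.w 0 = n := by rw [iw 0 (by omega) (by omega)]; simp [hw, h0]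
  have e22 : υ.w 22 = Nat.log 2 n := by rw [iw 22 (by omega) (by omega)]; simp
  have e20 : υ.w 20 = lglg n := by rw [i20]; simp [lglg]
  have eb : Nat.log 2 n / (12 * (lglg n + 2)) + (1 - Nat.log 2 n / (12 * (lglg n + 2))) = blockLen n := by
    unfold blockLen; omega
  have hX : (n + (blockLen n - 1)) / blockLen n = numX n := rfl
  have hY : numX n * blockLen n - blockLen n + n = numY n := rfl
  simp only [wp_seq, wp_wset, rules, St.setW_w, true_and, Nat.reduceEqDiff, if_true, if_false, e0, e20, e22, eb, hX, hY, hd]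
  have hn' : numX n ≤ numX n * blockLen n := Nat.le_mul_of_pos_right _ hd
  have hy : numY n + 1 ≤ blockLen n * (numY n + 1) := Nat.le_mul_of_pos_left _ hd
  simp only [St.setW_w, if_true] at ht₂
  rw [h0] at ht₁
  have hdiv := Nat.div_le_self (Nat.log 2 n) (12 * (lglg n + 2))
  refine ⟨by omega, by omega, by simp only [and_true]; omega, by simp only [and_true]; omega, by omega, by omega, by omega,
      by omega,
    by omega, by omega, hQ _ _ ?_ ?_ ?_ ?_⟩
  · constructor <;> simp [e0] <;> omega
  · simp; omega
  · simp [irm, hrm]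
  · omega

end RealRAM

namespace RealRAM

theorem Params.keeps {n : ℕ} {σ τ : St} (h : Params n σ) (hK : Keeps 10 σ τ) : Params n τ :=
  ⟨(hK.w 0).trans h.w0, (hK.w 1).trans h.w1, (hK.w 2).trans h.w2,
    (hK.w 3).trans h.w3, (hK.w 4).trans h.w4, (hK.w 5).trans h.w5,
    (hK.w 6).trans h.w6, (hK.w 7).trans h.w7, (hK.w 8).trans h.w8,
    (hK.w 9).trans h.w9⟩

/-- Write the padded first necklace and the unrolled second necklace. -/
def setUp : Stmt :=
  .wset 20 0 ;; append 0 (.mem (.reg 20)) (.reg 0) ;; append 0 (.cast 10) (.reg 9) ;;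
  .wset 20 0 ;; append 0 (.mem (.reg 0 + .reg 20)) (.reg 0) ;;
  append 0 (.mem (.reg 99 - .reg 0) + .cast 1) (.reg 9 + .reg 0) ;;
  .wset 99 (.reg 99 + 2 * (.reg 9 * .reg 4))

theorem setUp_spec {B n : ℕ} {X Y : ℕ → ℝ} {Q : ℕ → St → Prop} (σ : St) (hp : Params n σ) (h99 : σ.w 99 = 2 * n)
    (hn : 0 < n) (hX : ∀ i < n, σ.rm i = X i) (hY : ∀ j < n, σ.rm (n + j) = Y j) (hY' : ∀ t, Y (t + n) = Y t + 1)
    (hB : 3 * n + 2 * (numX n * blockLen n) + 2 * (numX n * blockLen n * numY n) + 20 < B)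
    (hQ : ∀ t τ, Params n τ → τ.w 99 = 3 * n + 2 * (numX n * blockLen n) + 2 * (numX n * blockLen n * numY n) →
      (∀ i < n, τ.rm (2 * n + i) = X i) → (∀ i, n ≤ i → i < numX n * blockLen n → τ.rm (2 * n + i) = 10) →
      (∀ t < numX n * blockLen n + n, τ.rm (2 * n + numX n * blockLen n + t) = Y t) → t ≤ 200 * n + 100 → Q t τ) :
    wp B setUp Q σ := by
  have h1 := le_numX_mul n
  have h2 := numX_mul_le n
  have hd' := blockLen_le n hn
  generalize hN : numX n * blockLen n = N at *
  have w0 := hp.w0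
  have w9 := hp.w9
  rw [hN] at w9
  unfold setUp
  rw [wp_seq, wp_wset]
  refine ⟨by simp; omega, ?_⟩
  rw [wp_seq]
  refine append_spec (N := n) (f := fun _ => 0) (g :=
  fun i => if i < n then X i else 10) (σ₀ := σ) Appended.zero (by omega) (by simp) (by simp)
    (by omega) (fun τ h _ _ => ⟨by simp [h.w, w0], trivial⟩) (fun τ h _ hlt => ⟨⟨rfl, show 0 < B by omega⟩,
    fun v => ⟨?_, trivial⟩⟩) fun t₁ σ₁ hσ₁ ht₁ => ?_
  · simp [hlt, h.low _ (show τ.w 20 < σ.w 99 by omega), hX]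
  rw [wp_seq]
  refine append_spec (N := N) (σ₀ := σ) hσ₁ (by omega) (by simp) (by simp) (by omega)
    (fun τ h _ _ => ⟨by simp [h.w, w9], trivial⟩) (fun τ h h3 hlt => ⟨⟨rfl, show 0 < B by omega⟩,
    fun v => ⟨by simp [not_lt.2 h3], show 10 < B by omega⟩⟩) fun t₂ σ₂ hσ₂ ht₂ => ?_
  have hK := hσ₂.keeps
  have v0 : σ₂.w 0 = n := by rw [hσ₂.w _ (by omega) (by omega), w0]
  have v9 : σ₂.w 9 = N := by rw [hσ₂.w _ (by omega) (by omega), w9]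
  have v99 : σ₂.w 99 = 2 * n + N := by rw [hσ₂.al, h99]
  rw [wp_seq, wp_wset]
  refine ⟨by simp; omega, ?_⟩
  rw [wp_seq]
  refine append_spec (N := n) (f := fun _ => 0) (g := Y) (σ₀ := σ₂) Appended.zero (by omega) (by simp) (by simp)
    (by omega) (fun τ h _ _ => ⟨by simp [h.w, v0], trivial⟩) (fun τ h _ hlt => ⟨⟨rfl, show 0 < B by omega⟩,
    fun v => ⟨?_, ?_⟩⟩) fun t₃ σ₃ hσ₃ ht₃ => ?_
  · simp only [rules, St.putW_w, St.putW_rm, h.w 0 (by omega) (by omega), v0,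
      (h.low _ (show n + τ.w 20 < σ₂.w 99 by omega)).2, (hσ₂.low _ (show n + τ.w 20 < σ.w 99 by omega)).2, hY _ hlt]
  · simp [h.w, v0]; omega
  rw [wp_seq]
  refine append_spec (N := N + n) (σ₀ := σ₂) hσ₃ (by omega) (by simp) (by simp) (by omega)
    (fun τ h _ _ => ⟨by simp [h.w, v0, v9], by simp [h.w, v0, v9]; omega⟩) (fun τ h h3 hlt => ⟨⟨rfl, show 0 < B by omega⟩,
    fun v => ⟨?_, ?_⟩⟩) fun t₄ σ₄ hσ₄ ht₄ => ?_
  · simp only [rules, St.putW_w, St.putW_rm, h.w 0 (by omega) (by omega), v0, h.al]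
    obtain ⟨u, hu⟩ := Nat.exists_eq_add_of_le' h3
    rw [hu, show σ₂.w 99 + (u + n) - n = σ₂.w 99 + u by omega, (h.new u (by omega)).2, hY']
    simp
  · simp; omega
  have hK' := hK.trans hσ₄.keeps
  have hP := hp.keeps (hK'.mono)
  have u99 : σ₄.w 99 = 3 * n + 2 * N := by rw [hσ₄.al, v99]; omega
  have u9 := hP.w9
  rw [wp_wset]
  refine ⟨?_, hQ _ _ ?_ ?_ ?_ ?_ ?_ ?_⟩
  · simp [u99, u9, hP.w4, hN]
    omega
  · exact hP.keeps (Keeps.rfl'.setAl (by simp))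
  · simp [u99, u9, hP.w4, hN]
  · intro i hi
    have := (hσ₂.new i (by omega)).2
    rw [h99] at this
    simp only [St.setW_rm, (hσ₄.low (2 * n + i) (by omega)).2, this, if_pos hi]
  · intro i hi hi'
    have := (hσ₂.new i hi').2
    rw [h99] at this
    simp only [St.setW_rm, (hσ₄.low (2 * n + i) (by omega)).2, this, if_neg (not_lt.2 hi)]
  · intro t ht
    have := (hσ₄.new t ht).2
    rw [v99] at this
    simpa using this
  · simp
    omega

/-- The item that holds all blocks. -/
def wholeItem (n : ℕ) : Item where
  els := (List.range (numX n + numY n)).map fun t =>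
    if t < numX n then 2 * n + t * blockLen n else 2 * n + numX n * blockLen n + (t - numX n)
  perm := List.range (blockLen n)
  p := 0
  lo := 0
  hi := 0
  r := Nat.size (numX n + numY n)

/-- Push the item that holds all blocks to the empty stack. -/
def pushWhole : Stmt :=
  .wset 23 (.reg 99) ;; .wset 20 0 ;; append (.reg 20) (.cast 0) (.reg 1) ;;
  .wset 27 (.reg 99) ;; .wset 20 0 ;; append (.reg 5 + .reg 20 * .reg 1) (.cast 0) (.reg 2) ;;
  append (.reg 6 + (.reg 20 - .reg 2)) (.cast 0) (.reg 2 + .reg 4) ;; .wset 28 (.reg 20) ;;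
  .wset 20 0 ;; .wset 24 0 ;; .wset 31 0 ;; .wset 32 0 ;; push

theorem Appended.seg {σ τ υ : St} {f : ℕ → ℕ} {g : ℕ → ℝ} {N A b : ℕ} (h : Appended σ f g N τ) (hb : b = σ.w 99) (hA : A ≤ b)
    (hal : τ.w 99 ≤ υ.w 99) (hw : ∀ p < τ.w 99, υ.wm p = τ.wm p) : Seg υ A b ((List.range N).map f) := by
  have h' := h.al
  subst hb
  refine ⟨hA, by simp; omega, ?_⟩
  rw [List.length_map, List.length_range, arr, List.range'_eq_map_range, List.map_map]
  refine List.map_congr_left fun t ht => ?_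
  have := List.mem_range.1 ht
  rw [Function.comp, hw _ (by omega), (h.new t this).1]

theorem pushWhole_spec {B n A : ℕ} {Q : ℕ → St → Prop} (σ : St) (hp : Params n σ) (hn : 0 < n) (hA : 0 < A) (hA' : A ≤ σ.w 99)
    (hA'' : 2 * n + numX n * blockLen n + numY n ≤ A) (hB : σ.w 99 + blockLen n + numX n + numY n + 20 < B)
    (hQ : ∀ t τ, Keeps 20 σ τ → StackAt τ A (τ.w 20) [wholeItem n] →
      τ.w 99 = σ.w 99 + blockLen n + (numX n + numY n) + 7 → t ≤ 400 * n + 300 → Q t τ) :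
    wp B pushWhole Q σ := by
  have h1 := le_numX_mul n
  have h2 := numX_mul_le n
  have hd := blockLen_pos n
  have hd' := blockLen_le n hn
  have hY : numX n * blockLen n - blockLen n + n = numY n := rfl
  have hn' : numX n ≤ numX n * blockLen n := Nat.le_mul_of_pos_right _ hd
  unfold pushWhole
  rw [wp_seq, wp_wset]
  refine ⟨trivial, ?_⟩
  generalize hσ1 : σ.setW 23 (WExp.eval σ (.reg 99)) = σ₁
  have hK1 : Keeps 20 σ σ₁ := hσ1 ▸ Keeps.rfl'.setW
  have hp1 := hp.keeps (hK1.mono)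
  have al1 : σ₁.w 99 = σ.w 99 := by simp [← hσ1]
  have v23 : σ₁.w 23 = σ.w 99 := by simp [← hσ1]
  rw [wp_seq, wp_wset]
  refine ⟨by simp; omega, ?_⟩
  rw [wp_seq]
  refine append_spec (N := blockLen n) (f := fun t => t) (g :=
  fun _ => 0) (σ₀ := σ₁) Appended.zero (by omega) (by simp) (by simp)
    (by omega) (fun τ h _ _ => ⟨by simp [h.w, hp1.w1], trivial⟩) (fun τ h _ hlt => ⟨⟨rfl, trivial⟩,
    fun v => ⟨by simp, show 0 < B by omega⟩⟩)
    fun t₁ σ₂ hσ₂ ht₁ => ?_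
  rw [wp_seq, wp_wset]
  refine ⟨trivial, ?_⟩
  generalize hσ3 : σ₂.setW 27 (WExp.eval σ₂ (.reg 99)) = σ₃
  have hK2 : Keeps 20 σ₂ σ₃ := hσ3 ▸ Keeps.rfl'.setW
  have hK3 := (hK1.trans hσ₂.keeps).trans hK2
  have hp3 := hp.keeps (hK3.mono)
  have al2 := hσ₂.al
  have al3 : σ₃.w 99 = σ.w 99 + blockLen n := by simp [← hσ3]; omega
  have v27 : σ₃.w 27 = σ₃.w 99 := by simp [← hσ3]
  have v23' : σ₃.w 23 = σ.w 99 := by simp [← hσ3, hσ₂.w, v23]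
  rw [wp_seq, wp_wset]
  refine ⟨by simp; omega, ?_⟩
  have hlt1 : ∀ t < numX n, t * blockLen n + blockLen n ≤ numX n * blockLen n := by
    intro t ht
    have := Nat.mul_le_mul_right (blockLen n) (show t + 1 ≤ numX n from ht)
    rwa [Nat.add_mul, one_mul] at this
  rw [wp_seq]
  refine append_spec (N := numX n) (f := fun t =>
    if t < numX n then 2 * n + t * blockLen n else 2 * n + numX n * blockLen n + (t - numX n)) (g := fun _ => 0) (σ₀ := σ₃)
    Appended.zero (by omega) (by simp) (by simp) (by omega) (fun τ h _ _ => ⟨by simp [h.w, hp3.w2], trivial⟩)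
    (fun τ h _ hlt => ⟨⟨by simp [h.w, hp3.w5, hp3.w1, hlt], ?_⟩, fun v => ⟨by simp, show 0 < B by omega⟩⟩)
    fun t₂ σ₄ hσ₄ ht₂ => ?_
  · have := hlt1 _ hlt
    simp [h.w, hp3.w5, hp3.w1]
    omega
  rw [wp_seq]
  refine append_spec (N := numX n + numY n) (σ₀ := σ₃) hσ₄ (by omega) (by simp) (by simp) (by omega)
    (fun τ h _ _ => ⟨by simp [h.w, hp3.w2, hp3.w4], by simp [h.w, hp3.w2, hp3.w4]; omega⟩)
    (fun τ h hle hlt => ⟨⟨by simp [h.w, hp3.w6, hp3.w2, not_lt.2 hle], ?_⟩, fun v => ⟨by simp, show 0 < B by omega⟩⟩)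
    fun t₃ σ₅ hσ₅ ht₃ => ?_
  · simp [h.w, hp3.w6, hp3.w2]
    omega
  have al5 := hσ₅.al
  have hK5 := hσ₅.keeps
  simp only [wp_seq, wp_wset, rules, true_and]
  refine ⟨by omega, by omega, by omega, by omega, ?_⟩
  generalize hσ6 : ((((σ₅.setW 28 _).setW 20 _).setW 24 _).setW 31 _).setW 32 _ = σ₆
  have hK6 : Keeps 20 σ₅ σ₆ := by
    rw [← hσ6]
    exact ((((Keeps.rfl'.setW).setW).setW).setW).setW
  have al6 : σ₆.w 99 = σ₅.w 99 := by simp [← hσ6]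
  refine push_spec (A := A) σ₆ (wholeItem n) [] ?_ ?_ ?_ ?_ ?_ ?_ ?_ hA (by omega) (by omega) fun t₄ τ hτ hst ht₄ => ?_
  · refine hσ₅.seg (by simp [← hσ6, hσ₅.w, v27]) ?_ al6.ge hK6.wm
    simp [← hσ6, hσ₅.w, v27, al3]; omega
  · simp [← hσ6, hσ₅.count, wholeItem]
  · have := hσ₂.seg (υ := σ₆) (A := A) (b := σ₆.w 23) (by simp [← hσ6, hσ₅.w, v23', al1])
      (by simp [← hσ6, hσ₅.w, v23']; omega) ((hK2.trans (hK5.trans hK6)).al) (hK2.trans (hK5.trans hK6)).wm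
    simpa [wholeItem] using this
  · simp [← hσ6, wholeItem]
  · simp [← hσ6, wholeItem]
  · simp [← hσ6, wholeItem]
  · simp [← hσ6, StackAt]
  · refine hQ _ τ (hK3.trans (hK5.trans (hK6.trans hτ.keeps))) hst ?_ ?_
    · rw [hτ.al]; omega
    · omega

theorem wholeItem_length (n : ℕ) : (wholeItem n).els.length = numX n + numY n := by simp [wholeItem]

theorem wholeItem_els (n : ℕ) : (wholeItem n).els = (List.range (numX n)).map (fun t => 2 * n + t * blockLen n) ++
    (List.range (numY n)).map fun t => 2 * n + numX n * blockLen n + t := by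
  simp only [wholeItem, List.range_add, List.map_append, List.map_map]
  congr 1
  · exact List.map_congr_left fun t ht => by rw [if_pos (List.mem_range.1 ht)]
  · exact List.map_congr_left fun t ht => by simp

theorem mul_blockLen_lt {n t : ℕ} (h : t < numX n) : t * blockLen n + blockLen n ≤ numX n * blockLen n := by
  have := Nat.mul_le_mul_right (blockLen n) (show t + 1 ≤ numX n from h)
  rwa [Nat.add_mul, one_mul] at this

theorem pairs_wholeItem (n : ℕ) :
    pairs (2 * n + numX n * blockLen n) (wholeItem n).els ≤ numX n * numY n := by
  have hd := blockLen_pos n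
  rw [wholeItem_els]
  refine Nat.mul_le_mul ?_ ?_
  · rw [List.countP_append, show List.countP _ (List.map _ (List.range (numY n))) = 0 from List.countP_eq_zero.2 (by simp)]
    simpa using List.countP_le_length (p := (· < 2 * n + numX n * blockLen n))
      (l := (List.range (numX n)).map (fun t => 2 * n + t * blockLen n))
  · rw [List.countP_append, show List.countP _ (List.map _ (List.range (numX n))) = 0 from List.countP_eq_zero.2 ?_,
      Nat.zero_add]
    · simpa using List.countP_le_length (p := fun e => !decide (e < 2 * n + numX n * blockLen n))
        (l := (List.range (numY n)).map (fun t => 2 * n + numX n * blockLen n + t))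
    · intro e he
      obtain ⟨t, ht, rfl⟩ := List.mem_map.1 he
      have := mul_blockLen_lt (List.mem_range.1 ht)
      simp; omega

/-- The data of the classification of all blocks. -/
def wholeData (n : ℕ) (v : ℕ → ℝ) : Data := ⟨0, v, 2 * n, blockLen n, 2 * n + numX n * blockLen n, numY n⟩

theorem wholeItem_valid (n : ℕ) (v : ℕ → ℝ) : (wholeItem n).Valid (wholeData n v) := by
  refine ⟨List.Perm.refl _, Nat.zero_le _, le_rfl, le_rfl, ?_, ?_, ?_⟩
  · rw [wholeItem_length]
    exact (Nat.lt_size_self _).le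
  · intro e he
    rw [wholeItem_els, List.mem_append] at he
    rcases he with he | he <;> obtain ⟨t, ht, rfl⟩ := List.mem_map.1 he
    · have := mul_blockLen_lt (List.mem_range.1 ht)
      left; simp only [wholeData]; omega
    · have := List.mem_range.1 ht
      right; simp only [wholeData]; omega
  · intro x _ _ y _ _
    simp [SortedAt, wholeItem]

theorem wholeItem_covers {n a j : ℕ} (v : ℕ → ℝ) (ha : a < numX n) (hj : j < numY n) :
    (wholeItem n).Covers (wholeData n v) (2 * n + a * blockLen n) (2 * n + numX n * blockLen n + j) := by
  have := mul_blockLen_lt ha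
  have hd := blockLen_pos n
  rw [Item.Covers, wholeItem_els]
  refine ⟨?_, by simp only [wholeData]; omega, ?_, by simp [wholeData]⟩
  · exact List.mem_append_left _ (List.mem_map.2 ⟨a, List.mem_range.2 ha, rfl⟩)
  · exact List.mem_append_right _ (List.mem_map.2 ⟨j, List.mem_range.2 hj, rfl⟩)

end RealRAM

namespace RealRAM

/-! ## The program -/

/-- Bound for the cost of the classification. -/
def classCost (n : ℕ) : ℕ :=
  200 + 400 * ((numX n + numY n) * budget (Nat.size (numX n + numY n) + blockLen n + 10) (Nat.size (numX n + numY n))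
    (blockLen n * (Nat.size (blockLen n) + 1))) + 100 * (numX n * numY n)

/-- Bound for the cost of the final sorting in one selection. -/
def leafCost (n : ℕ) : ℕ :=
  ((12 * numX n + 40) / 16 ^ (lglg n + 1) + 11) * (Nat.size (24 * numX n + 230) + 6)

/-- Bound for the running time. -/
def time (n : ℕ) : ℕ :=
  700 * n + 800 + classCost n + n * (((lglg n + 1) + (lglg n + 1)) * (60000 * (numX n + 4)) +
    1000 * (leafCost n + numX n + 1) + 140 * numX n + 40 * (numX n * blockLen n - n) + 200)

/-- Bound for all words. -/
def space (n : ℕ) : ℕ :=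
  3 * n + 2 * (numX n * blockLen n) + 2 * (numX n * blockLen n * numY n) + blockLen n + numX n + numY n + classCost n +
    n * (((lglg n + 1) + (lglg n + 1)) * (160 * (numX n + 4)) + 3 * numX n + leafCost n) + 3000 * (numX n + 4) +
    4 * leafCost n + numX n * (2 * (blockLen n * (numY n + 1))) + numX n * blockLen n + 2 * blockLen n + 50 * n + 50 +
    2 * (blockLen n * (numY n + 1))

/-- Reduce `r12` modulo `1`. -/
def finish : Stmt :=
  .ite (.rlt (.reg 12) (.cast 0)) (.rset 0 (.reg 12 + .cast 1))
    (.ite (.rlt (.reg 12) (.cast 1)) (.rset 0 (.reg 12)) (.rset 0 (.reg 12 - .cast 1))) ;;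
  .wset 0 (.reg 12)

/-- The program. -/
def align : Stmt := params ;; setUp ;; pushWhole ;; classify ;; shiftLoop ;; finish

theorem finish_spec {B : ℕ} {Q : ℕ → St → Prop} (σ : St) (h : -1 < σ.r 12) (h' : σ.r 12 < 2) (hB : 2 < B)
    (hQ : ∀ t τ, τ.r 0 = Int.fract (σ.r 12) → τ.w 0 = σ.w 12 → t ≤ 40 → Q t τ) : wp B finish Q σ := by
  unfold finish
  simp only [wp_seq, wp_ite, wp_rset, wp_wset, rules, true_and, Nat.cast_zero, Nat.cast_one]
  refine ⟨by omega, fun h0 => ⟨by omega, ?_⟩, fun h0 => ⟨by omega, fun h1 => ?_, fun h1 => ⟨by omega, ?_⟩⟩⟩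
  · refine hQ _ _ ?_ (by simp) (by omega)
    simp only [St.setW_r, St.setR_r, if_true]
    symm
    rw [Int.fract_eq_iff]
    exact ⟨by linarith, by linarith, -1, by push_cast; ring⟩
  · refine hQ _ _ ?_ (by simp) (by omega)
    simp only [St.setW_r, St.setR_r, if_true]
    exact (Int.fract_eq_self.2 ⟨not_lt.1 h0, h1⟩).symm
  · refine hQ _ _ ?_ (by simp) (by omega)
    simp only [St.setW_r, St.setR_r, if_true]
    symm
    rw [Int.fract_eq_iff]
    exact ⟨by linarith, by linarith, 1, by push_cast; ring⟩

theorem stackPot_wholeItem (n : ℕ) (v : ℕ → ℝ) :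
    stackPot (wholeData n v) (Nat.size (numX n + numY n) + (wholeData n v).d + 10) [wholeItem n] ≤ classCost n := by
  have := pairs_wholeItem n
  rw [stackPot_cons, stackPot_nil, Item.pot, wholeItem_length, classCost]
  have hh : (wholeItem n).height (wholeData n v).d = blockLen n * (Nat.size (blockLen n) + 1) := by
    simp [Item.height, wholeItem, wholeData]
  rw [hh]
  simp only [wholeData, wholeItem] at this ⊢
  omega

theorem blockLen_le_two_pow (n : ℕ) : blockLen n ≤ 2 ^ (lglg n + 1) := by
  have h1 : Nat.log 2 n < 2 ^ (lglg n + 1) := Nat.lt_pow_succ_log_self (by norm_num) _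
  have h2 := Nat.div_le_self (Nat.log 2 n) (12 * (lglg n + 2))
  have h3 := Nat.one_le_two_pow (n := lglg n + 1)
  unfold blockLen
  omega

theorem align_spec {B n : ℕ} {X Y : ℕ → ℝ} {Q : ℕ → St → Prop} (σ : St) (hn : 0 < n) (h0 : σ.w 0 = n)
    (hX : ∀ i < n, σ.rm i = X i) (hY : ∀ j < n, σ.rm (n + j) = Y j) (hY' : ∀ t, Y (t + n) = Y t + 1)
    (hX01 : ∀ i < n, 0 ≤ X i ∧ X i < 1) (hY01 : ∀ j < n, 0 ≤ Y j ∧ Y j < 1) (hB : space n < B)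
    (hQ : ∀ t τ (c : ℝ), τ.r 0 = Int.fract c → τ.w 0 < n →
      (∀ s < n, ∀ c', ∑ i ∈ Finset.range n, |Y (i + τ.w 0) - X i - c| ≤ ∑ i ∈ Finset.range n, |Y (i + s) - X i - c'|) →
      t ≤ time n → Q t τ) : wp B align Q σ := by
  have h1 := le_numX_mul n
  have h2 := numX_mul_le n
  have hd := blockLen_pos n
  have hd' := blockLen_le n hn
  have hnY : numX n * blockLen n - blockLen n + n = numY n := rfl
  have hX1 : 1 ≤ numX n := by
    by_contra hcon
    rw [show numX n = 0 by omega] at h1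
    omega
  have hdm : blockLen n ≤ numX n * blockLen n := Nat.le_mul_of_pos_left _ hX1
  have hB' := hB
  unfold space at hB'
  unfold align
  rw [wp_seq]
  refine params_spec σ h0 hn (by omega) fun t₁ σ₁ hp₁ al₁ rm₁ ht₁ => ?_
  rw [wp_seq]
  refine setUp_spec (X := X) (Y := Y) σ₁ hp₁ al₁ hn (by rwa [rm₁]) (by rwa [rm₁]) hY' (by omega)
    fun t₂ σ₂ hp₂ al₂ hx hpad hy ht₂ => ?_
  have hIn : (wholeData n σ₂.rm).In (σ₂.w 99) σ₂ := by
    refine ⟨fun _ _ => rfl, hp₂.w1, hp₂.w3, hp₂.w4, hp₂.w5, hp₂.w6, ?_, ?_, ?_, le_rfl⟩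
    · simp only [wholeData, Nat.add_sub_cancel_left, al₂]; omega
    · simp only [wholeData, al₂]; omega
    · omega
  rw [wp_seq]
  refine pushWhole_spec (A := σ₂.w 99) σ₂ hp₂ hn (by omega) le_rfl (by omega) (by omega) fun t₃ σ₃ hK₃ hst al₃ ht₃ => ?_
  have hpot := stackPot_wholeItem n σ₂.rm
  rw [wp_seq]
  refine classify_spec σ₃ (wholeData n σ₂.rm) [wholeItem n] (Nat.size (numX n + numY n)) (hIn.keeps (by omega) hK₃) hd hst
    (by simpa using ⟨wholeItem_valid n _, le_rfl⟩) (by omega) fun t₄ σ₄ hS hgood al₄ ht₄ => ?_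
  have hp₃ := hp₂.keeps (hK₃.mono)
  have hw : ∀ i < 10, σ₄.w i = σ₃.w i := fun i hi => hS.w i
  have hYb : ∀ t < 2 * n, 0 ≤ Y t ∧ Y t < 2 := by
    intro t ht
    rcases lt_or_ge t n with h | h
    · exact ⟨(hY01 t h).1, by linarith [(hY01 t h).2]⟩
    · obtain ⟨u, rfl⟩ := Nat.exists_eq_add_of_le' h
      have := hY01 u (by omega)
      rw [hY']
      constructor <;> linarith
  have hYc : ∀ t < 3 * n, Y t < 3 := by
    intro t ht
    rcases lt_or_ge t n with h | h
    · linarith [(hY01 t h).2]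
    · obtain ⟨u, rfl⟩ := Nat.exists_eq_add_of_le' h
      have := hYb u (by omega)
      rw [hY']
      linarith
  have hz : ∀ s < n, ∀ i < n, (wholeData n σ₂.rm).z (2 * n) (2 * n + numX n * blockLen n + s) i = Y (i + s) - X i := by
    intro s hs i hi
    simp only [Data.z, wholeData]
    rw [hx i hi, Nat.add_assoc _ s i, Nat.add_comm s i, hy (i + s) (by omega)]
  have hReady : Ready (wholeData n σ₂.rm) n (numX n) (lglg n + 1) (lglg n + 1) (σ₂.w 99) B σ₄ := by
    refine ⟨(hIn.keeps (by omega) hK₃).step (by omega) hS, hd, hn, rfl, ?_, ?_, ?_, ?_, ?_, h1, le_rfl, ?_,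
      blockLen_le_two_pow n, ?_, ?_, ?_, ?_⟩
    · rw [hw 0 (by omega), hp₃.w0]
    · rw [hw 2 (by omega), hp₃.w2]
    · rw [hw 7 (by omega), hp₃.w7]; rfl
    · rw [hw 8 (by omega), hp₃.w8]
    · rw [hw 9 (by omega), hp₃.w9]; rfl
    · simp only [wholeData]; omega
    · simp only [wholeData]; omega
    · intro a ha j hj
      refine hgood _ _ ⟨⟨?_, ?_⟩, ?_, ?_⟩ ⟨_, by simp, wholeItem_covers σ₂.rm ha hj⟩
      · simp
      · have := mul_blockLen_lt ha
        simp only [wholeData]; omega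
      · simp
      · simpa using hj
    · intro s hs i hi
      have b1 := hX01 i hi
      have b2 := hYb (i + s) (by omega)
      have := hz s hs i hi
      simp only [wholeData] at this ⊢
      rw [this]
      constructor <;> linarith
    · intro s hs i hi hi'
      simp only [wholeData] at hi'
      have b1 := hYc (s + i) (by omega)
      simp only [Data.z, wholeData]
      rw [hpad i hi hi', Nat.add_assoc _ s i, hy (s + i) (by omega)]
      linarith
  rw [wp_seq]
  refine shiftLoop_spec (g := Nat.size (24 * numX n + 230)) (X := leafCost n) σ₄ hReady (Nat.lt_size_self _).le ?_ ?_
    fun t₅ σ₅ hK₅ hc1 hc2 hs hopt ht₅ => ?_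
  · intro N hN
    refine Nat.mul_le_mul_right _ ?_
    have hpos : 0 < 16 ^ (lglg n + 1) := by positivity
    rw [← Nat.add_mul_div_right _ _ hpos]
    exact (Nat.le_div_iff_mul_le hpos).2 (by rwa [Nat.mul_comm])
  · omega
  refine finish_spec σ₅ hc1 hc2 (by omega) fun t₆ τ hr hw6 ht₆ => hQ _ τ _ hr (by omega) ?_ ?_
  · intro s hs' c'
    have key := hopt s hs' c'
    have e : ∀ s < n, ∀ c : ℝ, ∑ i ∈ Finset.range n, |(wholeData n σ₂.rm).z (wholeData n σ₂.rm).xb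
        ((wholeData n σ₂.rm).yb + s) i - c| = ∑ i ∈ Finset.range n, |Y (i + s) - X i - c| := by
      intro s hs c
      refine Finset.sum_congr rfl fun i hi => ?_
      have := hz s hs i (Finset.mem_range.1 hi)
      simp only [wholeData] at this ⊢
      rw [this]
    rw [e _ hs, e _ hs'] at key
    rwa [hw6]
  · unfold time
    simp only [wholeData] at ht₅ ht₄ hpot
    omega

end RealRAM

namespace RealRAM

/-- The compiled program. -/
def program : Program := align.code 0 ++ [.halt]

theorem le_space (n : ℕ) : n ≤ space n := by unfold space; omega

end RealRAM

namespace Necklace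
open RealRAM

/-- The state of the structured program that represents the input. -/
noncomputable def inputSt {n : ℕ} (x y : Fin n → ℝ) : St :=
  ⟨(input x y).wreg, (input x y).rreg, (input x y).wmem, (input x y).rmem⟩

theorem sim_input {n B : ℕ} (x y : Fin n → ℝ) (hB : n < B) : Sim B (input x y) (inputSt x y) := by
  refine ⟨fun i => ?_, fun i => rfl, rfl, rfl, fun i => ?_, fun i => ?_⟩
  · simp [inputSt, input]
  · simp only [inputSt, input]; split <;> omega
  · simp only [inputSt, input]; omega

theorem solvesInTime_program {k : ℕ} (hk : ∀ n, 1 ≤ n → space n < 2 ^ (k * (Nat.log 2 n + 1))) :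
    SolvesInTime program k time := by
  intro n hn x y hx hy
  have : NeZero n := ⟨by omega⟩
  have hs := hk n hn
  have hlast : ∃ t τ, Exec (2 ^ (k * (Nat.log 2 n + 1))) align (inputSt x y) t τ ∧
      (t ≤ time n ∧ IsOptimal x y (τ.r 0) (τ.w 0)) := by
    refine align_spec (n := n) (X := fun i => unroll x i) (Y := fun i => unroll y i) (inputSt x y) (by omega) ?_ ?_ ?_ ?_ ?_ ?_ hs ?_
    · simp [inputSt, input]
    · intro i hi
      simp [inputSt, input, unroll_natCast, Nat.mod_eq_of_lt hi, Nat.div_eq_of_lt hi, hi]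
    · intro i hi
      simp [inputSt, input, unroll_natCast, Nat.mod_eq_of_lt hi, Nat.div_eq_of_lt hi, hi]
    · intro t
      push_cast
      exact unroll_add y t
    · intro i hi
      simpa [unroll_natCast, Nat.mod_eq_of_lt hi, Nat.div_eq_of_lt hi] using hx.2 ⟨i, hi⟩
    · intro i hi
      simpa [unroll_natCast, Nat.mod_eq_of_lt hi, Nat.div_eq_of_lt hi] using hy.2 ⟨i, hi⟩
    · intro t τ c hr hw hopt ht
      refine ⟨ht, ?_⟩
      rw [hr]
      have e : ∀ (c : ℝ) (s : ℕ), lineCost x y c s = ∑ i ∈ Finset.range n, |unroll y ((i + s : ℕ) : ℤ) - unroll x (i : ℕ) - c| := by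
        intro c s
        rw [lineCost, Finset.sum_range]
        refine Finset.sum_congr rfl fun i _ => ?_
        rw [unroll_natCast x i]
        simp [Nat.mod_eq_of_lt i.2, Nat.div_eq_of_lt i.2]
      refine isOptimal_fract hx hy hw fun s' hs' c' => ?_
      rw [e, e]
      exact hopt s' hs' c'
  obtain ⟨t, τ, he, ht, hopt⟩ := hlast
  obtain ⟨t', ht', τ', hsteps, hsim, hpc⟩ := he.run rfl (P := program) 0 (input x y) (codeAt_self _ _)
    (sim_input x y ((le_space n).trans_lt hs)) rfl
  refine ⟨t', ht'.trans ht, τ', ⟨hsteps, ?_⟩, ?_⟩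
  · rw [hpc, Nat.zero_add, program, List.getElem?_append_right (by simp)]
    simp
  · have h0 := hsim.w 0
    have h1 := hsim.r 0
    rw [Nat.mul_zero] at h0 h1
    rwa [h0, h1]

end Necklace

namespace RealRAM

/-! ## Bounds -/

theorem log_succ_pow_le (k n : ℕ) (hk : 0 < k) (hn : 0 < n) : (Nat.log 2 n + 1) ^ k ≤ k ^ k * n := by
  have h1 : Nat.log 2 n / k + 1 ≤ 2 ^ (Nat.log 2 n / k) := Nat.lt_two_pow_self
  have h2 : Nat.log 2 n + 1 ≤ k * (Nat.log 2 n / k + 1) := Nat.lt_mul_div_succ _ hk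
  calc (Nat.log 2 n + 1) ^ k ≤ (k * 2 ^ (Nat.log 2 n / k)) ^ k :=
        Nat.pow_le_pow_left (h2.trans (Nat.mul_le_mul_left _ h1)) _
    _ = k ^ k * 2 ^ (Nat.log 2 n / k * k) := by rw [mul_pow, ← pow_mul]
    _ ≤ k ^ k * 2 ^ Nat.log 2 n := Nat.mul_le_mul_left _ (Nat.pow_le_pow_right (by norm_num) (Nat.div_mul_le_self _ _))
    _ ≤ k ^ k * n := Nat.mul_le_mul_left _ (Nat.pow_log_le_self 2 hn.ne')

section bounds
variable {n : ℕ}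

theorem log_succ_le_blockLen (n : ℕ) : Nat.log 2 n + 1 ≤ 24 * (lglg n + 2) * blockLen n := by
  have h : Nat.log 2 n < 12 * (lglg n + 2) * (Nat.log 2 n / (12 * (lglg n + 2)) + 1) :=
    Nat.lt_mul_div_succ _ (by positivity)
  have h' : Nat.log 2 n / (12 * (lglg n + 2)) + 1 ≤ 2 * blockLen n := by unfold blockLen; omega
  have := Nat.mul_le_mul_left (12 * (lglg n + 2)) h'
  linarith

theorem blockLen_le_log (n : ℕ) : blockLen n ≤ Nat.log 2 n + 1 := by
  have := Nat.div_le_self (Nat.log 2 n) (12 * (lglg n + 2))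
  unfold blockLen
  omega

theorem numX_mul_blockLen_le (hn : 0 < n) : numX n * blockLen n ≤ 2 * n := by
  have h2 := numX_mul_le n
  have hd' := blockLen_le n hn
  omega

theorem numX_le (hn : 0 < n) : numX n ≤ 2 * n :=
  (Nat.le_mul_of_pos_right _ (blockLen_pos n)).trans (numX_mul_blockLen_le hn)

theorem numY_lt (hn : 0 < n) : numY n < 2 * n := by
  have h2 := numX_mul_le n
  have hd' := blockLen_le n hn
  have hd := blockLen_pos n
  unfold numY
  omega

theorem numX_mul_log_le (hn : 0 < n) : numX n * (Nat.log 2 n + 1) ≤ 48 * (lglg n + 2) * n := by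
  have h1 := Nat.mul_le_mul_left (numX n) (log_succ_le_blockLen n)
  have h2 := Nat.mul_le_mul_left (24 * (lglg n + 2)) (numX_mul_blockLen_le hn)
  linarith

theorem height_le (n : ℕ) : 12 * (blockLen n * (Nat.size (blockLen n) + 1)) ≤ Nat.log 2 n + 24 := by
  have hlt : Nat.log 2 n < 2 ^ (lglg n + 1) := Nat.lt_pow_succ_log_self (by norm_num) _
  have hq := Nat.div_mul_le_self (Nat.log 2 n) (12 * (lglg n + 2))
  have hle := Nat.div_le_self (Nat.log 2 n) (12 * (lglg n + 2))
  rcases Nat.eq_zero_or_pos (Nat.log 2 n / (12 * (lglg n + 2))) with h0 | h0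
  · rw [show blockLen n = 1 by unfold blockLen; omega]
    simp
  · have hb : blockLen n = Nat.log 2 n / (12 * (lglg n + 2)) := by unfold blockLen; omega
    have hs : Nat.size (blockLen n) ≤ lglg n + 1 := Nat.size_le.2 (by omega)
    rw [← hb] at hq
    have := Nat.mul_le_mul_left (blockLen n) (Nat.succ_le_succ hs)
    simp only [Nat.succ_eq_add_one] at this
    linarith

theorem two_pow_size_le {m : ℕ} (hm : 0 < m) : 2 ^ Nat.size m ≤ 2 * m := by
  obtain ⟨k, hk⟩ := Nat.exists_eq_succ_of_ne_zero (Nat.size_pos.2 hm).ne'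
  have : 2 ^ k ≤ m := Nat.lt_size.1 (by omega)
  rw [hk, pow_succ]
  omega

theorem budget_mul_log_le (hn : 0 < n) :
    budget (Nat.size (numX n + numY n) + blockLen n + 10) (Nat.size (numX n + numY n))
      (blockLen n * (Nat.size (blockLen n) + 1)) * (Nat.log 2 n + 1) ≤ 2 ^ 21 * n := by
  have hX := numX_le hn
  have hY := numY_lt hn
  have hsum : 0 < numX n + numY n := by unfold numY; omega
  have hR := two_pow_size_le hsum
  have hH := height_le n
  have hd := blockLen_le_log n
  have hL : n < 2 ^ (Nat.log 2 n + 1) := Nat.lt_pow_succ_log_self (by norm_num) _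
  have hL' : 2 ^ Nat.log 2 n ≤ n := Nat.pow_log_le_self 2 hn.ne'
  have h8 := log_succ_pow_le 8 n (by norm_num) hn
  have hRL : Nat.size (numX n + numY n) ≤ Nat.log 2 n + 4 := by
    refine Nat.size_le.2 ?_
    rw [show Nat.log 2 n + 4 = (Nat.log 2 n + 1) + 3 by omega, pow_add]
    omega
  have hb := budget_le (Nat.size (numX n + numY n) + blockLen n + 10) (Nat.size (numX n + numY n))
    (blockLen n * (Nat.size (blockLen n) + 1))
  generalize Nat.size (numX n + numY n) = R at *
  generalize blockLen n * (Nat.size (blockLen n) + 1) = H at *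
  generalize hD : R + blockLen n + 10 = D at *
  generalize budget D R H = b at *
  generalize Nat.log 2 n = L at *
  have hD' : D ≤ 15 * (L + 1) := by omega
  have h4 : b ^ 4 ≤ 2 ^ 42 * D ^ 4 * n ^ 3 := by
    have h3 : 0 < 81 ^ R := by positivity
    refine Nat.le_of_mul_le_mul_left ?_ h3
    calc 81 ^ R * b ^ 4 = (3 ^ R * b) ^ 4 := by
          rw [mul_pow, ← pow_mul, Nat.mul_comm R 4, pow_mul]; norm_num
      _ ≤ (8 * D * 4 ^ R * 8 ^ H) ^ 4 := Nat.pow_le_pow_left hb 4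
      _ = 2 ^ 12 * D ^ 4 * 256 ^ R * 2 ^ (12 * H) := by
          simp only [mul_pow, ← pow_mul]
          rw [Nat.mul_comm R 4, Nat.mul_comm H 4, pow_mul 4 4 R, pow_mul 8 4 H, pow_mul 2 12 H]
          norm_num
      _ ≤ 2 ^ 12 * D ^ 4 * (81 ^ R * (2 ^ R) ^ 2) * (2 ^ 24 * 2 ^ L) := by
          refine Nat.mul_le_mul (Nat.mul_le_mul_left _ ?_) ?_
          · rw [← pow_mul, Nat.mul_comm R 2, pow_mul, ← mul_pow]
            exact Nat.pow_le_pow_left (by norm_num) _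
          · rw [← pow_add]
            exact Nat.pow_le_pow_right (by norm_num) (by omega)
      _ ≤ 2 ^ 12 * D ^ 4 * (81 ^ R * (8 * n) ^ 2) * (2 ^ 24 * n) := by
          gcongr
          omega
      _ = 81 ^ R * (2 ^ 42 * D ^ 4 * n ^ 3) := by ring
  refine le_of_pow_le_pow_left₀ (n := 4) (by norm_num) (Nat.zero_le _) ?_
  calc (b * (L + 1)) ^ 4 = b ^ 4 * (L + 1) ^ 4 := mul_pow _ _ _
    _ ≤ (2 ^ 42 * (15 * (L + 1)) ^ 4 * n ^ 3) * (L + 1) ^ 4 := by gcongr; exact h4.trans (by gcongr)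
    _ = 2 ^ 42 * 15 ^ 4 * n ^ 3 * (L + 1) ^ 8 := by ring
    _ ≤ 2 ^ 42 * 15 ^ 4 * n ^ 3 * (8 ^ 8 * n) := Nat.mul_le_mul_left _ h8
    _ = (2 ^ 42 * 15 ^ 4 * 8 ^ 8) * n ^ 4 := by ring
    _ ≤ (2 ^ 21) ^ 4 * n ^ 4 := Nat.mul_le_mul_right _ (by norm_num)
    _ = (2 ^ 21 * n) ^ 4 := (mul_pow _ _ _).symm

theorem log_succ_le (hn : 0 < n) : Nat.log 2 n + 1 ≤ n := by simpa using log_succ_pow_le 1 n one_pos hn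

theorem log_succ_mul_le (hn : 0 < n) : (Nat.log 2 n + 1) * (Nat.log 2 n + 1) ≤ 4 * n := by
  simpa [sq] using log_succ_pow_le 2 n two_pos hn

theorem classCost_mul_log_le (hn : 0 < n) : classCost n * (Nat.log 2 n + 1) ≤ 2 ^ 32 * ((lglg n + 2) * (n * n)) := by
  have hX := numX_le hn
  have hY := numY_lt hn
  have hL := log_succ_le hn
  have h1 := Nat.mul_le_mul (show numX n + numY n ≤ 4 * n by omega) (budget_mul_log_le hn)
  have h2 := Nat.mul_le_mul (numX_mul_log_le hn) hY.le
  have h3 : n * n ≤ (lglg n + 2) * (n * n) := Nat.le_mul_of_pos_left _ (by omega)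
  have h4 : n ≤ n * n := Nat.le_mul_of_pos_left _ hn
  unfold classCost
  generalize budget _ _ _ = b at *
  generalize Nat.log 2 n + 1 = L at *
  calc _ = 200 * L + 400 * ((numX n + numY n) * (b * L)) + 100 * (numX n * L * numY n) := by ring
    _ ≤ 200 * n + 400 * (4 * n * (2 ^ 21 * n)) + 100 * (48 * (lglg n + 2) * n * (2 * n)) := by gcongr
    _ = 200 * n + 400 * 4 * 2 ^ 21 * (n * n) + 9600 * ((lglg n + 2) * (n * n)) := by ring
    _ ≤ _ := by omega

theorem leafCost_mul_log_le (hn : 0 < n) : leafCost n * (Nat.log 2 n + 1) ≤ 12000 * ((lglg n + 2) * n) := by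
  have hX := numX_le hn
  have hL := log_succ_le hn
  have hLL := log_succ_mul_le hn
  have hm := numX_mul_log_le hn
  have hlt : n < 2 ^ (Nat.log 2 n + 1) := Nat.lt_pow_succ_log_self (by norm_num) _
  have hg : Nat.size (24 * numX n + 230) ≤ Nat.log 2 n + 10 := by
    refine Nat.size_le.2 ?_
    rw [show Nat.log 2 n + 10 = (Nat.log 2 n + 1) + 9 by omega, pow_add]
    omega
  have hlog : Nat.log 2 n + 1 ≤ 16 ^ (lglg n + 1) :=
    (Nat.lt_pow_succ_log_self (b := 2) (by norm_num) (Nat.log 2 n)).trans_le (Nat.pow_le_pow_left (by norm_num) _)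
  have hq := Nat.div_mul_le_self (12 * numX n + 40) (16 ^ (lglg n + 1))
  have h3 : n ≤ (lglg n + 2) * n := Nat.le_mul_of_pos_left _ (by omega)
  have hq' := (Nat.mul_le_mul_left ((12 * numX n + 40) / 16 ^ (lglg n + 1)) hlog).trans hq
  unfold leafCost
  generalize Nat.log 2 n = L at *
  generalize (12 * numX n + 40) / 16 ^ (lglg n + 1) = q at *
  calc _ ≤ (q + 11) * (16 * (L + 1)) * (L + 1) := by gcongr; omega
    _ = 16 * (q * (L + 1)) * (L + 1) + 176 * ((L + 1) * (L + 1)) := by ring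
    _ ≤ 16 * (12 * numX n + 40) * (L + 1) + 176 * (4 * n) := by gcongr
    _ = 192 * (numX n * (L + 1)) + 640 * (L + 1) + 704 * n := by ring
    _ ≤ 192 * (48 * (lglg n + 2) * n) + 640 * n + 704 * n := by gcongr
    _ = 9216 * ((lglg n + 2) * n) + 1344 * n := by ring
    _ ≤ _ := by omega

theorem time_mul_log_le (hn : 0 < n) : time n * (Nat.log 2 n + 1) ≤ 2 ^ 33 * ((lglg n + 2) ^ 2 * (n * n)) := by
  have hL := log_succ_le hn
  have hLL := log_succ_mul_le hn
  have hm := numX_mul_log_le hn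
  have hc := classCost_mul_log_le hn
  have hl := leafCost_mul_log_le hn
  have hd : numX n * blockLen n - n ≤ Nat.log 2 n + 1 := by
    have := numX_mul_le n
    have := blockLen_le_log n
    omega
  unfold time
  rw [show (lglg n + 1) + (lglg n + 1) = 2 * (lglg n + 1) by omega]
  generalize classCost n = c at *
  generalize leafCost n = l at *
  generalize numX n * blockLen n - n = e at *
  generalize Nat.log 2 n + 1 = L at *
  generalize numX n = m at *
  have hK : lglg n + 1 ≤ lglg n + 2 := by omega
  have hK' : 1 ≤ lglg n + 2 := by omega
  generalize lglg n + 2 = K at *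
  generalize lglg n + 1 = K' at *
  have h1 : n * n ≤ K * (n * n) := Nat.le_mul_of_pos_left _ hK'
  have h2 : K * (n * n) ≤ K ^ 2 * (n * n) := Nat.mul_le_mul_right _ (Nat.le_self_pow two_ne_zero K)
  have h4 : n ≤ n * n := Nat.le_mul_of_pos_left _ hn
  calc _ = (700 * n + 800) * L + c * L + n * (2 * K' * (60000 * (m * L + 4 * L)) + 1000 * (l * L + m * L + L) + 140 * (m * L) +
        40 * (e * L) + 200 * L) := by ring
    _ ≤ (700 * n + 800) * n + 2 ^ 32 * (K * (n * n)) + n * (2 * K * (60000 * (48 * K * n + 4 * n)) +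
        1000 * (12000 * (K * n) + 48 * K * n + n) + 140 * (48 * K * n) + 40 * (4 * n) + 200 * n) := by
          have heL := (Nat.mul_le_mul_right L hd).trans hLL
          generalize e * L = eL at heL ⊢
          gcongr
    _ = 2060 * (n * n) + 800 * n + (2 ^ 32 + 12534720) * (K * (n * n)) + 5760000 * (K ^ 2 * (n * n)) := by ring
    _ ≤ _ := by omega

theorem space_le (hn : 0 < n) : space n ≤ time n + 30000 * (n * n) := by
  have hX := numX_le hn
  have hY := numY_lt hn
  have hXd := numX_mul_blockLen_le hn
  have hd := blockLen_le n hn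
  have h1 := Nat.mul_le_mul hXd hY.le
  have h2 := Nat.mul_le_mul hXd (show numY n + 1 ≤ 2 * n from hY)
  have h3 := Nat.mul_le_mul hd (show numY n + 1 ≤ 2 * n from hY)
  have h4 : n ≤ n * n := Nat.le_mul_of_pos_left _ hn
  have h5 : leafCost n ≤ n * leafCost n := Nat.le_mul_of_pos_left _ hn
  have h6 : n * (((lglg n + 1) + (lglg n + 1)) * (160 * (numX n + 4))) ≤
      n * (((lglg n + 1) + (lglg n + 1)) * (60000 * (numX n + 4))) := by gcongr; norm_num
  have h7 : numX n * (2 * (blockLen n * (numY n + 1))) = 2 * (numX n * blockLen n * (numY n + 1)) := by ring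
  have h8 : n * numX n ≤ n * (2 * n) := Nat.mul_le_mul_left _ hX
  unfold space time
  generalize numX n * blockLen n - n = e
  have h9 := Nat.zero_le (n * e)
  generalize (lglg n + 1) + (lglg n + 1) = r at *
  linarith [Nat.zero_le (n * leafCost n), Nat.zero_le (n * numX n), Nat.zero_le (leafCost n)]

theorem space_lt (hn : 0 < n) : space n < 2 ^ (40 * (Nat.log 2 n + 1)) := by
  have hL := log_succ_le hn
  have hl : lglg n ≤ Nat.log 2 n := Nat.log_le_self 2 _
  have h1 : time n ≤ 2 ^ 33 * ((2 * n) ^ 2 * (n * n)) :=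
    ((Nat.le_mul_of_pos_right _ (by omega)).trans (time_mul_log_le hn)).trans (by gcongr; omega)
  have h2 := space_le hn
  have h3 : n * n ≤ n ^ 4 := by
    rw [show n ^ 4 = (n * n) * (n * n) by ring]
    exact Nat.le_mul_of_pos_left _ (by positivity)
  have h4 : n < 2 ^ (Nat.log 2 n + 1) := Nat.lt_pow_succ_log_self (by norm_num) _
  calc space n ≤ 2 ^ 33 * ((2 * n) ^ 2 * (n * n)) + 30000 * (n * n) := by omega
    _ = 2 ^ 35 * n ^ 4 + 30000 * (n * n) := by ring
    _ ≤ 2 ^ 36 * n ^ 4 := by omega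
    _ < 2 ^ 36 * (2 ^ (Nat.log 2 n + 1)) ^ 4 := by gcongr
    _ = 2 ^ (36 + (Nat.log 2 n + 1) * 4) := by rw [← pow_mul, pow_add]
    _ ≤ _ := Nat.pow_le_pow_right (by norm_num) (by omega)

end bounds

/-- Real form of the bound for the running time. -/
theorem time_le {n : ℕ} (hn : 4 ≤ n) : (time n : ℝ) ≤
    9 * 2 ^ 33 * ((n : ℝ) ^ 2 * Real.logb 2 (Real.logb 2 n) ^ 2 / Real.logb 2 n) := by
  have hn0 : (0 : ℝ) < n := by positivity
  have h4 : (4 : ℝ) ≤ n := by exact_mod_cast hn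
  have h2 : (2 : ℝ) ≤ Real.logb 2 n := by
    rw [Real.le_logb_iff_rpow_le (by norm_num) hn0]
    norm_num
    linarith
  have h1 : (1 : ℝ) ≤ Real.logb 2 (Real.logb 2 n) := by
    rw [Real.le_logb_iff_rpow_le (by norm_num) (by linarith)]
    simpa using h2
  have hL : Real.logb 2 n ≤ (Nat.log 2 n : ℝ) + 1 := by
    rw [Real.logb_le_iff_le_rpow (by norm_num) hn0]
    have := (Nat.lt_pow_succ_log_self (b := 2) (by norm_num) n).le
    exact_mod_cast this
  have hL' : (Nat.log 2 n : ℝ) ≤ Real.logb 2 n := Real.natLog_le_logb n 2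
  have hL1 : 0 < Nat.log 2 n := Nat.log_pos (by norm_num) (by omega)
  have hK : (lglg n : ℝ) ≤ Real.logb 2 (Real.logb 2 n) :=
    (Real.natLog_le_logb _ 2).trans (Real.logb_le_logb_of_le (by norm_num) (by exact_mod_cast hL1) hL')
  have hmain : (time n : ℝ) * ((Nat.log 2 n : ℝ) + 1) ≤ 2 ^ 33 * (((lglg n : ℝ) + 2) ^ 2 * (n * n)) := by
    exact_mod_cast time_mul_log_le (show 0 < n by omega)
  rw [← mul_div_assoc, le_div_iff₀ (by linarith)]
  calc (time n : ℝ) * Real.logb 2 n ≤ time n * ((Nat.log 2 n : ℝ) + 1) := by gcongr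
    _ ≤ 2 ^ 33 * (((lglg n : ℝ) + 2) ^ 2 * (n * n)) := hmain
    _ ≤ 2 ^ 33 * ((3 * Real.logb 2 (Real.logb 2 n)) ^ 2 * (n * n)) := by gcongr; linarith
    _ = _ := by ring

theorem tendsto_logb_natCast : Filter.Tendsto (fun n : ℕ => Real.logb 2 (n : ℝ)) Filter.atTop Filter.atTop :=
  (Real.tendsto_logb_atTop (by norm_num)).comp tendsto_natCast_atTop_atTop

theorem isLittleO_bound : (fun n : ℕ => (n : ℝ) ^ 2 * (Real.logb 2 (Real.logb 2 (n : ℝ))) ^ 2 / Real.logb 2 (n : ℝ))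
    =o[Filter.atTop] fun n : ℕ => (n : ℝ) ^ 2 := by
  have h1 : (fun x : ℝ => Real.logb 2 x ^ 2) =o[Filter.atTop] fun x => x := by
    have := (Real.isLittleO_pow_log_id_atTop (n := 2)).const_mul_left ((Real.log 2)⁻¹ ^ 2)
    refine this.congr_left fun x => ?_
    rw [Real.logb]; ring
  have h2 := h1.comp_tendsto tendsto_logb_natCast
  have h3 : (fun n : ℕ => Real.logb 2 (Real.logb 2 (n : ℝ)) ^ 2 / Real.logb 2 (n : ℝ)) =o[Filter.atTop] fun _ => (1 : ℝ) := by
    rw [isLittleO_one_iff]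
    exact h2.tendsto_div_nhds_zero
  have := (isBigO_refl (fun n : ℕ => (n : ℝ) ^ 2) Filter.atTop).mul_isLittleO h3
  simpa only [mul_one, mul_div_assoc] using this

end RealRAM

theorem mainTheorem12 :
    ∃ (P : RealRAM.Program) (k : ℕ) (T : ℕ → ℕ),
      Necklace.SolvesInTime P k T ∧
      (fun n : ℕ => (T n : ℝ)) =O[Filter.atTop]
        (fun n : ℕ =>
          (n : ℝ) ^ 2 * (Real.logb 2 (Real.logb 2 (n : ℝ))) ^ 2 / Real.logb 2 (n : ℝ)) ∧
      (fun n : ℕ => (T n : ℝ)) =o[Filter.atTop] (fun n : ℕ => (n : ℝ) ^ 2) := by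
  have hO : (fun n : ℕ => (RealRAM.time n : ℝ)) =O[Filter.atTop] fun n : ℕ =>
      (n : ℝ) ^ 2 * (Real.logb 2 (Real.logb 2 (n : ℝ))) ^ 2 / Real.logb 2 (n : ℝ) := by
    refine IsBigO.of_bound (9 * 2 ^ 33) (Filter.eventually_atTop.2 ⟨4, fun n hn => ?_⟩)
    rw [Real.norm_of_nonneg (Nat.cast_nonneg _)]
    exact (RealRAM.time_le hn).trans (mul_le_mul_of_nonneg_left (Real.le_norm_self _) (by positivity))
  exact ⟨RealRAM.program, 40, RealRAM.time, Necklace.solvesInTime_program fun n hn => RealRAM.space_lt hn, hO,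
    hO.trans_isLittleO RealRAM.isLittleO_bound⟩
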